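/- \textbf{Setting.} Let $\mathcal N$ be a von Neumann algebra with a normal semifinite faithful trace $\tau$, and let $L_p=L_p(\mathcal N,\tau)$. Let $(T_t)_{t\ge0}$ be a \emph{standard semigroup} on $\mathcal N$: $T_0=\mathrm{id}$, $T_{s+t}=T_sT_t$, every $T_t$ is normal, completely positive, unital and satisfies $\tau(T_t(f)g)=\tau(fT_t(g))$, and $T_tf\to f$ strongly as $t\to0$ for every $f\in\mathcal N$. Let $A=\lim_{t\to0}t^{-1}(1-T_t)$ be its negative generator, with domain $\mathrm{dom}(A)=\bigcup_{1\le p\le\infty}\mathrm{dom}_p(A)$, where $\mathrm{dom}_p(A)$ is the set of $f\in L_p$ for which the limit exists in $L_p$. Let $P_t=\exp(-tA^{1/2})=\frac1{2\sqrt\pi}\int_0^\infty te^{-t^2/4u}u^{-3/2}T_u\,du$ be the subordinated Poisson semigroup (so $AP_t=\partial_t^2P_t$), $\mathcal P=(P_t)_t$, and $2\Gamma(f,g)=A(f^*)g+f^*A(g)-A(f^*g)$. Write $|f|^2=f^*f$ and $P_s'=\partial_sP_s$. For $f\in\mathcal N\cup L_2$ define, in $[0,\infty]$, $$\|f\|_{BMO^c(\partial)}=\sup_{t>0}\Big\|P_t\int_0^t|P_s'f|^2s\,ds\Big\|^{1/2},\qquad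 \|f\|_{BMO^c(\Gamma)}=\sup_{t>0}\Big\|P_t\int_0^t\Gamma(P_sf,P_sf)s\,ds\Big\|^{1/2},$$ $$\|f\|_{BMO^c(\mathcal P)}=\sup_{t>0}\big\|P_t|f-P_tf|^2\big\|^{1/2},$$ where $\|\cdot\|$ is the operator norm (possibly $\infty$) and $P_t\Gamma(P_sf,P_sf)$ stands for $\frac12\big[P_t((AP_sf)^*P_sf)+P_t((P_sf)^*AP_sf)-AP_t(|P_sf|^2)\big]$. We say that $(T_t)$ satisfies $\Gamma^2\ge0$ if there is a weak$^*$ dense $*$-subalgebra $\mathcal A\subset\mathcal N$ with $T_s(\mathcal A)\subset\mathcal A\subset\mathrm{dom}(A)$ for all $s$ and $\Gamma(T_vf,T_vf)\le T_v\Gamma(f,f)$ for all $v>0$ and $f\in\mathcal A$. Let $n\ge1$ be an integer, let $a:(0,\infty)\to\mathbb C$ be measurable and let $c_a>0$ be such that $$s\int_s^\infty\frac{|a(v-s)|^2}{v^2}\,dv\le c_a^2\qquad\text{for all }s>0 .$$ For $f,g\in\mathcal N\cup L_2$ we write $g=M_{a,n}f=\int_0^\infty a(t)\,t^{n-1}\,\partial_t^nP_tf\,dt$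 if $\tau(gx)=\lim_{\varepsilon\to0,\,R\to\infty}\int_\varepsilon^Ra(t)\,t^{n-1}\,\tau\big((\partial_t^nP_tf)x\big)\,dt$ for all $x\in\mathcal N\cap L_1$. \textbf{Theorem.} There are constants $c_n$, depending only on $n$, such that in this setting the following hold. (0) $M_{a,n}f$ exists in $L_2$ for every $f\in L_2$; if moreover $\int_0^\infty|a(t)|\,\frac{dt}t<\infty$, then $M_{a,n}f$ exists in $\mathcal N$ for every $f\in\mathcal N$. (i) For every $f\in\mathcal N\cup L_2$ such that $M_{a,n}f$ exists in $\mathcal N\cup L_2$, $$\|M_{a,n}f\|_{BMO^c(\partial)}\le c_nc_a\|f\|_{BMO^c(\partial)} .$$ (ii) If $(T_t)$ satisfies $\Gamma^2\ge0$, then for all such $f$ also $$\|M_{a,n}f\|_{BMO^c(\Gamma)}\le c_nc_a\|f\|_{BMO^c(\Gamma)}\qquad\text{and}\qquad\|M_{a,n}f\|_{BMO^c(\mathcal P)}\le c_nc_a\|f\|_{BMO^c(\mathcal P)} .$$ -/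

import Mathlib

open scoped CStarAlgebra ENNReal NNReal InnerProductSpace Real Topology
open Filter Set MeasureTheory

universe u

section

variable {H : Type u} [NormedAddCommGroup H] [InnerProductSpace ℂ H] [CompleteSpace H]

/-! A von Neumann algebra is a C⋆-algebra, ordered by the operators in it that are positive. -/

instance VonNeumannAlgebra.smulMemClass : SMulMemClass (VonNeumannAlgebra H) ℂ (H →L[ℂ] H) where
  smul_mem {N} c _ hx := N.toStarSubalgebra.smul_mem hx c

theorem VonNeumannAlgebra.isClosed (N : VonNeumannAlgebra H) : IsClosed (N : Set (H →L[ℂ] H)) := by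
  rw [← N.centralizer_centralizer]
  exact Set.isClosed_centralizer _

noncomputable instance VonNeumannAlgebra.cstarAlgebra (N : VonNeumannAlgebra H) : CStarAlgebra N :=
  StarSubalgebra.cstarAlgebra N (h_closed := N.isClosed)

theorem VonNeumannAlgebra.coe_spectrum (N : VonNeumannAlgebra H) (x : N) :
    spectrum ℂ x = spectrum ℂ (x : H →L[ℂ] H) :=
  StarSubalgebra.spectrum_eq N.toStarSubalgebra (hS := N.isClosed) (a := x)

instance VonNeumannAlgebra.starOrderedRing (N : VonNeumannAlgebra H) : StarOrderedRing N := by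
  refine StarOrderedRing.of_nonneg_iff' (fun {x y} hxy z => ?_) (fun x => ⟨fun hx => ?_, ?_⟩)
  · exact add_le_add_right (show (x : H →L[ℂ] H) ≤ y from hxy) (z : H →L[ℂ] H)
  · have hx' : (0 : H →L[ℂ] H) ≤ (x : H →L[ℂ] H) := hx
    have hsa : IsSelfAdjoint x := Subtype.ext (IsSelfAdjoint.of_nonneg hx')
    have hsp : SpectrumRestricts x ContinuousMap.realToNNReal := by
      rw [SpectrumRestricts.nnreal_iff]
      intro r hr
      rw [← spectrum.algebraMap_mem_iff ℂ, N.coe_spectrum, spectrum.algebraMap_mem_iff] at hr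
      exact spectrum_nonneg_of_nonneg hx' hr
    obtain ⟨s, hs, -, hss⟩ :=
      CFC.exists_sqrt_of_isSelfAdjoint_of_quasispectrumRestricts hsa hsp
    exact ⟨s, by rw [hs.star_eq, hss]⟩
  · rintro ⟨s, rfl⟩
    exact star_mul_self_nonneg (s : H →L[ℂ] H)


/-- Normal, semifinite, faithful trace on the positive cone; only values at `0 ≤ x` matter. -/
structure NSFTrace (N : VonNeumannAlgebra H) where
  toFun : N → ℝ≥0∞
  map_add : ∀ x y : N, 0 ≤ x → 0 ≤ y → toFun (x + y) = toFun x + toFun y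
  map_smul : ∀ (r : ℝ≥0) (x : N), 0 ≤ x → toFun ((r : ℂ) • x) = r * toFun x
  tracial : ∀ x : N, toFun (star x * x) = toFun (x * star x)
  faithful : ∀ x : N, 0 ≤ x → toFun x = 0 → x = 0
  normal : ∀ (D : Set N) (b : N), (∀ x ∈ D, 0 ≤ x) → D.Nonempty → DirectedOn (· ≤ ·) D →
    IsLUB D b → toFun b = ⨆ x ∈ D, toFun x
  semifinite : ∀ x : N, 0 ≤ x → x ≠ 0 → ∃ y : N, 0 ≤ y ∧ y ≤ x ∧ y ≠ 0 ∧ toFun y < ∞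

namespace NSFTrace

variable {N : VonNeumannAlgebra H} (τ : NSFTrace N)

theorem mono {x y : N} (hx : 0 ≤ x) (hxy : x ≤ y) : τ.toFun x ≤ τ.toFun y := by
  have h := τ.map_add x (y - x) hx (sub_nonneg.2 hxy)
  rw [add_sub_cancel] at h
  rw [h]
  exact le_self_add

theorem map_zero : τ.toFun 0 = 0 := by
  simpa using τ.map_smul 0 0 le_rfl

theorem lt_top_mul_left (b : N) {x : N} (hx : τ.toFun (star x * x) < ∞) :
    τ.toFun (star (b * x) * (b * x)) < ∞ := by
  have h1 : star (b * x) * (b * x) ≤ ((‖star b * b‖₊ : ℝ≥0) : ℂ) • (star x * x) := by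
    have h := CStarAlgebra.star_left_conjugate_le_norm_smul (a := x) (b := star b * b)
      (IsSelfAdjoint.star_mul_self b)
    have e : star (b * x) * (b * x) = star x * (star b * b) * x := by
      simp only [star_mul, mul_assoc]
    rw [e]
    exact h
  refine (τ.mono (star_mul_self_nonneg _) h1).trans_lt ?_
  rw [τ.map_smul _ _ (star_mul_self_nonneg _)]
  exact ENNReal.mul_lt_top ENNReal.coe_lt_top hx

theorem lt_top_star {x : N} (hx : τ.toFun (star x * x) < ∞) :
    τ.toFun (star (star x) * star x) < ∞ := by
  rwa [star_star, ← τ.tracial]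

theorem lt_top_mul_right (b : N) {x : N} (hx : τ.toFun (star x * x) < ∞) :
    τ.toFun (star (x * b) * (x * b)) < ∞ := by
  have h := τ.lt_top_star (τ.lt_top_mul_left (star b) (τ.lt_top_star hx))
  simpa only [star_mul, star_star] using h

/-- The parallelogram identity. -/
theorem parallelogram (x y : N) :
    τ.toFun (star (x + y) * (x + y)) + τ.toFun (star (x - y) * (x - y)) =
      2 * τ.toFun (star x * x) + 2 * τ.toFun (star y * y) := by
  have p := fun z : N => star_mul_self_nonneg z
  rw [two_mul, two_mul, ← τ.map_add _ _ (p _) (p _), ← τ.map_add _ _ (p _) (p _),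
    ← τ.map_add _ _ (p _) (p _), ← τ.map_add _ _ (add_nonneg (p _) (p _)) (add_nonneg (p _) (p _))]
  congr 1
  simp only [star_add, star_sub]
  noncomm_ring

theorem lt_top_add {x y : N} (hx : τ.toFun (star x * x) < ∞) (hy : τ.toFun (star y * y) < ∞) :
    τ.toFun (star (x + y) * (x + y)) < ∞ := by
  refine lt_of_le_of_lt (le_self_add (b := τ.toFun (star (x - y) * (x - y)))) ?_
  rw [τ.parallelogram]
  exact ENNReal.add_lt_top.2 ⟨ENNReal.mul_lt_top (by simp) hx, ENNReal.mul_lt_top (by simp) hy⟩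

/-- The two-sided ideal `{x ∈ N : τ(x⋆x) < ∞} = N ∩ L₂(N)`. -/
def sqInt : Submodule ℂ N where
  carrier := {x | τ.toFun (star x * x) < ∞}
  zero_mem' := by simp [τ.map_zero]
  add_mem' hx hy := τ.lt_top_add hx hy
  smul_mem' c x hx := by
    have h := τ.lt_top_mul_left (c • (1 : N)) hx
    simp only [smul_mul_assoc, one_mul] at h
    exact h

/-- `N ∩ L₂(N)` with the `L₂`-norm (a synonym, since `sqInt` also carries the operator norm). -/
def PreL2 : Type u := τ.sqInt

noncomputable instance : AddCommGroup τ.PreL2 := inferInstanceAs (AddCommGroup τ.sqInt)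
noncomputable instance : Module ℂ τ.PreL2 := inferInstanceAs (Module ℂ τ.sqInt)

variable {τ}

/-- The underlying element of `N`. -/
def PreL2.val (x : τ.PreL2) : N := Subtype.val (p := fun a => a ∈ τ.sqInt) x

theorem PreL2.lt_top (x : τ.PreL2) : τ.toFun (star x.val * x.val) < ∞ :=
  Subtype.property (p := fun a => a ∈ τ.sqInt) x

/-- An element `x` of `N` with `τ(x⋆x) < ∞`, as an element of `N ∩ L₂(N)`. -/
def PreL2.mk (x : N) (hx : τ.toFun (star x * x) < ∞) : τ.PreL2 := (⟨x, hx⟩ : τ.sqInt)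

/-- The left multiplication `y ↦ b y` on `N ∩ L₂(N)`. -/
def PreL2.mulLeft (b : N) (y : τ.PreL2) : τ.PreL2 := .mk (b * y.val) (τ.lt_top_mul_left b y.lt_top)

/-- The right multiplication `y ↦ y b` on `N ∩ L₂(N)`. -/
def PreL2.mulRight (b : N) (y : τ.PreL2) : τ.PreL2 :=
  .mk (y.val * b) (τ.lt_top_mul_right b y.lt_top)

/-- `‖x‖₂² = τ(x⋆x)`. -/
noncomputable def PreL2.sqNorm (x : τ.PreL2) : ℝ := (τ.toFun (star x.val * x.val)).toReal

/-- The real part of `τ(x⋆y)`, by polarization of `‖x‖₂²`. -/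
noncomputable def PreL2.reInner (x y : τ.PreL2) : ℝ := ((x + y).sqNorm - (x - y).sqNorm) / 4

namespace PreL2

@[simp] theorem val_add (x y : τ.PreL2) : (x + y).val = x.val + y.val := rfl
@[simp] theorem val_sub (x y : τ.PreL2) : (x - y).val = x.val - y.val := rfl
@[simp] theorem val_smul (c : ℂ) (x : τ.PreL2) : (c • x).val = c • x.val := rfl

theorem ext {x y : τ.PreL2} (h : x.val = y.val) : x = y := Subtype.ext h

theorem sqNorm_nonneg (x : τ.PreL2) : 0 ≤ x.sqNorm := ENNReal.toReal_nonneg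

theorem sqNorm_smul (c : ℂ) (x : τ.PreL2) : (c • x).sqNorm = ‖c‖ ^ 2 * x.sqNorm := by
  have e : star (c • x.val) * (c • x.val) = ((‖c‖₊ ^ 2 : ℝ≥0) : ℂ) • (star x.val * x.val) := by
    rw [star_smul, smul_mul_smul_comm]
    congr 1
    simpa using RCLike.conj_mul c
  unfold sqNorm
  rw [val_smul, e, τ.map_smul _ _ (star_mul_self_nonneg _), ENNReal.toReal_mul]
  simp

/-- Two equal sums of squares have equal sums of squared norms. -/
theorem sqNorm_three {x y z x' y' z' : τ.PreL2}
    (h : star x.val * x.val + star y.val * y.val + star z.val * z.val =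
      star x'.val * x'.val + star y'.val * y'.val + star z'.val * z'.val) :
    x.sqNorm + y.sqNorm + z.sqNorm = x'.sqNorm + y'.sqNorm + z'.sqNorm := by
  have p := fun w : N => star_mul_self_nonneg w
  have h' := congrArg τ.toFun h
  rw [τ.map_add _ _ (add_nonneg (p _) (p _)) (p _), τ.map_add _ _ (p _) (p _),
    τ.map_add _ _ (add_nonneg (p _) (p _)) (p _), τ.map_add _ _ (p _) (p _)] at h'
  have h2 := congrArg ENNReal.toReal h'
  have t := fun w : τ.PreL2 => w.lt_top.ne
  rwa [ENNReal.toReal_add (ENNReal.add_ne_top.2 ⟨t _, t _⟩) (t _), ENNReal.toReal_add (t _) (t _),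
    ENNReal.toReal_add (ENNReal.add_ne_top.2 ⟨t _, t _⟩) (t _),
    ENNReal.toReal_add (t _) (t _)] at h2

theorem sqNorm_neg (x : τ.PreL2) : (-x).sqNorm = x.sqNorm := by
  have := sqNorm_smul (-1) x
  simpa using this

theorem reInner_comm (x y : τ.PreL2) : reInner x y = reInner y x := by
  unfold reInner
  rw [add_comm y x, ← sqNorm_neg (y - x), neg_sub]

theorem reInner_add_right (x y z : τ.PreL2) :
    reInner x (y + z) = reInner x y + reInner x z := by
  have h : (x + (y + z)).sqNorm + (x - y).sqNorm + (x - z).sqNorm =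
      (x - (y + z)).sqNorm + (x + y).sqNorm + (x + z).sqNorm := by
    apply sqNorm_three
    simp only [val_add, val_sub, star_add, star_sub]
    noncomm_ring
  unfold reInner
  linarith

theorem reInner_neg_right (x y : τ.PreL2) : reInner x (-y) = -reInner x y := by
  unfold reInner
  rw [sub_neg_eq_add, ← sub_eq_add_neg]
  ring

theorem reInner_smul_smul (c : ℂ) (x y : τ.PreL2) :
    reInner (c • x) (c • y) = ‖c‖ ^ 2 * reInner x y := by
  unfold reInner
  rw [← smul_add, ← smul_sub, sqNorm_smul, sqNorm_smul]
  ring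

theorem reInner_self (x : τ.PreL2) : reInner x x = x.sqNorm := by
  have h := sqNorm_smul 2 x
  have h0 := sqNorm_smul 0 x
  unfold reInner
  rw [← two_smul ℂ x, h, sub_self]
  simp at h0 ⊢
  rw [h0]; ring

theorem reInner_nnreal_smul_right (r : ℝ) (hr : 0 ≤ r) (x y : τ.PreL2) :
    reInner x ((r : ℂ) • y) = r * reInner x y := by
  have hs : ((Real.sqrt r : ℝ) : ℂ) * ((Real.sqrt r : ℝ) : ℂ) = r := by
    rw [← Complex.ofReal_mul, Real.mul_self_sqrt hr]
  have hn : ‖((Real.sqrt r : ℝ) : ℂ)‖ ^ 2 = r := by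
    rw [Complex.norm_real, Real.norm_eq_abs, sq_abs, Real.sq_sqrt hr]
  have key : ∀ w : τ.PreL2, star (((Real.sqrt r : ℝ) : ℂ) • w).val *
      (((Real.sqrt r : ℝ) : ℂ) • w).val = (r : ℂ) • (star w.val * w.val) := by
    intro w
    rw [val_smul, star_smul, smul_mul_smul_comm]
    congr 1
    rw [← hs]; simp
  have z : ((0 : τ.PreL2)).sqNorm = 0 := by simpa using sqNorm_smul 0 (0 : τ.PreL2)
  have zv : (0 : τ.PreL2).val = 0 := rfl
  have h : (x + (r : ℂ) • y).sqNorm + (((Real.sqrt r : ℝ) : ℂ) • (x - y)).sqNorm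
      + (0 : τ.PreL2).sqNorm =
      (x - (r : ℂ) • y).sqNorm + (((Real.sqrt r : ℝ) : ℂ) • (x + y)).sqNorm
      + (0 : τ.PreL2).sqNorm := by
    apply sqNorm_three
    rw [key, key, zv]
    simp only [val_add, val_sub, val_smul, star_add, star_sub, star_smul, mul_add, add_mul,
      mul_sub, sub_mul, smul_mul_assoc, mul_smul_comm, smul_add, smul_sub, Complex.star_def,
      Complex.conj_ofReal]
    abel
  rw [sqNorm_smul, sqNorm_smul, hn, z] at h
  unfold reInner
  linarith

theorem reInner_real_smul_right (r : ℝ) (x y : τ.PreL2) :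
    reInner x ((r : ℂ) • y) = r * reInner x y := by
  rcases le_total 0 r with hr | hr
  · exact reInner_nnreal_smul_right r hr x y
  · have h := reInner_nnreal_smul_right (-r) (by linarith) x y
    rw [Complex.ofReal_neg, neg_smul, reInner_neg_right] at h
    linarith

theorem reInner_I_smul_left (x y : τ.PreL2) :
    reInner (Complex.I • x) y = -reInner x (Complex.I • y) := by
  have h := reInner_smul_smul Complex.I x (-(Complex.I • y))
  rw [smul_neg, smul_smul, Complex.I_mul_I, neg_one_smul, neg_neg, reInner_neg_right] at h
  simpa using h

/-- The inner product `⟪x, y⟫ = τ(x⋆y)` on `N ∩ L₂(N)`. -/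
noncomputable abbrev core : InnerProductSpace.Core ℂ τ.PreL2 where
  inner x y := (reInner x y : ℂ) - (reInner x (Complex.I • y) : ℂ) * Complex.I
  conj_inner_symm x y := by
    have h : reInner y (Complex.I • x) = -reInner x (Complex.I • y) := by
      rw [reInner_comm, reInner_I_smul_left]
    rw [h, reInner_comm y x]
    simp [sub_eq_add_neg]
  re_inner_nonneg x := by
    simpa [reInner_self] using sqNorm_nonneg x
  add_left x y z := by
    simp only [reInner_comm (x + y), reInner_add_right]
    simp only [reInner_comm z, reInner_comm (Complex.I • z)]
    push_cast; ring
  smul_left x y r := by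
    have hl : ∀ w : τ.PreL2, reInner (r • x) w = r.re * reInner x w
        - r.im * reInner x (Complex.I • w) := by
      intro w
      have e : r • x = (r.re : ℂ) • x + (r.im : ℂ) • (Complex.I • x) := by
        conv_lhs => rw [← Complex.re_add_im r]
        rw [add_smul, mul_smul]
      rw [e, reInner_comm, reInner_add_right, reInner_real_smul_right, reInner_real_smul_right,
        reInner_comm w, reInner_comm w, reInner_I_smul_left]
      ring
    have hI : reInner x (Complex.I • Complex.I • y) = -reInner x y := by
      rw [smul_smul, Complex.I_mul_I, neg_one_smul, reInner_neg_right]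
    rw [hl, hl, hI]
    apply Complex.ext
    all_goals simp
    all_goals ring
  definite x h := by
    have h1 : x.sqNorm = 0 := by
      have := congrArg Complex.re h
      simpa [reInner_self] using this
    have h2 : τ.toFun (star x.val * x.val) = 0 :=
      ((ENNReal.toReal_eq_zero_iff _).1 h1).resolve_right x.lt_top.ne
    have h3 := τ.faithful _ (star_mul_self_nonneg _) h2
    exact ext (CStarRing.star_mul_self_eq_zero_iff _ |>.1 h3)

end PreL2

noncomputable instance : NormedAddCommGroup τ.PreL2 :=
  InnerProductSpace.Core.toNormedAddCommGroup (cd := PreL2.core)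

noncomputable instance : InnerProductSpace ℂ τ.PreL2 := InnerProductSpace.ofCore PreL2.core.toCore

theorem PreL2.inner_self (x : τ.PreL2) : ⟪x, x⟫_ℂ = (τ.toFun (star x.val * x.val)).toReal := by
  have h : reInner x (Complex.I • x) = 0 := by
    have h1 := reInner_I_smul_left x x
    rw [reInner_comm] at h1
    linarith
  change (reInner x x : ℂ) - (reInner x (Complex.I • x) : ℂ) * Complex.I = _
  rw [h, reInner_self]
  simp [sqNorm]

variable (τ)

/-- The Hilbert space `L₂(N)`, the completion of `N ∩ L₂(N)`. -/
abbrev L2 : Type u := UniformSpace.Completion τ.PreL2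

/-- `‖x‖_p = τ(|x|^p)^{1/p}` for `x ∈ N` (the operator norm for `p = ∞`). -/
noncomputable def lpNorm (p : ℝ≥0∞) (x : N) : ℝ≥0∞ :=
  if p = ∞ then ‖x‖ₑ else (τ.toFun (CFC.abs x ^ p.toReal)) ^ (1 / p.toReal)

variable {τ}

/-- The right multiplication `f ↦ f b` on `L₂(N)` by `b ∈ N`: the continuous extension of the right
multiplication on `N ∩ L₂(N)`. -/
noncomputable def L2.mulRight (b : N) : τ.L2 → τ.L2 :=
  UniformSpace.Completion.map (PreL2.mulRight b)

end NSFTrace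

/-- A standard semigroup: completely positive, normal, unital, `τ`-symmetric maps that are strongly
continuous at `0`. -/
structure StandardSemigroup {N : VonNeumannAlgebra H} (τ : NSFTrace N) where
  T : ℝ≥0 → N →CP N
  map_zero : ∀ x : N, T 0 x = x
  map_add : ∀ (s t : ℝ≥0) (x : N), T (s + t) x = T s (T t x)
  map_one : ∀ t, T t 1 = 1
  normal : ∀ (t : ℝ≥0) (D : Set N) (b : N), D.Nonempty → DirectedOn (· ≤ ·) D → IsLUB D b →
    IsLUB (T t '' D) (T t b)
  /-- `τ(T_t(f) g) = τ(f T_t(g))` in `[0, ∞]` for all positive `f = x⋆x` and `g = y y⋆`. -/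
  symmetric : ∀ (t : ℝ≥0) (x y : N),
    τ.toFun (star y * T t (star x * x) * y) = τ.toFun (x * T t (y * star y) * star x)
  strong_continuity : ∀ (x : N) (ξ : H),
    Tendsto (fun t : ℝ≥0 => (T t x : H →L[ℂ] H) ξ) (𝓝 0) (𝓝 ((x : H →L[ℂ] H) ξ))

namespace StandardSemigroup

open NSFTrace

variable {N : VonNeumannAlgebra H} {τ : NSFTrace N} (S : StandardSemigroup τ)

open scoped Classical in
/-- The extension of `T_t` to `L₂(N)`. Every `T_t` maps `N ∩ L₂(N)` into itself contractively, so
the second case does not occur and this is the continuous extension. -/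
noncomputable def T2 (t : ℝ≥0) : τ.L2 → τ.L2 :=
  UniformSpace.Completion.map fun y : τ.PreL2 =>
    if h : τ.toFun (star (S.T t y.val) * S.T t y.val) < ∞ then PreL2.mk (S.T t y.val) h else 0

/-- The density of the subordination formula. -/
noncomputable def poissonDensity (t u : ℝ) : ℝ :=
  1 / (2 * √π) * (t * Real.exp (-t ^ 2 / (4 * u)) * u ^ (-(3 / 2) : ℝ))

open scoped Classical in
/-- The subordinated Poisson semigroup on `N`, for `t > 0`: the weak integral
`P_t f = ∫₀^∞ φ_t(u) T_u f du`, that is, the unique element of `N` with these matrix elements. -/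
noncomputable def P (t : ℝ) (f : N) : N :=
  if h : ∃ g : N, ∀ ξ η : H, ⟪ξ, (g : H →L[ℂ] H) η⟫_ℂ =
      ∫ u in Ioi (0 : ℝ), (poissonDensity t u : ℂ) * ⟪ξ, (S.T u.toNNReal f : H →L[ℂ] H) η⟫_ℂ
  then h.choose else 0

/-- The subordinated Poisson semigroup on `L₂(N)`, for `t > 0`. -/
noncomputable def P2 (t : ℝ) (f : τ.L2) : τ.L2 :=
  ∫ u in Ioi (0 : ℝ), poissonDensity t u • S.T2 u.toNNReal f

/-- `∂_t^n P_t f` for `f ∈ N`, in the norm of `N`. -/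
noncomputable def dP (n : ℕ) (t : ℝ) (f : N) : N := iteratedDeriv n (fun r => S.P r f) t

/-- `∂_t^n P_t f` for `f ∈ L₂(N)`, in the norm of `L₂(N)`. -/
noncomputable def dP2 (n : ℕ) (t : ℝ) (f : τ.L2) : τ.L2 := iteratedDeriv n (fun r => S.P2 r f) t

/-- `τ(y⋆ ∂_t^m P_t(g⋆k) y)` for `g, k ∈ N`. -/
noncomputable def smear (m : ℕ) (t : ℝ) (g k : N) (y : τ.PreL2) : ℂ :=
  ⟪y, PreL2.mulLeft (S.dP m t (star g * k)) y⟫_ℂ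

/-- `τ(y⋆ ∂_t^m P_t(g⋆k) y) = τ(g⋆ k ∂_t^m P_t(y y⋆))` for `g, k ∈ L₂(N)`; here `g⋆k ∈ L₁(N)`, on
which `P_t` acts by `τ(P_t(h) x) = τ(h P_t(x))`. -/
noncomputable def smear2 (m : ℕ) (t : ℝ) (g k : τ.L2) (y : τ.PreL2) : ℂ :=
  ⟪g, L2.mulRight (S.dP m t (y.val * star y.val)) k⟫_ℂ

/-- The operator norm, in `[0, ∞]`, of a positive element or integral `h` of elements of
`N ∪ L₁(N)` that is given by its values `q y = τ(y⋆ h y)`. -/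
noncomputable def opNorm (q : τ.PreL2 → ℝ≥0∞) : ℝ≥0∞ := ⨆ (y : τ.PreL2) (_ : ‖y‖ ≤ 1), q y

section norms

/-! The three seminorms, for `X = N` and for `X = L₂(N)` at once: `d n t f` is `∂_t^n P_t f` and
`w m t g k y` is `τ(y⋆ ∂_t^m P_t(g⋆k) y)`. -/

variable {X : Type u} (d : ℕ → ℝ → X → X) (w : ℕ → ℝ → X → X → τ.PreL2 → ℂ)

/-- `τ(y⋆ P_t Γ(P_s f, P_s f) y)`, where `2 P_t Γ(P_s f, P_s f)` is
`P_t((A P_s f)⋆ P_s f) + P_t((P_s f)⋆ A P_s f) - A P_t((P_s f)⋆ P_s f)` and `A P_r = ∂_r² P_r`. -/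
noncomputable def smearedGamma (t s : ℝ) (f : X) (y : τ.PreL2) : ℝ :=
  ((w 0 t (d 2 s f) (d 0 s f) y + w 0 t (d 0 s f) (d 2 s f) y
    - w 2 t (d 0 s f) (d 0 s f) y) / 2).re

/-- `sup_t ‖P_t ∫₀^t |P_s' f|² s ds‖^{1/2}`. -/
noncomputable def bmoPartialAux (f : X) : ℝ≥0∞ :=
  (⨆ (t : ℝ) (_ : 0 < t), opNorm fun y =>
    ∫⁻ s in Ioo 0 t, ENNReal.ofReal (s * (w 0 t (d 1 s f) (d 1 s f) y).re)) ^ (1 / 2 : ℝ)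

/-- `sup_t ‖P_t ∫₀^t Γ(P_s f, P_s f) s ds‖^{1/2}`. -/
noncomputable def bmoGammaAux (f : X) : ℝ≥0∞ :=
  (⨆ (t : ℝ) (_ : 0 < t), opNorm fun y =>
    ∫⁻ s in Ioo 0 t, ENNReal.ofReal (s * smearedGamma d w t s f y)) ^ (1 / 2 : ℝ)

/-- `sup_t ‖P_t |f - P_t f|²‖^{1/2}`. -/
noncomputable def bmoPoissonAux [Sub X] (f : X) : ℝ≥0∞ :=
  (⨆ (t : ℝ) (_ : 0 < t), opNorm fun y =>
    ENNReal.ofReal (w 0 t (f - d 0 t f) (f - d 0 t f) y).re) ^ (1 / 2 : ℝ)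

end norms

/-- `‖f‖_{BMO^c(∂)}` for `f ∈ N ∪ L₂(N)`. -/
noncomputable def bmoPartial : N ⊕ τ.L2 → ℝ≥0∞
  | .inl f => bmoPartialAux S.dP S.smear f
  | .inr f => bmoPartialAux S.dP2 S.smear2 f

/-- `‖f‖_{BMO^c(Γ)}` for `f ∈ N ∪ L₂(N)`. -/
noncomputable def bmoGamma : N ⊕ τ.L2 → ℝ≥0∞
  | .inl f => bmoGammaAux S.dP S.smear f
  | .inr f => bmoGammaAux S.dP2 S.smear2 f

/-- `‖f‖_{BMO^c(𝒫)}` for `f ∈ N ∪ L₂(N)`. -/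
noncomputable def bmoPoisson : N ⊕ τ.L2 → ℝ≥0∞
  | .inl f => bmoPoissonAux S.dP S.smear f
  | .inr f => bmoPoissonAux S.dP2 S.smear2 f

/-- The trace pairing `τ(z⋆ f y)` of `f ∈ N ∪ L₂(N)` with the elements `y z⋆` of `N ∩ L₁(N)`. -/
noncomputable def pair : N ⊕ τ.L2 → τ.PreL2 → τ.PreL2 → ℂ
  | .inl f, y, z => ⟪z, PreL2.mulLeft f y⟫_ℂ
  | .inr f, y, z => ⟪((PreL2.mulRight (star y.val) z : τ.PreL2) : τ.L2), f⟫_ℂ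

/-- `g = M_{a,n} f = ∫₀^∞ a(t) t^{n-1} ∂_t^n P_t f dt` in `N ∪ L₂(N)`: the integral is the weak
limit, against `N ∩ L₁(N)`, of the integrals over `(ε, R)` as `ε → 0` and `R → ∞`. -/
def IsMultiplier (a : ℝ → ℂ) (n : ℕ) (f g : N ⊕ τ.L2) : Prop :=
  ∀ y z : τ.PreL2, Tendsto
    (fun r : ℝ × ℝ => ∫ t in r.1..r.2,
      a t * (t : ℂ) ^ (n - 1) * pair (Sum.map (S.dP n t) (S.dP2 n t) f) y z)
    (𝓝[>] 0 ×ˢ atTop) (𝓝 (pair g y z))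

/-- The difference quotient `(f - T_r f) / r` of the negative generator `A`. -/
noncomputable def genQuot (r : ℝ) (f : N) : N := ((r⁻¹ : ℝ) : ℂ) • (f - S.T r.toNNReal f)

/-- `f ∈ N` lies in the domain of `A` on `L_p(N)`: `f ∈ L_p(N)`, and the difference quotients
converge in `L_p(N)`, that is, they are Cauchy for the `L_p`-norm as `r → 0`. -/
def MemDom (p : ℝ≥0∞) (f : N) : Prop :=
  τ.lpNorm p f < ∞ ∧
    Tendsto (fun r : ℝ × ℝ => τ.lpNorm p (S.genQuot r.1 f - S.genQuot r.2 f))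
      (𝓝[>] 0 ×ˢ 𝓝[>] 0) (𝓝 0)

/-- The difference quotient of `Γ(f, f) = (A(f⋆) f + f⋆ A(f) - A(f⋆ f)) / 2`. -/
noncomputable def gammaQuot (r : ℝ) (f : N) : N :=
  (2⁻¹ : ℂ) • (S.genQuot r (star f) * f + star f * S.genQuot r f - S.genQuot r (star f * f))

/-- `τ(y⋆ T_v Γ(f, f) y)`; the limit exists when `f`, `f⋆` and `f⋆ f` lie in the domain of `A`. -/
noncomputable def gammaForm (v : ℝ≥0) (f : N) (y : τ.PreL2) : ℝ :=
  limUnder (𝓝[>] (0 : ℝ)) fun r => (⟪y, PreL2.mulLeft (S.T v (S.gammaQuot r f)) y⟫_ℂ).re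

/-- The weak⋆ (ultraweak) topology of `N`. -/
@[reducible] noncomputable def weakStar (N : VonNeumannAlgebra H) : TopologicalSpace N :=
  ⨅ (ξ : lp (fun _ : ℕ => H) 2) (η : lp (fun _ : ℕ => H) 2),
    TopologicalSpace.induced (fun b : N => ∑' i, ⟪ξ i, (b : H →L[ℂ] H) (η i)⟫_ℂ) inferInstance

/-- `Γ² ≥ 0`: there is a weak⋆ dense `⋆`-algebra `𝒜 ⊆ dom(A)`, invariant under the semigroup, with
`Γ(T_v f, T_v f) ≤ T_v Γ(f, f)` for all `v > 0` and `f ∈ 𝒜`. -/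
def GammaSqNonneg : Prop :=
  ∃ 𝒜 : NonUnitalStarSubalgebra ℂ N,
    (∀ b : N, b ∈ @closure N (weakStar N) (𝒜 : Set N)) ∧
    (∀ s, ∀ f ∈ 𝒜, S.T s f ∈ 𝒜) ∧
    (∀ f ∈ 𝒜, ∃ p : ℝ≥0∞, 1 ≤ p ∧ S.MemDom p f) ∧
    ∀ v : ℝ≥0, 0 < v → ∀ f ∈ 𝒜, ∀ y : τ.PreL2,
      S.gammaForm 0 (S.T v f) y ≤ S.gammaForm v f y

end StandardSemigroup

end

noncomputable section

open UniformSpace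
open scoped ComplexConjugate ComplexOrder
open ENNReal (ofReal ofReal_mul ofReal_mul' ofReal_le_ofReal ofReal_ne_top ofReal_add measurable_ofReal
  ofReal_le_ofReal_iff ofReal_lt_top ofReal_pow tendsto_ofReal ofReal_toReal ofReal_div_of_pos
  ofReal_ofNat continuous_ofReal toReal_mono)
open Complex (I coe_smul ofReal_re norm_real continuous_re sub_re real_smul re_ofReal_mul conj_ofReal)
open Real (exp norm_of_nonneg sqrt_pos sq_sqrt norm_eq_abs toNNReal_add)
open ContinuousLinearMap (opNorm_le_bound adjoint_inner_right adjoint_inner_left le_opNorm)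
open IsSelfAdjoint (of_nonneg)

variable {H : Type u} [NormedAddCommGroup H] [InnerProductSpace ℂ H] [CompleteSpace H]
  {N : VonNeumannAlgebra H} {τ : NSFTrace N} {t s r ε K e ca : ℝ} {ψ : ℝ → ℝ} {a : ℝ → ℂ} {n : ℕ}
  {f g : N × τ.L2} {φ : StrongDual ℂ N}

local notation "𝔭" => StandardSemigroup.poissonDensity

namespace StandardSemigroup

open Polynomial in
/-- `∂_t^m φ_t(u) = t^{1-m} q_m(t²/u) e^{-t²/4u} u^{-3/2} / 2√π` with these polynomials `q_m`. -/
def pPoly : ℕ → ℝ[X]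
  | 0 => 1
  | m + 1 => C (1 - (m : ℝ)) * pPoly m + 2 * X * derivative (pPoly m) - C (1 / 2) * X * pPoly m

open Polynomial in
lemma pPoly_add_two (m : ℕ) : pPoly (m + 2) =
    X * (-(X * derivative (pPoly m)) + C (1 / 4) * X * pPoly m
      - C (3 / 2) * pPoly m) := by
  have c4 : (C (1 / 2) : ℝ[X]) = 2 * C (1 / 4) := by
    rw [← C_ofNat, ← C_mul]; norm_num
  have c6 : (C (3 / 2) : ℝ[X]) = 6 * C (1 / 4) := by
    rw [← C_ofNat, ← C_mul]; norm_num
  have c1 : (4 : ℝ[X]) * C (1 / 4) = 1 := by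
    rw [← C_ofNat, ← C_mul]; norm_num
  induction m with
  | zero =>
    simp only [pPoly, derivative_one, derivative_sub, derivative_mul, derivative_X, derivative_C,
      derivative_add, derivative_ofNat, c4, c6, Nat.cast_zero, Nat.cast_one, sub_zero, sub_self,
      C_1, C_0, derivative_zero]
    linear_combination (X ^ 2 * C (1 / 4) : ℝ[X]) * c1
  | succ m ih =>
    rw [show m + 1 + 2 = (m + 2) + 1 from rfl, pPoly, ih, pPoly]
    simp only [derivative_add, derivative_sub, derivative_mul, derivative_X, derivative_C,
      derivative_neg, derivative_ofNat, c4, c6]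
    push_cast; simp only [C_sub, C_add, C_1, C_ofNat]; ring

/-- `∂_t^m φ_t(u)`, where `φ_t` is the density of the subordination formula. -/
def pDeriv (m : ℕ) (t u : ℝ) : ℝ :=
  1 / (2 * √π) * (t ^ (1 - (m : ℤ)) * (pPoly m).eval (t ^ 2 / u) *
    exp (-t ^ 2 / (4 * u)) * u ^ (-(3 / 2) : ℝ))

lemma pDeriv_zero (t u : ℝ) : pDeriv 0 t u = 𝔭 t u := by
  simp [pDeriv, poissonDensity, pPoly]

lemma hasDerivAt_pDeriv (m : ℕ) {t u : ℝ} (ht : t ≠ 0) (hu : u ≠ 0) :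
    HasDerivAt (fun r => pDeriv m r u) (pDeriv (m + 1) t u) t := by
  have h2 : HasDerivAt (fun r => -r ^ 2 / (4 * u)) (-(2 * t) / (4 * u)) t := by
    simpa using ((hasDerivAt_pow 2 t).neg).div_const (4 * u)
  have h3 : HasDerivAt (fun r => (pPoly m).eval (r ^ 2 / u))
      ((Polynomial.derivative (pPoly m)).eval (t ^ 2 / u) * (2 * t / u)) t :=
    HasDerivAt.comp (h₂ := fun x => (pPoly m).eval x) t
      ((pPoly m).hasDerivAt (t ^ 2 / u)) (by simpa using (hasDerivAt_pow 2 t).div_const u)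
  have h4 := hasDerivAt_zpow (1 - (m : ℤ)) t (Or.inl ht)
  have h5 := (((h4.mul h3).mul h2.exp).mul_const (u ^ (-(3 / 2) : ℝ))).const_mul (1 / (2 * √π))
  refine h5.congr_deriv ?_
  have e1 : t ^ (1 - (m : ℤ)) = t ^ (1 - ((m + 1 : ℕ) : ℤ)) * t := by
    rw [← zpow_add_one₀ ht]; congr 1; push_cast; ring
  have e2 : (1 - (m : ℤ) - 1) = 1 - ((m + 1 : ℕ) : ℤ) := by push_cast; ring
  simp only [Pi.mul_apply]; rw [pDeriv, e1, e2, pPoly]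
  simp only [Polynomial.eval_add, Polynomial.eval_sub, Polynomial.eval_mul, Polynomial.eval_C,
    Polynomial.eval_X, Polynomial.eval_ofNat, Int.cast_sub, Int.cast_one, Int.cast_natCast]
  ring

lemma hasDerivAt_pDeriv_right (m : ℕ) {t u : ℝ} (ht : t ≠ 0) (hu : 0 < u) :
    HasDerivAt (fun r => pDeriv m t r) (pDeriv (m + 2) t u) u := by
  have h0 := hasDerivAt_inv hu.ne'
  have h1 : HasDerivAt (fun r => t ^ 2 / r) (t ^ 2 * (-(u ^ 2)⁻¹)) u := by
    simpa [div_eq_mul_inv] using h0.const_mul (t ^ 2)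
  have h2 : HasDerivAt (fun r => -t ^ 2 / (4 * r)) (-t ^ 2 / 4 * (-(u ^ 2)⁻¹)) u := by
    refine (h0.const_mul (-t ^ 2 / 4)).congr_of_eventuallyEq (.of_forall fun r => ?_); simp; ring
  have h4 := Real.hasDerivAt_rpow_const (p := (-(3 / 2) : ℝ)) (Or.inl hu.ne')
  have h5 := ((((HasDerivAt.comp u ((pPoly m).hasDerivAt (t ^ 2 / u)) h1).const_mul (t ^ (1 - (m : ℤ)))).mul h2.exp).mul h4).const_mul (1 / (2 * √π))
  refine h5.congr_deriv ?_
  have e1 : t ^ (1 - (m : ℤ)) = t ^ (1 - ((m + 2 : ℕ) : ℤ)) * t ^ 2 := by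
    rw [← zpow_natCast, ← zpow_add₀ ht]; congr 1; push_cast; ring
  have e2 : u ^ (-(3 / 2) : ℝ) = u ^ (-(3 / 2) - 1 : ℝ) * u := by
    rw [Real.rpow_sub_one hu.ne']; field_simp
  simp; rw [pDeriv, e1, e2, pPoly_add_two]
  simp only [Polynomial.eval_add, Polynomial.eval_sub, Polynomial.eval_mul, Polynomial.eval_C,
    Polynomial.eval_X, Polynomial.eval_neg]
  field_simp; ring

lemma exists_abs_eval_le (p : Polynomial ℝ) :
    ∃ C : ℝ, 0 ≤ C ∧ ∀ w : ℝ, 0 ≤ w → |p.eval w| ≤ C * exp (3 / 16 * w) := by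
  induction p using Polynomial.induction_on' with
  | add p q hp hq =>
    obtain ⟨C, hC, h⟩ := hp
    obtain ⟨D, hD, h'⟩ := hq
    refine ⟨C + D, by positivity, fun w hw => ?_⟩
    rw [Polynomial.eval_add, add_mul]; exact (abs_add_le _ _).trans (add_le_add (h w hw) (h' w hw))
  | monomial n a =>
    refine ⟨|a| * (n.factorial * (16 / 3) ^ n), by positivity, fun w hw => ?_⟩
    have h := Real.pow_div_factorial_le_exp (x := 3 / 16 * w) (by positivity) n
    rw [div_le_iff₀ (by positivity), mul_pow] at h
    rw [Polynomial.eval_monomial, abs_mul, abs_pow, abs_of_nonneg hw, mul_assoc]; gcongr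
    calc w ^ n = (16 / 3) ^ n * ((3 / 16) ^ n * w ^ n) := by
          rw [← mul_assoc, ← mul_pow]; norm_num
      _ ≤ (16 / 3) ^ n * (exp (3 / 16 * w) * n.factorial) := by gcongr
      _ = _ := by ring

/-- A constant `C_m` with `|∂_t^m φ_t| ≤ C_m t^{-m} φ_{t/2}`. -/
def pConst (m : ℕ) : ℝ := 2 * (exists_abs_eval_le (pPoly m)).choose

lemma pConst_nonneg (m : ℕ) : 0 ≤ pConst m :=
  mul_nonneg zero_le_two (exists_abs_eval_le (pPoly m)).choose_spec.1

lemma pDensity_nonneg {t u : ℝ} (ht : 0 ≤ t) (hu : 0 ≤ u) : 0 ≤ 𝔭 t u := by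
  unfold poissonDensity; positivity

lemma abs_pDeriv_le (m : ℕ) {t u : ℝ} (ht : 0 < t) (hu : 0 < u) :
    |pDeriv m t u| ≤ pConst m * (t ^ m)⁻¹ * 𝔭 (t / 2) u := by
  have h := (exists_abs_eval_le (pPoly m)).choose_spec.2 (t ^ 2 / u) (by positivity)
  have e : t ^ (1 - (m : ℤ)) = (t ^ m)⁻¹ * t := by
    rw [zpow_sub₀ ht.ne', zpow_one, zpow_natCast]; field_simp
  rw [pDeriv, poissonDensity, pConst, e]; simp only [abs_mul]
  rw [abs_of_nonneg (by positivity : 0 ≤ 1 / (2 * √π)), abs_of_nonneg (by positivity : 0 ≤ (t ^ m)⁻¹),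
    abs_of_pos ht, abs_of_pos (Real.exp_pos _), abs_of_pos (Real.rpow_pos_of_pos hu _)]
  have e2 : exp (-(t / 2) ^ 2 / (4 * u)) = exp (3 / 16 * (t ^ 2 / u)) * exp (-t ^ 2 / (4 * u)) := by
    rw [← Real.exp_add]; congr 1; field_simp; ring
  rw [e2]
  calc _ ≤ 1 / (2 * √π) * ((t ^ m)⁻¹ * t * ((exists_abs_eval_le (pPoly m)).choose *
        exp (3 / 16 * (t ^ 2 / u))) * exp (-t ^ 2 / (4 * u)) * u ^ (-(3 / 2) : ℝ)) := by
        gcongr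
    _ = _ := by ring

lemma pDensity_le {s t u : ℝ} (hs : 0 < s) (hst : s ≤ t) (hu : 0 < u) :
    𝔭 t u ≤ t / s * 𝔭 s u := by
  unfold poissonDensity
  calc _ ≤ 1 / (2 * √π) * (t * exp (-s ^ 2 / (4 * u)) * u ^ (-(3 / 2) : ℝ)) := by
        have := hs.le.trans hst; gcongr
    _ = _ := by field_simp

lemma lintegral_ofReal_deriv {s : Set ℝ} {a b : ℕ → ℝ} {F f : ℝ → ℝ} {A B : ℝ}
    (hc : AECover (volume.restrict s) atTop fun i => Icc (a i) (b i)) (hab : ∀ i, a i ≤ b i)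
    (hs : ∀ i, Icc (a i) (b i) ⊆ s) (hd : ∀ x ∈ s, HasDerivAt F (f x) x) (hf : ContinuousOn f s)
    (h0 : ∀ x ∈ s, 0 ≤ f x) (hA : Tendsto (fun i => F (a i)) atTop (𝓝 A))
    (hB : Tendsto (fun i => F (b i)) atTop (𝓝 B)) (hm : MeasurableSet s) :
    ∫⁻ x in s, ofReal (f x) = ofReal (B - A) := by
  refine hc.lintegral_eq_of_tendsto _ ?_ ?_
  · exact (hf.aemeasurable hm).ennreal_ofReal
  · have h := tendsto_ofReal (hB.sub hA)
    refine h.congr fun i => ?_; rw [Measure.restrict_restrict_of_subset (hs i)]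
    have hi := (hf.mono (hs i)).integrableOn_Icc (μ := volume)
    rw [← ofReal_integral_eq_lintegral_ofReal hi
      ((ae_restrict_iff' measurableSet_Icc).2 (ae_of_all _ fun x hx => h0 x (hs i hx))),
      integral_Icc_eq_integral_Ioc, ← intervalIntegral.integral_of_le (hab i),
      intervalIntegral.integral_eq_sub_of_hasDerivAt]
    · intro x hx; rw [uIcc_of_le (hab i)] at hx; exact hd x (hs i hx)
    · exact (intervalIntegrable_iff_integrableOn_Icc_of_le (hab i)).2 hi

/-- `∫₀^x e^{-z²} dz`. -/
def gaussPrimitive (x : ℝ) : ℝ := ∫ z in (0 : ℝ)..x, exp (-z ^ 2)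

lemma hasDerivAt_gaussPrimitive (x : ℝ) : HasDerivAt gaussPrimitive (exp (-x ^ 2)) x := by
  have hc : Continuous fun z => exp (-z ^ 2) := by fun_prop
  exact intervalIntegral.integral_hasDerivAt_right (hc.intervalIntegrable _ _)
    hc.stronglyMeasurable.stronglyMeasurableAtFilter hc.continuousAt

lemma tendsto_gaussPrimitive_atTop : Tendsto gaussPrimitive atTop (𝓝 (√π / 2)) := by
  have h := intervalIntegral_tendsto_integral_Ioi 0 (by simpa using (integrable_exp_neg_mul_sq one_pos).integrableOn (s := Ioi (0 : ℝ))) tendsto_id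
  have e := integral_gaussian_Ioi 1
  simp at e; rw [e] at h; exact h

lemma tendsto_gaussPrimitive_atBot : Tendsto gaussPrimitive atBot (𝓝 (-(√π / 2))) := by
  have h := (tendsto_gaussPrimitive_atTop.comp tendsto_neg_atBot_atTop).neg
  refine h.congr fun x => ?_
  have e := intervalIntegral.integral_comp_neg (a := 0) (b := x) fun z => exp (-z ^ 2)
  simp at e; simp only [Function.comp, gaussPrimitive]
  rw [e, intervalIntegral.integral_symm 0 (-x)]

lemma aecover_Ioi_Icc : AECover (volume.restrict (Ioi (0 : ℝ))) atTop
    fun i : ℕ => Icc ((i + 1 : ℝ)⁻¹) (i + 1) where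
  ae_eventually_mem := by
    refine (ae_restrict_iff' measurableSet_Ioi).2 (ae_of_all _ fun x hx => ?_)
    have h1 : Tendsto (fun i : ℕ => ((i : ℝ) + 1)⁻¹) atTop (𝓝 0) := by
      simpa [one_div] using tendsto_one_div_add_atTop_nhds_zero_nat (𝕜 := ℝ)
    filter_upwards [h1.eventually_le_const hx, (tendsto_atTop_add_const_right _ _ tendsto_natCast_atTop_atTop).eventually_ge_atTop x] with i a b
    exact ⟨a, b⟩
  measurableSet _ := measurableSet_Icc

lemma rpow_neg_three_half {u : ℝ} (hu : 0 < u) : u ^ (-(3 / 2) : ℝ) = (u * √u)⁻¹ := by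
  rw [Real.rpow_neg hu.le, show (3 / 2 : ℝ) = 1 + 1 / 2 by norm_num, Real.rpow_add hu,
    Real.rpow_one, ← Real.sqrt_eq_rpow]

lemma continuousOn_pDeriv (m : ℕ) (ht : t ≠ 0) :
    ContinuousOn (pDeriv m t) (Ioi 0) := fun _ hu =>
  (hasDerivAt_pDeriv_right m ht hu).continuousAt.continuousWithinAt

lemma continuousOn_pDensity (ht : t ≠ 0) :
    ContinuousOn (𝔭 t) (Ioi 0) := by
  have h := continuousOn_pDeriv 0 ht
  rwa [show pDeriv 0 t = 𝔭 t from funext (pDeriv_zero t)] at h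

lemma lintegral_pDensity (ht : 0 < t) :
    ∫⁻ u in Ioi 0, ofReal (𝔭 t u) = 1 := by
  have hd : ∀ u ∈ Ioi 0, HasDerivAt (fun u => -(2 / √π) * gaussPrimitive (t / (2 * √u)))
      (𝔭 t u) u := by
    intro u hu
    have hu : 0 < u := hu
    have h1 := ((Real.hasDerivAt_sqrt hu.ne').const_mul 2).inv (by positivity)
    have h2 := (h1.const_mul t)
    have h3 := HasDerivAt.comp u (hasDerivAt_gaussPrimitive (t * (2 * √u)⁻¹)) h2
    have h4 := h3.const_mul (-(2 / √π))
    refine (h4.congr_of_eventuallyEq (.of_forall fun x => ?_)).congr_deriv ?_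
    · simp [div_eq_mul_inv, Function.comp]
    · have e : -(t * (2 * √u)⁻¹) ^ 2 = -t ^ 2 / (4 * u) := by grind
      rw [e, poissonDensity, rpow_neg_three_half hu]
      have hq := sq_sqrt hu.le
      have hpi := Real.sqrt_pos.2 Real.pi_pos
      field_simp; rw [hq]
  have l1 : Tendsto (fun i : ℕ => -(2 / √π) * gaussPrimitive (t / (2 * √((i + 1 : ℝ)⁻¹)))) atTop
      (𝓝 (-(2 / √π) * (√π / 2))) := by
    refine (tendsto_gaussPrimitive_atTop.comp ?_).const_mul _
    have : Tendsto (fun i : ℕ => t / 2 * √(i + 1 : ℝ)) atTop atTop :=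
      (Real.tendsto_sqrt_atTop.comp (tendsto_atTop_add_const_right _ _
        tendsto_natCast_atTop_atTop)).const_mul_atTop (by positivity)
    refine this.congr fun i => ?_; rw [Real.sqrt_inv]; field_simp
  have l2 : Tendsto (fun i : ℕ => -(2 / √π) * gaussPrimitive (t / (2 * √(i + 1 : ℝ)))) atTop
      (𝓝 (-(2 / √π) * 0)) := by
    have h0 : gaussPrimitive 0 = 0 := by simp [gaussPrimitive]
    have hc := (hasDerivAt_gaussPrimitive 0).continuousAt.tendsto
    rw [h0] at hc; refine (hc.comp ?_).const_mul _
    have : Tendsto (fun i : ℕ => 2 * √(i + 1 : ℝ)) atTop atTop :=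
      (Real.tendsto_sqrt_atTop.comp (tendsto_atTop_add_const_right _ _
        tendsto_natCast_atTop_atTop)).const_mul_atTop (by positivity)
    exact this.const_div_atTop t
  rw [lintegral_ofReal_deriv aecover_Ioi_Icc (fun i => ?_) (fun i x hx => ?_) hd
    (continuousOn_pDensity ht.ne') (fun x hx => pDensity_nonneg ht.le (le_of_lt hx)) l1 l2
    measurableSet_Ioi]
  · rw [← ENNReal.ofReal_one]; congr 1; field_simp; ring
  · have : (1 : ℝ) ≤ i + 1 := by grind
    exact (inv_le_one_of_one_le₀ this).trans this
  · exact lt_of_lt_of_le (by positivity) hx.1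

lemma lintegral_pDensity_mul {t s u : ℝ} (ht : 0 < t) (hs : 0 < s) (hu : 0 < u) :
    ∫⁻ r in Ioo 0 u, ofReal (𝔭 t r * 𝔭 s (u - r)) =
      ofReal (𝔭 (t + s) u) := by
  have hw := Real.sqrt_pos.2 hu
  have hw2 := sq_sqrt hu.le
  set w := √u with hwdef
  set z : ℝ → ℝ → ℝ := fun c r => (t * (√(u - r) / √r) - c * (√r / √(u - r))) / (2 * w) with hz
  have hdz : ∀ c, ∀ r ∈ Ioo 0 u, HasDerivAt (z c)
      (-(w / 4) * ((r * √r) * ((u - r) * √(u - r)))⁻¹ * (t * (u - r) + c * r)) r := by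
    intro c r hr
    have h0 := hr.1
    have h1 := sub_pos.2 hr.2
    have p0 := Real.sqrt_pos.2 h0
    have q0 := Real.sqrt_pos.2 h1
    have p2 := sq_sqrt h0.le
    have q2 := sq_sqrt h1.le
    have dp := Real.hasDerivAt_sqrt h0.ne'
    have dq := ((hasDerivAt_id r).const_sub u).sqrt h1.ne'
    have d := (((dq.div dp p0.ne').const_mul t).sub
      ((dp.div dq q0.ne').const_mul c)).div_const (2 * w)
    refine (d.congr_of_eventuallyEq (.of_forall fun x => ?_)).congr_deriv ?_
    · simp [hz]
    · simp only [id]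
      generalize √r = p at *
      generalize √(u - r) = q at *
      obtain rfl : r = p ^ 2 := p2.symm
      obtain rfl : u = q ^ 2 + p ^ 2 := by linarith
      have e : q ^ 2 + p ^ 2 - p ^ 2 = q ^ 2 := by ring
      rw [e]; field_simp; rw [hw2]; ring
  have hexp : ∀ c, ∀ r ∈ Ioo 0 u, c ^ 2 = s ^ 2 →
      exp (-(t + c) ^ 2 / (4 * u)) * exp (-(z c r) ^ 2) =
      exp (-t ^ 2 / (4 * r)) * exp (-s ^ 2 / (4 * (u - r))) := by
    intro c r hr hc
    have h0 := hr.1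
    have h1 := sub_pos.2 hr.2
    have p0 := Real.sqrt_pos.2 h0
    have q0 := Real.sqrt_pos.2 h1
    have p2 := sq_sqrt h0.le
    have q2 := sq_sqrt h1.le
    rw [← Real.exp_add, ← Real.exp_add, ← hc]; congr 1; simp only [hz]
    generalize √r = p at *
    generalize √(u - r) = q at *
    obtain rfl : r = p ^ 2 := p2.symm
    obtain rfl : u = q ^ 2 + p ^ 2 := by linarith
    have e : q ^ 2 + p ^ 2 - p ^ 2 = q ^ 2 := by ring
    rw [e, div_pow, mul_pow, hw2]; field_simp; ring
  set α := (s + t) / (2 * π * (u * w)) with hα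
  set β := (s - t) / (2 * π * (u * w)) with hβ
  set F : ℝ → ℝ := fun r => -(α * exp (-(t + s) ^ 2 / (4 * u)) * gaussPrimitive (z s r) +
    β * exp (-(t + -s) ^ 2 / (4 * u)) * gaussPrimitive (z (-s) r)) with hF
  have hd : ∀ r ∈ Ioo 0 u, HasDerivAt F (𝔭 t r * 𝔭 s (u - r)) r := by
    intro r hr
    have h0 := hr.1
    have h1 := sub_pos.2 hr.2
    have d1 := HasDerivAt.comp r (hasDerivAt_gaussPrimitive _) (hdz s r hr)
    have d2 := HasDerivAt.comp r (hasDerivAt_gaussPrimitive _) (hdz (-s) r hr)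
    have d := ((d1.const_mul (α * exp (-(t + s) ^ 2 / (4 * u)))).add
      (d2.const_mul (β * exp (-(t + -s) ^ 2 / (4 * u))))).neg
    refine (d.congr_of_eventuallyEq (.of_forall fun x => rfl)).congr_deriv ?_
    have e1 := hexp s r hr rfl
    have e2 := hexp (-s) r hr (by ring)
    calc _ = (exp (-(t + s) ^ 2 / (4 * u)) * exp (-(z s r) ^ 2)) * (α *
          ((w / 4) * ((r * √r) * ((u - r) * √(u - r)))⁻¹ * (t * (u - r) + s * r))) +
          (exp (-(t + -s) ^ 2 / (4 * u)) * exp (-(z (-s) r) ^ 2)) * (β *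
          ((w / 4) * ((r * √r) * ((u - r) * √(u - r)))⁻¹ * (t * (u - r) + -s * r))) := by ring
      _ = _ := by
        rw [e1, e2, poissonDensity, poissonDensity, rpow_neg_three_half h0, rpow_neg_three_half h1,
          hα, hβ]
        field_simp; rw [sq_sqrt Real.pi_pos.le]; ring
  have ia : ∀ i : ℕ, (0 : ℝ) < i + 2 := fun i => by positivity
  have q1 : ∀ i : ℕ, √(u - u / (i + 2)) / √(u / (i + 2)) = √(i + 1 : ℝ) := by
    intro i; rw [← Real.sqrt_div' _ (by positivity)]
    congr 1; have := ia i; field_simp; ring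
  have q2 : ∀ i : ℕ, √(u / (i + 2)) / √(u - u / (i + 2)) = (√(i + 1 : ℝ))⁻¹ := by
    intro i; rw [← q1, inv_div]
  have hsq : Tendsto (fun i : ℕ => √(i + 1 : ℝ)) atTop atTop :=
    Real.tendsto_sqrt_atTop.comp (tendsto_atTop_add_const_right _ _ tendsto_natCast_atTop_atTop)
  have hinv := fun c => (tendsto_inv_atTop_zero.comp hsq).const_mul c
  have limA : ∀ c, Tendsto (fun i : ℕ => z c (u / (i + 2))) atTop atTop := by
    intro c; simp only [hz, q1, q2]
    exact Tendsto.atTop_div_const (by positivity) ((hsq.const_mul_atTop ht).atTop_add (hinv c).neg)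
  have q3 : ∀ i : ℕ, √(u - (u - u / (i + 2))) / √(u - u / (i + 2)) = (√(i + 1 : ℝ))⁻¹ := by grind
  have q4 : ∀ i : ℕ, √(u - u / (i + 2)) / √(u - (u - u / (i + 2))) = √(i + 1 : ℝ) := by grind
  have limB1 : Tendsto (fun i : ℕ => z s (u - u / (i + 2))) atTop atBot := by
    simp only [hz, q3, q4]
    exact Tendsto.atBot_div_const (by positivity) ((hinv t).add_atBot (tendsto_neg_atTop_atBot.comp (hsq.const_mul_atTop hs)))
  have limB2 : Tendsto (fun i : ℕ => z (-s) (u - u / (i + 2))) atTop atTop := by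
    simp only [hz, q3, q4]; refine Tendsto.atTop_div_const (by positivity) ?_
    simp only [sub_eq_add_neg, neg_mul, neg_neg]; exact (hinv t).add_atTop (hsq.const_mul_atTop hs)
  have lA := (((tendsto_gaussPrimitive_atTop.comp (limA s)).const_mul
      (α * exp (-(t + s) ^ 2 / (4 * u)))).add ((tendsto_gaussPrimitive_atTop.comp
      (limA (-s))).const_mul (β * exp (-(t + -s) ^ 2 / (4 * u))))).neg
  have lB := (((tendsto_gaussPrimitive_atBot.comp limB1).const_mul
      (α * exp (-(t + s) ^ 2 / (4 * u)))).add ((tendsto_gaussPrimitive_atTop.comp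
      limB2).const_mul (β * exp (-(t + -s) ^ 2 / (4 * u))))).neg
  have l0 : Tendsto (fun i : ℕ => u / ((i : ℝ) + 2)) atTop (𝓝 0) :=
    (tendsto_atTop_add_const_right _ _ tendsto_natCast_atTop_atTop).const_div_atTop u
  have hle : ∀ i : ℕ, u / ((i : ℝ) + 2) ≤ u / 2 := fun i => by
    gcongr; linarith [i.cast_nonneg (α := ℝ)]
  have hsub : ∀ i : ℕ, Icc (u / ((i : ℝ) + 2)) (u - u / (i + 2)) ⊆ Ioo 0 u := fun i x hx => by
    have h3 : 0 < u / ((i : ℝ) + 2) := by positivity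
    exact ⟨h3.trans_le hx.1, hx.2.trans_lt (by linarith)⟩
  rw [lintegral_ofReal_deriv (aecover_Ioo_of_Icc l0 (by simpa using l0.const_sub u))
    (fun i => by linarith [hle i]) hsub hd (by exact ((continuousOn_pDensity ht.ne').mono fun x hx => hx.1).mul ((continuousOn_pDensity hs.ne').comp (by fun_prop) fun x hx => sub_pos.2 hx.2)) (fun r hr => mul_nonneg
      (pDensity_nonneg ht.le hr.1.le) (pDensity_nonneg hs.le (sub_pos.2 hr.2).le))
    lA lB measurableSet_Ioo, poissonDensity, rpow_neg_three_half hu, hα]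
  congr 1; field_simp; rw [sq_sqrt Real.pi_pos.le]; ring

/-- The probability measure `φ_t(u) du` on `(0, ∞)`. -/
def poissonMeasure (t : ℝ) : Measure ℝ :=
  (volume.restrict (Ioi 0)).withDensity fun u => ofReal (𝔭 t u)

lemma measurable_pDensity (t : ℝ) : Measurable (𝔭 t) := by
  unfold poissonDensity; fun_prop

lemma measurable_pDeriv (m : ℕ) (t : ℝ) : Measurable (pDeriv m t) := by
  unfold pDeriv
  have := (pPoly m).continuous.measurable
  fun_prop

lemma isProb_poissonMeasure (ht : 0 < t) :
    IsProbabilityMeasure (poissonMeasure t) :=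
  ⟨by rw [poissonMeasure, withDensity_apply _ MeasurableSet.univ, Measure.restrict_univ,
    lintegral_pDensity ht]⟩

lemma lintegral_poissonMeasure (t : ℝ) {F : ℝ → ℝ≥0∞} (hF : Measurable F) :
    ∫⁻ u, F u ∂poissonMeasure t =
      ∫⁻ u in Ioi 0, ofReal (𝔭 t u) * F u := by
  rw [poissonMeasure, lintegral_withDensity_eq_lintegral_mul _
    (measurable_pDensity t).ennreal_ofReal hF]
  rfl

lemma poissonMeasure_conv (ht : 0 < t) (hs : 0 < s) :
    (poissonMeasure t).conv (poissonMeasure s) = poissonMeasure (t + s) := by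
  have := isProb_poissonMeasure ht
  have := isProb_poissonMeasure hs
  refine Measure.ext_of_lintegral _ fun F hF => ?_
  rw [Measure.lintegral_conv hF, lintegral_poissonMeasure _ hF, lintegral_poissonMeasure]
  swap
  · exact Measurable.lintegral_prod_right' (f := fun p : ℝ × ℝ => F (p.1 + p.2)) (by fun_prop)
  have m1 := (measurable_pDensity t).ennreal_ofReal
  have m2 := (measurable_pDensity s).ennreal_ofReal
  have e1 : ∀ r : ℝ, ∫⁻ q, F (r + q) ∂poissonMeasure s =
      ∫⁻ u, (Ioi r).indicator (fun u => ofReal (𝔭 s (u - r)) * F u) u := by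
    intro r
    rw [lintegral_poissonMeasure s (by fun_prop), ← lintegral_indicator measurableSet_Ioi,
      ← lintegral_add_right_eq_self
        ((Ioi r).indicator fun u => ofReal (𝔭 s (u - r)) * F u) r]
    refine lintegral_congr fun u => ?_
    by_cases h : 0 < u
    · simp [indicator, h, add_comm r u]
    · simp [indicator, h]
  simp_rw [e1]
  have m3 : Measurable fun p : ℝ × ℝ => (if 0 < p.1 ∧ p.1 < p.2 then
      ofReal (𝔭 t p.1 * 𝔭 s (p.2 - p.1)) * F p.2 else 0 : ℝ≥0∞) := by
    have m1 := measurable_pDensity t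
    have m2 := measurable_pDensity s
    exact Measurable.ite ((measurableSet_lt measurable_const measurable_fst).inter (measurableSet_lt measurable_fst measurable_snd)) (by fun_prop) measurable_const
  calc _ = ∫⁻ r, ∫⁻ u, (if 0 < r ∧ r < u then
        ofReal (𝔭 t r * 𝔭 s (u - r)) * F u else 0) := by
        rw [← lintegral_indicator measurableSet_Ioi]; refine lintegral_congr fun r => ?_
        by_cases h : 0 < r
        · rw [indicator_of_mem (show r ∈ Ioi 0 from h), ← lintegral_const_mul']
          swap
          · exact ofReal_ne_top
          refine lintegral_congr fun u => ?_
          by_cases h' : r < u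
          · rw [indicator_of_mem (show u ∈ Ioi r from h'), if_pos ⟨h, h'⟩,
              ofReal_mul (pDensity_nonneg ht.le h.le), mul_assoc]
          · rw [indicator_of_notMem (show u ∉ Ioi r from h'), if_neg (fun h => h' h.2), mul_zero]
        · simp [h]
    _ = ∫⁻ u, ∫⁻ r, (if 0 < r ∧ r < u then
        ofReal (𝔭 t r * 𝔭 s (u - r)) * F u else 0) :=
        lintegral_lintegral_swap m3.aemeasurable
    _ = _ := by
        rw [← lintegral_indicator measurableSet_Ioi]; refine lintegral_congr fun u => ?_
        by_cases h : 0 < u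
        · rw [indicator_of_mem (show u ∈ Ioi 0 from h), ← lintegral_pDensity_mul ht hs h,
            ← lintegral_mul_const _ (by
              have m1 := measurable_pDensity t
              have m2 := measurable_pDensity s
              fun_prop), ← lintegral_indicator measurableSet_Ioo]
          refine lintegral_congr fun r => ?_; simp only [indicator, mem_Ioo]
        · rw [indicator_of_notMem (show u ∉ Ioi 0 from h)]
          exact (lintegral_congr fun r => if_neg fun h' => h (h'.1.trans h'.2)).trans lintegral_zero

variable {E : Type*} [NormedAddCommGroup E] [NormedSpace ℝ E]

lemma integrableOn_pDensity (ht : 0 < t) :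
    IntegrableOn (𝔭 t) (Ioi 0) := by
  exact ⟨(measurable_pDensity t).aestronglyMeasurable, (lintegral_congr_ae ((ae_restrict_iff' measurableSet_Ioi).2 (ae_of_all _ fun u hu => Real.enorm_of_nonneg (pDensity_nonneg ht.le (le_of_lt hu))))).trans_lt ((lintegral_pDensity ht).trans_lt ENNReal.one_lt_top)⟩

lemma integral_pDensity (ht : 0 < t) :
    ∫ u in Ioi 0, 𝔭 t u = 1 := by
  rw [integral_eq_lintegral_of_nonneg_ae, lintegral_pDensity ht, ENNReal.toReal_one]
  · exact (ae_restrict_iff' measurableSet_Ioi).2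
      (ae_of_all _ fun u hu => pDensity_nonneg ht.le (le_of_lt hu))
  · exact (measurable_pDensity t).aestronglyMeasurable

lemma integrableOn_pDeriv (m : ℕ) (ht : 0 < t) :
    IntegrableOn (pDeriv m t) (Ioi 0) := by
  exact ((integrableOn_pDensity (half_pos ht)).const_mul
    (pConst m * (t ^ m)⁻¹)).mono' (measurable_pDeriv m t).aestronglyMeasurable ((ae_restrict_iff' measurableSet_Ioi).2 (ae_of_all _ fun u hu => abs_pDeriv_le m ht hu))

lemma integral_abs_pDeriv_le (m : ℕ) (ht : 0 < t) :
    ∫ u in Ioi 0, |pDeriv m t u| ≤ pConst m * (t ^ m)⁻¹ := by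
  have h := setIntegral_mono_on (integrableOn_pDeriv m ht).abs
    ((integrableOn_pDensity (half_pos ht)).const_mul (pConst m * (t ^ m)⁻¹))
    measurableSet_Ioi fun u hu => abs_pDeriv_le m ht hu
  rwa [integral_const_mul, integral_pDensity (half_pos ht), mul_one] at h

/-- A map on functions on `(0, ∞)` that is linear and bounded on `L₁`. -/
structure IsL1Bounded (J : (ℝ → ℝ) → E) (C : ℝ) : Prop where
  sub : ∀ ψ χ : ℝ → ℝ, IntegrableOn ψ (Ioi 0) → IntegrableOn χ (Ioi 0) → J (ψ - χ) = J ψ - J χ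
  smul : ∀ (c : ℝ) (ψ : ℝ → ℝ), IntegrableOn ψ (Ioi 0) → J (c • ψ) = c • J ψ
  bound : ∀ ψ : ℝ → ℝ, IntegrableOn ψ (Ioi 0) → ‖J ψ‖ ≤ C * ∫ u in Ioi 0, |ψ u|

lemma abs_pDeriv_taylor_le (m : ℕ) {t h u : ℝ} (ht : 0 < t) (hh : |h| ≤ t / 2) (hu : 0 < u) :
    |pDeriv m (t + h) u - pDeriv m t u - h * pDeriv (m + 1) t u| ≤
      3 * pConst (m + 2) * ((t / 2) ^ (m + 2))⁻¹ * h ^ 2 * 𝔭 (t / 4) u := by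
  set s := Icc (t - |h|) (t + |h|) with hs
  have hpos : ∀ r ∈ s, t / 2 ≤ r ∧ r ≤ 3 * t / 2 ∧ |r - t| ≤ |h| := fun r hr =>
    ⟨by linarith [hr.1], by linarith [hr.2], abs_le.2 ⟨by linarith [hr.1], by linarith [hr.2]⟩⟩
  have hts : t ∈ s := ⟨by linarith [abs_nonneg h], by linarith [abs_nonneg h]⟩
  have hths : t + h ∈ s := ⟨by linarith [neg_abs_le h], by linarith [le_abs_self h]⟩
  set M := 3 * pConst (m + 2) * ((t / 2) ^ (m + 2))⁻¹ * 𝔭 (t / 4) u with hM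
  have hM0 : 0 ≤ M := by
    have := pConst_nonneg (m + 2)
    have := pDensity_nonneg (t := t / 4) (by positivity) hu.le
    positivity
  have b2 : ∀ r ∈ s, |pDeriv (m + 2) r u| ≤ M := by
    intro r hr
    obtain ⟨h1, h2, -⟩ := hpos r hr
    have hr0 : 0 < r := by linarith
    refine (abs_pDeriv_le (m + 2) hr0 hu).trans ?_
    have h3 := pDensity_le (s := t / 4) (t := r / 2) (by positivity) (by linarith) hu
    have h4 : r / 2 / (t / 4) ≤ 3 := by rw [div_le_iff₀ (by positivity)]; linarith
    have c0 := pConst_nonneg (m + 2)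
    have p0 := pDensity_nonneg (t := t / 4) (by positivity) hu.le
    have p1 := pDensity_nonneg (t := r / 2) (by positivity) hu.le
    calc _ ≤ pConst (m + 2) * ((t / 2) ^ (m + 2))⁻¹ * (3 * 𝔭 (t / 4) u) := by
          gcongr; exact h3.trans (by gcongr)
      _ = M := by rw [hM]; ring
  have b1 : ∀ r ∈ s, |pDeriv (m + 1) r u - pDeriv (m + 1) t u| ≤ M * |h| := by
    intro r hr
    have h1 := (convex_Icc (t - |h|) (t + |h|)).norm_image_sub_le_of_norm_hasDerivWithin_le
      (f' := fun r => pDeriv (m + 2) r u)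
      (fun x hx => (hasDerivAt_pDeriv (m + 1) (by linarith [(hpos x hx).1]) hu.ne').hasDerivWithinAt)
      b2 hts hr
    exact h1.trans (mul_le_mul_of_nonneg_left (hpos r hr).2.2 hM0)
  have h1 := (convex_Icc (t - |h|) (t + |h|)).norm_image_sub_le_of_norm_hasDerivWithin_le
      (f' := fun r => pDeriv (m + 1) r u - 1 * pDeriv (m + 1) t u)
      (fun x hx => ((hasDerivAt_pDeriv m (by linarith [(hpos x hx).1]) hu.ne').sub
        ((hasDerivAt_id x).mul_const _)).hasDerivWithinAt)
      (fun x hx => by rw [one_mul]; exact b1 x hx) hts hths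
  rw [norm_eq_abs, norm_eq_abs, add_sub_cancel_left] at h1
  calc _ = |pDeriv m (t + h) u - (t + h) * pDeriv (m + 1) t u -
      (pDeriv m t u - t * pDeriv (m + 1) t u)| := by congr 1; ring
    _ ≤ _ := h1
    _ = M * |h| ^ 2 := by ring
    _ = _ := by rw [sq_abs, hM]; ring

lemma IsL1Bounded.hasDerivAt {J : (ℝ → ℝ) → E} {C : ℝ} (hJ : IsL1Bounded J C) (m : ℕ)
    (ht : 0 < t) : HasDerivAt (fun r => J (pDeriv m r)) (J (pDeriv (m + 1) t)) t := by
  rw [hasDerivAt_iff_isLittleO_nhds_zero]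
  set M := 3 * pConst (m + 2) * ((t / 2) ^ (m + 2))⁻¹ with hM
  have hC : Asymptotics.IsBigO (𝓝 0) (fun h => J (pDeriv m (t + h)) - J (pDeriv m t)
      - h • J (pDeriv (m + 1) t)) (fun h => h ^ 2) := by
    refine Asymptotics.IsBigO.of_bound (|C| * M) ?_
    filter_upwards [Metric.closedBall_mem_nhds 0 (half_pos ht)] with h hh
    rw [Metric.mem_closedBall, dist_zero_right, norm_eq_abs] at hh
    have hth : 0 < t + h := by linarith [neg_abs_le h]
    have i1 := integrableOn_pDeriv m hth
    have i2 := integrableOn_pDeriv m ht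
    have i3 := integrableOn_pDeriv (m + 1) ht
    rw [← hJ.smul _ _ i3, ← hJ.sub _ _ i1 i2, ← hJ.sub _ _ (i1.sub i2) (i3.smul h)]
    refine (hJ.bound _ ((i1.sub i2).sub (i3.smul h))).trans ?_
    have hle := setIntegral_mono_on ((i1.sub i2).sub (i3.smul h)).abs
      ((integrableOn_pDensity (t := t / 4) (by positivity)).const_mul (M * h ^ 2))
      measurableSet_Ioi fun u hu => by
        simpa using abs_pDeriv_taylor_le m ht hh hu
    rw [integral_const_mul, integral_pDensity (by positivity), mul_one] at hle
    calc _ ≤ |C| * ∫ u in Ioi 0, |(pDeriv m (t + h) - pDeriv m t -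
        h • pDeriv (m + 1) t) u| := by gcongr; exact le_abs_self C
      _ ≤ |C| * (M * h ^ 2) := by gcongr
      _ = _ := by rw [norm_of_nonneg (sq_nonneg h)]; ring
  refine hC.trans_isLittleO ?_; simpa using Asymptotics.isLittleO_pow_id one_lt_two

lemma integrableOn_smul_bdd {F : ℝ → E} {s : Set ℝ}
    (hψ : IntegrableOn ψ s) (hF : AEStronglyMeasurable F (volume.restrict s))
    (hK : ∀ u, ‖F u‖ ≤ K) : IntegrableOn (fun u => ψ u • F u) s :=
  hψ.smul_bdd K hF (ae_of_all _ hK)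

lemma isL1Bounded_integral [CompleteSpace E] {F : ℝ → E}
    (hF : AEStronglyMeasurable F (volume.restrict (Ioi 0))) (hK : ∀ u, ‖F u‖ ≤ K) :
    IsL1Bounded (fun ψ => ∫ u in Ioi 0, ψ u • F u) K where
  sub ψ χ hψ hχ := by
    rw [← integral_sub (integrableOn_smul_bdd hψ hF hK) (integrableOn_smul_bdd hχ hF hK)]
    simp only [Pi.sub_apply, sub_smul]
  smul c ψ hψ := by
    rw [← integral_smul]; simp only [Pi.smul_apply, smul_assoc]
  bound ψ hψ := by
    rw [← integral_const_mul]
    refine norm_integral_le_of_norm_le (hψ.abs.const_mul K) (ae_of_all _ fun u => ?_)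
    rw [norm_smul, mul_comm, norm_eq_abs]; gcongr; exact hK u

lemma integral_poissonMeasure (ht : 0 < t) (F : ℝ → E) :
    ∫ u, F u ∂poissonMeasure t = ∫ u in Ioi 0, 𝔭 t u • F u := by
  rw [poissonMeasure, integral_withDensity_eq_integral_toReal_smul
    (measurable_pDensity t).ennreal_ofReal (ae_of_all _ fun _ => ofReal_lt_top)]
  refine setIntegral_congr_fun measurableSet_Ioi fun u hu => ?_
  simp only [ENNReal.toReal_ofReal (pDensity_nonneg ht.le (le_of_lt hu))]

lemma integral_pDeriv_conv [CompleteSpace E] {F : ℝ → E}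
    (hF : StronglyMeasurable F) (hK : ∀ u, ‖F u‖ ≤ K) (m k : ℕ) (ht : 0 < t)
    (hs : 0 < s) : ∫ r in Ioi 0, pDeriv m t r • ∫ q in Ioi 0, pDeriv k s q • F (r + q) =
      ∫ u in Ioi 0, pDeriv (m + k) (t + s) u • F u := by
  induction m generalizing t with
  | zero =>
    induction k generalizing s with
    | zero =>
      have := isProb_poissonMeasure ht
      have := isProb_poissonMeasure hs
      have := isProb_poissonMeasure (add_pos ht hs)
      simp only [pDeriv_zero, add_zero]
      rw [← integral_poissonMeasure (add_pos ht hs), ← poissonMeasure_conv ht hs, Measure.conv,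
        integral_map (by fun_prop) hF.aestronglyMeasurable, integral_prod,
        integral_poissonMeasure ht]
      · simp only [integral_poissonMeasure hs]
      · refine Integrable.mono' (integrable_const K)
          (hF.comp_measurable (by fun_prop)).aestronglyMeasurable (ae_of_all _ fun p => hK _)
    | succ k ih =>
      have swap : ∀ (k : ℕ) {s : ℝ}, 0 < s →
          (∫ r in Ioi 0, pDeriv 0 t r • ∫ q in Ioi 0, pDeriv k s q • F (r + q)) =
          ∫ q in Ioi 0, pDeriv k s q • ∫ r in Ioi 0, pDeriv 0 t r • F (r + q) := by
        intro k s hs; simp_rw [← integral_smul]; rw [integral_integral_swap]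
        · refine integral_congr_ae (ae_of_all _ fun q => integral_congr_ae (ae_of_all _ fun r => ?_))
          exact smul_comm _ _ _
        · have h := ((integrableOn_pDeriv 0 ht).mul_prod (integrableOn_pDeriv k hs)).smul_bdd
            (f := fun p => F (p.1 + p.2)) K
            (hF.comp_measurable (by fun_prop)).aestronglyMeasurable (ae_of_all _ fun p => hK _)
          exact h.congr (ae_of_all _ fun p => mul_smul _ _ _)
      have h1 := (isL1Bounded_integral (StronglyMeasurable.integral_prod_right' (f := fun p : ℝ × ℝ => pDeriv 0 t p.2 • F (p.2 + p.1)) (((measurable_pDeriv 0 t).comp measurable_snd).stronglyMeasurable.smul (hF.comp_measurable (by fun_prop)))).aestronglyMeasurable (fun q => (isL1Bounded_integral (hF.comp_measurable (measurable_add_const q)).aestronglyMeasurable (K := K) fun r => hK _).bound _ (integrableOn_pDeriv 0 ht))).hasDerivAt k hs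
      rw [← swap (k + 1) hs] at h1
      have h2 := ((isL1Bounded_integral hF.aestronglyMeasurable hK).hasDerivAt (0 + k)
        (add_pos ht hs)).comp_const_add t s
      refine h1.unique (h2.congr_of_eventuallyEq ?_)
      filter_upwards [lt_mem_nhds hs] with x hx using (swap k hx).symm.trans (ih hx)
  | succ m ih =>
    have h1 := (isL1Bounded_integral ((fun ψ hψ => StronglyMeasurable.integral_prod_right' (f := fun p : ℝ × ℝ => ψ p.2 • F (p.1 + p.2)) ((hψ.comp measurable_snd).stronglyMeasurable.smul (hF.comp_measurable (by fun_prop)))) _ (measurable_pDeriv k s)).aestronglyMeasurable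
      ((fun ψ hψ r => (isL1Bounded_integral (hF.comp_measurable (measurable_const_add r)).aestronglyMeasurable (K := K) fun q => hK _).bound ψ hψ) _ (integrableOn_pDeriv k hs))).hasDerivAt m ht
    have h2 := ((isL1Bounded_integral hF.aestronglyMeasurable hK).hasDerivAt (m + k)
        (add_pos ht hs)).comp_add_const t s
    rw [show m + 1 + k = m + k + 1 by ring]
    refine h1.unique (h2.congr_of_eventuallyEq ?_)
    filter_upwards [lt_mem_nhds ht] with x hx using ih hx

lemma exists_pDensity_le (ht : 0 < t) : ∃ A : ℝ, 0 ≤ A ∧ ∀ u : ℝ, 0 < u →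
    𝔭 t u ≤ A * (u * √u) ∧ 𝔭 t u ≤ A * (1 + u) ^ (-(3 / 2) : ℝ) := by
  have b1 : ∀ u : ℝ, 0 < u → 𝔭 t u ≤ 1 / (2 * √π) * t * (6 * (4 / t ^ 2) ^ 3) * (u * √u) := by
    intro u hu
    have h2 := sq_sqrt hu.le
    have h := Real.pow_div_factorial_le_exp (x := t ^ 2 / (4 * u)) (by positivity) 3
    have h' : exp (-t ^ 2 / (4 * u)) ≤ 6 * (4 / t ^ 2) ^ 3 * u ^ 3 := by
      rw [neg_div, Real.exp_neg]; refine (inv_anti₀ (by positivity) h).trans (le_of_eq ?_)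
      simp [Nat.factorial]; field_simp
    rw [poissonDensity, rpow_neg_three_half hu]
    calc _ ≤ 1 / (2 * √π) * (t * (6 * (4 / t ^ 2) ^ 3 * u ^ 3) * (u * √u)⁻¹) := by gcongr
      _ = _ := by
        field_simp; exact h2.symm
  have b2 : ∀ u : ℝ, 0 < u → 𝔭 t u ≤ 1 / (2 * √π) * t * (u * √u)⁻¹ := by
    intro u hu
    have h : exp (-t ^ 2 / (4 * u)) ≤ 1 := by
      rw [Real.exp_le_one_iff, neg_div]; exact neg_nonpos.2 (by positivity)
    rw [poissonDensity, rpow_neg_three_half hu]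
    calc _ ≤ 1 / (2 * √π) * (t * 1 * (u * √u)⁻¹) := by gcongr
      _ = _ := by ring
  set A := 1 / (2 * √π) * t * (6 * (4 / t ^ 2) ^ 3) with hA
  set B := 1 / (2 * √π) * t with hB
  have hA0 : 0 ≤ A := by positivity
  have hB0 : 0 ≤ B := by positivity
  refine ⟨4 * (A + B), by positivity, fun u hu => ⟨(b1 u hu).trans ?_, ?_⟩⟩
  · have := Real.sqrt_nonneg u
    gcongr; linarith
  · have h2 : (1 : ℝ) ≤ 4 * 2 ^ (-(3 / 2) : ℝ) := by
      have : (4 : ℝ) = 2 ^ (2 : ℝ) := by norm_num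
      rw [this, ← Real.rpow_add two_pos]; exact Real.one_le_rpow one_le_two (by norm_num)
    rcases le_total u 1 with h | h
    · have h1 : 2 ^ (-(3 / 2) : ℝ) ≤ (1 + u) ^ (-(3 / 2) : ℝ) :=
        Real.rpow_le_rpow_of_nonpos (by linarith) (by linarith) (by norm_num)
      have h3 := mul_le_one₀ h (Real.sqrt_nonneg _) (Real.sqrt_le_one.2 h)
      calc _ ≤ A * 1 := (b1 u hu).trans (by gcongr)
        _ ≤ (A + B) * (4 * 2 ^ (-(3 / 2) : ℝ)) := by gcongr; linarith
        _ ≤ (A + B) * (4 * (1 + u) ^ (-(3 / 2) : ℝ)) := by gcongr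
        _ = _ := by ring
    · have h1 : (2 * u) ^ (-(3 / 2) : ℝ) ≤ (1 + u) ^ (-(3 / 2) : ℝ) :=
        Real.rpow_le_rpow_of_nonpos (by linarith) (by linarith) (by norm_num)
      rw [Real.mul_rpow two_pos.le hu.le] at h1
      calc _ ≤ B * u ^ (-(3 / 2) : ℝ) := by rw [rpow_neg_three_half hu]; exact b2 u hu
        _ = B * (1 * u ^ (-(3 / 2) : ℝ)) := by ring
        _ ≤ (A + B) * ((4 * 2 ^ (-(3 / 2) : ℝ)) * u ^ (-(3 / 2) : ℝ)) := by gcongr; linarith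
        _ ≤ (A + B) * (4 * (1 + u) ^ (-(3 / 2) : ℝ)) := by
          rw [mul_assoc 4]; gcongr
        _ = _ := by ring

lemma hasDerivAt_indicator_pDeriv (m : ℕ) (ht : 0 < t) (x : ℝ) :
    HasDerivAt ((Ioi 0).indicator (pDeriv m t)) ((Ioi 0).indicator (pDeriv (m + 2) t) x)
      x := by
  rcases lt_trichotomy x 0 with h | rfl | h
  · rw [indicator_of_notMem (by simpa using h.le)]
    refine (hasDerivAt_const x 0).congr_of_eventuallyEq ?_
    filter_upwards [gt_mem_nhds h] with y hy
    exact indicator_of_notMem (by simpa using hy.le) _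
  · rw [indicator_of_notMem (by simp), hasDerivAt_iff_isLittleO_nhds_zero]
    obtain ⟨A, hA, h⟩ := exists_pDensity_le (half_pos ht)
    have c0 := pConst_nonneg m
    have hO : Asymptotics.IsBigO (𝓝 0)
        (fun h => (Ioi 0).indicator (pDeriv m t) (0 + h) -
          (Ioi 0).indicator (pDeriv m t) 0 - h • 0) (fun h => h * √|h|) := by
      refine Asymptotics.IsBigO.of_bound (pConst m * (t ^ m)⁻¹ * A) (.of_forall ?_); intro y
      simp only [zero_add, smul_zero, sub_zero, mem_Ioi, lt_irrefl, not_false_eq_true,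
        indicator_of_notMem]
      by_cases hy : 0 < y
      · rw [indicator_of_mem (by exact hy), norm_mul, norm_of_nonneg (Real.sqrt_nonneg _),
          norm_eq_abs, norm_eq_abs, abs_of_pos hy]
        refine (abs_pDeriv_le m ht hy).trans ?_; rw [mul_assoc (pConst m * (t ^ m)⁻¹)]; gcongr
        exact (h y hy).1
      · rw [indicator_of_notMem (by simpa using hy)]
        simp; positivity
    refine hO.trans_isLittleO ?_
    have : Tendsto (fun h => √|h|) (𝓝 0) (𝓝 0) := by
      have : Continuous fun h => √|h| := by fun_prop
      simpa using this.tendsto 0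
    simpa using (Asymptotics.isBigO_refl (fun h => h) (𝓝 0)).mul_isLittleO
      ((Asymptotics.isLittleO_one_iff ℝ).2 this)
  · rw [indicator_of_mem (by exact h)]
    refine (hasDerivAt_pDeriv_right m ht.ne' h).congr_of_eventuallyEq ?_
    filter_upwards [lt_mem_nhds h] with y hy
    exact indicator_of_mem (by exact hy) _

lemma hasDerivAt_integral_translate [CompleteSpace E] {F : ℝ → E}
    (hF : StronglyMeasurable F) (hK : ∀ u, ‖F u‖ ≤ K) (m : ℕ) (ht : 0 < t) (ρ : ℝ) :
    HasDerivAt (fun ρ => ∫ u in Ioi 0, pDeriv m t u • F (u + ρ))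
      (-∫ u in Ioi 0, pDeriv (m + 2) t u • F (u + ρ)) ρ := by
  have e : ∀ (m : ℕ) (ρ : ℝ), ∫ u in Ioi 0, pDeriv m t u • F (u + ρ) =
      ∫ x, (Ioi 0).indicator (pDeriv m t) (x - ρ) • F x := by
    intro m ρ
    rw [← integral_indicator measurableSet_Ioi, ← integral_add_right_eq_self
      (fun x => (Ioi 0).indicator (pDeriv m t) (x - ρ) • F x) ρ]
    refine integral_congr_ae (ae_of_all _ fun u => ?_); simp only [add_sub_cancel_right, indicator]
    split_ifs <;> simp
  simp_rw [e, ← integral_neg]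
  obtain ⟨A, hA, hA'⟩ := exists_pDensity_le (half_pos ht)
  have bd : ∀ (m : ℕ) (x : ℝ), |(Ioi 0).indicator (pDeriv m t) x| ≤
      pConst m * (t ^ m)⁻¹ * A * (1 + |x|) ^ (-(3 / 2) : ℝ) := by
    intro m x
    have c0 := pConst_nonneg m
    by_cases hx : 0 < x
    · rw [indicator_of_mem (by exact hx), abs_of_pos hx]
      refine (abs_pDeriv_le m ht hx).trans ?_; rw [mul_assoc (pConst m * (t ^ m)⁻¹)]; gcongr
      exact (hA' x hx).2
    · rw [indicator_of_notMem (by simpa using hx), abs_zero]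
      positivity
  have hi : Integrable (fun x : ℝ => (1 + |x|) ^ (-(3 / 2) : ℝ)) := by
    simpa using integrable_one_add_norm (E := ℝ) (μ := volume) (r := 3 / 2) (by simp; norm_num)
  have bd2 : ∀ (m : ℕ), ∀ x, ∀ r ∈ Metric.ball ρ 1,
      ‖(Ioi 0).indicator (pDeriv m t) (x - r) • F x‖ ≤
      pConst m * (t ^ m)⁻¹ * A * ((2 + |ρ|) ^ (3 / 2 : ℝ) * (1 + |x|) ^ (-(3 / 2) : ℝ)) * K := by
    intro m x r hr
    have c0 := pConst_nonneg m
    rw [norm_smul, norm_eq_abs]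
    have h1 : (1 + |x|) / (2 + |ρ|) ≤ 1 + |x - r| := by
      rw [Metric.mem_ball, Real.dist_eq] at hr
      have h2 : |x| ≤ |x - r| + |r| := by grind
      have h3 : |r| ≤ |r - ρ| + |ρ| := by grind
      rw [div_le_iff₀ (by positivity)]
      nlinarith [abs_nonneg (x - r), abs_nonneg ρ]
    have h2 : (1 + |x - r|) ^ (-(3 / 2) : ℝ) ≤
        (2 + |ρ|) ^ (3 / 2 : ℝ) * (1 + |x|) ^ (-(3 / 2) : ℝ) := by
      refine (Real.rpow_le_rpow_of_nonpos (by positivity) h1 (by norm_num)).trans (le_of_eq ?_)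
      rw [Real.div_rpow (by positivity) (by positivity), Real.rpow_neg (x := 2 + |ρ|) (by positivity)]
      field_simp
    exact mul_le_mul ((bd m _).trans (by gcongr)) (hK x) (norm_nonneg _) (by positivity)
  have ms : ∀ (m : ℕ) (r : ℝ), AEStronglyMeasurable
      (fun x => (Ioi 0).indicator (pDeriv m t) (x - r) • F x) volume := fun m r =>
    ((((measurable_pDeriv m t).indicator measurableSet_Ioi).comp
      (measurable_sub_const r)).stronglyMeasurable.smul hF).aestronglyMeasurable
  have hb : ∀ m : ℕ, Integrable fun x : ℝ =>
      pConst m * (t ^ m)⁻¹ * A * ((2 + |ρ|) ^ (3 / 2 : ℝ) * (1 + |x|) ^ (-(3 / 2) : ℝ)) * K :=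
    fun m => ((hi.const_mul _).const_mul _).mul_const _
  refine (hasDerivAt_integral_of_dominated_loc_of_deriv_le
    (F' := fun r x => -((Ioi 0).indicator (pDeriv (m + 2) t) (x - r) • F x)) (Metric.ball_mem_nhds ρ one_pos)
    (.of_forall fun r => ms m r) ?_ (ms (m + 2) ρ).neg
    (ae_of_all _ fun x r hr => by simpa using bd2 (m + 2) x r hr)
    (hb (m + 2)) (ae_of_all _ fun x r hr => ?_)).2
  · exact (hb m).mono' (ms m ρ) (ae_of_all _ fun x => bd2 m x ρ (Metric.mem_ball_self one_pos))
  · have h1 := (hasDerivAt_indicator_pDeriv m ht (x - r)).comp r ((hasDerivAt_id r).const_sub x)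
    have h2 := h1.smul_const (F x)
    simpa using h2

lemma tendsto_integral_pDensity_zero [CompleteSpace E] {F : ℝ → E}
    (hF : StronglyMeasurable F) (hK : ∀ u, ‖F u‖ ≤ K) (hc : ContinuousWithinAt F (Ici 0) 0) :
    Tendsto (fun s => ∫ u in Ioi 0, 𝔭 s u • F u) (𝓝[>] 0) (𝓝 (F 0)) := by
  have key : ∀ s : ℝ, 0 < s → (∫ u in Ioi 0, 𝔭 s u • F u) =
      ∫ u in Ioi 0, 𝔭 1 u • F (s ^ 2 * u) := by
    intro s hs
    have h := integral_comp_mul_left_Ioi (fun u => 𝔭 s u • F u) 0 (b := s ^ 2) (by positivity)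
    rw [mul_zero] at h; rw [eq_comm, inv_smul_eq_iff₀ (by positivity : s ^ 2 ≠ 0)] at h
    rw [h, ← integral_smul]; refine setIntegral_congr_fun measurableSet_Ioi fun u hu => ?_
    have hu : 0 < u := hu
    simp only [smul_smul]; congr 1
    have hsq : √(s ^ 2 * u) = s * √u := by
      rw [Real.sqrt_mul (by positivity), Real.sqrt_sq hs.le]
    have := Real.sqrt_pos.2 hu
    rw [poissonDensity, poissonDensity, rpow_neg_three_half hu, rpow_neg_three_half (by positivity), hsq]
    have e : -s ^ 2 / (4 * (s ^ 2 * u)) = -1 ^ 2 / (4 * u) := by field_simp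
    rw [e]; field_simp
  have h1 : F 0 = ∫ u in Ioi 0, 𝔭 1 u • F 0 := by
    rw [integral_smul_const, integral_pDensity one_pos, one_smul]
  rw [h1]
  refine Tendsto.congr' (by filter_upwards [self_mem_nhdsWithin] with s hs using (key s hs).symm) ?_
  refine tendsto_integral_filter_of_dominated_convergence (fun u => |poissonDensity 1 u| * K)
    (.of_forall fun s => ?_) (.of_forall fun s => ae_of_all _ fun u => ?_)
    ((integrableOn_pDensity one_pos).abs.mul_const K)
    ((ae_restrict_iff' measurableSet_Ioi).2 (ae_of_all _ fun u hu => ?_))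
  · exact ((measurable_pDensity 1).stronglyMeasurable.smul
      (hF.comp_measurable (measurable_const_mul _))).aestronglyMeasurable
  · rw [norm_smul, norm_eq_abs]; exact mul_le_mul_of_nonneg_left (hK _) (abs_nonneg _)
  · refine Tendsto.const_smul ?_ _
    refine hc.tendsto.comp (tendsto_nhdsWithin_iff.2 ⟨?_, Eventually.of_forall fun s => ?_⟩)
    · have : Continuous fun s : ℝ => s ^ 2 * u := by fun_prop
      simpa using (this.tendsto 0).mono_left nhdsWithin_le_nhds
    · exact mul_nonneg (sq_nonneg s) (le_of_lt hu)

end StandardSemigroup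

namespace VonNeumannAlgebra

lemma nonneg_iff (x : N) : 0 ≤ x ↔ ∀ ξ : H, 0 ≤ ⟪ξ, (x : H →L[ℂ] H) ξ⟫_ℂ := by
  have h : 0 ≤ x ↔ (0 : H →L[ℂ] H) ≤ (x : H →L[ℂ] H) := Iff.rfl
  rw [h, ContinuousLinearMap.nonneg_iff_isPositive]
  refine ⟨fun h ξ => h.inner_nonneg_right ξ, fun h => ?_⟩
  rw [ContinuousLinearMap.isPositive_iff_complex]; intro ξ
  have := h ξ
  rw [← inner_conj_symm, ← Complex.star_def, star_nonneg_iff, Complex.nonneg_iff] at this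
  exact ⟨Complex.ext rfl (by simpa using this.2), this.1⟩

lemma le_iff (x y : N) :
    x ≤ y ↔ ∀ ξ : H, ⟪ξ, (x : H →L[ℂ] H) ξ⟫_ℂ ≤ ⟪ξ, (y : H →L[ℂ] H) ξ⟫_ℂ := by
  rw [← sub_nonneg, nonneg_iff]; simp

lemma ext_inner_left {x y : N}
    (h : ∀ ξ η : H, ⟪ξ, (x : H →L[ℂ] H) η⟫_ℂ = ⟪ξ, (y : H →L[ℂ] H) η⟫_ℂ) : x = y :=
  Subtype.ext (ContinuousLinearMap.ext fun η => _root_.ext_inner_left ℂ fun ξ => h ξ η)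

lemma exists_of_form (N : VonNeumannAlgebra H) (B : H → H → ℂ)
    (hadd' : ∀ ξ ξ' η, B (ξ + ξ') η = B ξ η + B ξ' η)
    (hsmul' : ∀ (c : ℂ) ξ η, B (c • ξ) η = conj c * B ξ η)
    (hadd : ∀ ξ η η', B ξ (η + η') = B ξ η + B ξ η')
    (hsmul : ∀ (c : ℂ) ξ η, B ξ (c • η) = c * B ξ η)
    (hK0 : 0 ≤ K) (hK : ∀ ξ η, ‖B ξ η‖ ≤ K * ‖ξ‖ * ‖η‖)
    (hc : ∀ y ∈ N.commutant, ∀ ξ η, B (star y ξ) η = B ξ (y η)) :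
    ∃ b : N, (∀ ξ η, ⟪ξ, (b : H →L[ℂ] H) η⟫_ℂ = B ξ η) ∧ ‖b‖ ≤ K := by
  let B' : H →L⋆[ℂ] H →L[ℂ] ℂ := LinearMap.mkContinuous₂
    (LinearMap.mk₂'ₛₗ (starRingEnd ℂ) (RingHom.id ℂ) B hadd' hsmul' hadd hsmul) K hK
  let b : H →L[ℂ] H := star (InnerProductSpace.continuousLinearMapOfBilin B')
  have hb : ∀ ξ η, ⟪ξ, b η⟫_ℂ = B ξ η := fun ξ η => by
    change ⟪ξ, ContinuousLinearMap.adjoint _ η⟫_ℂ = _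
    rw [adjoint_inner_right, InnerProductSpace.continuousLinearMapOfBilin_apply]; rfl
  have hbN : b ∈ N := by
    rw [← N.commutant_commutant, mem_commutant_iff]; intro y hy
    refine ContinuousLinearMap.ext fun η => _root_.ext_inner_left ℂ fun ξ => ?_
    have h : ⟪ξ, y (b η)⟫_ℂ = ⟪star y ξ, b η⟫_ℂ := (adjoint_inner_left y (b η) ξ).symm
    change ⟪ξ, y (b η)⟫_ℂ = ⟪ξ, b (y η)⟫_ℂ; rw [h, hb, hb, hc y hy]
  refine ⟨⟨b, hbN⟩, hb, opNorm_le_bound b hK0 fun η => ?_⟩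
  rcases eq_or_ne (b η) 0 with h0 | h0
  · rw [h0, norm_zero]; positivity
  · have h1 := hK (b η) η
    rw [← hb, inner_self_eq_norm_sq_to_K] at h1
    have h2 : ‖b η‖ ^ 2 ≤ K * ‖b η‖ * ‖η‖ := by simpa using h1
    have h3 := norm_pos_iff.2 h0
    nlinarith

lemma exists_weak_limit {ι : Type*} (𝒰 : Ultrafilter ι) (x : ι → N) (hK : ∀ i, ‖x i‖ ≤ K) :
    ∃ b : N, ∀ ξ η : H, Tendsto (fun i => ⟪ξ, (x i : H →L[ℂ] H) η⟫_ℂ) 𝒰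
      (𝓝 ⟪ξ, (b : H →L[ℂ] H) η⟫_ℂ) := by
  have hb : ∀ i (ξ η : H), ‖⟪ξ, (x i : H →L[ℂ] H) η⟫_ℂ‖ ≤ K * ‖ξ‖ * ‖η‖ := fun i ξ η => by
    have h1 := (x i : H →L[ℂ] H).le_of_opNorm_le (hK i) η
    have h2 := norm_inner_le_norm (𝕜 := ℂ) ξ ((x i : H →L[ℂ] H) η)
    nlinarith [norm_nonneg ξ]
  have hK0 : 0 ≤ K := by
    obtain ⟨i, -⟩ := 𝒰.nonempty_of_mem univ_mem
    exact (norm_nonneg _).trans (hK i)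
  have hl : ∀ ξ η : H, ∃ z : ℂ, Tendsto (fun i => ⟪ξ, (x i : H →L[ℂ] H) η⟫_ℂ) 𝒰 (𝓝 z) := by
    intro ξ η
    obtain ⟨z, -, hz⟩ := (isCompact_closedBall 0 (K * ‖ξ‖ * ‖η‖)).ultrafilter_le_nhds
      (𝒰.map fun i => ⟪ξ, (x i : H →L[ℂ] H) η⟫_ℂ)
      (tendsto_principal.2 (.of_forall fun i => by simpa using hb i ξ η))
    exact ⟨z, hz⟩
  choose B hB using hl
  obtain ⟨b, hb, -⟩ := exists_of_form N B
    (fun ξ ξ' η => tendsto_nhds_unique (hB _ _) (((hB ξ η).add (hB ξ' η)).congr fun i => by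
      rw [inner_add_left]))
    (fun c ξ η => tendsto_nhds_unique (hB _ _) (((hB ξ η).const_mul (conj c)).congr fun i => by
      rw [inner_smul_left]))
    (fun ξ η η' => tendsto_nhds_unique (hB _ _) (((hB ξ η).add (hB ξ η')).congr fun i => by
      rw [map_add, inner_add_right]))
    (fun c ξ η => tendsto_nhds_unique (hB _ _) (((hB ξ η).const_mul c).congr fun i => by
      rw [map_smul, inner_smul_right]))
    hK0 (fun ξ η => le_of_tendsto (hB ξ η).norm (.of_forall fun i => hb i ξ η))
    (fun y hy ξ η => tendsto_nhds_unique (hB _ _) ((hB ξ (y η)).congr fun i => by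
      have h2 := congrArg (fun z => ⟪ξ, z η⟫_ℂ) ((mem_commutant_iff.1 hy _ (x i).2).symm)
      exact h2.symm.trans (adjoint_inner_left y _ ξ).symm))
  exact ⟨b, fun ξ η => by rw [hb]; exact hB ξ η⟩

lemma exists_isLUB {D : Set N} (hne : D.Nonempty) (hD : DirectedOn (· ≤ ·) D) {c : N}
    (h0 : ∀ x ∈ D, 0 ≤ x) (hc : ∀ x ∈ D, x ≤ c) :
    ∃ b : N, IsLUB D b ∧ ∀ ξ : H, ∀ ε > 0, ∃ x ∈ D,
      (⟪ξ, (b : H →L[ℂ] H) ξ⟫_ℂ).re - ε < (⟪ξ, (x : H →L[ℂ] H) ξ⟫_ℂ).re := by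
  have : Nonempty D := hne.to_subtype
  have : IsDirected D (· ≤ ·) := ⟨hD.directed_val⟩
  obtain ⟨b, hb⟩ := exists_weak_limit (Ultrafilter.of (atTop : Filter D)) (fun i => (i : N))
    fun i => CStarAlgebra.norm_le_norm_of_nonneg_of_le (h0 i i.2) (hc i i.2)
  refine ⟨b, ⟨fun x hx => (le_iff _ _).2 fun ξ => ?_, fun y hy => (le_iff _ _).2 fun ξ => ?_⟩,
    fun ξ ε hε => ?_⟩
  · refine ge_of_tendsto (hb ξ ξ) ?_
    exact Ultrafilter.of_le _ ((eventually_ge_atTop (⟨x, hx⟩ : D)).mono fun i hi => (le_iff _ _).1 hi ξ)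
  · exact le_of_tendsto (hb ξ ξ) (.of_forall fun i => (le_iff _ _).1 (hy i.2) ξ)
  · have h1 := ((Complex.continuous_re.tendsto _).comp (hb ξ ξ)).eventually
      (lt_mem_nhds (sub_lt_self _ hε))
    obtain ⟨i, hi⟩ := h1.exists
    exact ⟨i, i.2, hi⟩

lemma exists_lt_of_isLUB {D : Set N} (hne : D.Nonempty) (hD : DirectedOn (· ≤ ·) D)
    (h0 : ∀ x ∈ D, 0 ≤ x) {b : N} (hb : IsLUB D b) (ξ : H) (hε : 0 < ε) : ∃ x ∈ D,
      (⟪ξ, (b : H →L[ℂ] H) ξ⟫_ℂ).re - ε < (⟪ξ, (x : H →L[ℂ] H) ξ⟫_ℂ).re := by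
  obtain ⟨b', hb', h⟩ := exists_isLUB hne hD h0 hb.1
  rw [hb.unique hb']; exact h ξ ε hε

lemma isLUB_conj {D : Set N} (hne : D.Nonempty) (hD : DirectedOn (· ≤ ·) D)
    (h0 : ∀ x ∈ D, 0 ≤ x) {b : N} (hb : IsLUB D b) (z : N) :
    IsLUB ((fun x => star z * x * z) '' D) (star z * b * z) := by
  have hre : ∀ {x : N} (_ : 0 ≤ x) (ξ : H), ((⟪ξ, (x : H →L[ℂ] H) ξ⟫_ℂ).re : ℂ) =
      ⟪ξ, (x : H →L[ℂ] H) ξ⟫_ℂ := fun hx ξ =>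
    (Complex.eq_re_of_ofReal_le (r := 0) (by simpa using (nonneg_iff _).1 hx ξ)).symm
  refine ⟨?_, fun y hy => (le_iff _ _).2 fun ξ => ?_⟩
  · rintro _ ⟨x, hx, rfl⟩; exact star_left_conjugate_le_conjugate (hb.1 hx) z
  · have hform : ∀ x : N, ⟪ξ, ((star z * x * z : N) : H →L[ℂ] H) ξ⟫_ℂ =
        ⟪(z : H →L[ℂ] H) ξ, (x : H →L[ℂ] H) ((z : H →L[ℂ] H) ξ)⟫_ℂ := fun x =>
      adjoint_inner_right (z : H →L[ℂ] H) ξ _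
    obtain ⟨x0, hx0⟩ := hne
    rw [hform, ← hre ((h0 _ hx0).trans (hb.1 hx0)), ← hre ((star_left_conjugate_nonneg (h0 _ hx0) z).trans (hy ⟨x0, hx0, rfl⟩)), Complex.real_le_real]
    refine le_of_forall_pos_lt_add fun ε hε => ?_
    obtain ⟨x, hx, hxε⟩ := exists_lt_of_isLUB ⟨x0, hx0⟩ hD h0 hb ((z : H →L[ℂ] H) ξ) hε
    have h1 := (Complex.le_def.1 ((le_iff _ _).1 (hy ⟨x, hx, rfl⟩) ξ)).1
    simp only [hform] at h1; linarith

/-- The functional `b ↦ ⟪ξ, b η⟫` on `N`. -/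
def vecFun (N : VonNeumannAlgebra H) (ξ η : H) : StrongDual ℂ N :=
  LinearMap.mkContinuous
    { toFun := fun b => ⟪ξ, (b : H →L[ℂ] H) η⟫_ℂ
      map_add' := fun a b => by
        change ⟪ξ, (a : H →L[ℂ] H) η + (b : H →L[ℂ] H) η⟫_ℂ = _; rw [inner_add_right]
      map_smul' := fun c a => by
        change ⟪ξ, c • (a : H →L[ℂ] H) η⟫_ℂ = _
        rw [inner_smul_right]; rfl } (‖ξ‖ * ‖η‖) fun b => by
      have h1 := (b : H →L[ℂ] H).le_opNorm η
      have h2 := norm_inner_le_norm (𝕜 := ℂ) ξ ((b : H →L[ℂ] H) η)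
      change ‖⟪ξ, (b : H →L[ℂ] H) η⟫_ℂ‖ ≤ ‖ξ‖ * ‖η‖ * ‖(b : H →L[ℂ] H)‖; nlinarith [norm_nonneg ξ]

@[simp] lemma vecFun_apply (ξ η : H) (b : N) : N.vecFun ξ η b = ⟪ξ, (b : H →L[ℂ] H) η⟫_ℂ := rfl

/-- The predual of `N`, as a space of functionals. -/
def predual (N : VonNeumannAlgebra H) : Submodule ℂ (StrongDual ℂ N) :=
  (Submodule.span ℂ (range fun p : H × H => N.vecFun p.1 p.2)).topologicalClosure

lemma vecFun_mem_predual (ξ η : H) : N.vecFun ξ η ∈ N.predual :=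
  Submodule.le_topologicalClosure _ (Submodule.subset_span ⟨(ξ, η), rfl⟩)

end VonNeumannAlgebra

lemma exists_inner_eq_of_norm_le {V H : Type*} [AddCommGroup V] [Module ℂ V]
    [NormedAddCommGroup H] [InnerProductSpace ℂ H] [CompleteSpace H] (f : V →ₗ[ℂ] ℂ) (Λ : V →ₗ[ℂ] H)
    {C : ℝ} (h : ∀ b, ‖f b‖ ≤ C * ‖Λ b‖) : ∃ ζ : H, ∀ b, f b = ⟪ζ, Λ b⟫_ℂ := by
  have hker : LinearMap.ker Λ ≤ LinearMap.ker f := fun b hb => by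
    have := h b
    rw [LinearMap.mem_ker.1 hb, norm_zero, mul_zero] at this; exact norm_le_zero_iff.1 this
  let g : LinearMap.range Λ →ₗ[ℂ] ℂ :=
    ((LinearMap.ker Λ).liftQ f hker).comp Λ.quotKerEquivRange.symm.toLinearMap
  have hg : ∀ b, g ⟨Λ b, b, rfl⟩ = f b := fun b => by
    have e : Λ.quotKerEquivRange.symm ⟨Λ b, b, rfl⟩ = Submodule.Quotient.mk b :=
      Λ.quotKerEquivRange_symm_apply_image b _
    simp [g, e]
  let g' : StrongDual ℂ (LinearMap.range Λ) := g.mkContinuous C (by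
    rintro ⟨_, b, rfl⟩; rw [hg]; exact h b)
  obtain ⟨G, hG, -⟩ := exists_extension_norm_eq _ g'
  refine ⟨(InnerProductSpace.toDual ℂ H).symm G, fun b => ?_⟩
  rw [InnerProductSpace.toDual_symm_apply, ← hg]; exact (hG ⟨Λ b, b, rfl⟩).symm

namespace VonNeumannAlgebra

lemma norm_sq_apply_star_mul_le (ω : StrongDual ℂ N) (hω : ∀ x, 0 ≤ x → 0 ≤ ω x) (a b : N) :
    ‖ω (star a * b)‖ ^ 2 ≤ (ω (star a * a)).re * (ω (star b * b)).re := by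
  let f : N →ₚ[ℂ] ℂ := PositiveLinearMap.mk₀ (ω : N →ₗ[ℂ] ℂ) hω
  have h := inner_mul_inner_self_le (𝕜 := ℂ) (f.toPreGNS a) (f.toPreGNS b)
  rw [norm_inner_symm (f.toPreGNS b), ← sq] at h; exact h

/-- The functional `b ↦ ω (b k)`. -/
def mulRightFun (ω : StrongDual ℂ N) (k : N) : StrongDual ℂ N :=
  ω ∘L (ContinuousLinearMap.mul ℂ N).flip k

@[simp] lemma mulRightFun_apply (ω : StrongDual ℂ N) (k b : N) : mulRightFun ω k b = ω (b * k) :=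
  rfl

lemma mulRightFun_add (ω : StrongDual ℂ N) (k l : N) :
    mulRightFun ω (k + l) = mulRightFun ω k + mulRightFun ω l := by
  ext b; simp [mul_add]

lemma exists_le_mulRightFun_mem_predual (ω : StrongDual ℂ N) (hω : ∀ x, 0 ≤ x → 0 ≤ ω x)
    {e : N} (he : 0 ≤ e) (he0 : e ≠ 0) :
    ∃ d : N, 0 ≤ d ∧ d ≤ e ∧ d ≠ 0 ∧ mulRightFun ω d ∈ N.predual := by
  have mono : ∀ {x y : N}, x ≤ y → (ω x).re ≤ (ω y).re := fun {x y} h => by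
    have := Complex.nonneg_iff.1 (hω (y - x) (sub_nonneg.2 h))
    simp at this; linarith
  obtain ⟨ξ, hξ⟩ : ∃ ξ : H, (ω e).re < (⟪ξ, (e : H →L[ℂ] H) ξ⟫_ℂ).re := by
    obtain ⟨η, hη⟩ : ∃ η : H, 0 < (⟪η, (e : H →L[ℂ] H) η⟫_ℂ).re := by
      by_contra! hcon
      refine he0 (le_antisymm ((le_iff _ _).2 fun ξ => ?_) he)
      have h1 := Complex.nonneg_iff.1 ((nonneg_iff e).1 he ξ)
      exact ⟨by simpa using hcon ξ, by simpa using h1.2.symm⟩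
    obtain ⟨r, hr⟩ := exists_nat_gt ((ω e).re / (⟪η, (e : H →L[ℂ] H) η⟫_ℂ).re)
    rw [div_lt_iff₀ hη] at hr; refine ⟨((r + 1 : ℕ) : ℂ) • η, hr.trans_le ?_⟩
    rw [map_smul, inner_smul_left, inner_smul_right, ← mul_assoc, Complex.conj_natCast,
      ← Nat.cast_mul, ← Complex.ofReal_natCast, re_ofReal_mul]
    gcongr; nlinarith
  obtain ⟨a, -, ⟨⟨ha0, hae, haω⟩, hmax⟩⟩ := zorn_le_nonempty₀
    {a : N | 0 ≤ a ∧ a ≤ e ∧ (⟪ξ, (a : H →L[ℂ] H) ξ⟫_ℂ).re ≤ (ω a).re} (by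
      intro C hC hch y hy
      obtain ⟨b, hb, hbξ⟩ := exists_isLUB ⟨y, hy⟩ hch.directedOn (fun x hx => (hC hx).1)
        (fun x hx => (hC hx).2.1)
      refine ⟨b, ⟨(hC hy).1.trans (hb.1 hy), hb.2 fun x hx => (hC hx).2.1, ?_⟩, hb.1⟩
      refine le_of_forall_pos_lt_add fun ε hε => ?_
      obtain ⟨x, hx, h⟩ := hbξ ξ ε hε
      linarith [(hC hx).2.2, mono (hb.1 hx)]) 0 ⟨le_rfl, he, by simp⟩
  set d := e - a with hd
  have hd0 := sub_nonneg.2 hae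
  have hdom : ∀ x : N, 0 ≤ x → x ≤ d → (ω x).re ≤ (⟪ξ, (x : H →L[ℂ] H) ξ⟫_ℂ).re := by
    intro x hx hxd
    by_contra! hcon
    have h1 := hmax ⟨add_nonneg ha0 hx, by
      rw [hd] at hxd; exact le_sub_iff_add_le'.1 hxd, by
      simp; linarith⟩ (le_add_of_nonneg_right hx)
    rw [le_antisymm (by simpa using h1) hx] at hcon
    simp at hcon
  refine ⟨d, hd0, sub_le_self _ ha0, ?_, ?_⟩
  · intro h; rw [sub_eq_zero.1 h] at hξ; linarith
  set s := CFC.sqrt d with hs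
  have hss := CFC.sqrt_mul_sqrt_self d hd0
  have hsa : star s = s := (of_nonneg (CFC.sqrt_nonneg d)).star_eq
  have key : ∀ b : N, (ω (star (b * s) * (b * s))).re ≤ ‖((b * s : N) : H →L[ℂ] H) ξ‖ ^ 2 := by
    intro b
    have hform : ∀ c : N, ‖(c : H →L[ℂ] H) ξ‖ ^ 2 =
        (⟪ξ, ((star c * c : N) : H →L[ℂ] H) ξ⟫_ℂ).re := by
      intro c
      have : ⟪ξ, ((star c * c : N) : H →L[ℂ] H) ξ⟫_ℂ = ⟪(c : H →L[ℂ] H) ξ, (c : H →L[ℂ] H) ξ⟫_ℂ :=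
        adjoint_inner_right (c : H →L[ℂ] H) ξ _
      rw [this, inner_self_eq_norm_sq_to_K]; norm_cast
    have hle : star (b * s) * (b * s) ≤ ‖star b * b‖ • d := by
      have h := CStarAlgebra.star_left_conjugate_le_norm_smul (a := s)
        (IsSelfAdjoint.star_mul_self b)
      rw [hsa, hss] at h; simpa only [star_mul, hsa, mul_assoc] using h
    rw [hform]
    rcases eq_or_ne b 0 with rfl | hb
    · simp
    have hn : 0 < ‖star b * b‖ := norm_pos_iff.2 (by simpa using hb)
    have h1 := hdom (((‖star b * b‖⁻¹ : ℝ) : ℂ) • (star (b * s) * (b * s)))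
      (smul_nonneg (by simp) (star_mul_self_nonneg _)) (by
        have h2 := smul_le_smul_of_nonneg_left hle (inv_nonneg.2 hn.le)
        rw [smul_smul, inv_mul_cancel₀ hn.ne', one_smul] at h2; exact h2)
    have e2 : (⟪ξ, ((((‖star b * b‖⁻¹ : ℝ) : ℂ) • (star (b * s) * (b * s)) : N) : H →L[ℂ] H) ξ⟫_ℂ).re =
        ‖star b * b‖⁻¹ * (⟪ξ, ((star (b * s) * (b * s) : N) : H →L[ℂ] H) ξ⟫_ℂ).re := by simp
    rw [map_smul, smul_eq_mul, re_ofReal_mul, e2] at h1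
    exact le_of_mul_le_mul_left h1 (inv_pos.2 hn)
  obtain ⟨ζ, hζ⟩ := exists_inner_eq_of_norm_le (mulRightFun ω s : N →ₗ[ℂ] ℂ)
    (Λ := { toFun := fun b => ((b * s : N) : H →L[ℂ] H) ξ
            map_add' := fun a b => by rw [add_mul]; rfl
            map_smul' := fun c a => by rw [smul_mul_assoc]; rfl }) (C := √(ω 1).re) fun b => by
      have h1 := norm_sq_apply_star_mul_le ω hω 1 (b * s)
      simp only [star_one, one_mul] at h1
      have h0 : 0 ≤ (ω 1).re := by simpa using mono zero_le_one
      refine le_of_sq_le_sq ?_ (by positivity)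
      rw [mul_pow, sq_sqrt h0]; exact h1.trans (mul_le_mul_of_nonneg_left (key b) h0)
  have : mulRightFun ω d = N.vecFun ζ ((d : H →L[ℂ] H) ξ) := by
    ext b
    have h := hζ (b * s)
    change ω (b * s * s) = ⟪ζ, ((b * s * s : N) : H →L[ℂ] H) ξ⟫_ℂ at h; rw [mul_assoc, hss] at h
    exact h
  rw [this]; exact vecFun_mem_predual _ _

lemma mem_predual_of_normal (ω : StrongDual ℂ N) (hω : ∀ x, 0 ≤ x → 0 ≤ ω x)
    (hn : ∀ D : Set N, D.Nonempty → DirectedOn (· ≤ ·) D → (∀ x ∈ D, 0 ≤ x) → ∀ b, IsLUB D b →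
      ∀ ε > 0, ∃ x ∈ D, (ω b).re - ε < (ω x).re) : ω ∈ N.predual := by
  obtain ⟨k, -, ⟨⟨hk0, hk1, hkω⟩, hmax⟩⟩ := zorn_le_nonempty₀
    {k : N | 0 ≤ k ∧ k ≤ 1 ∧ mulRightFun ω k ∈ N.predual} (by
      intro C hC hch y hy
      obtain ⟨b, hb, -⟩ := exists_isLUB ⟨y, hy⟩ hch.directedOn (fun x hx => (hC hx).1)
        (fun x hx => (hC hx).2.1)
      refine ⟨b, ⟨(hC hy).1.trans (hb.1 hy), hb.2 fun x hx => (hC hx).2.1, ?_⟩, hb.1⟩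
      refine (Submodule.isClosed_topologicalClosure _).closure_subset (Metric.mem_closure_iff.2 fun ε hε => ?_)
      have h0 : 0 ≤ (ω 1).re := by simpa using (Complex.nonneg_iff.1 (hω 1 zero_le_one)).1
      obtain ⟨x, hx, hxε⟩ := hn C ⟨y, hy⟩ hch.directedOn (fun x hx => (hC hx).1) b hb
        ((ε / 2) ^ 2 / ((ω 1).re + 1)) (by positivity)
      refine ⟨_, (hC hx).2.2, ?_⟩; rw [dist_eq_norm]
      refine (opNorm_le_bound _ (half_pos hε).le fun z => ?_).trans_lt (half_lt_self hε)
      have hbx := sub_nonneg.2 (hb.1 hx)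
      set s := CFC.sqrt (b - x)
      have hss : s * s = b - x := CFC.sqrt_mul_sqrt_self _ hbx
      have hsa : star s = s := (of_nonneg (CFC.sqrt_nonneg _)).star_eq
      have h1 := norm_sq_apply_star_mul_le ω hω (s * star z) s
      have e1 : star (s * star z) * s = z * b - z * x := by
        rw [star_mul, star_star, hsa, mul_assoc, hss, mul_sub]
      rw [e1, hsa, hss, map_sub, map_sub, sub_re] at h1
      have h2 : (ω (star (s * star z) * (s * star z))).re ≤ ‖z‖ ^ 2 * (ω 1).re := by
        have h3 : star (s * star z) * (s * star z) ≤ (‖z‖ ^ 2 : ℝ) • (1 : N) := by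
          have e : star (s * star z) * (s * star z) = star (star z) * (b - x) * star z := by
            rw [star_mul, hsa, ← hss]; simp only [mul_assoc]
          rw [e]
          refine (star_left_conjugate_le_conjugate ((sub_le_self _ (hC hx).1).trans (hb.2 fun x hx => (hC hx).2.1)) (star z)).trans ?_
          rw [mul_one, star_star, ← Algebra.algebraMap_eq_smul_one]
          have := IsSelfAdjoint.le_algebraMap_norm_self (IsSelfAdjoint.mul_star_self z)
          simpa [sq, CStarRing.norm_self_mul_star] using this
        have h4 := (Complex.nonneg_iff.1 (hω _ (sub_nonneg.2 h3))).1
        have e5 : ω ((‖z‖ ^ 2 : ℝ) • (1 : N)) = ((‖z‖ ^ 2 : ℝ) : ℂ) * ω 1 := by simp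
        rw [map_sub, sub_re, e5, re_ofReal_mul] at h4; linarith
      refine le_of_sq_le_sq ?_ (by positivity)
      have h5 : 0 ≤ (ω b).re - (ω x).re := by
        have := (Complex.nonneg_iff.1 (hω _ hbx)).1
        rwa [map_sub, sub_re] at this
      calc _ ≤ _ := h1
        _ ≤ ‖z‖ ^ 2 * (ω 1).re * ((ε / 2) ^ 2 / ((ω 1).re + 1)) := by
          refine mul_le_mul h2 (by linarith) h5 (by positivity)
        _ = (ε / 2 * ‖z‖) ^ 2 * ((ω 1).re / ((ω 1).re + 1)) := by ring
        _ ≤ (ε / 2 * ‖z‖) ^ 2 * 1 := by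
          gcongr; rw [div_le_one (by positivity)]; linarith
        _ = _ := mul_one _)
    0 ⟨le_rfl, zero_le_one, by
      have : mulRightFun ω 0 = 0 := by ext b; simp
      rw [this]; exact zero_mem _⟩
  have hk : k = 1 := by
    by_contra hne
    obtain ⟨d, hd0, hdk, hdne, hdω⟩ := exists_le_mulRightFun_mem_predual ω hω
      (sub_nonneg.2 hk1) (sub_ne_zero.2 (Ne.symm hne))
    have h1 := hmax ⟨add_nonneg hk0 hd0, le_sub_iff_add_le'.1 hdk, by
      rw [mulRightFun_add]; exact add_mem hkω hdω⟩ (le_add_of_nonneg_right hd0)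
    exact hdne (le_antisymm (by simpa using h1) hd0)
  have : mulRightFun ω k = ω := by ext b; simp [hk]
  rwa [this] at hkω

/-- The vector functionals of norm at most one, indexed by all pairs of vectors. -/
def unitFun (N : VonNeumannAlgebra H) (p : H × H) : StrongDual ℂ N :=
  (((‖p.1‖ * ‖p.2‖)⁻¹ : ℝ) : ℂ) • N.vecFun p.1 p.2

lemma norm_vecFun_le (N : VonNeumannAlgebra H) (ξ η : H) : ‖N.vecFun ξ η‖ ≤ ‖ξ‖ * ‖η‖ :=
  LinearMap.mkContinuous_norm_le _ (by positivity) _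

lemma norm_unitFun_le (N : VonNeumannAlgebra H) (p : H × H) : ‖N.unitFun p‖ ≤ 1 := by
  rw [unitFun, norm_smul, norm_real, norm_of_nonneg (by positivity)]
  exact (mul_le_mul_of_nonneg_left (N.norm_vecFun_le _ _) (by positivity)).trans inv_mul_le_one

lemma smul_unitFun (N : VonNeumannAlgebra H) (ξ η : H) :
    ((‖ξ‖ * ‖η‖ : ℝ) : ℂ) • N.unitFun (ξ, η) = N.vecFun ξ η := by
  rcases eq_or_ne (‖ξ‖ * ‖η‖) 0 with h | h
  · have := N.norm_vecFun_le ξ η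
    rw [h] at this; rw [h, norm_le_zero_iff.1 this, Complex.ofReal_zero]
    exact zero_smul ℂ (N.unitFun (ξ, η))
  · rw [unitFun, smul_smul, ← Complex.ofReal_mul, mul_inv_cancel₀ h, Complex.ofReal_one, one_smul]

lemma div_mul_le (x y : ℝ) (hx : 0 ≤ x) : x / y * y ≤ x := by
  rcases eq_or_ne y 0 with rfl | h
  · simpa
  · rw [div_mul_cancel₀ _ h]

lemma summable_norm_lp_one {ι : Type*} (c : lp (fun _ : ι => ℂ) 1) : Summable fun i => ‖c i‖ := by
  simpa using (lp.memℓp c).summable (by simp)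

lemma summable_smul_unitFun (N : VonNeumannAlgebra H) (c : lp (fun _ : H × H => ℂ) 1) :
    Summable fun p => c p • N.unitFun p := by
  refine Summable.of_norm_bounded (summable_norm_lp_one c) fun p => ?_; rw [norm_smul]
  exact mul_le_of_le_one_right (norm_nonneg _) (N.norm_unitFun_le p)

/-- The map from `ℓ¹` onto the predual. -/
def sumFun (N : VonNeumannAlgebra H) :
    lp (fun _ : H × H => ℂ) 1 →L[ℂ] StrongDual ℂ N :=
  LinearMap.mkContinuous
    { toFun := fun c => ∑' p, c p • N.unitFun p
      map_add' := fun c c' => by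
        rw [← (N.summable_smul_unitFun c).tsum_add (N.summable_smul_unitFun c')]
        exact tsum_congr fun p => add_smul (c p : ℂ) (c' p : ℂ) (N.unitFun p)
      map_smul' := fun z c => by
        simp only [lp.coeFn_smul, Pi.smul_apply, smul_assoc, RingHom.id_apply]
        exact (N.summable_smul_unitFun c).tsum_const_smul z } 1 fun c => by
    have h : ‖c‖ = ∑' p, ‖c p‖ := by
      simpa using lp.norm_eq_tsum_rpow (p := 1) (by simp) c
    rw [one_mul, h]; refine tsum_of_norm_bounded (summable_norm_lp_one c).hasSum fun p => ?_
    rw [norm_smul]; exact mul_le_of_le_one_right (norm_nonneg _) (N.norm_unitFun_le p)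

lemma sumFun_single (N : VonNeumannAlgebra H) (p : H × H) (z : ℂ) [DecidableEq (H × H)] :
    N.sumFun (lp.single 1 p z) = z • N.unitFun p := by
  change ∑' q, (lp.single 1 p z : lp (fun _ => ℂ) 1) q • N.unitFun q = _
  rw [tsum_eq_single p fun q hq => by
      rw [lp.single_apply_ne _ _ _ hq]; exact zero_smul ℂ (N.unitFun q),
    lp.single_apply_self]

lemma norm_mk_le_norm_sumFun (N : VonNeumannAlgebra H) (c : lp (fun _ : H × H => ℂ) 1) :
    ‖(Submodule.Quotient.mk c : _ ⧸ LinearMap.ker N.sumFun.toLinearMap)‖ ≤ ‖N.sumFun c‖ := by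
  classical
  obtain ⟨Λ, hΛ, hc⟩ := exists_dual_vector'' ℂ
    (Submodule.Quotient.mk c : _ ⧸ LinearMap.ker N.sumFun.toLinearMap)
  let Λ' : lp (fun _ => ℂ) 1 →ₗ[ℂ] ℂ :=
    Λ.toLinearMap.comp (Submodule.mkQ (LinearMap.ker N.sumFun.toLinearMap))
  have hb : ∀ x, ‖Λ' x‖ ≤ 1 * ‖x‖ := fun x => by
    refine (Λ.le_of_opNorm_le hΛ _).trans ?_; gcongr; exact Submodule.Quotient.norm_mk_le _ _
  have hker : ∀ x y, N.sumFun x = N.sumFun y → Λ' x = Λ' y := fun x y h => by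
    refine congrArg Λ ((Submodule.Quotient.eq _).2 ?_); rw [LinearMap.mem_ker, map_sub, sub_eq_zero]
    exact h
  let e : H → H → lp (fun _ => ℂ) 1 := fun ξ η => lp.single 1 (ξ, η) ((‖ξ‖ * ‖η‖ : ℝ) : ℂ)
  have he : ∀ ξ η, N.sumFun (e ξ η) = N.vecFun ξ η := fun ξ η => by
    rw [sumFun_single, smul_unitFun]
  obtain ⟨b, hbe, hb1⟩ := exists_of_form N (fun ξ η => Λ' (e ξ η)) (fun ξ ξ' η => by
      rw [← map_add]; apply hker; rw [map_add, he, he, he]; ext b; simp)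
    (fun c ξ η => by
      rw [← smul_eq_mul, ← map_smul]; apply hker; rw [map_smul, he, he]; ext b; simp [mul_comm])
    (fun ξ η η' => by
      rw [← map_add]; apply hker; rw [map_add, he, he, he]; ext b; simp)
    (fun c ξ η => by
      rw [← smul_eq_mul, ← map_smul]; apply hker; rw [map_smul, he, he]; ext b; simp)
    zero_le_one (fun ξ η => by
      refine (hb _).trans (le_of_eq ?_)
      rw [lp.norm_single (by simp), norm_real, norm_of_nonneg (by positivity)]
      ring)
    (fun y hy ξ η => by
      apply hker; rw [he, he]; ext b
      have h2 := congrArg (fun z => ⟪ξ, z η⟫_ℂ) ((mem_commutant_iff.1 hy _ b.2).symm)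
      exact (adjoint_inner_left y _ ξ).trans h2)
  have heq : ∀ x, Λ' x = N.sumFun x b := by
    have h1 : ∀ p z, Λ' (lp.single 1 p z) = N.sumFun (lp.single 1 p z) b := by
      intro p z
      have h2 : N.sumFun (lp.single 1 p z) = N.sumFun ((z * ((‖p.1‖ * ‖p.2‖)⁻¹ : ℝ)) • e p.1 p.2) := by
        rw [map_smul, he, sumFun_single, unitFun, smul_smul]
      rw [h2, hker _ _ h2, map_smul, map_smul, he]; simp [← hbe]
    intro x
    have h2 := lp.hasSum_single (by simp) x
    have h3 := (Λ'.mkContinuous 1 hb).hasSum h2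
    have h4 := (ContinuousLinearMap.apply ℂ ℂ b ∘L N.sumFun).hasSum h2
    refine h3.unique ?_; simp only [LinearMap.mkContinuous_apply, h1]; exact h4
  have hn : ‖(Submodule.Quotient.mk c : _ ⧸ LinearMap.ker N.sumFun.toLinearMap)‖ =
      ‖N.sumFun c b‖ := by
    rw [← heq]; change _ = ‖Λ (Submodule.Quotient.mk c)‖; rw [hc]; simp
  rw [hn]; exact ((N.sumFun c).le_opNorm b).trans (mul_le_of_le_one_right (norm_nonneg _) hb1)

lemma isClosed_range_sumFun (N : VonNeumannAlgebra H) : IsClosed (range N.sumFun) := by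
  let K := LinearMap.ker N.sumFun.toLinearMap
  have : IsClosed (K : Set (lp (fun _ : H × H => ℂ) 1)) := N.sumFun.isClosed_ker
  let f : (lp (fun _ => ℂ) 1 ⧸ K) →ₗ[ℂ] StrongDual ℂ N := K.liftQ N.sumFun.toLinearMap le_rfl
  have hf : ∀ x, f (Submodule.Quotient.mk x) = N.sumFun x := fun x => rfl
  have hal : AntilipschitzWith 1 f := by
    refine AddMonoidHomClass.antilipschitz_of_bound f fun x => ?_
    obtain ⟨c, rfl⟩ := Submodule.Quotient.mk_surjective _ x
    simpa [hf] using N.norm_mk_le_norm_sumFun c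
  have hli : UniformContinuous f := by
    have : Continuous f := by
      exact K.isQuotientMap_mkQ.continuous_iff.2 N.sumFun.continuous
    exact uniformContinuous_addMonoidHom_of_continuous this
  have hr : range f = range N.sumFun := by
    ext φ; constructor
    · rintro ⟨x, rfl⟩
      obtain ⟨c, rfl⟩ := Submodule.Quotient.mk_surjective _ x
      exact ⟨c, rfl⟩
    · rintro ⟨c, rfl⟩; exact ⟨Submodule.Quotient.mk c, rfl⟩
  rw [← hr]; exact hal.isClosed_range hli

lemma exists_sumFun_eq {N : VonNeumannAlgebra H} {φ : StrongDual ℂ N} (hφ : φ ∈ N.predual) :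
    ∃ c, N.sumFun c = φ := by
  classical
  have h1 : Submodule.span ℂ (range fun p : H × H => N.vecFun p.1 p.2) ≤
      LinearMap.range N.sumFun.toLinearMap := by
    refine Submodule.span_le.2 ?_; rintro _ ⟨p, rfl⟩
    exact ⟨lp.single 1 p ((‖p.1‖ * ‖p.2‖ : ℝ) : ℂ), (N.sumFun_single _ _).trans (N.smul_unitFun _ _)⟩
  have h2 := Submodule.topologicalClosure_minimal _ h1 N.isClosed_range_sumFun
  exact h2 hφ

lemma exists_tsum_inner {N : VonNeumannAlgebra H} {φ : StrongDual ℂ N} (hφ : φ ∈ N.predual) :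
    ∃ ξ η : lp (fun _ : ℕ => H) 2, ∀ b : N, φ b = ∑' i, ⟪ξ i, (b : H →L[ℂ] H) (η i)⟫_ℂ := by
  obtain ⟨c, rfl⟩ := exists_sumFun_eq hφ
  have hs := summable_norm_lp_one c
  have : Countable (Function.support fun p => ‖c p‖) := (hs.countable_support).to_subtype
  obtain ⟨f, hf⟩ := exists_injective_nat (Function.support fun p => ‖c p‖)
  let u : (Function.support fun p => ‖c p‖) → H := fun p => ((√‖c p‖ / ‖p.1.1‖ : ℝ) : ℂ) • p.1.1
  let v : (Function.support fun p => ‖c p‖) → H := fun p => (c p / (√‖c p‖ * ‖p.1.2‖ : ℝ)) • p.1.2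
  have hmem : ∀ w : (Function.support fun p => ‖c p‖) → H, (∀ p, ‖w p‖ ≤ √‖c p‖) →
      Memℓp (Function.extend f w 0) 2 := by
    intro w hw; refine memℓp_gen ?_
    have e : (fun i => ‖Function.extend f w 0 i‖ ^ (2 : ℝ≥0∞).toReal) ∘ f = fun p => ‖w p‖ ^ 2 := by
      ext p; simp [hf.extend_apply]
    rw [← hf.summable_iff, e]
    · refine (hs.subtype _).of_nonneg_of_le (fun p => by positivity) fun p => ?_
      calc _ ≤ √‖c p‖ ^ 2 := by gcongr; exact hw p
        _ = _ := sq_sqrt (norm_nonneg _)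
    · intro i hi; rw [Function.extend_apply' _ _ _ (by simpa using hi)]
      simp
  have hu : ∀ p, ‖u p‖ ≤ √‖c p‖ := fun p => by
    rw [norm_smul, norm_real, norm_of_nonneg (by positivity)]
    exact div_mul_le _ _ (Real.sqrt_nonneg _)
  have hv : ∀ p, ‖v p‖ ≤ √‖c p‖ := fun p => by
    rw [norm_smul, norm_div, norm_real, norm_of_nonneg (by positivity)]
    have h0 := Real.sqrt_pos.2 ((norm_nonneg _).lt_of_ne' p.2)
    have h1 : ‖c p‖ / (√‖c p‖ * ‖p.1.2‖) = √‖c p‖ / ‖p.1.2‖ := by grind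
    rw [h1]; exact div_mul_le _ _ (Real.sqrt_nonneg _)
  refine ⟨⟨_, hmem u hu⟩, ⟨_, hmem v hv⟩, fun b => ?_⟩
  change N.sumFun c b = ∑' i, ⟪Function.extend f u 0 i, (b : H →L[ℂ] H) (Function.extend f v 0 i)⟫_ℂ
  have h1 : N.sumFun c b = ∑' p, c p * N.unitFun p b := by
    exact (ContinuousLinearMap.apply ℂ ℂ b).map_tsum (N.summable_smul_unitFun c)
  rw [h1, ← hf.tsum_eq, ← Subtype.val_injective.tsum_eq]
  · refine tsum_congr fun p => ?_
    rw [hf.extend_apply, hf.extend_apply, map_smul, inner_smul_left, inner_smul_right, unitFun]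
    have h0 := (Real.sqrt_pos.2 ((norm_nonneg _).lt_of_ne' p.2)).ne'
    simp only [smul_apply, vecFun_apply, smul_eq_mul, conj_ofReal]; push_cast
    rw [← mul_assoc, ← mul_assoc]; congr 1; field_simp
  · intro p hp; simp only [Subtype.range_coe_subtype, Function.mem_support] at hp ⊢; intro h
    exact hp (by rw [norm_eq_zero.1 h, zero_mul])
  · intro i hi
    by_contra hcon
    exact hi (show ⟪_, (b : H →L[ℂ] H) (Function.extend f v 0 i)⟫_ℂ = 0 by rw [Function.extend_apply' _ _ _ (by simpa using hcon)]; simp)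

lemma eq_zero_of_weakStar_dense {N : VonNeumannAlgebra H} {φ : StrongDual ℂ N}
    (hφ : φ ∈ N.predual) {A : Set N}
    (hA : ∀ b : N, b ∈ @closure N (StandardSemigroup.weakStar N) A) (h : ∀ b ∈ A, φ b = 0) : φ = 0 := by
  obtain ⟨ξ, η, hξη⟩ := exists_tsum_inner hφ
  have hcont : @Continuous N ℂ (StandardSemigroup.weakStar N) _ φ := by
    rw [funext hξη]; exact continuous_iInf_dom (continuous_iInf_dom continuous_induced_dom)
  ext b
  exact @closure_minimal N (StandardSemigroup.weakStar N) _ _ (fun b hb => h b hb) (@IsClosed.preimage _ _ (StandardSemigroup.weakStar N) _ _ hcont _ isClosed_singleton) _ (hA b)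

end VonNeumannAlgebra

open NSFTrace PreL2

namespace NSFTrace

namespace PreL2

@[simp] lemma val_mk (x : N) (hx : τ.toFun (star x * x) < ∞) : (PreL2.mk x hx).val = x := rfl
@[simp] lemma val_zero : (0 : τ.PreL2).val = 0 := rfl
@[simp] lemma val_neg (x : τ.PreL2) : (-x).val = -x.val := rfl
@[simp] lemma val_mulLeft (b : N) (y : τ.PreL2) : (mulLeft b y).val = b * y.val := rfl
@[simp] lemma val_mulRight (b : N) (y : τ.PreL2) : (mulRight b y).val = y.val * b := rfl

lemma norm_sq (x : τ.PreL2) : ‖x‖ ^ 2 = (τ.toFun (star x.val * x.val)).toReal := by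
  have h := PreL2.inner_self x
  rw [inner_self_eq_norm_sq_to_K, RCLike.ofReal_eq_complex_ofReal] at h; exact_mod_cast h

lemma norm_sq_eq_sqNorm (x : τ.PreL2) : ‖x‖ ^ 2 = x.sqNorm := norm_sq x

lemma inner_def (x y : τ.PreL2) :
    ⟪x, y⟫_ℂ = (reInner x y : ℂ) - (reInner x (I • y) : ℂ) * I := rfl

lemma norm_sq_le_of_le {x y : τ.PreL2} {c : ℝ} (hc : 0 ≤ c)
    (h : star x.val * x.val ≤ (c : ℂ) • (star y.val * y.val)) : ‖x‖ ^ 2 ≤ c * ‖y‖ ^ 2 := by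
  lift c to ℝ≥0 using hc
  have h1 := τ.mono (star_mul_self_nonneg _) h
  have h2 := τ.map_smul c (star y.val * y.val) (star_mul_self_nonneg _)
  rw [norm_sq, norm_sq]
  refine (toReal_mono (ENNReal.mul_ne_top ENNReal.coe_ne_top y.lt_top.ne) (h1.trans_eq h2)).trans_eq ?_
  rw [ENNReal.toReal_mul]; rfl

lemma norm_mulLeft_le (b : N) (y : τ.PreL2) : ‖mulLeft b y‖ ≤ ‖b‖ * ‖y‖ := by
  refine le_of_sq_le_sq ?_ (by positivity)
  rw [mul_pow]; refine norm_sq_le_of_le (by positivity) ?_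
  have h := CStarAlgebra.star_left_conjugate_le_norm_smul (a := y.val)
    (IsSelfAdjoint.star_mul_self b)
  rw [CStarRing.norm_star_mul_self, ← sq] at h
  have e : star (b * y.val) * (b * y.val) = star y.val * (star b * b) * y.val := by
    simp only [star_mul, mul_assoc]
  rw [val_mulLeft, e]; exact h

/-- The adjoint of `x ∈ N ∩ L₂`. -/
def adj (x : τ.PreL2) : τ.PreL2 := .mk (star x.val) (τ.lt_top_star x.lt_top)

@[simp] lemma val_adj (x : τ.PreL2) : (adj x).val = star x.val := rfl

lemma norm_adj (x : τ.PreL2) : ‖adj x‖ = ‖x‖ := by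
  exact (sq_eq_sq₀ (norm_nonneg _) (norm_nonneg _)).1 (by rw [norm_sq, norm_sq, val_adj, star_star, τ.tracial])

lemma norm_mulRight_le (b : N) (y : τ.PreL2) : ‖mulRight b y‖ ≤ ‖b‖ * ‖y‖ := by
  have e : mulRight b y = adj (mulLeft (star b) (adj y)) := ext (by simp)
  rw [e, norm_adj]; simpa [norm_adj] using norm_mulLeft_le (star b) (adj y)

lemma sqNorm_adj (x : τ.PreL2) : (adj x).sqNorm = x.sqNorm := by
  rw [← norm_sq_eq_sqNorm, norm_adj, norm_sq_eq_sqNorm]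

lemma inner_adj (x y : τ.PreL2) : ⟪adj x, adj y⟫_ℂ = ⟪y, x⟫_ℂ := by
  have h : ∀ x y : τ.PreL2, reInner (adj x) (adj y) = reInner x y := fun x y => by
    have e1 : adj x + adj y = adj (x + y) := ext (by simp)
    have e2 : adj x - adj y = adj (x - y) := ext (by simp)
    rw [reInner, e1, e2, sqNorm_adj, sqNorm_adj, reInner]
  have e3 : I • adj x = -adj (I • x) := ext (by simp)
  rw [← inner_conj_symm, inner_def, inner_def, e3, reInner_neg_right, h, h]; simp [sub_eq_add_neg]

lemma inner_mulLeft (b : N) (z y : τ.PreL2) :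
    ⟪z, mulLeft b y⟫_ℂ = ⟪mulLeft (star b) z, y⟫_ℂ := by
  have h : ∀ z y : τ.PreL2, reInner z (mulLeft b y) = reInner (mulLeft (star b) z) y := by
    intro z y
    have h := sqNorm_three (x := z + mulLeft b y) (y := mulLeft (star b) z - y) (z := (0 : τ.PreL2))
      (x' := z - mulLeft b y) (y' := mulLeft (star b) z + y) (z' := 0) (by
        simp
        noncomm_ring)
    unfold reInner; linarith
  have e : I • mulLeft b y = mulLeft b (I • y) := ext (by simp)
  rw [inner_def, inner_def, e, h, h]

lemma inner_mulRight (b : N) (z y : τ.PreL2) :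
    ⟪z, mulRight b y⟫_ℂ = ⟪mulRight (star b) z, y⟫_ℂ := by
  have e1 : mulRight b y = adj (mulLeft (star b) (adj y)) := ext (by simp)
  have e2 : mulRight (star b) z = adj (mulLeft b (adj z)) := ext (by simp)
  have e3 : ∀ x : τ.PreL2, adj (adj x) = x := fun x => ext (by simp)
  have h1 := inner_adj (adj z) (mulLeft (star b) (adj y))
  have h2 := inner_adj (mulLeft b (adj z)) (adj y)
  rw [e3] at h1 h2; rw [e1, e2, h1, h2, inner_mulLeft]

/-- Left multiplication as a bounded bilinear map into `N ∩ L₂`. -/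
def mulLeftL (y : τ.PreL2) : N →L[ℂ] τ.PreL2 :=
  LinearMap.mkContinuous
    { toFun := fun b => mulLeft b y
      map_add' := fun a b => ext (by simp [add_mul])
      map_smul' := fun c a => ext (by simp) } ‖y‖ fun b => by
    rw [mul_comm]; exact norm_mulLeft_le b y

@[simp] lemma mulLeftL_apply (y : τ.PreL2) (b : N) : mulLeftL y b = mulLeft b y := rfl

def mulRightL (b : N) : τ.PreL2 →L[ℂ] τ.PreL2 :=
  LinearMap.mkContinuous
    { toFun := fun y => mulRight b y
      map_add' := fun x y => ext (by simp [add_mul])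
      map_smul' := fun c x => ext (by simp) } ‖b‖ fun y => norm_mulRight_le b y

@[simp] lemma mulRightL_apply (b : N) (y : τ.PreL2) : mulRightL b y = mulRight b y := rfl

lemma mulLeft_add_right (b : N) (x y : τ.PreL2) : mulLeft b (x + y) = mulLeft b x + mulLeft b y :=
  ext (by simp [mul_add])

lemma mulLeft_smul_right (b : N) (c : ℂ) (x : τ.PreL2) : mulLeft b (c • x) = c • mulLeft b x :=
  ext (by simp)

/-- The functional `b ↦ τ(z⋆ b y)`. -/
def form (z y : τ.PreL2) : StrongDual ℂ N := (innerSL ℂ z) ∘L mulLeftL y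

@[simp] lemma form_apply (z y : τ.PreL2) (b : N) : form z y b = ⟪z, mulLeft b y⟫_ℂ := rfl

lemma form_self_star_mul (y : τ.PreL2) (b : N) :
    form y y (star b * b) = ((‖mulLeft b y‖ ^ 2 : ℝ) : ℂ) := by
  have e : mulLeft (star b * b) y = mulLeft (star b) (mulLeft b y) := ext (by simp [mul_assoc])
  rw [form_apply, e, inner_mulLeft, star_star, inner_self_eq_norm_sq_to_K]; simp

lemma form_self_nonneg (y : τ.PreL2) {b : N} (hb : 0 ≤ b) : 0 ≤ form y y b := by
  obtain ⟨s, rfl⟩ := CStarAlgebra.nonneg_iff_eq_star_mul_self.1 hb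
  rw [form_self_star_mul]; exact Complex.zero_le_real.2 (sq_nonneg _)

lemma form_self_eq_trace (y : τ.PreL2) {b : N} (hb : 0 ≤ b) :
    (form y y b).re = (τ.toFun (star y.val * b * y.val)).toReal ∧
      τ.toFun (star y.val * b * y.val) < ∞ := by
  obtain ⟨s, rfl⟩ := CStarAlgebra.nonneg_iff_eq_star_mul_self.1 hb
  have e : star y.val * (star s * s) * y.val = star (mulLeft s y).val * (mulLeft s y).val := by
    simp [mul_assoc]
  rw [form_self_star_mul, e, ofReal_re, norm_sq]; exact ⟨rfl, (mulLeft s y).lt_top⟩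

lemma form_polarization (z y : τ.PreL2) : form z y = (4⁻¹ : ℂ) • (form (y + z) (y + z) -
    form (y - z) (y - z) + I • form (y + I • z) (y + I • z) -
    I • form (y - I • z) (y - I • z)) := by
  ext b
  have e : ∀ x w : τ.PreL2, mulLeft b (x - w) = mulLeft b x - mulLeft b w := fun x w =>
    ext (by simp [mul_sub])
  simp only [form_apply, smul_apply, add_apply, sub_apply, e, mulLeft_add_right,
    mulLeft_smul_right, inner_add_left, inner_add_right, inner_sub_left, inner_sub_right,
    inner_smul_left, inner_smul_right, smul_eq_mul, Complex.conj_I]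
  ring_nf; simp; ring

lemma form_self_normal (y : τ.PreL2) (D : Set N) (hne : D.Nonempty)
    (hD : DirectedOn (· ≤ ·) D) (h0 : ∀ x ∈ D, 0 ≤ x) (b : N) (hb : IsLUB D b) (ε : ℝ) (hε : ε > 0) :
    ∃ x ∈ D, (form y y b).re - ε < (form y y x).re := by
  have h1 := VonNeumannAlgebra.isLUB_conj hne hD h0 hb y.val
  have hb0 : 0 ≤ b := by
    obtain ⟨x, hx⟩ := hne
    exact (h0 x hx).trans (hb.1 hx)
  have h2 := τ.normal _ _ (by
    rintro _ ⟨x, hx, rfl⟩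
    exact star_left_conjugate_nonneg (h0 x hx) _) (hne.image _) (by
    rintro _ ⟨x, hx, rfl⟩ _ ⟨x', hx', rfl⟩
    obtain ⟨w, hw, h, h'⟩ := hD x hx x' hx'
    exact ⟨_, ⟨w, hw, rfl⟩, star_left_conjugate_le_conjugate h _,
      star_left_conjugate_le_conjugate h' _⟩) h1
  rw [iSup_image] at h2
  obtain ⟨hre, hfin⟩ := form_self_eq_trace y hb0
  by_contra! hcon
  have h3 : τ.toFun (star y.val * b * y.val) ≤ ofReal ((form y y b).re - ε) := by
    rw [h2]; refine iSup₂_le fun x hx => ?_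
    obtain ⟨hre', hfin'⟩ := form_self_eq_trace y (h0 x hx)
    rw [← ofReal_toReal hfin'.ne, ← hre']; exact ofReal_le_ofReal (hcon x hx)
  have h4 : (form y y b).re - ε < 0 ∨ 0 ≤ (form y y b).re - ε := lt_or_ge _ _
  rcases h4 with h4 | h4
  · obtain ⟨x, hx⟩ := hne
    have := (Complex.nonneg_iff.1 (form_self_nonneg y (h0 x hx))).1
    linarith [hcon x hx]
  · have h5 := toReal_mono ofReal_ne_top h3
    rw [← hre, ENNReal.toReal_ofReal h4] at h5; linarith

lemma form_self_mem_predual (y : τ.PreL2) : form y y ∈ N.predual :=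
  VonNeumannAlgebra.mem_predual_of_normal _ (fun _ hx => form_self_nonneg y hx) (form_self_normal y)

lemma form_mem_predual (z y : τ.PreL2) : form z y ∈ N.predual := by
  rw [form_polarization]
  have h := form_self_mem_predual (τ := τ)
  exact Submodule.smul_mem _ _ (sub_mem (add_mem (sub_mem (h _) (h _)) (Submodule.smul_mem _ _ (h _)))
    (Submodule.smul_mem _ _ (h _)))

end PreL2

/-- The elements `a (1 + a)⁻¹` with `τ(a) < ∞`. -/
def finUnits (τ : NSFTrace N) : Set N :=
  {e | ∃ (a : N) (u : Nˣ), 0 ≤ a ∧ τ.toFun a < ∞ ∧ (u : N) = 1 + a ∧ e = 1 - (u⁻¹ : Nˣ)}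

lemma exists_unit_one_add {a : N} (ha : 0 ≤ a) : ∃ u : Nˣ, (u : N) = 1 + a :=
  CStarAlgebra.isUnit_of_le 1 (le_add_of_nonneg_right ha) (by simp)

lemma finUnits_nonempty (τ : NSFTrace N) : τ.finUnits.Nonempty :=
  ⟨0, 0, 1, le_rfl, by simp [τ.map_zero], by simp, by simp⟩

lemma finUnits_mem {τ : NSFTrace N} {e : N} (he : e ∈ τ.finUnits) :
    0 ≤ e ∧ e ≤ 1 ∧ τ.toFun e < ∞ := by
  obtain ⟨a, u, ha, hτ, hu, rfl⟩ := he
  have hi0 := CFC.inv_nonneg_of_nonneg u (hu ▸ add_nonneg zero_le_one ha)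
  have hi1 : ((u⁻¹ : Nˣ) : N) ≤ 1 := by
    have := CStarAlgebra.inv_le_inv (a := (1 : Nˣ)) (b := u) (by simp) (by simp [hu, ha])
    simpa using this
  refine ⟨sub_nonneg.2 hi1, sub_le_self _ hi0, ?_⟩
  have e1 : 1 - ((u⁻¹ : Nˣ) : N) = a - star a * (u⁻¹ : Nˣ) * a := by
    have h1 : ((u⁻¹ : Nˣ) : N) * (1 + a) = 1 := by rw [← hu]; simp
    have h2 : (1 + a) * ((u⁻¹ : Nˣ) : N) = 1 := by rw [← hu]; simp
    rw [(of_nonneg ha).star_eq]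
    have h3 : ((u⁻¹ : Nˣ) : N) * a = 1 - (u⁻¹ : Nˣ) := by rw [← h1]; noncomm_ring
    have h4 : a * ((u⁻¹ : Nˣ) : N) = 1 - (u⁻¹ : Nˣ) := by rw [← h2]; noncomm_ring
    rw [h4, sub_mul, one_mul, h3]; noncomm_ring
  refine (τ.mono (sub_nonneg.2 hi1) ?_).trans_lt hτ; rw [e1]
  exact sub_le_self _ (star_left_conjugate_nonneg hi0 a)

lemma directedOn_finUnits (τ : NSFTrace N) : DirectedOn (· ≤ ·) τ.finUnits := by
  rintro _ ⟨a, u, ha, hτ, hu, rfl⟩ _ ⟨b, v, hb, hτ', hv, rfl⟩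
  obtain ⟨w, hw⟩ := exists_unit_one_add (add_nonneg ha hb)
  refine ⟨1 - (w⁻¹ : Nˣ), ⟨a + b, w, add_nonneg ha hb, ?_, hw, rfl⟩, ?_, ?_⟩
  · rw [τ.map_add _ _ ha hb]; exact ENNReal.add_lt_top.2 ⟨hτ, hτ'⟩
  · refine sub_le_sub_left (CStarAlgebra.inv_le_inv (hu ▸ add_nonneg zero_le_one ha) ?_) _
    rw [hu, hw]; gcongr; exact le_add_of_nonneg_right hb
  · refine sub_le_sub_left (CStarAlgebra.inv_le_inv (hv ▸ add_nonneg zero_le_one hb) ?_) _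
    rw [hv, hw]; gcongr; exact le_add_of_nonneg_left ha

lemma isLUB_finUnits (τ : NSFTrace N) : IsLUB τ.finUnits 1 := by
  obtain ⟨b, hb, -⟩ := VonNeumannAlgebra.exists_isLUB τ.finUnits_nonempty τ.directedOn_finUnits
    (fun x hx => (finUnits_mem hx).1) (fun x hx => (finUnits_mem hx).2.1)
  rcases eq_or_ne (1 - b) 0 with h | h
  · rwa [← sub_eq_zero.1 h] at hb
  obtain ⟨x, hx0, hxb, hxne, hτ⟩ := τ.semifinite _ (sub_nonneg.2 (hb.2 fun x hx => (finUnits_mem hx).2.1)) h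
  have key : ∀ k : ℕ, ‖x * x‖ ≤ 1 / ((k : ℝ) + 1) := by
    intro k
    have hk : 0 ≤ ((k + 1 : ℝ≥0) : ℂ) := by simp; positivity
    have hkx := smul_nonneg hk hx0
    obtain ⟨u, hu⟩ := exists_unit_one_add hkx
    have h1 := hb.1 ⟨_, u, hkx, by
      rw [τ.map_smul _ _ hx0]; exact ENNReal.mul_lt_top ENNReal.coe_lt_top hτ, hu, rfl⟩
    have hc : Commute (u : N) x := hu ▸ (Commute.one_left x).add_left ((Commute.refl x).smul_left _)
    have h2 := (((Commute.refl (u : N)).units_inv_right).sub_right hc).mul_nonneg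
      (hu ▸ add_nonneg zero_le_one hkx) (sub_nonneg.2 (hxb.trans (sub_le_comm.1 h1)))
    rw [mul_sub, u.mul_inv, hu, add_mul, one_mul, smul_mul_assoc, ← sub_sub, sub_nonneg] at h2
    have h3 := (CStarAlgebra.norm_le_one_iff_of_nonneg _ (smul_nonneg hk ((Commute.refl x).mul_nonneg hx0 hx0))).2 (h2.trans (sub_le_self _ hx0))
    rw [norm_smul] at h3; rw [le_div_iff₀ (by positivity), mul_comm]
    have hn : ‖(k : ℂ) + 1‖ = k + 1 := by exact_mod_cast Complex.norm_natCast (k + 1)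
    simpa [hn] using h3
  exact absurd ((CStarRing.star_mul_self_eq_zero_iff x).1 (by
    rw [(of_nonneg hx0).star_eq]
    exact norm_le_zero_iff.1 (ge_of_tendsto' tendsto_one_div_add_atTop_nhds_zero_nat key))) hxne

end NSFTrace

lemma mul_star_polarization {A : Type*} [Ring A] [StarRing A] [Algebra ℂ A] [StarModule ℂ A]
    (z w : A) : z * star w = (4⁻¹ : ℂ) • ((z + w) * star (z + w) - (z - w) * star (z - w) +
      I • ((z + I • w) * star (z + I • w)) -
      I • ((z - I • w) * star (z - I • w))) := by
  have e : (4 : ℂ) • (z * star w) = ((z + w) * star (z + w) - (z - w) * star (z - w) +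
      I • ((z + I • w) * star (z + I • w)) -
      I • ((z - I • w) * star (z - I • w))) := by
    simp only [star_add, star_sub, star_smul, Complex.star_def, Complex.conj_I, mul_add, add_mul,
      mul_sub, sub_mul, smul_mul_assoc, mul_smul_comm, smul_add, smul_sub, smul_smul, neg_smul,
      smul_neg, mul_neg, Complex.I_mul_I, one_smul]
    rw [show (4 : ℂ) = 1 + 1 + 1 + 1 by norm_num]
    simp only [add_smul, one_smul]; abel
  rw [← e, smul_smul]; norm_num

namespace NSFTrace

/-- The filter of the increasing approximate unit of elements of finite trace. -/
def unitFilter (τ : NSFTrace N) : Filter N := map Subtype.val (atTop : Filter τ.finUnits)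

instance : τ.unitFilter.NeBot := by
  have : Nonempty τ.finUnits := τ.finUnits_nonempty.to_subtype
  have : IsDirected τ.finUnits (· ≤ ·) := ⟨τ.directedOn_finUnits.directed_val⟩
  exact map_neBot

lemma eventually_unitFilter_ge {e : N} (he : e ∈ τ.finUnits) :
    ∀ᶠ e' in τ.unitFilter, e' ∈ τ.finUnits ∧ e ≤ e' := by
  exact eventually_map.2 ((eventually_ge_atTop (⟨e, he⟩ : τ.finUnits)).mono fun i hi => ⟨i.2, hi⟩)

lemma eventually_mem_finUnits : ∀ᶠ e in τ.unitFilter, e ∈ τ.finUnits := by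
  obtain ⟨e, he⟩ := τ.finUnits_nonempty
  exact (eventually_unitFilter_ge he).mono fun _ h => h.1

lemma one_sub_mul_self_le {e : N} (he : e ∈ τ.finUnits) :
    star (1 - e) * (1 - e) ≤ 1 - e := by
  obtain ⟨h0, h1, -⟩ := finUnits_mem he
  have h2 := sub_nonneg.2 h1
  set s := CFC.sqrt (1 - e)
  have hss : s * s = 1 - e := CFC.sqrt_mul_sqrt_self _ h2
  have h3 := star_left_conjugate_le_conjugate (sub_le_self 1 h0) s
  rw [(of_nonneg (CFC.sqrt_nonneg _)).star_eq, mul_one] at h3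
  calc star (1 - e) * (1 - e) = s * (1 - e) * s := by
        rw [(of_nonneg h2).star_eq, ← hss]; simp only [mul_assoc]
    _ ≤ s * s := h3
    _ = 1 - e := hss

lemma tendsto_of_normal {f : N → ℝ} {g : N → ℝ} (hmono : ∀ x y : N, x ≤ y → f x ≤ f y)
    (hn : ∀ ε > 0, ∃ x ∈ τ.finUnits, f 1 - ε < f x) (hg0 : ∀ e, 0 ≤ g e)
    (hg : ∀ e ∈ τ.finUnits, g e ^ 2 ≤ f 1 - f e) : Tendsto g τ.unitFilter (𝓝 0) := by
  refine Metric.tendsto_nhds.2 fun ε hε => ?_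
  obtain ⟨x, hx, hxε⟩ := hn (ε ^ 2) (by positivity)
  filter_upwards [eventually_unitFilter_ge hx] with e he
  rw [dist_zero_right, norm_of_nonneg (hg0 e)]
  have h1 := hg e he.1
  have h2 := hmono _ _ he.2
  exact lt_of_pow_lt_pow_left₀ 2 hε.le (by linarith)

namespace PreL2

lemma re_form_self_mono (y : τ.PreL2) {a b : N} (h : a ≤ b) :
    (form y y a).re ≤ (form y y b).re := by
  have := (Complex.nonneg_iff.1 (form_self_nonneg y (sub_nonneg.2 h))).1
  rwa [map_sub, sub_re, sub_nonneg] at this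

lemma tendsto_norm_sub_mulLeft (y : τ.PreL2) :
    Tendsto (fun e => ‖mulLeft (1 - e) y‖) τ.unitFilter (𝓝 0) := by
  refine tendsto_of_normal (fun _ _ => re_form_self_mono y)
    (fun ε hε => form_self_normal y _ τ.finUnits_nonempty τ.directedOn_finUnits
      (fun x hx => (finUnits_mem hx).1) _ τ.isLUB_finUnits ε hε) (fun e => norm_nonneg _) ?_
  intro e he
  have h := re_form_self_mono y (one_sub_mul_self_le he)
  rw [form_self_star_mul, ofReal_re, map_sub, sub_re] at h; exact h

end PreL2

lemma tendsto_norm_sub_apply (τ : NSFTrace N) (ξ : H) :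
    Tendsto (fun e : N => ‖((1 - e : N) : H →L[ℂ] H) ξ‖) τ.unitFilter (𝓝 0) := by
  refine tendsto_of_normal
    (fun x y h => (Complex.le_def.1 ((VonNeumannAlgebra.le_iff _ _).1 h ξ)).1)
    (fun ε hε => VonNeumannAlgebra.exists_lt_of_isLUB τ.finUnits_nonempty τ.directedOn_finUnits
      (fun x hx => (finUnits_mem hx).1) τ.isLUB_finUnits ξ hε) (fun e => norm_nonneg _) ?_
  intro e he
  have h := (Complex.le_def.1 ((VonNeumannAlgebra.le_iff _ _).1 (one_sub_mul_self_le he) ξ)).1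
  have e1 : ⟪ξ, ((star (1 - e) * (1 - e) : N) : H →L[ℂ] H) ξ⟫_ℂ =
      ⟪((1 - e : N) : H →L[ℂ] H) ξ, ((1 - e : N) : H →L[ℂ] H) ξ⟫_ℂ :=
    adjoint_inner_right ((1 - e : N) : H →L[ℂ] H) ξ _
  rw [e1, inner_self_eq_norm_sq_to_K, RCLike.ofReal_eq_complex_ofReal, ← Complex.ofReal_pow,
    ofReal_re] at h
  refine h.trans (le_of_eq ?_); rw [← sub_re, ← inner_sub_right]; rfl

lemma predual_induction {p : StrongDual ℂ N → Prop} (hvec : ∀ ξ η, p (N.vecFun ξ η))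
    (hadd : ∀ φ χ, p φ → p χ → p (φ + χ)) (hsmul : ∀ (c : ℂ) φ, p φ → p (c • φ))
    (hlim : ∀ φ, (∀ ε > 0, ∃ χ, p χ ∧ ‖φ - χ‖ < ε) → p φ)
    (hφ : φ ∈ N.predual) : p φ := by
  refine hlim φ fun ε hε => ?_
  obtain ⟨χ, hχ, h⟩ := Metric.mem_closure_iff.1 hφ ε hε
  exact ⟨χ, Submodule.span_induction (by rintro _ ⟨q, rfl⟩; exact hvec _ _) ((zero_smul ℂ (N.vecFun 0 0)) ▸ hsmul 0 _ (hvec 0 0)) (fun _ _ _ _ => hadd _ _) (fun c _ _ => hsmul c _) hχ, by rwa [← dist_eq_norm]⟩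

lemma tendsto_apply_of_mem_predual {ι : Type*} {l : Filter ι} {x : ι → N} {b : N}
    (hK : ∀ᶠ i in l, ‖x i - b‖ ≤ K)
    (hx : ∀ ξ η : H, Tendsto (fun i => ⟪ξ, (x i : H →L[ℂ] H) η⟫_ℂ) l
      (𝓝 ⟪ξ, (b : H →L[ℂ] H) η⟫_ℂ)) (hφ : φ ∈ N.predual) :
    Tendsto (fun i => φ (x i)) l (𝓝 (φ b)) := by
  refine predual_induction (p := fun φ => Tendsto (fun i => φ (x i)) l (𝓝 (φ b))) hx
    (fun φ χ h1 h2 => h1.add h2) (fun c φ h => h.const_smul c) (fun φ h => ?_) hφ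
  refine Metric.tendsto_nhds.2 fun ε hε => ?_
  obtain ⟨χ, hχ, hφχ⟩ := h (ε / 2 / (|K| + 1)) (by positivity)
  filter_upwards [Metric.tendsto_nhds.1 hχ (ε / 2) (half_pos hε), hK] with i hi hKi
  rw [dist_eq_norm] at hi ⊢
  have h1 : ‖(φ - χ) (x i - b)‖ ≤ ε / 2 / (|K| + 1) * (|K| + 1) :=
    ((φ - χ).le_opNorm _).trans (mul_le_mul hφχ.le (by linarith [le_abs_self K]) (norm_nonneg _)
      (by positivity))
  rw [div_mul_cancel₀ _ (by positivity)] at h1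
  have h2 : φ (x i) - φ b = (φ - χ) (x i - b) + (χ (x i) - χ b) := by simp
  rw [h2]; linarith [norm_add_le ((φ - χ) (x i - b)) (χ (x i) - χ b)]

lemma tendsto_apply_mul_unit (hφ : φ ∈ N.predual) (b : N) :
    Tendsto (fun e => φ (b * e)) τ.unitFilter (𝓝 (φ b)) := by
  refine tendsto_apply_of_mem_predual (K := ‖b‖ * 1) ?_ (fun ξ η => ?_) hφ
  · filter_upwards [eventually_mem_finUnits] with e he
    rw [norm_sub_rev, show b - b * e = b * (1 - e) by rw [mul_sub, mul_one]]
    exact (norm_mul_le _ _).trans (by gcongr; exact (CStarAlgebra.norm_le_one_iff_of_nonneg _ (sub_nonneg.2 (finUnits_mem he).2.1)).2 (sub_le_self _ (finUnits_mem he).1))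
  · rw [tendsto_iff_norm_sub_tendsto_zero]
    have h := (tendsto_norm_sub_apply τ η).const_mul (‖ξ‖ * ‖(b : H →L[ℂ] H)‖)
    rw [mul_zero] at h; refine squeeze_zero (fun _ => norm_nonneg _) (fun e => ?_) h
    have e1 : ⟪ξ, ((b * e : N) : H →L[ℂ] H) η⟫_ℂ - ⟪ξ, (b : H →L[ℂ] H) η⟫_ℂ =
        -⟪ξ, (b : H →L[ℂ] H) (((1 - e : N) : H →L[ℂ] H) η)⟫_ℂ := by simp
    rw [e1, norm_neg, mul_assoc]
    exact (norm_inner_le_norm _ _).trans (mul_le_mul_of_nonneg_left ((b : H →L[ℂ] H).le_opNorm _)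
      (norm_nonneg _))

namespace PreL2

/-- The square root of an element of finite trace. -/
def sqrt (a : N) (ha : 0 ≤ a) (h : τ.toFun a < ∞) : τ.PreL2 :=
  .mk (CFC.sqrt a) (by
    rwa [(of_nonneg (CFC.sqrt_nonneg a)).star_eq, CFC.sqrt_mul_sqrt_self a ha])

@[simp] lemma val_sqrt (a : N) (ha : 0 ≤ a) (h : τ.toFun a < ∞) :
    (sqrt a ha h).val = CFC.sqrt a := rfl

lemma sqrt_mul_star (a : N) (ha : 0 ≤ a) (h : τ.toFun a < ∞) :
    (sqrt a ha h).val * star (sqrt a ha h).val = a := by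
  rw [val_sqrt, (of_nonneg (CFC.sqrt_nonneg a)).star_eq, CFC.sqrt_mul_sqrt_self a ha]

lemma form_self_mul_star (y z : τ.PreL2) :
    form y y (z.val * star z.val) = form z z (y.val * star y.val) := by
  have h1 := form_self_star_mul y (star z.val)
  have h2 := form_self_star_mul z (star y.val)
  rw [star_star] at h1 h2
  have e : mulLeft (star z.val) y = adj (mulLeft (star y.val) z) := ext (by simp)
  rw [h1, h2, e, norm_adj]

end PreL2

lemma predual_ext {φ χ : StrongDual ℂ N} (hφ : φ ∈ N.predual) (hχ : χ ∈ N.predual)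
    (h : ∀ z : τ.PreL2, φ (z.val * star z.val) = χ (z.val * star z.val)) : φ = χ := by
  have h1 : ∀ z w : τ.PreL2, φ (z.val * star w.val) = χ (z.val * star w.val) := by
    intro z w; rw [mul_star_polarization]; simp only [_root_.map_smul, _root_.map_add, map_sub]
    have a1 := h (z + w)
    have a2 := h (z - w)
    have a3 := h (z + I • w)
    have a4 := h (z - I • w)
    simp only [val_add, PreL2.val_sub, val_smul] at a1 a2 a3 a4; rw [a1, a2, a3, a4]
  ext b
  refine tendsto_nhds_unique (tendsto_apply_mul_unit (τ := τ) hφ b)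
    ((tendsto_apply_mul_unit hχ b).congr' ?_)
  filter_upwards [eventually_mem_finUnits] with e he
  obtain ⟨h0, -, hτ⟩ := finUnits_mem he
  have := h1 (mulLeft b (PreL2.sqrt e h0 hτ)) (PreL2.sqrt e h0 hτ)
  rw [PreL2.val_mulLeft, mul_assoc, PreL2.sqrt_mul_star] at this; exact this.symm

lemma trace_le_of_form_le {x : N} (hx : 0 ≤ x) {M : ℝ≥0∞}
    (h : ∀ z : τ.PreL2, z.val * star z.val ≤ 1 → τ.toFun (star z.val * x * z.val) ≤ M) :
    τ.toFun x ≤ M := by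
  set s := CFC.sqrt x
  have hss : s * s = x := CFC.sqrt_mul_sqrt_self _ hx
  have hs : star s = s := (of_nonneg (CFC.sqrt_nonneg _)).star_eq
  have h1 := VonNeumannAlgebra.isLUB_conj τ.finUnits_nonempty τ.directedOn_finUnits
    (fun x hx => (finUnits_mem hx).1) τ.isLUB_finUnits s
  rw [mul_one, hs, hss] at h1
  have h2 := τ.normal _ _ (by
    rintro _ ⟨e, he, rfl⟩
    have := star_left_conjugate_nonneg (finUnits_mem he).1 s
    rwa [hs] at this) (τ.finUnits_nonempty.image _) (by
    rintro _ ⟨x, hx, rfl⟩ _ ⟨x', hx', rfl⟩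
    obtain ⟨w, hw, h, h'⟩ := τ.directedOn_finUnits x hx x' hx'
    have a1 := star_left_conjugate_le_conjugate h s
    have a2 := star_left_conjugate_le_conjugate h' s
    rw [hs] at a1 a2; exact ⟨_, ⟨w, hw, rfl⟩, a1, a2⟩) h1
  rw [h2, iSup_image]; refine iSup₂_le fun e he => ?_
  obtain ⟨h0, he1, hτ⟩ := finUnits_mem he
  set z := PreL2.sqrt e h0 hτ
  have hz : z.val * star z.val = e := PreL2.sqrt_mul_star e h0 hτ
  have h3 := h z (hz.trans_le he1)
  have h4 := τ.tracial (star z.val * s)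
  rw [star_mul, star_star, hs] at h4
  have e1 : s * z.val * (star z.val * s) = s * e * s := by grind
  have e2 : star z.val * s * (s * z.val) = star z.val * x * z.val := by grind
  rw [e1, e2] at h4; rwa [h4]

end NSFTrace

lemma CompletelyPositiveMap.star_mul_self_le {A : Type*} [CStarAlgebra A] [PartialOrder A]
    [StarOrderedRing A] (T : A →CP A) (h1 : T 1 = 1) (x : A) :
    star (T x) * T x ≤ T (star x * x) := by
  let a : CStarMatrix (Fin 2) (Fin 2) A := CStarMatrix.ofMatrix !![1, x; 0, 0]
  have h2 := T.map_cstarMatrix_nonneg (star a * a) (star_mul_self_nonneg a)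
  have key : ∀ (M : CStarMatrix (Fin 2) (Fin 2) A), 0 ≤ M → ∀ v : Fin 2 → A,
      0 ≤ ∑ i, ∑ j, star (v i) * M i j * v j := by
    intro M hM v; rw [StarOrderedRing.nonneg_iff] at hM
    induction hM using AddSubmonoid.closure_induction with
    | mem M hM =>
      obtain ⟨s, rfl⟩ := hM
      have e : ∑ i, ∑ j, star (v i) * (star s * s) i j * v j =
          ∑ k, star (∑ i, s k i * v i) * ∑ i, s k i * v i := by
        simp only [CStarMatrix.mul_apply, CStarMatrix.star_apply, Fin.sum_univ_two, star_add, star_mul]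
        noncomm_ring
      rw [e]; exact Finset.sum_nonneg fun k _ => star_mul_self_nonneg _
    | zero => simp
    | add M M' _ _ h h' =>
      have e : ∑ i, ∑ j, star (v i) * (M + M') i j * v j =
          ∑ i, ∑ j, star (v i) * M i j * v j + ∑ i, ∑ j, star (v i) * M' i j * v j := by
        simp
        noncomm_ring
      rw [e]; exact add_nonneg h h'
  have h3 := key _ h2 ![-T x, 1]
  have ha : (star a * a) 0 0 = 1 ∧ (star a * a) 0 1 = x ∧ (star a * a) 1 0 = star x ∧
      (star a * a) 1 1 = star x * x := by
    refine ⟨?_, ?_, ?_, ?_⟩ <;> rw [CStarMatrix.mul_apply, Fin.sum_univ_two] <;>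
      simp [a, CStarMatrix.star_apply]
  simp only [Fin.sum_univ_two, CStarMatrix.map_apply, ha, h1, map_star T x,
    Matrix.cons_val_zero, Matrix.cons_val_one, star_neg, star_one, one_mul, mul_one, neg_mul,
    mul_neg, neg_neg] at h3
  rw [← sub_nonneg]; refine h3.trans_eq ?_; abel

lemma star_mul_self_le_self {A : Type*} [CStarAlgebra A] [PartialOrder A] [StarOrderedRing A]
    {e : A} (h0 : 0 ≤ e) (h1 : e ≤ 1) : star e * e ≤ e := by
  have h4 := CFC.sqrt_mul_sqrt_self e h0
  have h3 := star_left_conjugate_le_conjugate h1 (CFC.sqrt e)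
  rw [(of_nonneg (CFC.sqrt_nonneg e)).star_eq, mul_one, h4] at h3; refine le_trans (le_of_eq ?_) h3
  rw [(of_nonneg h0).star_eq]
  calc e * e = CFC.sqrt e * CFC.sqrt e * (CFC.sqrt e * CFC.sqrt e) := by rw [h4]
    _ = CFC.sqrt e * (CFC.sqrt e * CFC.sqrt e) * CFC.sqrt e := by simp only [mul_assoc]
    _ = _ := by rw [h4]

namespace StandardSemigroup

variable (S : StandardSemigroup τ)

lemma map_star' (t : ℝ≥0) (x : N) : S.T t (star x) = star (S.T t x) := map_star (S.T t) x

lemma kadison_schwarz (t : ℝ≥0) (x : N) : star (S.T t x) * S.T t x ≤ S.T t (star x * x) :=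
  (S.T t).star_mul_self_le (S.map_one t) x

lemma T_mono (t : ℝ≥0) {x y : N} (h : x ≤ y) : S.T t x ≤ S.T t y := OrderHomClass.mono (S.T t) h

lemma T_nonneg (t : ℝ≥0) {x : N} (h : 0 ≤ x) : 0 ≤ S.T t x := by
  simpa using S.T_mono t h

lemma norm_T_le (t : ℝ≥0) (x : N) : ‖S.T t x‖ ≤ ‖x‖ := by
  have h1 : star x * x ≤ algebraMap ℝ N (‖x‖ ^ 2) := by
    have := IsSelfAdjoint.le_algebraMap_norm_self (IsSelfAdjoint.star_mul_self x)
    rwa [CStarRing.norm_star_mul_self, ← sq] at this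
  have h2 := (S.kadison_schwarz t x).trans (S.T_mono t h1)
  have h3 : S.T t (algebraMap ℝ N (‖x‖ ^ 2)) = algebraMap ℝ N (‖x‖ ^ 2) := by
    rw [Algebra.algebraMap_eq_smul_one, ← coe_smul, _root_.map_smul, S.map_one]
  rw [h3] at h2
  have h4 := CStarAlgebra.norm_le_norm_of_nonneg_of_le (star_mul_self_nonneg _) h2
  rw [CStarRing.norm_star_mul_self, ← sq, norm_algebraMap, norm_of_nonneg (by positivity)] at h4
  exact le_of_sq_le_sq (h4.trans (mul_le_of_le_one_right (by positivity) ((CStarAlgebra.norm_le_one_iff_of_nonneg 1 zero_le_one).2 le_rfl))) (norm_nonneg _)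

/-- `T_t` as a bounded operator on `N`. -/
def TL (t : ℝ≥0) : N →L[ℂ] N :=
  LinearMap.mkContinuous (S.T t).toLinearMap 1 fun x => by rw [one_mul]; exact S.norm_T_le t x

@[simp] lemma TL_apply (t : ℝ≥0) (x : N) : S.TL t x = S.T t x := rfl

lemma trace_T (t : ℝ≥0) {a : N} (ha : 0 ≤ a) : τ.toFun (S.T t a) = τ.toFun a := by
  obtain ⟨x, rfl⟩ := CStarAlgebra.nonneg_iff_eq_star_mul_self.1 ha
  have h := S.symmetric t x 1
  simpa [S.map_one, ← τ.tracial] using h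

lemma trace_T_mul_star_lt_top (u : ℝ≥0) (y : τ.PreL2) :
    τ.toFun (S.T u (y.val * star y.val)) < ∞ := by
  rw [S.trace_T u (mul_star_self_nonneg _), ← τ.tracial]; exact y.lt_top

/-- The square root of `T_u(y y⋆)`. -/
def evolve (u : ℝ≥0) (y : τ.PreL2) : τ.PreL2 :=
  .sqrt (S.T u (y.val * star y.val)) (S.T_nonneg u (mul_star_self_nonneg _))
    (S.trace_T_mul_star_lt_top u y)

lemma evolve_mul_star (u : ℝ≥0) (y : τ.PreL2) :
    (S.evolve u y).val * star (S.evolve u y).val = S.T u (y.val * star y.val) :=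
  PreL2.sqrt_mul_star _ _ _

lemma evolve_evolve (v u : ℝ≥0) (y : τ.PreL2) :
    S.evolve v (S.evolve u y) = S.evolve (v + u) y := by
  apply PreL2.ext
  change CFC.sqrt (S.T v ((S.evolve u y).val * star (S.evolve u y).val)) =
    CFC.sqrt (S.T (v + u) (y.val * star y.val))
  rw [evolve_mul_star, S.map_add]

lemma norm_val_evolve_le (u : ℝ≥0) (y : τ.PreL2) : ‖(S.evolve u y).val‖ ≤ ‖y.val‖ := by
  have h := S.norm_T_le u (y.val * star y.val)
  rw [← evolve_mul_star, CStarRing.norm_self_mul_star, CStarRing.norm_self_mul_star] at h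
  exact le_of_sq_le_sq (by simpa only [sq] using h) (norm_nonneg _)

lemma form_evolve (u : ℝ≥0) (y : τ.PreL2) (b : N) :
    form (S.evolve u y) (S.evolve u y) b = form y y (S.T u b) := by
  have h : ∀ b : N, 0 ≤ b → form (S.evolve u y) (S.evolve u y) b = form y y (S.T u b) := by
    intro b hb
    obtain ⟨x, rfl⟩ := CStarAlgebra.nonneg_iff_eq_star_mul_self.1 hb
    have h1 := (form_self_eq_trace (S.evolve u y) hb).1
    have h2 := (form_self_eq_trace y (S.T_nonneg u hb)).1
    have h3 := S.symmetric u x y.val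
    rw [← evolve_mul_star] at h3
    have h4 := τ.tracial (star (x * (S.evolve u y).val))
    rw [star_star, star_mul] at h4
    have e1 : x * ((S.evolve u y).val * star (S.evolve u y).val) * star x =
        x * (S.evolve u y).val * (star (S.evolve u y).val * star x) := by simp only [mul_assoc]
    have e2 : star (S.evolve u y).val * (star x * x) * (S.evolve u y).val =
        star (S.evolve u y).val * star x * (x * (S.evolve u y).val) := by simp only [mul_assoc]
    rw [e1, h4, ← e2] at h3; refine Complex.ext (by rw [h1, h2, h3]) ?_
    rw [← (Complex.nonneg_iff.1 (form_self_nonneg (S.evolve u y) hb)).2,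
      ← (Complex.nonneg_iff.1 (form_self_nonneg y (S.T_nonneg u hb))).2]
  obtain ⟨p, hp, -, hb⟩ := CStarAlgebra.exists_sum_four_nonneg b
  rw [hb]; simp only [map_sum, _root_.map_smul, h _ (hp _)]

lemma norm_mulLeft_evolve (u : ℝ≥0) (y : τ.PreL2) (f : N) :
    ‖mulLeft f (S.evolve u y)‖ ^ 2 = (form y y (S.T u (star f * f))).re := by
  rw [← form_evolve, form_self_star_mul, ofReal_re]

lemma norm_evolve (u : ℝ≥0) (y : τ.PreL2) : ‖S.evolve u y‖ = ‖y‖ := by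
  have h1 := S.norm_mulLeft_evolve u y 1
  have h2 := form_self_star_mul y 1
  have e : ∀ y : τ.PreL2, mulLeft 1 y = y := fun y => PreL2.ext (by simp)
  rw [star_one, mul_one] at h1 h2; rw [S.map_one, h2, e, e, ofReal_re] at h1
  exact (sq_eq_sq₀ (norm_nonneg _) (norm_nonneg _)).1 h1

lemma trace_star_T_mul_T_le (t : ℝ≥0) (y : τ.PreL2) :
    τ.toFun (star (S.T t y.val) * S.T t y.val) ≤ τ.toFun (star y.val * y.val) := by
  rw [← S.trace_T t (star_mul_self_nonneg y.val)]
  exact τ.mono (star_mul_self_nonneg _) (S.kadison_schwarz t _)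

/-- `T_t` on `N ∩ L₂`. -/
def TP (t : ℝ≥0) : τ.PreL2 →L[ℂ] τ.PreL2 :=
  LinearMap.mkContinuous
    { toFun := fun y => .mk (S.T t y.val) ((S.trace_star_T_mul_T_le t y).trans_lt y.lt_top)
      map_add' := fun x y => PreL2.ext (by simp)
      map_smul' := fun c x => PreL2.ext (by simp) } 1 fun y => by
    refine le_of_sq_le_sq ?_ (by positivity)
    rw [one_mul, PreL2.norm_sq, PreL2.norm_sq]
    exact toReal_mono y.lt_top.ne (S.trace_star_T_mul_T_le t y)

@[simp] lemma val_TP (t : ℝ≥0) (y : τ.PreL2) : (S.TP t y).val = S.T t y.val := rfl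

lemma norm_TP_le (t : ℝ≥0) (y : τ.PreL2) : ‖S.TP t y‖ ≤ ‖y‖ := by
  simpa using (S.TP t).le_of_opNorm_le (LinearMap.mkContinuous_norm_le _ zero_le_one _) y

/-- `T_t` as a bounded operator on `L₂`. -/
def T2L (t : ℝ≥0) : τ.L2 →L[ℂ] τ.L2 := (S.TP t).completion

lemma T2L_apply (t : ℝ≥0) (f : τ.L2) : S.T2L t f = S.T2 t f := by
  have e : (fun y : τ.PreL2 => if h : τ.toFun (star (S.T t y.val) * S.T t y.val) < ∞
      then PreL2.mk (S.T t y.val) h else 0) = S.TP t := by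
    ext y; rw [dif_pos ((S.trace_star_T_mul_T_le t y).trans_lt y.lt_top)]; rfl
  rw [T2L, ContinuousLinearMap.coe_completion, T2, e]

@[simp] lemma T2L_coe (t : ℝ≥0) (y : τ.PreL2) : S.T2L t (y : τ.L2) = (S.TP t y : τ.PreL2) :=
  ContinuousLinearMap.completion_apply_coe _ _

lemma norm_T2L_le (t : ℝ≥0) (f : τ.L2) : ‖S.T2L t f‖ ≤ ‖f‖ := by
  induction f using Completion.induction_on with
  | hp => exact isClosed_le (S.T2L t).continuous.norm continuous_norm
  | ih y => simpa using S.norm_TP_le t y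

lemma T2L_add (s t : ℝ≥0) (f : τ.L2) : S.T2L (s + t) f = S.T2L s (S.T2L t f) := by
  induction f using Completion.induction_on with
  | hp => exact isClosed_eq (S.T2L _).continuous ((S.T2L s).continuous.comp (S.T2L t).continuous)
  | ih y =>
    simp only [T2L_coe]; congr 1; exact PreL2.ext (by simp [S.map_add])

lemma T2L_zero (f : τ.L2) : S.T2L 0 f = f := by
  induction f using Completion.induction_on with
  | hp => exact isClosed_eq (S.T2L _).continuous continuous_id
  | ih y =>
    simp; congr 1; exact PreL2.ext (by simp [S.map_zero])

lemma tendsto_apply_T (hφ : φ ∈ N.predual) (b : N) :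
    Tendsto (fun h : ℝ≥0 => φ (S.T h b)) (𝓝 0) (𝓝 (φ b)) := by
  refine tendsto_apply_of_mem_predual (K := ‖b‖ + ‖b‖) (.of_forall fun h => ?_) (fun ξ η => ?_) hφ
  · exact (norm_sub_le _ _).trans (by gcongr; exact S.norm_T_le h b)
  · exact tendsto_const_nhds.inner (S.strong_continuity b η)

lemma tendsto_TP_zero (y : τ.PreL2) : Tendsto (fun h : ℝ≥0 => S.TP h y) (𝓝 0) (𝓝 y) := by
  have hre : Tendsto (fun h => ⟪y, S.TP h y⟫_ℂ) (𝓝 0) (𝓝 ⟪y, y⟫_ℂ) := by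
    refine Metric.tendsto_nhds.2 fun ε hε => ?_
    have h1 := (tendsto_norm_sub_mulLeft (adj y)).eventually
      (gt_mem_nhds (show 0 < ε / (3 * (‖y‖ + 1)) by positivity))
    obtain ⟨e, he, hee⟩ := (h1.and eventually_mem_finUnits).exists
    obtain ⟨h0, -, hτ⟩ := finUnits_mem hee
    have hse := (of_nonneg h0).star_eq
    have hτ2 :=
      (τ.mono (star_mul_self_nonneg _) (star_mul_self_le_self h0 (finUnits_mem hee).2.1)).trans_lt hτ
    have hd : ∀ z : τ.PreL2, ⟪y, z⟫_ℂ = form y (PreL2.mk e hτ2) z.val +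
        ⟪PreL2.mulRight (1 - e) y, z⟫_ℂ := by
      intro z
      have e1 : mulLeft z.val (PreL2.mk e hτ2) = PreL2.mulRight e z := PreL2.ext (by simp)
      have e2 : y = PreL2.mulRight e y + PreL2.mulRight (1 - e) y := PreL2.ext (by simp [mul_sub])
      rw [form_apply, e1, PreL2.inner_mulRight, hse, ← inner_add_left, ← e2]
    have hn : ‖PreL2.mulRight (1 - e) y‖ < ε / (3 * (‖y‖ + 1)) := by
      have e3 : PreL2.mulRight (1 - e) y = adj (mulLeft (1 - e) (adj y)) :=
        PreL2.ext (by simp [hse])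
      rwa [e3, norm_adj]
    have h2 := Metric.tendsto_nhds.1 (S.tendsto_apply_T (form_mem_predual y (PreL2.mk e hτ2))
      y.val) (ε / 3) (by positivity)
    filter_upwards [h2] with h hh
    rw [dist_eq_norm] at hh ⊢; rw [hd, hd y]
    have b : ∀ z : τ.PreL2, ‖z‖ ≤ ‖y‖ → ‖⟪PreL2.mulRight (1 - e) y, z⟫_ℂ‖ ≤ ε / 3 := by
      intro z hz
      refine (norm_inner_le_norm _ _).trans ((mul_le_mul hn.le hz (norm_nonneg _) (by positivity)).trans ?_)
      rw [div_mul_eq_mul_div, div_le_div_iff₀ (by positivity) (by positivity)]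
      nlinarith [norm_nonneg y]
    have b1 := b _ (S.norm_TP_le h y)
    have b2 := b y le_rfl
    set p := form y (PreL2.mk e hτ2) (S.TP h y).val
    set p' := form y (PreL2.mk e hτ2) y.val
    set q := ⟪PreL2.mulRight (1 - e) y, S.TP h y⟫_ℂ
    set q' := ⟪PreL2.mulRight (1 - e) y, y⟫_ℂ
    have hh' : ‖p - p'‖ < ε / 3 := hh
    calc ‖p + q - (p' + q')‖ = ‖(p - p') + q - q'‖ := by congr 1; ring
      _ ≤ ‖p - p'‖ + ‖q‖ + ‖q'‖ := (norm_sub_le _ _).trans (by gcongr; exact norm_add_le _ _)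
      _ < ε := by linarith
  rw [tendsto_iff_norm_sub_tendsto_zero]
  have hb : ∀ h : ℝ≥0, ‖S.TP h y - y‖ ≤ √(2 * (‖y‖ ^ 2 - (⟪y, S.TP h y⟫_ℂ).re)) := by
    intro h; refine Real.le_sqrt_of_sq_le ?_
    have h1 := norm_sub_sq (𝕜 := ℂ) (S.TP h y) y
    have h2 : RCLike.re ⟪S.TP h y, y⟫_ℂ = (⟪y, S.TP h y⟫_ℂ).re := inner_re_symm _ _
    have := pow_le_pow_left₀ (norm_nonneg _) (S.norm_TP_le h y) 2
    linarith
  refine squeeze_zero (fun _ => norm_nonneg _) hb ?_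
  have h1 : Tendsto (fun h => √(2 * (‖y‖ ^ 2 - (⟪y, S.TP h y⟫_ℂ).re))) (𝓝 0)
      (𝓝 √(2 * (‖y‖ ^ 2 - (⟪y, y⟫_ℂ).re))) :=
    ((((Complex.continuous_re.tendsto _).comp hre).const_sub _).const_mul _).sqrt
  have h2 : (⟪y, y⟫_ℂ).re = ‖y‖ ^ 2 := by
    rw [inner_self_eq_norm_sq_to_K, RCLike.ofReal_eq_complex_ofReal, ← Complex.ofReal_pow,
      ofReal_re]
  rwa [h2, sub_self, mul_zero, Real.sqrt_zero] at h1

end StandardSemigroup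

/-- The space `N ⊕ L₂`. -/
abbrev NSFTrace.X (τ : NSFTrace N) := N × τ.L2

namespace NSFTrace

/-- Right multiplication by `b ∈ N` as a bounded operator on `L₂`. -/
def L2.mulRightL (b : N) : τ.L2 →L[ℂ] τ.L2 := (PreL2.mulRightL b).completion

lemma L2.mulRightL_apply (b : N) (f : τ.L2) : L2.mulRightL b f = L2.mulRight b f := by
  rw [mulRightL, ContinuousLinearMap.coe_completion]; rfl

@[simp] lemma L2.mulRightL_coe (b : N) (y : τ.PreL2) :
    L2.mulRightL b (y : τ.L2) = (PreL2.mulRight b y : τ.PreL2) :=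
  ContinuousLinearMap.completion_apply_coe _ _

lemma L2.norm_mulRightL_le (b : N) (f : τ.L2) : ‖L2.mulRightL b f‖ ≤ ‖b‖ * ‖f‖ := by
  induction f using Completion.induction_on with
  | hp => exact isClosed_le (L2.mulRightL b).continuous.norm (continuous_norm.const_mul _)
  | ih y => simpa using PreL2.norm_mulRight_le b y

lemma L2.inner_mulRightL (b : N) (f g : τ.L2) :
    ⟪f, L2.mulRightL b g⟫_ℂ = ⟪L2.mulRightL (star b) f, g⟫_ℂ := by
  induction f, g using Completion.induction_on₂ with
  | hp => exact isClosed_eq (by fun_prop) (by fun_prop)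
  | ih x y => simpa using PreL2.inner_mulRight b x y

lemma L2.mulRightL_mul (b c : N) (f : τ.L2) :
    L2.mulRightL c (L2.mulRightL b f) = L2.mulRightL (b * c) f := by
  induction f using Completion.induction_on with
  | hp => exact isClosed_eq (by fun_prop) (by fun_prop)
  | ih y =>
    have e : PreL2.mulRight c (PreL2.mulRight b y) = PreL2.mulRight (b * c) y :=
      PreL2.ext (by simp [mul_assoc])
    simp only [L2.mulRightL_coe, e]

namespace PreL2

/-- The element `y y⋆` of `N ∩ L₂`. -/
def mulStar (y : τ.PreL2) : τ.PreL2 := mulRight (star y.val) y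

@[simp] lemma val_mulStar (y : τ.PreL2) : (mulStar y).val = y.val * star y.val := rfl

/-- The action `f ↦ f y` of `N ⊕ L₂` on `y ∈ N ∩ L₂`. -/
def act (y : τ.PreL2) : τ.X →L[ℂ] τ.L2 :=
  (Completion.toComplL ∘L mulLeftL y) ∘L ContinuousLinearMap.fst ℂ N τ.L2 +
    L2.mulRightL y.val ∘L ContinuousLinearMap.snd ℂ N τ.L2

lemma act_apply (y : τ.PreL2) (f : τ.X) :
    act y f = (mulLeft f.1 y : τ.PreL2) + L2.mulRightL y.val f.2 := rfl

lemma norm_act_le (y : τ.PreL2) (f : τ.X) : ‖act y f‖ ≤ (‖y‖ + ‖y.val‖) * ‖f‖ := by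
  rw [act_apply]; refine (norm_add_le _ _).trans ?_; rw [Completion.norm_coe]
  have h1 := norm_mulLeft_le f.1 y
  have h2 := L2.norm_mulRightL_le y.val f.2
  have h3 := norm_fst_le f
  have h4 := norm_snd_le f
  nlinarith [norm_nonneg y, norm_nonneg y.val]

lemma inner_act (y : τ.PreL2) (f g : τ.X) : ⟪act y f, act y g⟫_ℂ =
    form y y (star f.1 * g.1) + ⟪((mulLeft f.1 (mulStar y) : τ.PreL2) : τ.L2), g.2⟫_ℂ +
      ⟪f.2, ((mulLeft g.1 (mulStar y) : τ.PreL2) : τ.L2)⟫_ℂ +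
      ⟪f.2, L2.mulRightL (y.val * star y.val) g.2⟫_ℂ := by
  have e1 : ∀ b : N, mulLeft b (mulStar y) = mulRight (star y.val) (mulLeft b y) := fun b =>
    ext (by simp [mul_assoc])
  have e2 : form y y (star f.1 * g.1) = ⟪mulLeft f.1 y, mulLeft g.1 y⟫_ℂ := by
    have e : mulLeft (star f.1 * g.1) y = mulLeft (star f.1) (mulLeft g.1 y) :=
      ext (by simp [mul_assoc])
    rw [form_apply, e, inner_mulLeft, star_star]
  rw [act_apply, act_apply, inner_add_left, inner_add_right, inner_add_right, e2, e1, e1,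
    ← L2.mulRightL_coe, ← L2.mulRightL_coe, ← L2.mulRightL_mul, L2.inner_mulRightL (star y.val),
    L2.inner_mulRightL (star y.val), star_star, ← L2.inner_mulRightL,
    Completion.inner_coe]
  ring

end PreL2

end NSFTrace

namespace StandardSemigroup

variable (S : StandardSemigroup τ)

lemma mulStar_evolve (u : ℝ≥0) (y : τ.PreL2) :
    mulStar (S.evolve u y) = S.TP u (mulStar y) :=
  PreL2.ext (S.evolve_mul_star u y)

lemma tendsto_form_evolve_zero (y : τ.PreL2) : Tendsto (fun h : ℝ≥0 =>
    ‖form (S.evolve h y) (S.evolve h y) - form y y‖) (𝓝 0) (𝓝 0) := by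
  refine Metric.tendsto_nhds.2 fun ε hε => ?_
  have h1 := ((tendsto_norm_sub_mulLeft y).const_mul (4 * ‖y‖)).eventually
    (gt_mem_nhds (show 4 * ‖y‖ * 0 < ε by simpa using hε))
  obtain ⟨e, he, hee⟩ := (h1.and eventually_mem_finUnits).exists
  obtain ⟨h0, he1, hτ⟩ := finUnits_mem hee
  set ê := PreL2.mk e ((τ.mono (star_mul_self_nonneg _) (star_mul_self_le_self h0 he1)).trans_lt hτ)
  have hcut : ∀ (y : τ.PreL2) (b : N), form y y b =
      ⟪mulLeft (1 - e) y, mulLeft b y⟫_ℂ +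
      ⟪mulLeft e y, mulLeft b (mulLeft (1 - e) y)⟫_ℂ +
      ⟪ê, mulLeft b (mulLeft e (mulStar y))⟫_ℂ := by
    intro y b
    have e1 : mulLeft b (mulLeft e (mulStar y)) =
        PreL2.mulRight (star y.val) (mulLeft b (mulLeft e y)) :=
      PreL2.ext (by simp [mul_assoc])
    have e2 : PreL2.mulRight y.val ê = mulLeft e y := PreL2.ext (by simp [ê])
    have e3 : y = mulLeft e y + mulLeft (1 - e) y := PreL2.ext (by simp [sub_mul])
    rw [e1, PreL2.inner_mulRight, star_star, e2, add_assoc, ← inner_add_right,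
      ← mulLeft_add_right, add_comm (mulLeft (1 - e) y), ← e3, ← inner_add_left,
      add_comm (mulLeft (1 - e) y), ← e3, form_apply]
  have hne : ∀ y : τ.PreL2, ‖mulLeft e y‖ ≤ ‖y‖ := fun y => by
    exact (norm_mulLeft_le _ _).trans (mul_le_of_le_one_left (norm_nonneg _) ((CStarAlgebra.norm_le_one_iff_of_nonneg e h0).2 he1))
  set R : ℝ≥0 → ℝ := fun h => 2 * ‖y‖ * ‖mulLeft (1 - e) (S.evolve h y)‖ +
    2 * ‖y‖ * ‖mulLeft (1 - e) y‖ + ‖ê‖ * ‖S.TP h (mulStar y) - mulStar y‖ with hR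
  have htri : ∀ p p' p'' q q' q'' : ℂ, ‖p + p' + p'' - (q + q' + q'')‖ ≤
      ‖p‖ + ‖p'‖ + (‖q‖ + ‖q'‖) + ‖p'' - q''‖ := fun p p' p'' q q' q'' => by
    rw [add_sub_add_comm]
    linarith [norm_add_le (p + p' - (q + q')) (p'' - q''), norm_sub_le (p + p') (q + q'), norm_add_le p p', norm_add_le q q']
  have hle : ∀ h : ℝ≥0, ‖form (S.evolve h y) (S.evolve h y) - form y y‖ ≤ R h := by
    intro h; refine opNorm_le_bound _ (by positivity) fun b => ?_
    have hb : ∀ y : τ.PreL2, ‖⟪mulLeft (1 - e) y, mulLeft b y⟫_ℂ‖ +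
        ‖⟪mulLeft e y, mulLeft b (mulLeft (1 - e) y)⟫_ℂ‖ ≤
        2 * ‖y‖ * ‖mulLeft (1 - e) y‖ * ‖b‖ := by
      intro y
      have a1 := (norm_inner_le_norm (𝕜 := ℂ) (mulLeft (1 - e) y) (mulLeft b y)).trans
        (mul_le_mul_of_nonneg_left (norm_mulLeft_le b y) (norm_nonneg _))
      have a2 := (norm_inner_le_norm (𝕜 := ℂ) (mulLeft e y)
        (mulLeft b (mulLeft (1 - e) y))).trans
        (mul_le_mul (hne y) (norm_mulLeft_le b _) (norm_nonneg _) (norm_nonneg _))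
      linarith
    have hb1 := hb (S.evolve h y)
    have hb2 := hb y
    rw [S.norm_evolve] at hb1
    have hb3 : ‖⟪ê, mulLeft b (mulLeft e (S.TP h (mulStar y) - mulStar y))⟫_ℂ‖ ≤
        ‖ê‖ * ‖S.TP h (mulStar y) - mulStar y‖ * ‖b‖ := by
      refine (norm_inner_le_norm _ _).trans ?_; rw [mul_assoc]
      refine mul_le_mul_of_nonneg_left ((norm_mulLeft_le _ _).trans ?_) (norm_nonneg _)
      rw [mul_comm]; exact mul_le_mul_of_nonneg_right (hne _) (norm_nonneg _)
    rw [sub_apply, hcut (S.evolve h y), hcut y, mulStar_evolve]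
    have e4 : ⟪ê, mulLeft b (mulLeft e (S.TP h (mulStar y) - mulStar y))⟫_ℂ =
        ⟪ê, mulLeft b (mulLeft e (S.TP h (mulStar y)))⟫_ℂ -
        ⟪ê, mulLeft b (mulLeft e (mulStar y))⟫_ℂ := by
      rw [← inner_sub_right]; congr 1; exact PreL2.ext (by simp [mul_sub])
    rw [e4] at hb3; exact (htri ..).trans (by rw [hR]; linarith)
  have hlim : Tendsto R (𝓝 0) (𝓝 (2 * ‖y‖ * ‖mulLeft (1 - e) y‖ +
      2 * ‖y‖ * ‖mulLeft (1 - e) y‖ + ‖ê‖ * 0)) := by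
    refine ((Tendsto.const_mul _ ?_).add tendsto_const_nhds).add (Tendsto.const_mul _ ?_)
    · have h2 : ∀ h : ℝ≥0, ‖mulLeft (1 - e) (S.evolve h y)‖ =
          √(form y y (S.T h (star (1 - e) * (1 - e)))).re := fun h => by
        rw [← S.norm_mulLeft_evolve, Real.sqrt_sq (norm_nonneg _)]
      have h3 : ‖mulLeft (1 - e) y‖ = √(form y y (star (1 - e) * (1 - e))).re := by
        rw [form_self_star_mul, ofReal_re, Real.sqrt_sq (norm_nonneg _)]
      simp only [h2]; rw [h3]
      exact ((Complex.continuous_re.tendsto _).comp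
        (S.tendsto_apply_T (form_self_mem_predual y) _)).sqrt
    · exact tendsto_iff_norm_sub_tendsto_zero.1 (S.tendsto_TP_zero _)
  have hlt : 2 * ‖y‖ * ‖mulLeft (1 - e) y‖ +
      2 * ‖y‖ * ‖mulLeft (1 - e) y‖ + ‖ê‖ * 0 < ε := by linarith
  filter_upwards [hlim.eventually (gt_mem_nhds hlt)] with h hh
  rw [dist_zero_right, norm_norm]; exact (hle h).trans_lt hh

lemma norm_form_evolve_sub_le (y : τ.PreL2) (u h : ℝ≥0) :
    ‖form (S.evolve (u + h) y) (S.evolve (u + h) y) - form (S.evolve u y) (S.evolve u y)‖ ≤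
      ‖form (S.evolve h y) (S.evolve h y) - form y y‖ := by
  refine opNorm_le_bound _ (norm_nonneg _) fun b => ?_
  have e : (form (S.evolve (u + h) y) (S.evolve (u + h) y) -
      form (S.evolve u y) (S.evolve u y)) b =
      (form (S.evolve h y) (S.evolve h y) - form y y) (S.T u b) := by
    rw [sub_apply, sub_apply, form_evolve, form_evolve, form_evolve, add_comm, S.map_add]
  rw [e]; exact (le_opNorm _ _).trans (mul_le_mul_of_nonneg_left (S.norm_T_le u b) (norm_nonneg _))

lemma continuous_of_forall_add {E : Type*} [SeminormedAddCommGroup E] {F : ℝ≥0 → E}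
    (ρ : ℝ≥0 → ℝ) (hρ : Tendsto ρ (𝓝 0) (𝓝 0)) (h : ∀ u r, ‖F (u + r) - F u‖ ≤ ρ r) :
    Continuous F := by
  refine Metric.continuous_iff.2 fun u ε hε => ?_
  obtain ⟨δ, hδ, h1⟩ := Metric.eventually_nhds_iff.1 (hρ.eventually (gt_mem_nhds hε))
  refine ⟨δ, hδ, fun v hv => ?_⟩
  rcases le_total u v with huv | huv
  · obtain ⟨r, rfl⟩ := exists_add_of_le huv
    rw [dist_eq_norm]; exact (h u r).trans_lt (h1 (by simpa [NNReal.dist_eq] using hv))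
  · obtain ⟨r, rfl⟩ := exists_add_of_le huv
    rw [dist_comm, dist_eq_norm]; exact (h v r).trans_lt (h1 (by simpa [NNReal.dist_eq] using hv))

lemma continuous_form_evolve (y : τ.PreL2) :
    Continuous fun u => form (S.evolve u y) (S.evolve u y) :=
  continuous_of_forall_add _ (S.tendsto_form_evolve_zero y) fun u h => S.norm_form_evolve_sub_le y u h

lemma continuous_TP (y : τ.PreL2) : Continuous fun u => S.TP u y := by
  refine continuous_of_forall_add (fun h => ‖S.TP h y - y‖)
    (tendsto_iff_norm_sub_tendsto_zero.1 (S.tendsto_TP_zero y)) fun u h => ?_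
  have e : S.TP (u + h) y = S.TP u (S.TP h y) := PreL2.ext (by simp [S.map_add])
  rw [e, ← map_sub]; exact S.norm_TP_le _ _

lemma continuous_T2L (f : τ.L2) : Continuous fun u => S.T2L u f := by
  refine continuous_iff_continuousAt.2 fun u => ?_; refine Metric.continuousAt_iff'.2 fun ε hε => ?_
  obtain ⟨y, hy⟩ := Completion.denseRange_coe.exists_dist_lt f (show 0 < ε / 3 by positivity)
  have hd : ∀ v, dist (S.T2L v f) (S.TP v y : τ.PreL2) < ε / 3 := fun v => by
    rw [← T2L_coe, dist_eq_norm, ← map_sub]; rw [dist_eq_norm] at hy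
    exact (S.norm_T2L_le _ _).trans_lt hy
  have h1 := Metric.continuousAt_iff'.1 ((S.continuous_TP y).continuousAt (x := u)) (ε / 3) (by positivity)
  filter_upwards [h1] with v hv
  have h2 : dist ((S.TP v y : τ.PreL2) : τ.L2) (S.TP u y : τ.PreL2) < ε / 3 := by
    rwa [Completion.dist_eq]
  have h3 := hd u
  rw [dist_comm] at h3
  have h4 := dist_triangle4 (S.T2L v f) (S.TP v y : τ.PreL2) (S.TP u y : τ.PreL2) (S.T2L u f)
  linarith [hd v]

/-- `T_v` on `N ⊕ L₂`. -/
def TX (v : ℝ≥0) : τ.X →L[ℂ] τ.X := (S.TL v).prodMap (S.T2L v)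

@[simp] lemma TX_fst (v : ℝ≥0) (f : τ.X) : (S.TX v f).1 = S.T v f.1 := rfl
@[simp] lemma TX_snd (v : ℝ≥0) (f : τ.X) : (S.TX v f).2 = S.T2L v f.2 := rfl

lemma norm_TX_le (v : ℝ≥0) (f : τ.X) : ‖S.TX v f‖ ≤ ‖f‖ := by
  have h1 := S.norm_T_le v f.1
  have h2 := S.norm_T2L_le v f.2
  exact max_le_max h1 h2

lemma TX_add (s t : ℝ≥0) (f : τ.X) : S.TX (s + t) f = S.TX s (S.TX t f) :=
  Prod.ext (S.map_add s t f.1) (S.T2L_add s t f.2)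

/-- The vectors `T_v(f) y_u`, with `y_u y_u⋆ = T_u(y y⋆)`. -/
def frame (y : τ.PreL2) (u v : ℝ≥0) : τ.X →L[ℂ] τ.L2 :=
  act (S.evolve u y) ∘L S.TX v

lemma frame_apply (y : τ.PreL2) (u v : ℝ≥0) (f : τ.X) :
    S.frame y u v f = act (S.evolve u y) (S.TX v f) := rfl

lemma frame_TX (y : τ.PreL2) (u v w : ℝ≥0) (f : τ.X) :
    S.frame y u v (S.TX w f) = S.frame y u (v + w) f := by
  rw [frame_apply, frame_apply, TX_add]

lemma frame_evolve (y : τ.PreL2) (r u v : ℝ≥0) (f : τ.X) :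
    S.frame (S.evolve r y) u v f = S.frame y (u + r) v f := by
  rw [frame_apply, frame_apply, evolve_evolve]

lemma norm_frame_le (y : τ.PreL2) (u v : ℝ≥0) (f : τ.X) :
    ‖S.frame y u v f‖ ≤ (‖y‖ + ‖y.val‖) * ‖f‖ := by
  have h0 := norm_act_le (S.evolve u y) (S.TX v f)
  rw [norm_evolve] at h0
  have h1 := S.norm_val_evolve_le u y
  have h2 := S.norm_TX_le v f
  exact h0.trans (by gcongr)

end StandardSemigroup

lemma measurable_of_tendsto_add {F : ℝ≥0 → ℂ}
    (h : ∀ u, Tendsto (fun r => F (u + r)) (𝓝 0) (𝓝 (F u))) : Measurable F := by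
  have hle : ∀ (n : ℕ) (u : ℝ≥0), u ≤ (⌊(n + 1) * u⌋₊ + 1) / (n + 1) ∧
      (⌊(n + 1) * u⌋₊ + 1) / (n + 1) - u ≤ 1 / ((n : ℝ≥0) + 1) := by
    intro n u
    have hn : (0 : ℝ≥0) < n + 1 := by positivity
    constructor
    · rw [le_div_iff₀ hn, mul_comm]; exact (Nat.lt_floor_add_one _).le
    · have e : (u + 1 / ((n : ℝ≥0) + 1)) * (n + 1) = (n + 1) * u + 1 := by field_simp
      rw [tsub_le_iff_left, div_le_iff₀ hn, e]; gcongr; exact Nat.floor_le (by positivity)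
  have hm : ∀ n : ℕ, Measurable fun u => F ((⌊((n : ℝ≥0) + 1) * u⌋₊ + 1) / (n + 1)) := by
    intro n
    have h1 : Measurable fun k : ℕ => F (((k : ℝ≥0) + 1) / (n + 1)) := measurable_from_top
    exact h1.comp (Nat.measurable_floor.comp (measurable_const_mul _))
  refine measurable_of_tendsto_metrizable hm ?_
  · rw [tendsto_pi_nhds]; intro u
    refine ((h u).comp (tendsto_of_tendsto_of_tendsto_of_le_of_le tendsto_const_nhds (tendsto_one_div_add_atTop_nhds_zero_nat (𝕜 := ℝ≥0)) (fun n => zero_le) (fun n => (hle n u).2))).congr fun n => ?_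
    simp; rw [add_tsub_cancel_of_le (hle n u).1]

namespace StandardSemigroup

variable (S : StandardSemigroup τ)

lemma act_coe (y : τ.PreL2) (f : N) (z : τ.PreL2) :
    act y (f, (z : τ.L2)) = (mulLeft (f + z.val) y : τ.PreL2) := by
  have e : mulLeft (f + z.val) y = mulLeft f y + PreL2.mulRight y.val z :=
    PreL2.ext (by simp [add_mul])
  rw [act_apply, L2.mulRightL_coe, e, Completion.coe_add]

lemma norm_act_TX_le (y : τ.PreL2) (w : ℝ≥0) (f : τ.X) :
    ‖act y (S.TX w f)‖ ≤ ‖act (S.evolve w y) f‖ := by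
  obtain ⟨f, g⟩ := f
  induction g using Completion.induction_on with
  | hp =>
    refine isClosed_le ?_ ?_
    · exact ((act y ∘L S.TX w).continuous.comp (by fun_prop)).norm
    · exact ((act (S.evolve w y)).continuous.comp (by fun_prop)).norm
  | ih z =>
    have e : S.TX w (f, (z : τ.L2)) = (S.T w f, ((S.TP w z : τ.PreL2) : τ.L2)) :=
      Prod.ext rfl (S.T2L_coe w z)
    rw [e, act_coe, act_coe, Completion.norm_coe, Completion.norm_coe, val_TP, ← _root_.map_add]
    refine le_of_sq_le_sq ?_ (norm_nonneg _)
    have h := re_form_self_mono y (S.kadison_schwarz w (f + z.val))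
    rw [norm_mulLeft_evolve]; rwa [form_self_star_mul, ofReal_re] at h

lemma norm_frame_add_le (y : τ.PreL2) (u w v : ℝ≥0) (f : τ.X) :
    ‖S.frame y u (w + v) f‖ ≤ ‖S.frame y (u + w) v f‖ := by
  have h := S.norm_act_TX_le (S.evolve u y) w (S.TX v f)
  rwa [evolve_evolve, ← TX_add, add_comm w u] at h

lemma continuous_mulRightL_TP (y : τ.PreL2) (f g : τ.L2) :
    Continuous fun u => ⟪f, L2.mulRightL (S.T u y.val) g⟫_ℂ := by
  refine continuous_iff_continuousAt.2 fun u => Metric.continuousAt_iff'.2 fun ε hε => ?_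
  set K := ‖f‖ * ‖y.val‖ + 1
  have hK : 0 < K := by positivity
  obtain ⟨z, hz⟩ := Completion.denseRange_coe.exists_dist_lt g (show 0 < ε / 3 / K by positivity)
  have hd : ∀ v, ‖⟪f, L2.mulRightL (S.T v y.val) g⟫_ℂ - ⟪f, L2.mulRightL (S.T v y.val) (z : τ.L2)⟫_ℂ‖
      < ε / 3 := fun v => by
    rw [← inner_sub_right, ← map_sub]; rw [dist_eq_norm] at hz
    calc _ ≤ ‖f‖ * (‖S.T v y.val‖ * ‖g - z‖) := (norm_inner_le_norm _ _).trans
          (mul_le_mul_of_nonneg_left (L2.norm_mulRightL_le _ _) (norm_nonneg _))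
      _ ≤ ‖f‖ * (‖y.val‖ * ‖g - z‖) := by gcongr; exact S.norm_T_le _ _
      _ ≤ K * ‖g - z‖ := by rw [← mul_assoc]; gcongr; simp [K]
      _ < K * (ε / 3 / K) := by gcongr
      _ = ε / 3 := by field_simp
  have hc : Continuous fun u => ⟪f, L2.mulRightL (S.T u y.val) (z : τ.L2)⟫_ℂ := by
    have e : ∀ u, L2.mulRightL (S.T u y.val) (z : τ.L2) =
        Completion.toComplL (𝕜 := ℂ) (mulLeft z.val (S.TP u y)) := fun u => by
      rw [L2.mulRightL_coe, Completion.coe_toComplL]; congr 1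
    simp only [e]
    have h1 : Continuous fun u => mulLeft z.val (S.TP u y) := by
      refine continuous_iff_continuousAt.2 fun u => ?_
      rw [ContinuousAt, tendsto_iff_norm_sub_tendsto_zero]
      have h2 := (tendsto_iff_norm_sub_tendsto_zero.1 ((S.continuous_TP y).tendsto u)).const_mul ‖z.val‖
      rw [mul_zero] at h2; refine squeeze_zero (fun _ => norm_nonneg _) (fun v => ?_) h2
      have e2 : mulLeft z.val (S.TP v y) - mulLeft z.val (S.TP u y) =
          mulLeft z.val (S.TP v y - S.TP u y) := PreL2.ext (by simp [mul_sub])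
      rw [e2]; exact norm_mulLeft_le _ _
    exact continuous_const.inner ((Completion.toComplL).continuous.comp h1)
  filter_upwards [Metric.continuousAt_iff'.1 (hc.continuousAt) (ε / 3) (by positivity)] with v hv
  have h1 := hd v
  have h2 := hd u
  rw [dist_eq_norm] at hv ⊢; rw [norm_sub_rev] at h2
  set p := ⟪f, L2.mulRightL (S.T v y.val) g⟫_ℂ
  set q := ⟪f, L2.mulRightL (S.T u y.val) g⟫_ℂ
  set p' := ⟪f, L2.mulRightL (S.T v y.val) (z : τ.L2)⟫_ℂ
  set q' := ⟪f, L2.mulRightL (S.T u y.val) (z : τ.L2)⟫_ℂ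
  have : p - q = (p - p') + (p' - q') + (q' - q) := by ring
  rw [this]; linarith [norm_add_le ((p - p') + (p' - q')) (q' - q), norm_add_le (p - p') (p' - q')]

lemma continuous_inner_frame (y : τ.PreL2) (v w : ℝ≥0) (f g : τ.X) :
    Continuous fun u => ⟪S.frame y u v f, S.frame y u w g⟫_ℂ := by
  simp only [frame_apply, inner_act, mulStar_evolve, evolve_mul_star]
  have h1 : ∀ b : N, Continuous fun u => ((mulLeft b (S.TP u (mulStar y)) : τ.PreL2) : τ.L2) := by
    intro b; refine continuous_iff_continuousAt.2 fun u => ?_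
    rw [ContinuousAt, tendsto_iff_norm_sub_tendsto_zero]
    have h2 := (tendsto_iff_norm_sub_tendsto_zero.1
      ((S.continuous_TP (mulStar y)).tendsto u)).const_mul ‖b‖
    rw [mul_zero] at h2; refine squeeze_zero (fun _ => norm_nonneg _) (fun v => ?_) h2
    have e2 : mulLeft b (S.TP v (mulStar y)) - mulLeft b (S.TP u (mulStar y)) =
        mulLeft b (S.TP v (mulStar y) - S.TP u (mulStar y)) :=
      PreL2.ext (by simp [mul_sub])
    rw [← Completion.coe_sub, Completion.norm_coe, e2]; exact norm_mulLeft_le _ _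
  refine ((Continuous.add ?_ ?_).add ?_).add ?_
  · exact (S.continuous_form_evolve y).clm_apply continuous_const
  · exact (h1 _).inner continuous_const
  · exact continuous_const.inner (h1 _)
  · exact S.continuous_mulRightL_TP (mulStar y) _ _

lemma tendsto_mulLeft_T_sub (y : τ.PreL2) (f : N) :
    Tendsto (fun h => ‖mulLeft (S.T h f - f) y‖) (𝓝 0) (𝓝 0) := by
  have hle : ∀ h, ‖mulLeft (S.T h f - f) y‖ ≤ √((form y y (S.T h (star f * f))).re +
      (form y y (star f * f)).re - 2 * (form (mulLeft f y) y (S.T h f)).re) := by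
    intro h; refine Real.le_sqrt_of_sq_le ?_
    have e : mulLeft (S.T h f - f) y = mulLeft (S.T h f) y - mulLeft f y :=
      PreL2.ext (by simp [sub_mul])
    have h1 := norm_sub_sq (𝕜 := ℂ) (mulLeft (S.T h f) y) (mulLeft f y)
    rw [inner_re_symm] at h1
    have h2 := re_form_self_mono y (S.kadison_schwarz h f)
    rw [form_self_star_mul, ofReal_re] at h2; rw [e, h1, form_self_star_mul, ofReal_re]
    simp at h2 ⊢; linarith
  refine squeeze_zero (fun _ => norm_nonneg _) hle ?_
  have h1 := ((((Complex.continuous_re.tendsto _).comp (S.tendsto_apply_T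
    (form_self_mem_predual y) (star f * f))).add_const
    (form y y (star f * f)).re).sub (((Complex.continuous_re.tendsto _).comp
    (S.tendsto_apply_T (form_mem_predual (mulLeft f y) y) f)).const_mul 2)).sqrt
  have e2 : form (mulLeft f y) y f = form y y (star f * f) := by
    have e : mulLeft (star f * f) y = mulLeft (star f) (mulLeft f y) :=
      PreL2.ext (by simp [mul_assoc])
    rw [form_apply, form_apply, e, inner_mulLeft (star f) y, star_star]
  have e3 : ∀ x : ℝ, √(x + x - 2 * x) = 0 := fun x => by
    rw [show x + x - 2 * x = 0 by ring, Real.sqrt_zero]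
  rw [e2, e3] at h1; exact h1

lemma continuous_mulLeft_T (y : τ.PreL2) (f : N) :
    Continuous fun v => mulLeft (S.T v f) y := by
  refine continuous_iff_continuousAt.2 fun v => ?_
  rw [ContinuousAt, tendsto_iff_norm_sub_tendsto_zero]
  set d : ℝ≥0 → ℝ≥0 := fun w => (w - v) + (v - w) with hd
  have hd0 : Tendsto d (𝓝 v) (𝓝 0) := by
    have : Continuous d := (continuous_id.sub continuous_const).add (continuous_const.sub continuous_id)
    simpa [hd] using this.tendsto v
  have hle : ∀ w, ‖mulLeft (S.T w f) y - mulLeft (S.T v f) y‖ ≤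
      √(‖mulLeft (S.T (d w) f - f) (S.evolve v y)‖ ^ 2 +
        ‖form (S.evolve w y) (S.evolve w y) - form (S.evolve v y) (S.evolve v y)‖ *
          (2 * ‖f‖) ^ 2) := by
    intro w; refine Real.le_sqrt_of_sq_le ?_
    have hKS : ∀ (x : ℝ≥0) (g : N), ‖mulLeft (S.T x g) y‖ ≤ ‖mulLeft g (S.evolve x y)‖ := by
      intro x g
      have h := S.norm_act_TX_le y x (g, ((0 : τ.PreL2) : τ.L2))
      have e : S.TX x (g, ((0 : τ.PreL2) : τ.L2)) = (S.T x g, ((0 : τ.PreL2) : τ.L2)) :=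
        Prod.ext rfl (by rw [TX_snd, Completion.coe_zero, _root_.map_zero])
      rw [e, act_coe, act_coe, Completion.norm_coe, Completion.norm_coe] at h; simpa using h
    rcases le_total v w with hvw | hvw
    · obtain ⟨h, rfl⟩ := exists_add_of_le hvw
      have hdh : d (v + h) = h := by simp [hd, tsub_eq_zero_of_le hvw]
      have e : mulLeft (S.T (v + h) f) y - mulLeft (S.T v f) y =
          mulLeft (S.T v (S.T h f - f)) y := PreL2.ext (by simp [S.map_add, sub_mul])
      rw [e, hdh]
      have := pow_le_pow_left₀ (norm_nonneg _) (hKS v (S.T h f - f)) 2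
      have h2 : 0 ≤ ‖form (S.evolve (v + h) y) (S.evolve (v + h) y) -
        form (S.evolve v y) (S.evolve v y)‖ * (2 * ‖f‖) ^ 2 := by positivity
      linarith
    · obtain ⟨h, rfl⟩ := exists_add_of_le hvw
      have hdh : d w = h := by simp [hd, tsub_eq_zero_of_le hvw]
      have e : mulLeft (S.T w f) y - mulLeft (S.T (w + h) f) y =
          -mulLeft (S.T w (S.T h f - f)) y := PreL2.ext (by simp [S.map_add, sub_mul])
      rw [e, hdh, norm_neg]
      have h1 := pow_le_pow_left₀ (norm_nonneg _) (hKS w (S.T h f - f)) 2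
      refine h1.trans ?_
      set g := S.T h f - f
      have hg : ‖g‖ ≤ 2 * ‖f‖ := by
        have := norm_sub_le (S.T h f) f
        have := S.norm_T_le h f
        linarith
      have h3 : ‖mulLeft g (S.evolve w y)‖ ^ 2 = ‖mulLeft g (S.evolve (w + h) y)‖ ^ 2 +
          ((form (S.evolve w y) (S.evolve w y) -
            form (S.evolve (w + h) y) (S.evolve (w + h) y)) (star g * g)).re := by
        rw [sub_apply, form_self_star_mul, form_self_star_mul, ← Complex.ofReal_sub, ofReal_re]
        ring
      rw [h3]; gcongr; refine (Complex.re_le_norm _).trans ((le_opNorm _ _).trans ?_)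
      rw [CStarRing.norm_star_mul_self, ← sq]; gcongr
  refine squeeze_zero (fun _ => norm_nonneg _) hle ?_
  have h1 := ((((S.tendsto_mulLeft_T_sub (S.evolve v y) f).comp hd0).pow 2).add
    ((tendsto_iff_norm_sub_tendsto_zero.1 ((S.continuous_form_evolve y).tendsto v)).mul_const
      ((2 * ‖f‖) ^ 2))).sqrt
  simpa using h1

lemma continuous_frame (y : τ.PreL2) (u : ℝ≥0) (f : τ.X) :
    Continuous fun v => S.frame y u v f := by
  have e : (fun v => S.frame y u v f) = fun v =>
      Completion.toComplL (𝕜 := ℂ) (mulLeft (S.T v f.1) (S.evolve u y)) +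
      L2.mulRightL (S.evolve u y).val (S.T2L v f.2) := rfl
  rw [e]
  exact (Completion.toComplL.continuous.comp (S.continuous_mulLeft_T _ _)).add
    ((L2.mulRightL _).continuous.comp (S.continuous_T2L _))

lemma measurable_inner_T (f : N) (ξ η : H) :
    Measurable fun u : ℝ => ⟪ξ, (S.T u.toNNReal f : H →L[ℂ] H) η⟫_ℂ := by
  have h : Measurable fun u => ⟪ξ, (S.T u f : H →L[ℂ] H) η⟫_ℂ := by
    refine measurable_of_tendsto_add fun u => ?_; simp only [add_comm u, S.map_add]
    exact (innerSL ℂ ξ).continuous.tendsto _ |>.comp (S.strong_continuity (S.T u f) η)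
  exact h.comp measurable_real_toNNReal

lemma norm_inner_T_le (f : N) (ξ η : H) (u : ℝ) :
    ‖⟪ξ, (S.T u.toNNReal f : H →L[ℂ] H) η⟫_ℂ‖ ≤ ‖f‖ * ‖ξ‖ * ‖η‖ := by
  have h1 := norm_inner_le_norm (𝕜 := ℂ) ξ ((S.T u.toNNReal f : H →L[ℂ] H) η)
  have h2 := (S.T u.toNNReal f : H →L[ℂ] H).le_opNorm η
  have h3 : ‖(S.T u.toNNReal f : H →L[ℂ] H)‖ ≤ ‖f‖ := S.norm_T_le u.toNNReal f
  calc _ ≤ ‖ξ‖ * (‖f‖ * ‖η‖) := h1.trans (by gcongr; exact h2.trans (by gcongr))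
    _ = _ := by ring

lemma exists_wInt (hψ : IntegrableOn ψ (Ioi 0)) (f : N) :
    ∃ g : N, (∀ ξ η : H, ⟪ξ, (g : H →L[ℂ] H) η⟫_ℂ =
      ∫ u in Ioi (0 : ℝ), (ψ u : ℂ) * ⟪ξ, (S.T u.toNNReal f : H →L[ℂ] H) η⟫_ℂ) ∧
      ‖g‖ ≤ ‖f‖ * ∫ u in Ioi 0, |ψ u| := by
  have hint := fun ξ η => by
    have := integrableOn_smul_bdd hψ
      (S.measurable_inner_T f ξ η).aestronglyMeasurable (S.norm_inner_T_le f ξ η)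
    simpa only [real_smul] using this
  refine N.exists_of_form (fun ξ η => ∫ u in Ioi 0, (ψ u : ℂ) *
    ⟪ξ, (S.T u.toNNReal f : H →L[ℂ] H) η⟫_ℂ) ?_ ?_ ?_ ?_ ?_ ?_ ?_
  · intro ξ ξ' η; rw [← integral_add (hint _ _) (hint _ _)]; simp only [inner_add_left, mul_add]
  · intro c ξ η; rw [← integral_const_mul]; simp only [inner_smul_left, mul_left_comm]
  · intro ξ η η'; rw [← integral_add (hint _ _) (hint _ _)]
    simp only [_root_.map_add, inner_add_right, mul_add]
  · intro c ξ η; rw [← integral_const_mul]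
    simp only [_root_.map_smul, inner_smul_right, mul_left_comm]
  · exact mul_nonneg (norm_nonneg _) (integral_nonneg fun _ => abs_nonneg _)
  · intro ξ η
    have h := norm_integral_le_of_norm_le (hψ.abs.const_mul (‖f‖ * ‖ξ‖ * ‖η‖))
      (f := fun u => (ψ u : ℂ) * ⟪ξ, (S.T u.toNNReal f : H →L[ℂ] H) η⟫_ℂ)
      (.of_forall fun u => by
        rw [norm_mul, norm_real, norm_eq_abs, mul_comm]
        exact mul_le_mul_of_nonneg_right (S.norm_inner_T_le f ξ η u) (abs_nonneg _))
    rw [integral_const_mul] at h; linarith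
  · intro y hy ξ η; congr 1; ext u
    have e : (S.T u.toNNReal f : H →L[ℂ] H) (y η) = y ((S.T u.toNNReal f : H →L[ℂ] H) η) := by
      have := (VonNeumannAlgebra.mem_commutant_iff.1 hy) (S.T u.toNNReal f : H →L[ℂ] H)
        (S.T u.toNNReal f).2
      exact DFunLike.congr_fun this η
    rw [e, ContinuousLinearMap.star_eq_adjoint, adjoint_inner_left]

open scoped Classical in
/-- The weak integral `∫₀^∞ ψ(u) T_u f du` in `N`. -/
def wInt (ψ : ℝ → ℝ) (f : N) : N :=
  if h : ∃ g : N, ∀ ξ η : H, ⟪ξ, (g : H →L[ℂ] H) η⟫_ℂ =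
      ∫ u in Ioi (0 : ℝ), (ψ u : ℂ) * ⟪ξ, (S.T u.toNNReal f : H →L[ℂ] H) η⟫_ℂ
  then h.choose else 0

lemma inner_wInt (hψ : IntegrableOn ψ (Ioi 0)) (f : N) (ξ η : H) :
    ⟪ξ, (S.wInt ψ f : H →L[ℂ] H) η⟫_ℂ =
      ∫ u in Ioi (0 : ℝ), (ψ u : ℂ) * ⟪ξ, (S.T u.toNNReal f : H →L[ℂ] H) η⟫_ℂ := by
  obtain ⟨g, hg, -⟩ := S.exists_wInt hψ f
  have h : ∃ g : N, ∀ ξ η : H, ⟪ξ, (g : H →L[ℂ] H) η⟫_ℂ =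
      ∫ u in Ioi 0, (ψ u : ℂ) * ⟪ξ, (S.T u.toNNReal f : H →L[ℂ] H) η⟫_ℂ := ⟨g, hg⟩
  rw [wInt, dif_pos h]; exact h.choose_spec ξ η

lemma norm_wInt_le (hψ : IntegrableOn ψ (Ioi 0)) (f : N) :
    ‖S.wInt ψ f‖ ≤ ‖f‖ * ∫ u in Ioi 0, |ψ u| := by
  obtain ⟨g, hg, hn⟩ := S.exists_wInt hψ f
  have e : S.wInt ψ f = g := VonNeumannAlgebra.ext_inner_left fun ξ η => by
    rw [S.inner_wInt hψ, hg]
  rwa [e]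

lemma measurable_apply_T (hφ : φ ∈ N.predual) (f : N) :
    Measurable fun u : ℝ => φ (S.T u.toNNReal f) := by
  have h : Measurable fun u => φ (S.T u f) := by
    refine measurable_of_tendsto_add fun u => ?_; simp only [add_comm u, S.map_add]
    exact S.tendsto_apply_T hφ (S.T u f)
  exact h.comp measurable_real_toNNReal

lemma norm_apply_T_le (φ : StrongDual ℂ N) (f : N) (u : ℝ≥0) : ‖φ (S.T u f)‖ ≤ ‖φ‖ * ‖f‖ :=
  (φ.le_opNorm _).trans (mul_le_mul_of_nonneg_left (S.norm_T_le _ _) (norm_nonneg _))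

lemma integrableOn_apply_T (hψ : IntegrableOn ψ (Ioi 0))
    (hφ : φ ∈ N.predual) (f : N) :
    IntegrableOn (fun u : ℝ => ψ u • φ (S.T u.toNNReal f)) (Ioi 0) :=
  integrableOn_smul_bdd hψ (S.measurable_apply_T hφ f).aestronglyMeasurable
    fun _ => S.norm_apply_T_le φ f _

lemma apply_wInt (hψ : IntegrableOn ψ (Ioi 0))
    (hφ : φ ∈ N.predual) (f : N) :
    φ (S.wInt ψ f) = ∫ u in Ioi (0 : ℝ), ψ u • φ (S.T u.toNNReal f) := by
  have key : φ ∈ N.predual ∧ φ (S.wInt ψ f) = ∫ u in Ioi 0, ψ u • φ (S.T u.toNNReal f) := by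
    refine predual_induction (p := fun φ => φ ∈ N.predual ∧
      φ (S.wInt ψ f) = ∫ u in Ioi 0, ψ u • φ (S.T u.toNNReal f)) ?_ ?_ ?_ ?_ hφ
    · exact fun ξ η => ⟨VonNeumannAlgebra.vecFun_mem_predual _ _,
        (S.inner_wInt hψ f ξ η).trans (by simp only [real_smul]; rfl)⟩
    · rintro φ χ ⟨hφ, h1⟩ ⟨hχ, h2⟩; refine ⟨add_mem hφ hχ, ?_⟩; simp only [add_apply, smul_add]
      rw [integral_add (S.integrableOn_apply_T hψ hφ f) (S.integrableOn_apply_T hψ hχ f), h1, h2]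
    · rintro c φ ⟨hφ, h1⟩; refine ⟨N.predual.smul_mem c hφ, ?_⟩
      simp only [smul_apply, smul_comm _ c]; rw [integral_smul, h1]
    · intro φ h
      have hφ : φ ∈ N.predual := by
        have hc : IsClosed (N.predual : Set (StrongDual ℂ N)) :=
          Submodule.isClosed_topologicalClosure _
        rw [← SetLike.mem_coe, ← hc.closure_eq]; refine Metric.mem_closure_iff.2 fun ε hε => ?_
        obtain ⟨χ, hχ, hn⟩ := h ε hε
        exact ⟨χ, hχ.1, by rwa [dist_eq_norm]⟩
      refine ⟨hφ, ?_⟩; rw [← sub_eq_zero, ← norm_le_zero_iff]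
      set I := ∫ u in Ioi 0, |ψ u| with hI
      refine le_of_forall_pos_le_add fun ε hε => ?_
      set K := 2 * (‖f‖ * I) + 1 with hK
      have hK0 : 0 < K := by positivity
      obtain ⟨χ, ⟨hχ, h1⟩, h2⟩ := h (ε / K) (by positivity)
      have e : φ (S.wInt ψ f) - ∫ u in Ioi 0, ψ u • φ (S.T u.toNNReal f) =
          (φ - χ) (S.wInt ψ f) - ∫ u in Ioi 0, ψ u • (φ - χ) (S.T u.toNNReal f) := by
        simp only [sub_apply, smul_sub]
        rw [integral_sub (S.integrableOn_apply_T hψ hφ f) (S.integrableOn_apply_T hψ hχ f), h1]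
        ring
      have b1 := ((φ - χ).le_opNorm (S.wInt ψ f)).trans
        (mul_le_mul_of_nonneg_left (S.norm_wInt_le hψ f) (norm_nonneg _))
      have b2 := norm_integral_le_of_norm_le (hψ.abs.const_mul (‖φ - χ‖ * ‖f‖))
        (f := fun u => ψ u • (φ - χ) (S.T u.toNNReal f))
        (.of_forall fun u => by
          rw [norm_smul, norm_eq_abs, mul_comm]
          exact mul_le_mul_of_nonneg_right (S.norm_apply_T_le _ f _) (abs_nonneg _))
      rw [integral_const_mul, ← hI] at b2; rw [e, zero_add]; refine (norm_sub_le _ _).trans ?_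
      calc _ ≤ ‖φ - χ‖ * K := by rw [hK]; nlinarith [norm_nonneg (φ - χ)]
        _ ≤ ε / K * K := by gcongr
        _ = ε := div_mul_cancel₀ _ hK0.ne'
  exact key.2

lemma wInt_isL1Bounded (f : N) : IsL1Bounded (fun ψ => S.wInt ψ f) ‖f‖ where
  sub ψ χ hψ hχ := VonNeumannAlgebra.ext_inner_left fun ξ η => by
    have h0 : ∀ ψ : ℝ → ℝ, IntegrableOn ψ (Ioi 0) → N.vecFun ξ η (S.wInt ψ f) =
        ∫ u in Ioi (0 : ℝ), ψ u • N.vecFun ξ η (S.T u.toNNReal f) := fun ψ hψ =>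
      S.apply_wInt hψ (VonNeumannAlgebra.vecFun_mem_predual ξ η) f
    have h1 := h0 (ψ - χ) (hψ.sub hχ)
    simp only [Pi.sub_apply, sub_smul] at h1
    rw [integral_sub (S.integrableOn_apply_T hψ (VonNeumannAlgebra.vecFun_mem_predual ξ η) f)
      (S.integrableOn_apply_T hχ (VonNeumannAlgebra.vecFun_mem_predual ξ η) f), ← h0 ψ hψ, ← h0 χ hχ,
      ← _root_.map_sub] at h1
    exact h1
  smul c ψ hψ := VonNeumannAlgebra.ext_inner_left fun ξ η => by
    have h0 : ∀ ψ : ℝ → ℝ, IntegrableOn ψ (Ioi 0) → N.vecFun ξ η (S.wInt ψ f) =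
        ∫ u in Ioi (0 : ℝ), ψ u • N.vecFun ξ η (S.T u.toNNReal f) := fun ψ hψ =>
      S.apply_wInt hψ (VonNeumannAlgebra.vecFun_mem_predual ξ η) f
    have h1 := h0 (c • ψ) (hψ.smul c)
    have e : (c • S.wInt ψ f : N) = (c : ℂ) • S.wInt ψ f := rfl
    have e2 : N.vecFun ξ η ((c : ℂ) • S.wInt ψ f) = c • N.vecFun ξ η (S.wInt ψ f) := by simp
    rw [h0 ψ hψ, ← integral_smul] at e2
    exact h1.trans ((integral_congr_ae (.of_forall fun u =>
      by simp only [Pi.smul_apply, smul_assoc])).trans e2.symm)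
  bound ψ hψ := S.norm_wInt_le hψ f

lemma wInt_nonneg (hψ : IntegrableOn ψ (Ioi 0)) (h0 : ∀ u, 0 ≤ ψ u) {f : N}
    (hf : 0 ≤ f) : 0 ≤ S.wInt ψ f := by
  rw [VonNeumannAlgebra.nonneg_iff]; intro ξ; rw [S.inner_wInt hψ]
  exact integral_nonneg fun u => mul_nonneg (by simpa using h0 u) ((VonNeumannAlgebra.nonneg_iff _).1 (S.T_nonneg _ hf) ξ)

end StandardSemigroup

namespace NSFTrace

lemma isClosed_predual (N : VonNeumannAlgebra H) : IsClosed (N.predual : Set (StrongDual ℂ N)) :=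
  Submodule.isClosed_topologicalClosure _

lemma L2.mulRightL_add (a b : N) (f : τ.L2) :
    L2.mulRightL (a + b) f = L2.mulRightL a f + L2.mulRightL b f := by
  induction f using Completion.induction_on with
  | hp => exact isClosed_eq (by fun_prop) (by fun_prop)
  | ih y =>
    have e : PreL2.mulRight (a + b) y = PreL2.mulRight a y + PreL2.mulRight b y :=
      PreL2.ext (by simp [mul_add])
    simp only [L2.mulRightL_coe, e, Completion.coe_add]

lemma L2.mulRightL_smul (c : ℂ) (b : N) (f : τ.L2) :
    L2.mulRightL (c • b) f = c • L2.mulRightL b f := by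
  induction f using Completion.induction_on with
  | hp => exact isClosed_eq (L2.mulRightL _).continuous ((L2.mulRightL b).continuous.const_smul c)
  | ih y =>
    have e : PreL2.mulRight (c • b) y = c • PreL2.mulRight b y := PreL2.ext (by simp)
    simp only [L2.mulRightL_coe, e, Completion.coe_smul]

/-- The functional `b ↦ ⟪g, k b⟫` on `N`. -/
def L2.rightForm (g k : τ.L2) : StrongDual ℂ N :=
  LinearMap.mkContinuous
    { toFun := fun b => ⟪g, L2.mulRightL b k⟫_ℂ
      map_add' := fun a b => by rw [L2.mulRightL_add, inner_add_right]
      map_smul' := fun c b => by rw [L2.mulRightL_smul, inner_smul_right]; rfl }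
    (‖g‖ * ‖k‖) fun b => by
      refine (norm_inner_le_norm g (L2.mulRightL b k)).trans ?_; rw [mul_assoc, mul_comm ‖k‖]
      exact mul_le_mul_of_nonneg_left (L2.norm_mulRightL_le _ _) (norm_nonneg _)

lemma L2.rightForm_apply (g k : τ.L2) (b : N) :
    L2.rightForm g k b = ⟪g, L2.mulRightL b k⟫_ℂ := rfl

lemma L2.norm_rightForm_le (g k : τ.L2) : ‖L2.rightForm g k‖ ≤ ‖g‖ * ‖k‖ :=
  LinearMap.mkContinuous_norm_le _ (by positivity) _

lemma L2.rightForm_mem_predual (g k : τ.L2) : L2.rightForm g k ∈ N.predual := by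
  have c1 := fun g => by
    refine AddMonoidHomClass.continuous_of_bound (AddMonoidHom.mk' (fun k : τ.L2 => L2.rightForm g k)
      fun a b => ?_) ‖g‖ fun k => L2.norm_rightForm_le g k
    ext b; simp only [rightForm_apply, add_apply, _root_.map_add, inner_add_right]
  have c2 := fun k => by
    refine AddMonoidHomClass.continuous_of_bound (AddMonoidHom.mk' (fun g : τ.L2 => L2.rightForm g k)
      fun a b => ?_) ‖k‖ fun g => (L2.norm_rightForm_le g k).trans (mul_comm _ _).le
    ext b; simp only [rightForm_apply, add_apply, inner_add_left]
  induction g using Completion.induction_on with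
  | hp => exact (isClosed_predual N).preimage (c2 k)
  | ih z =>
    induction k using Completion.induction_on with
    | hp => exact (isClosed_predual N).preimage (c1 _)
    | ih w =>
      have e : L2.rightForm (z : τ.L2) (w : τ.L2) = form (adj w) (adj z) := by
        ext b
        have e1 : mulLeft b (adj z) = adj (PreL2.mulRight (star b) z) := PreL2.ext (by simp)
        rw [rightForm_apply, L2.mulRightL_coe, Completion.inner_coe,
          form_apply, e1, inner_adj, PreL2.inner_mulRight]
      rw [e]; exact form_mem_predual _ _

lemma L2.eq_of_inner_mulStar {f g : τ.L2}
    (h : ∀ y : τ.PreL2, ⟪((mulStar y : τ.PreL2) : τ.L2), f⟫_ℂ =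
      ⟪((mulStar y : τ.PreL2) : τ.L2), g⟫_ℂ) : f = g := by
  have h1 : ∀ y z : τ.PreL2, ⟪((PreL2.mulRight (star z.val) y : τ.PreL2) : τ.L2), f⟫_ℂ =
      ⟪((PreL2.mulRight (star z.val) y : τ.PreL2) : τ.L2), g⟫_ℂ := by
    intro y z
    have e : PreL2.mulRight (star z.val) y = (4⁻¹ : ℂ) • (mulStar (y + z) -
        mulStar (y - z) + I • mulStar (y + I • z) -
        I • mulStar (y - I • z)) :=
      PreL2.ext (by simpa using mul_star_polarization y.val z.val)
    rw [e]
    simp only [Completion.coe_smul, Completion.coe_add,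
      Completion.coe_sub, inner_smul_left, inner_add_left, inner_sub_left, h]
  refine ext_inner_left ℂ fun v => ?_
  induction v using Completion.induction_on with
  | hp => exact isClosed_eq (by fun_prop) (by fun_prop)
  | ih y =>
    have hlim : Tendsto (fun e => ((PreL2.mulRight e y : τ.PreL2) : τ.L2)) τ.unitFilter
        (𝓝 (y : τ.L2)) := by
      rw [tendsto_iff_norm_sub_tendsto_zero]; refine (tendsto_norm_sub_mulLeft (adj y)).congr' ?_
      filter_upwards [eventually_mem_finUnits] with e he
      have e1 : adj (mulLeft (1 - e) (adj y)) = -(PreL2.mulRight e y - y) := PreL2.ext (by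
          have : (-(PreL2.mulRight e y - y)).val = -(y.val * e - y.val) := rfl
          simp [(of_nonneg (finUnits_mem he).1).star_eq, mul_sub])
      rw [← Completion.coe_sub, Completion.norm_coe, ← norm_adj, e1, norm_neg]
    refine tendsto_nhds_unique_of_eventuallyEq
      (((innerSL ℂ).flip f).continuous.tendsto _ |>.comp hlim)
      (((innerSL ℂ).flip g).continuous.tendsto _ |>.comp hlim) ?_
    filter_upwards [eventually_mem_finUnits] with e he
    obtain ⟨h0, he1, hτ⟩ := finUnits_mem he
    have h2 := h1 y (PreL2.mk e ((τ.mono (star_mul_self_nonneg _) (star_mul_self_le_self h0 he1)).trans_lt hτ))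
    rw [PreL2.val_mk, (of_nonneg h0).star_eq] at h2; exact h2

end NSFTrace

namespace StandardSemigroup

variable (S : StandardSemigroup τ)

lemma inner_mulStar_eq_form (y : τ.PreL2) (z : τ.PreL2) :
    ⟪mulStar y, z⟫_ℂ = form y y z.val := by
  have e : mulLeft z.val y = PreL2.mulRight y.val z := PreL2.ext rfl
  rw [form_apply, e, PreL2.inner_mulRight]; rfl

lemma inner_T2L (t : ℝ≥0) (f g : τ.L2) : ⟪f, S.T2L t g⟫_ℂ = ⟪S.T2L t f, g⟫_ℂ := by
  have h : ∀ g : τ.L2, ContinuousLinearMap.adjoint (S.T2L t) g = S.T2L t g := by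
    intro g; refine L2.eq_of_inner_mulStar fun y => ?_; rw [adjoint_inner_right]
    induction g using Completion.induction_on with
    | hp => exact isClosed_eq (by fun_prop) (by fun_prop)
    | ih z =>
      rw [T2L_coe, T2L_coe, Completion.inner_coe, Completion.inner_coe,
        inner_mulStar_eq_form, ← mulStar_evolve, inner_mulStar_eq_form, form_evolve, val_TP]
  rw [← adjoint_inner_left, h]

lemma form_T_mem_predual (z y : τ.PreL2) (v : ℝ≥0) :
    form z y ∘L S.TL v ∈ N.predual := by
  have h : ∀ y : τ.PreL2, form y y ∘L S.TL v ∈ N.predual := fun y => by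
    have e : form y y ∘L S.TL v = form (S.evolve v y) (S.evolve v y) := by
      ext b; exact (S.form_evolve v y b).symm
    rw [e]; exact form_self_mem_predual _
  have hs := fun c {φ} (h : φ ∈ N.predual) => N.predual.smul_mem c h
  rw [form_polarization]; simp
  exact hs _ (sub_mem (add_mem (sub_mem (h _) (h _)) (hs _ (h _))) (hs _ (h _)))

/-- The integral `∫₀^∞ ψ(u) T_u f du` on `N ⊕ L₂`. -/
def intX (ψ : ℝ → ℝ) (f : τ.X) : τ.X :=
  (S.wInt ψ f.1, ∫ u in Ioi (0 : ℝ), ψ u • S.T2L u.toNNReal f.2)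

lemma continuous_T2L_toNNReal (f : τ.L2) : Continuous fun u : ℝ => S.T2L u.toNNReal f :=
  (S.continuous_T2L f).comp continuous_real_toNNReal

lemma intX_isL1Bounded (f : τ.X) : IsL1Bounded (fun ψ => S.intX ψ f) ‖f‖ := by
  have h1 := S.wInt_isL1Bounded f.1
  have h2 := isL1Bounded_integral
    (S.continuous_T2L_toNNReal f.2).aestronglyMeasurable fun u => S.norm_T2L_le _ _
  refine ⟨fun ψ χ hψ hχ => Prod.ext (h1.sub ψ χ hψ hχ) (h2.sub ψ χ hψ hχ),
    fun c ψ hψ => Prod.ext (h1.smul c ψ hψ) (h2.smul c ψ hψ), fun ψ hψ => ?_⟩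
  have hI : 0 ≤ ∫ u in Ioi 0, |ψ u| := integral_nonneg fun _ => abs_nonneg _
  refine max_le ((h1.bound ψ hψ).trans ?_) ((h2.bound ψ hψ).trans ?_)
  · exact mul_le_mul_of_nonneg_right (norm_fst_le f) hI
  · exact mul_le_mul_of_nonneg_right (norm_snd_le f) hI

/-- `∂_t^m P_t` on `N ⊕ L₂`. -/
def dX (m : ℕ) (t : ℝ) (f : τ.X) : τ.X := S.intX (pDeriv m t) f

lemma IsL1Bounded.iteratedDeriv_eq {E : Type*} [NormedAddCommGroup E] [NormedSpace ℝ E]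
    {J : (ℝ → ℝ) → E} {C : ℝ} (hJ : IsL1Bounded J C) (m : ℕ) (ht : 0 < t) :
    iteratedDeriv m (fun r => J (𝔭 r)) t = J (pDeriv m t) := by
  induction m generalizing t with
  | zero =>
    rw [iteratedDeriv_zero]; congr 1; ext u; rw [pDeriv_zero]
  | succ m ih =>
    rw [iteratedDeriv_succ]
    have : iteratedDeriv m (fun r => J (𝔭 r)) =ᶠ[𝓝 t] fun r => J (pDeriv m r) := by
      filter_upwards [lt_mem_nhds ht] with r hr using ih hr
    rw [this.deriv_eq]; exact (hJ.hasDerivAt m ht).deriv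

lemma dX_fst (m : ℕ) (ht : 0 < t) (f : τ.X) : (S.dX m t f).1 = S.dP m t f.1 :=
  (IsL1Bounded.iteratedDeriv_eq (S.wInt_isL1Bounded f.1) m ht).symm

lemma dX_snd (m : ℕ) (ht : 0 < t) (f : τ.X) : (S.dX m t f).2 = S.dP2 m t f.2 := by
  have h2 := isL1Bounded_integral
    (S.continuous_T2L_toNNReal f.2).aestronglyMeasurable fun u => S.norm_T2L_le _ _
  have e : (fun r => S.P2 r f.2) = fun r => ∫ u in Ioi 0, 𝔭 r u • S.T2L u.toNNReal f.2 := by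
    ext r; simp only [T2L_apply]; rfl
  rw [dP2, e]; exact (IsL1Bounded.iteratedDeriv_eq h2 m ht).symm

lemma mulLeft_T_wInt (hψ : IntegrableOn ψ (Ioi 0)) (f : N) (y : τ.PreL2) (v : ℝ≥0) :
    ((mulLeft (S.T v (S.wInt ψ f)) y : τ.PreL2) : τ.L2) =
      ∫ r in Ioi (0 : ℝ), ψ r • ((mulLeft (S.T (v + r.toNNReal) f) y : τ.PreL2) : τ.L2) := by
  have hc : Continuous fun r : ℝ =>
      ((mulLeft (S.T (v + r.toNNReal) f) y : τ.PreL2) : τ.L2) :=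
    (Completion.continuous_coe _).comp ((S.continuous_mulLeft_T y f).comp
      (continuous_const.add continuous_real_toNNReal))
  have hi := integrableOn_smul_bdd hψ hc.aestronglyMeasurable fun r => by
    rw [Completion.norm_coe]
    exact (norm_mulLeft_le _ _).trans (mul_le_mul_of_nonneg_right (S.norm_T_le _ _) (norm_nonneg _))
  refine ext_inner_left ℂ fun z => ?_
  induction z using Completion.induction_on with
  | hp => exact isClosed_eq (by fun_prop) (by fun_prop)
  | ih z =>
    have h1 := S.apply_wInt hψ (S.form_T_mem_predual z y v) f
    have h2 := (innerSL ℂ (z : τ.L2)).integral_comp_comm hi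
    simp only [innerSL_apply_apply] at h2; rw [Completion.inner_coe, ← h2]
    refine h1.trans (integral_congr_ae (.of_forall fun r => ?_)); simp only [← coe_smul (E := τ.L2)]
    rw [inner_smul_right, Completion.inner_coe, S.map_add, real_smul]; rfl

lemma integrableOn_frame (hψ : IntegrableOn ψ (Ioi 0)) (y : τ.PreL2) (u v : ℝ≥0)
    (f : τ.X) : IntegrableOn (fun r : ℝ => ψ r • S.frame y u (v + r.toNNReal) f) (Ioi 0) :=
  integrableOn_smul_bdd hψ ((S.continuous_frame y u f).comp
      (continuous_const.add continuous_real_toNNReal)).aestronglyMeasurable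
    fun _ => S.norm_frame_le y u _ f

lemma frame_intX (hψ : IntegrableOn ψ (Ioi 0)) (y : τ.PreL2) (u v : ℝ≥0)
    (f : τ.X) :
    S.frame y u v (S.intX ψ f) = ∫ r in Ioi (0 : ℝ), ψ r • S.frame y u (v + r.toNNReal) f := by
  have hi2 := integrableOn_smul_bdd hψ
    (S.continuous_T2L_toNNReal f.2).aestronglyMeasurable fun u => S.norm_T2L_le _ _
  have h2 := (L2.mulRightL (S.evolve u y).val ∘L S.T2L v).integral_comp_comm hi2
  have h3 := S.integrableOn_frame hψ y u v (f.1, 0)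
  have h4 := S.integrableOn_frame hψ y u v (0, f.2)
  have e : ∀ r : ℝ, ψ r • S.frame y u (v + r.toNNReal) f = ψ r • S.frame y u (v + r.toNNReal) (f.1, 0)
      + ψ r • S.frame y u (v + r.toNNReal) (0, f.2) := fun r => by
    rw [← smul_add, ← _root_.map_add, Prod.mk_add_mk, add_zero, zero_add]
  simp only [e]
  rw [integral_add h3 h4, frame_apply, act_apply, TX_fst, TX_snd, intX, S.mulLeft_T_wInt hψ]
  congr 1
  · refine integral_congr_ae (.of_forall fun r => ?_); simp [frame_apply, act_apply]
  · refine h2.symm.trans (integral_congr_ae (.of_forall fun r => ?_))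
    have e0 : mulLeft (0 : N) (S.evolve u y) = 0 := PreL2.ext (by simp)
    simp only [frame_apply, act_apply, TX_fst, TX_snd, _root_.map_zero, e0,
      Completion.coe_zero, zero_add, T2L_add]
    rw [← coe_smul, ← coe_smul, _root_.map_smul]; rfl

end StandardSemigroup

lemma integral_smul_mem_of_isClosed {E : Type*} [NormedAddCommGroup E] [NormedSpace ℂ E]
    [CompleteSpace E] {p : Submodule ℂ E} (hp : IsClosed (p : Set E)) {F : ℝ → E}
    (hF : Continuous F) (hm : ∀ u, F u ∈ p) (hK : ∀ u, ‖F u‖ ≤ K)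
    (hψ : IntegrableOn ψ (Ioi 0)) : ∫ u in Ioi 0, ψ u • F u ∈ p := by
  set G : ℝ → p := fun u => ⟨F u, hm u⟩ with hGd
  have hi :=
    StandardSemigroup.integrableOn_smul_bdd hψ (Continuous.subtype_mk hF hm).aestronglyMeasurable hK
  have e : ∫ u in Ioi 0, ψ u • F u = p.subtypeL (∫ u in Ioi 0, ψ u • G u) := ContinuousLinearMap.integral_comp_comm p.subtypeL hi
  rw [e]; exact (∫ u in Ioi 0, ψ u • G u).2

namespace StandardSemigroup

variable (S : StandardSemigroup τ)

lemma re_form_self_le {z : N} (hz : z ≤ 1) (y : τ.PreL2) : (form y y z).re ≤ ‖y‖ ^ 2 := by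
  have h1 := re_form_self_mono y hz
  have h2 : form y y (1 : N) = ((‖y‖ ^ 2 : ℝ) : ℂ) := by
    have := form_self_star_mul y (1 : N)
    have e : mulLeft (1 : N) y = y := PreL2.ext (by simp)
    rwa [star_one, one_mul, e] at this
  rwa [h2, ofReal_re] at h1

lemma trace_wInt_mul_star_lt_top (hψ : IntegrableOn ψ (Ioi 0)) (h0 : ∀ u, 0 ≤ ψ u)
    (y : τ.PreL2) : τ.toFun (S.wInt ψ (y.val * star y.val)) < ∞ := by
  have hb := S.wInt_nonneg hψ h0 (mul_star_self_nonneg y.val)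
  refine (trace_le_of_form_le hb (M := ofReal (∫ u in Ioi 0, ψ u * ‖y‖ ^ 2))
    fun z hz => ?_).trans_lt ofReal_lt_top
  obtain ⟨h1, h2⟩ := form_self_eq_trace z hb
  rw [← ofReal_toReal h2.ne, ← h1]; refine ofReal_le_ofReal ?_
  have hi := S.integrableOn_apply_T hψ (form_self_mem_predual z) (y.val * star y.val)
  rw [S.apply_wInt hψ (form_self_mem_predual z), ← RCLike.re_eq_complex_re, ← integral_re hi]
  refine integral_mono hi.re (hψ.mul_const _) fun u => ?_
  have e : form z z (S.T u.toNNReal (y.val * star y.val)) =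
      form (S.evolve u.toNNReal y) (S.evolve u.toNNReal y) (z.val * star z.val) := by
    rw [← evolve_mul_star, form_self_mul_star]
  have h3 := re_form_self_le hz (S.evolve u.toNNReal y)
  rw [norm_evolve] at h3; simp only [RCLike.re_eq_complex_re, real_smul, re_ofReal_mul]; rw [e]
  exact mul_le_mul_of_nonneg_left h3 (h0 u)

lemma exists_form_wInt (hψ : IntegrableOn ψ (Ioi 0)) (h0 : ∀ u, 0 ≤ ψ u)
    (y : τ.PreL2) : ∃ y' : τ.PreL2, ∀ b : N,
      form y y (S.wInt ψ b) = form y' y' b := by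
  have hb := S.wInt_nonneg hψ h0 (mul_star_self_nonneg y.val)
  have ht := S.trace_wInt_mul_star_lt_top hψ h0 y
  set y' := PreL2.sqrt _ hb ht
  set F : ℝ → StrongDual ℂ N := fun u => form (S.evolve u.toNNReal y) (S.evolve u.toNNReal y)
  have hFc := (S.continuous_form_evolve y).comp continuous_real_toNNReal
  have hFK : ∀ u, ‖F u‖ ≤ ‖y‖ * ‖y‖ := fun u => by
    refine opNorm_le_bound _ (by positivity) fun b => ?_
    rw [form_apply]; refine (norm_inner_le_norm _ _).trans ?_
    have := norm_mulLeft_le b (S.evolve u.toNNReal y)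
    rw [norm_evolve] at this ⊢; rw [mul_assoc, mul_comm ‖y‖ ‖b‖]; gcongr
  have hi := integrableOn_smul_bdd hψ hFc.aestronglyMeasurable hFK
  set χ : StrongDual ℂ N := ∫ u in Ioi 0, ψ u • F u
  have hχa : ∀ b, χ b = form y y (S.wInt ψ b) := fun b => by
    have h := (ContinuousLinearMap.apply ℂ ℂ b).integral_comp_comm hi
    rw [S.apply_wInt hψ (form_self_mem_predual y)]
    refine h.symm.trans (integral_congr_ae (.of_forall fun u => ?_)); simp only
    rw [← (S.form_evolve _ _ _)]; rfl
  have key : χ = form y' y' := by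
    refine predual_ext (τ := τ) (integral_smul_mem_of_isClosed (isClosed_predual N) hFc (fun u => form_self_mem_predual _) hFK hψ) (form_self_mem_predual y') fun z => ?_
    rw [hχa, form_self_mul_star, PreL2.sqrt_mul_star _ hb ht, S.apply_wInt hψ (form_self_mem_predual y),
      S.apply_wInt hψ (form_self_mem_predual z)]
    refine integral_congr_ae (.of_forall fun u => ?_); simp only
    rw [← form_evolve, form_self_mul_star, evolve_mul_star]
  exact ⟨y', fun b => by rw [← hχa, key]⟩

lemma inner_act_self (y : τ.PreL2) (f : τ.X) : ⟪(y : τ.L2), act y f⟫_ℂ =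
    form y y f.1 + ⟪((mulStar y : τ.PreL2) : τ.L2), f.2⟫_ℂ := by
  rw [act_apply, inner_add_right, Completion.inner_coe, L2.inner_mulRightL, L2.mulRightL_coe]; rfl

lemma exists_inner_act_intX (hψ : IntegrableOn ψ (Ioi 0)) (h0 : ∀ u, 0 ≤ ψ u)
    (y : τ.PreL2) : ∃ y' : τ.PreL2, ∀ f : τ.X,
      ⟪(y : τ.L2), act y (S.intX ψ f)⟫_ℂ = ⟪(y' : τ.L2), act y' f⟫_ℂ := by
  obtain ⟨y', hy'⟩ := S.exists_form_wInt hψ h0 y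
  refine ⟨y', fun f => ?_⟩; rw [inner_act_self, inner_act_self, ← hy']; congr 1
  have hi := fun g => integrableOn_smul_bdd hψ
    (S.continuous_T2L_toNNReal g).aestronglyMeasurable fun u => S.norm_T2L_le _ _
  have h1 := (innerSL ℂ ((mulStar y : τ.PreL2) : τ.L2)).integral_comp_comm (hi f.2)
  have h2 := (innerSL ℂ f.2).integral_comp_comm (hi ((mulStar y : τ.PreL2) : τ.L2))
  simp only [innerSL_apply_apply, ← coe_smul] at h1 h2; simp only [inner_smul_right] at h1 h2
  have e1 : ∀ g : τ.L2, ⟪∫ u in Ioi 0, ψ u •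
      S.T2L u.toNNReal ((mulStar y : τ.PreL2) : τ.L2), g⟫_ℂ =
      ⟪((mulStar y' : τ.PreL2) : τ.L2), g⟫_ℂ := by
    intro g
    induction g using Completion.induction_on with
    | hp => exact isClosed_eq (by fun_prop) (by fun_prop)
    | ih z =>
      have h3 := (innerSL ℂ (z : τ.L2)).integral_comp_comm (hi ((mulStar y : τ.PreL2) : τ.L2))
      simp only [innerSL_apply_apply, ← coe_smul] at h3; simp only [inner_smul_right] at h3
      rw [Completion.inner_coe, inner_mulStar_eq_form, ← hy',
        S.apply_wInt hψ (form_self_mem_predual y), ← inner_conj_symm]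
      simp only [← coe_smul (E := τ.L2)]; rw [← h3, ← integral_conj]
      refine integral_congr_ae (.of_forall fun u => ?_)
      simp only [_root_.map_mul, conj_ofReal, inner_conj_symm, T2L_coe]
      rw [Completion.inner_coe, ← mulStar_evolve, inner_mulStar_eq_form, form_evolve, real_smul]
  have e2 := e1 f.2
  have e3 := congrArg (starRingEnd ℂ) h2
  rw [inner_conj_symm] at e3; simp only [← coe_smul] at e2; rw [← e2, ← e3, intX, ← integral_conj]
  simp only [← coe_smul]; rw [← h1]; refine integral_congr_ae (.of_forall fun u => ?_)
  simp only [_root_.map_mul, conj_ofReal, inner_conj_symm]; rw [S.inner_T2L]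

lemma inner_act_TX (y : τ.PreL2) (v : ℝ≥0) (f : τ.X) :
    ⟪(y : τ.L2), act y (S.TX v f)⟫_ℂ =
      ⟪(S.evolve v y : τ.L2), act (S.evolve v y) f⟫_ℂ := by
  rw [inner_act_self, inner_act_self, form_evolve, TX_fst, TX_snd, inner_T2L, T2L_coe,
    mulStar_evolve]

lemma act_add_left (y z : τ.PreL2) (f : τ.X) :
    act (y + z) f = act y f + act z f := by
  simp only [act_apply, mulLeft_add_right, val_add, L2.mulRightL_add, Completion.coe_add]; abel

lemma act_smul_left (c : ℂ) (y : τ.PreL2) (f : τ.X) :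
    act (c • y) f = c • act y f := by
  simp only [act_apply, PreL2.mulLeft_smul_right, val_smul, L2.mulRightL_smul,
    Completion.coe_smul, smul_add]

lemma inner_act_polarization (y z : τ.PreL2) (f : τ.X) :
    ⟪(z : τ.L2), act y f⟫_ℂ = 4⁻¹ * ∑ k : Fin 4, I ^ (k : ℕ) *
      ⟪((y + I ^ (k : ℕ) • z : τ.PreL2) : τ.L2), act (y + I ^ (k : ℕ) • z) f⟫_ℂ := by
  simp only [act_add_left, act_smul_left, Completion.coe_add,
    Completion.coe_smul, inner_add_left, inner_add_right, inner_smul_left,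
    inner_smul_right, Fin.sum_univ_four, _root_.map_pow, Complex.conj_I]
  have h2 := Complex.I_sq
  have h3 : I ^ 3 = -I := by rw [pow_succ, h2]; ring
  simp only [Fin.isValue, Fin.val_zero, Fin.val_one, Fin.val_two,
    show ((3 : Fin 4) : ℕ) = 3 from rfl, pow_zero, pow_one, h2, h3, neg_sq,
    show (-I) ^ 3 = I by rw [pow_succ, neg_sq, h2]; ring]
  linear_combination (4⁻¹ : ℂ) * (-2 * ⟪(y : τ.L2), act z f⟫_ℂ + 2 * ⟪(z : τ.L2), act y f⟫_ℂ) * Complex.I_mul_I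

section bilinear

variable {X : Type*} [NormedAddCommGroup X] [NormedSpace ℝ X] {B : (ℝ → ℝ) → X → X → ℂ} {K : ℝ}

lemma hasDerivAt_of_isL1Bounded_bilinear (hK : 0 ≤ K)
    (hB : ∀ f g, IsL1Bounded (fun ψ => B ψ f g) (K * ‖f‖ * ‖g‖))
    (hal : ∀ ψ, IntegrableOn ψ (Ioi 0) → ∀ f f' g, B ψ (f + f') g = B ψ f g + B ψ f' g)
    (har : ∀ ψ, IntegrableOn ψ (Ioi 0) → ∀ f g g', B ψ f (g + g') = B ψ f g + B ψ f g')
    (hsl : ∀ ψ (c : ℝ) f g, B ψ (c • f) g = c • B ψ f g)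
    (hsr : ∀ ψ (c : ℝ) f g, B ψ f (c • g) = c • B ψ f g)
    (m : ℕ) {r : ℝ → ℝ} {p q : ℝ → X} {r' x : ℝ} {p' q' : X} (hr0 : 0 < r x)
    (hr : HasDerivAt r r' x) (hp : HasDerivAt p p' x) (hq : HasDerivAt q q' x) :
    HasDerivAt (fun v => B (pDeriv m (r v)) (p v) (q v))
      (r' • B (pDeriv (m + 1) (r x)) (p x) (q x) + B (pDeriv m (r x)) p' (q x) +
        B (pDeriv m (r x)) (p x) q') x := by
  classical
  set L : (ℝ → ℝ) → X →L[ℝ] X →L[ℝ] ℂ := fun ψ =>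
    if hψ : IntegrableOn ψ (Ioi 0) then
      LinearMap.mkContinuous₂ (LinearMap.mk₂ ℝ (B ψ) (hal ψ hψ) (hsl ψ) (har ψ hψ) (hsr ψ))
        (K * ∫ u in Ioi 0, |ψ u|) (fun f g => by
          refine ((hB f g).bound ψ hψ).trans (le_of_eq ?_); ring)
    else 0 with hL
  have hLa : ∀ {ψ : ℝ → ℝ}, IntegrableOn ψ (Ioi 0) → ∀ f g, L ψ f g = B ψ f g := by
    intro ψ hψ f g; simp only [hL]; rw [dif_pos hψ]; rfl
  have hLb : IsL1Bounded L K := by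
    refine ⟨fun ψ χ hψ hχ => ?_, fun c ψ hψ => ?_, fun ψ hψ => ?_⟩
    · refine ContinuousLinearMap.ext fun f => ContinuousLinearMap.ext fun g => ?_
      rw [sub_apply, sub_apply, hLa hψ, hLa hχ, hLa (hψ.sub hχ)]; exact (hB f g).sub ψ χ hψ hχ
    · refine ContinuousLinearMap.ext fun f => ContinuousLinearMap.ext fun g => ?_
      rw [smul_apply, smul_apply, hLa hψ, hLa (hψ.smul c)]; exact (hB f g).smul c ψ hψ
    · refine opNorm_le_bound _ (by positivity) fun f =>
        opNorm_le_bound _ (by positivity) fun g => ?_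
      rw [hLa hψ]; refine ((hB f g).bound ψ hψ).trans (le_of_eq ?_); ring
  have h1 := (hLb.hasDerivAt m hr0).scomp x hr
  have h2 := (h1.clm_apply hp).clm_apply hq
  have hm := integrableOn_pDeriv m hr0
  have hm1 := integrableOn_pDeriv (m + 1) hr0
  have e : (fun v => B (pDeriv m (r v)) (p v) (q v)) =ᶠ[𝓝 x]
      fun v => L (pDeriv m (r v)) (p v) (q v) := by
    filter_upwards [hr.continuousAt.eventually (lt_mem_nhds hr0)] with v hv
    exact (hLa (integrableOn_pDeriv m hv) _ _).symm
  refine (h2.congr_of_eventuallyEq e).congr_deriv ?_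
  simp only [Function.comp_apply, add_apply, smul_apply, hLa hm, hLa hm1]

end bilinear

lemma frame_dX (y : τ.PreL2) (u v : ℝ≥0) (m : ℕ) (ht : 0 < t) (f : τ.X) :
    S.frame y u v (S.dX m t f) =
      ∫ r in Ioi (0 : ℝ), pDeriv m t r • S.frame y u (v + r.toNNReal) f :=
  S.frame_intX (integrableOn_pDeriv m ht) y u v f

lemma continuous_frame_toNNReal (y : τ.PreL2) (u v : ℝ≥0) (f : τ.X) :
    Continuous fun r : ℝ => S.frame y u (v + r.toNNReal) f :=
  (S.continuous_frame y u f).comp (continuous_const.add continuous_real_toNNReal)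

lemma frame_dX_dX (y : τ.PreL2) (u v : ℝ≥0) (m k : ℕ) (ht : 0 < t) (hs : 0 < s)
    (f : τ.X) :
    S.frame y u v (S.dX m t (S.dX k s f)) = S.frame y u v (S.dX (m + k) (t + s) f) := by
  rw [S.frame_dX y u v m ht, S.frame_dX y u v (m + k) (add_pos ht hs),
    ← integral_pDeriv_conv ((S.continuous_frame_toNNReal y u v f).stronglyMeasurable) (fun r => S.norm_frame_le y u _ f) m k ht hs]
  refine setIntegral_congr_fun measurableSet_Ioi fun r hr => ?_; rw [S.frame_dX y u _ k hs]; congr 1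
  refine setIntegral_congr_fun measurableSet_Ioi fun q hq => ?_
  rw [toNNReal_add (le_of_lt hr) (le_of_lt hq), add_assoc]

lemma hasDerivAt_dX (m : ℕ) (ht : 0 < t) (f : τ.X) :
    HasDerivAt (fun r => S.dX m r f) (S.dX (m + 1) t f) t :=
  (S.intX_isL1Bounded f).hasDerivAt m ht

lemma continuousOn_dX (m : ℕ) (f : τ.X) : ContinuousOn (fun r => S.dX m r f) (Ioi 0) :=
  fun _ ht => (S.hasDerivAt_dX m ht f).continuousAt.continuousWithinAt

lemma norm_dX_le (m : ℕ) (ht : 0 < t) (f : τ.X) :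
    ‖S.dX m t f‖ ≤ ‖f‖ * (pConst m * (t ^ m)⁻¹) :=
  ((S.intX_isL1Bounded f).bound _ (integrableOn_pDeriv m ht)).trans
    (mul_le_mul_of_nonneg_left (integral_abs_pDeriv_le m ht) (norm_nonneg _))

/-- `⟪f y_u, g y_u⟫`. -/
def frameInner (y : τ.PreL2) (f g : τ.X) (u : ℝ) : ℂ :=
  ⟪S.frame y u.toNNReal 0 f, S.frame y u.toNNReal 0 g⟫_ℂ

lemma continuous_frameInner (y : τ.PreL2) (f g : τ.X) : Continuous (S.frameInner y f g) :=
  (S.continuous_inner_frame y 0 0 f g).comp continuous_real_toNNReal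

lemma norm_frameInner_le (y : τ.PreL2) (f g : τ.X) (u : ℝ) :
    ‖S.frameInner y f g u‖ ≤ (‖y‖ + ‖y.val‖) ^ 2 * ‖f‖ * ‖g‖ := by
  refine (norm_inner_le_norm _ _).trans ?_
  calc _ ≤ ((‖y‖ + ‖y.val‖) * ‖f‖) * ((‖y‖ + ‖y.val‖) * ‖g‖) := by
        gcongr <;> exact S.norm_frame_le _ _ _ _
    _ = _ := by ring

lemma integrableOn_frameInner (hψ : IntegrableOn ψ (Ioi 0)) (y : τ.PreL2)
    (f g : τ.X) : IntegrableOn (fun u => ψ u • S.frameInner y f g u) (Ioi 0) :=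
  integrableOn_smul_bdd hψ (S.continuous_frameInner y f g).aestronglyMeasurable
    (S.norm_frameInner_le y f g)

/-- `∫ ψ(u) ⟪f y_u, g y_u⟫ du = τ(y⋆ I_ψ(f⋆g) y)`. -/
def frameInt (y : τ.PreL2) (ψ : ℝ → ℝ) (f g : τ.X) : ℂ :=
  ∫ u in Ioi 0, ψ u • S.frameInner y f g u

/-- `τ(y⋆ ∂_t^m P_t(f⋆g) y)` for `f, g ∈ N ⊕ L₂`. -/
def W (m : ℕ) (t : ℝ) (f g : τ.X) (y : τ.PreL2) : ℂ :=
  S.frameInt y (pDeriv m t) f g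

lemma frameInt_isL1Bounded (y : τ.PreL2) (f g : τ.X) :
    IsL1Bounded (fun ψ => S.frameInt y ψ f g) ((‖y‖ + ‖y.val‖) ^ 2 * ‖f‖ * ‖g‖) :=
  isL1Bounded_integral (S.continuous_frameInner y f g).aestronglyMeasurable
    (S.norm_frameInner_le y f g)

lemma norm_W_le (m : ℕ) (ht : 0 < t) (f g : τ.X) (y : τ.PreL2) :
    ‖S.W m t f g y‖ ≤ (‖y‖ + ‖y.val‖) ^ 2 * ‖f‖ * ‖g‖ * (pConst m * (t ^ m)⁻¹) :=
  ((S.frameInt_isL1Bounded y f g).bound _ (integrableOn_pDeriv m ht)).trans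
    (mul_le_mul_of_nonneg_left (integral_abs_pDeriv_le m ht) (by positivity))

lemma frameInt_add_left (hψ : IntegrableOn ψ (Ioi 0)) (y : τ.PreL2)
    (f f' g : τ.X) :
    S.frameInt y ψ (f + f') g = S.frameInt y ψ f g + S.frameInt y ψ f' g := by
  rw [frameInt, frameInt, frameInt, ← integral_add (S.integrableOn_frameInner hψ y f g)
    (S.integrableOn_frameInner hψ y f' g)]
  simp only [frameInner, _root_.map_add, inner_add_left, smul_add]

lemma frameInt_add_right (hψ : IntegrableOn ψ (Ioi 0)) (y : τ.PreL2)
    (f g g' : τ.X) :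
    S.frameInt y ψ f (g + g') = S.frameInt y ψ f g + S.frameInt y ψ f g' := by
  rw [frameInt, frameInt, frameInt, ← integral_add (S.integrableOn_frameInner hψ y f g)
    (S.integrableOn_frameInner hψ y f g')]
  simp only [frameInner, _root_.map_add, inner_add_right, smul_add]

lemma frameInt_smul_left (c : ℝ) (y : τ.PreL2) (ψ : ℝ → ℝ) (f g : τ.X) :
    S.frameInt y ψ (c • f) g = c • S.frameInt y ψ f g := by
  rw [frameInt, frameInt, ← integral_smul]; congr 1; ext u
  have e : (c • f : τ.X) = (c : ℂ) • f := rfl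
  simp only [frameInner, e, _root_.map_smul, inner_smul_left, conj_ofReal, real_smul]; ring

lemma frameInt_smul_right (c : ℝ) (y : τ.PreL2) (ψ : ℝ → ℝ) (f g : τ.X) :
    S.frameInt y ψ f (c • g) = c • S.frameInt y ψ f g := by
  rw [frameInt, frameInt, ← integral_smul]; congr 1; ext u
  have e : (c • g : τ.X) = (c : ℂ) • g := rfl
  simp only [frameInner, e, _root_.map_smul, inner_smul_right, real_smul]; ring

lemma hasDerivAt_W (m : ℕ) (y : τ.PreL2) {r : ℝ → ℝ} {p q : ℝ → τ.X} {r' x : ℝ}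
    {p' q' : τ.X} (hr0 : 0 < r x) (hr : HasDerivAt r r' x) (hp : HasDerivAt p p' x)
    (hq : HasDerivAt q q' x) : HasDerivAt (fun v => S.W m (r v) (p v) (q v) y)
      (r' • S.W (m + 1) (r x) (p x) (q x) y + S.W m (r x) p' (q x) y + S.W m (r x) (p x) q' y) x :=
  hasDerivAt_of_isL1Bounded_bilinear (by positivity) (S.frameInt_isL1Bounded y)
    (fun _ hψ => S.frameInt_add_left hψ y) (fun _ hψ => S.frameInt_add_right hψ y)
    (fun _ c => S.frameInt_smul_left c y _) (fun _ c => S.frameInt_smul_right c y _) m hr0 hr hp hq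

lemma hasDerivAt_W_dX (m j k : ℕ) (y : τ.PreL2) (f g : τ.X) {r s : ℝ → ℝ} {r' s' x : ℝ}
    (hr0 : 0 < r x) (hs0 : 0 < s x) (hr : HasDerivAt r r' x) (hs : HasDerivAt s s' x) :
    HasDerivAt (fun v => S.W m (r v) (S.dX j (s v) f) (S.dX k (s v) g) y)
      (r' * S.W (m + 1) (r x) (S.dX j (s x) f) (S.dX k (s x) g) y
        + s' * (S.W m (r x) (S.dX (j + 1) (s x) f) (S.dX k (s x) g) y +
          S.W m (r x) (S.dX j (s x) f) (S.dX (k + 1) (s x) g) y)) x := by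
  refine (S.hasDerivAt_W m y hr0 hr ((S.hasDerivAt_dX j hs0 f).scomp x hs)
    ((S.hasDerivAt_dX k hs0 g).scomp x hs)).congr_deriv ?_
  simp only [W, frameInt_smul_left, frameInt_smul_right, real_smul, Function.comp_apply]; ring

lemma dX_inl (m : ℕ) (ht : 0 < t) (f : N) :
    S.dX m t (f, 0) = (S.dP m t f, 0) :=
  Prod.ext (S.dX_fst m ht _) (by simp [dX, intX])

lemma wInt_zero (hψ : IntegrableOn ψ (Ioi 0)) : S.wInt ψ 0 = 0 := by
  have h := S.norm_wInt_le hψ 0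
  rw [norm_zero, zero_mul] at h; exact norm_le_zero_iff.1 h

lemma dX_inr (m : ℕ) (ht : 0 < t) (f : τ.L2) :
    S.dX m t (0, f) = (0, S.dP2 m t f) :=
  Prod.ext (S.wInt_zero (integrableOn_pDeriv m ht)) (S.dX_snd m ht _)

lemma smear_eq (m : ℕ) (ht : 0 < t) (g k : N) (y : τ.PreL2) :
    S.smear m t g k y = S.W m t (g, 0) (k, 0) y := by
  rw [smear, ← form_apply, ← S.dX_fst m ht (star g * k, 0)]
  refine (S.apply_wInt (integrableOn_pDeriv m ht) (form_self_mem_predual y) _).trans ?_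
  refine integral_congr_ae (.of_forall fun u => ?_)
  simp only [frameInner, frame_apply, inner_act, TX_fst, TX_snd, _root_.map_zero,
    inner_zero_left, inner_zero_right, add_zero, S.map_zero, form_evolve]

lemma smear2_eq (m : ℕ) (ht : 0 < t) (g k : τ.L2) (y : τ.PreL2) :
    S.smear2 m t g k y = S.W m t (0, g) (0, k) y := by
  rw [smear2, ← L2.mulRightL_apply, ← L2.rightForm_apply, ← S.dX_fst m ht (y.val * star y.val, 0)]
  refine (S.apply_wInt (integrableOn_pDeriv m ht) (L2.rightForm_mem_predual _ _) _).trans ?_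
  refine integral_congr_ae (.of_forall fun u => ?_)
  have e0 : mulLeft (0 : N) (mulStar (S.evolve u.toNNReal y)) = 0 := PreL2.ext (by simp)
  simp only [frameInner, frame_apply, inner_act, TX_fst, TX_snd, _root_.map_zero, e0,
    Completion.coe_zero, inner_zero_left, inner_zero_right, add_zero, zero_add,
    star_zero, mul_zero, T2L_zero, evolve_mul_star, L2.rightForm_apply]

/-- The inclusion of `N ∪ L₂` into `N ⊕ L₂`. -/
def toX : N ⊕ τ.L2 → τ.X
  | .inl f => (f, 0)
  | .inr f => (0, f)

lemma bmoPartial_eq (f : N ⊕ τ.L2) : S.bmoPartial f = bmoPartialAux S.dX S.W (toX f) := by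
  rcases f with f | f
  all_goals
    simp only [bmoPartial, bmoPartialAux, opNorm, toX]
    refine congrArg (· ^ (1 / 2 : ℝ)) (iSup_congr fun t => iSup_congr fun ht => iSup_congr fun y =>
      iSup_congr fun _ =>
      setLIntegral_congr_fun measurableSet_Ioo fun s hs => ?_)
  · rw [S.smear_eq 0 ht, S.dX_inl 1 hs.1]
  · rw [S.smear2_eq 0 ht, S.dX_inr 1 hs.1]

lemma bmoGamma_eq (f : N ⊕ τ.L2) : S.bmoGamma f = bmoGammaAux S.dX S.W (toX f) := by
  rcases f with f | f
  all_goals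
    simp only [bmoGamma, bmoGammaAux, opNorm, toX, smearedGamma]
    refine congrArg (· ^ (1 / 2 : ℝ)) (iSup_congr fun t => iSup_congr fun ht => iSup_congr fun y =>
      iSup_congr fun _ =>
      setLIntegral_congr_fun measurableSet_Ioo fun s hs => ?_)
  · rw [S.smear_eq 0 ht, S.smear_eq 0 ht, S.smear_eq 2 ht, S.dX_inl 2 hs.1, S.dX_inl 0 hs.1]
  · rw [S.smear2_eq 0 ht, S.smear2_eq 0 ht, S.smear2_eq 2 ht, S.dX_inr 2 hs.1, S.dX_inr 0 hs.1]

lemma bmoPoisson_eq (f : N ⊕ τ.L2) : S.bmoPoisson f = bmoPoissonAux S.dX S.W (toX f) := by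
  rcases f with f | f
  all_goals
    simp only [bmoPoisson, bmoPoissonAux, opNorm, toX]
    refine congrArg (· ^ (1 / 2 : ℝ)) (iSup_congr fun t => iSup_congr fun ht => iSup_congr fun y =>
      iSup_congr fun _ => ?_)
  · rw [S.smear_eq 0 ht, S.dX_inl 0 ht, Prod.mk_sub_mk, sub_zero]
  · rw [S.smear2_eq 0 ht, S.dX_inr 0 ht, Prod.mk_sub_mk, sub_zero]

end StandardSemigroup

/-- The conditions on the symbol of a multiplier. -/
structure IsSymbol (a : ℝ → ℂ) (ca : ℝ) : Prop where
  pos : 0 < ca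
  meas : AEStronglyMeasurable a (volume.restrict (Ioi 0))
  bound (s : ℝ) : 0 < s →
    ofReal s * ∫⁻ v in Ioi s, ‖a (v - s)‖ₑ ^ 2 / ofReal (v ^ 2) ≤ ofReal (ca ^ 2)

lemma IsSymbol.lintegral_le (ha : IsSymbol a ca)
    (hr : 0 < r) : ∫⁻ t in Ioc 0 r, ‖a t‖ₑ ≤ ofReal (2 * r * ca) := by
  have hca := ha.pos
  have h1 : ∫⁻ v in Ioi r, ‖a (v - r)‖ₑ ^ 2 / ofReal (v ^ 2) =
      ∫⁻ t in Ioi 0, ‖a t‖ₑ ^ 2 / ofReal ((t + r) ^ 2) := by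
    have h := (measurePreserving_add_right volume r).setLIntegral_comp_preimage_emb
      (measurableEmbedding_addRight r) (fun v => ‖a (v - r)‖ₑ ^ 2 / ofReal (v ^ 2)) (Ioi r)
    rw [← h]; simp
  have h2 := ha.bound r hr
  rw [h1] at h2
  set I := ∫⁻ t in Ioi 0, ‖a t‖ₑ ^ 2 / ofReal ((t + r) ^ 2)
  have h3 : ∀ t ∈ Ioc 0 r, ‖a t‖ₑ ≤ ofReal (r ^ 2 / ca) *
      (‖a t‖ₑ ^ 2 / ofReal ((t + r) ^ 2)) + ofReal ca := by
    intro t ht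
    have htr : 0 < t + r := by linarith [ht.1]
    rw [← ofReal_norm, ← ofReal_pow (norm_nonneg _), ← ofReal_div_of_pos (by positivity),
      ← ofReal_mul (by positivity), ← ofReal_add (by positivity) ha.pos.le]
    refine ofReal_le_ofReal ?_
    have h4 : r ^ 2 / ca * (‖a t‖ ^ 2 / (2 * r) ^ 2) ≤ r ^ 2 / ca * (‖a t‖ ^ 2 / (t + r) ^ 2) := by
      gcongr; linarith [ht.2]
    have h5 : ‖a t‖ ≤ r ^ 2 / ca * (‖a t‖ ^ 2 / (2 * r) ^ 2) + ca := by
      have e : r ^ 2 / ca * (‖a t‖ ^ 2 / (2 * r) ^ 2) + ca - ‖a t‖ =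
          (‖a t‖ - 2 * ca) ^ 2 / (4 * ca) := by
        field_simp; ring
      have : 0 ≤ (‖a t‖ - 2 * ca) ^ 2 / (4 * ca) := by positivity
      linarith
    linarith
  calc ∫⁻ t in Ioc 0 r, ‖a t‖ₑ ≤ ∫⁻ t in Ioc 0 r, (ofReal (r ^ 2 / ca) *
        (‖a t‖ₑ ^ 2 / ofReal ((t + r) ^ 2)) + ofReal ca) :=
        setLIntegral_mono' measurableSet_Ioc h3
    _ = ofReal (r ^ 2 / ca) * (∫⁻ t in Ioc 0 r,
        (‖a t‖ₑ ^ 2 / ofReal ((t + r) ^ 2))) + ofReal ca * ofReal r := by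
        rw [lintegral_add_right _ measurable_const, lintegral_const_mul' _ _ ofReal_ne_top,
          setLIntegral_const, Real.volume_Ioc, sub_zero]
    _ ≤ ofReal (r ^ 2 / ca) * I + ofReal ca * ofReal r := by
        gcongr; exact lintegral_mono_set Ioc_subset_Ioi_self
    _ = ofReal (r / ca) * (ofReal r * I) + ofReal ca * ofReal r := by
        rw [show r ^ 2 / ca = r / ca * r by ring, ofReal_mul (by positivity), mul_assoc]
    _ ≤ ofReal (r / ca) * ofReal (ca ^ 2) + ofReal ca * ofReal r := by
        gcongr
    _ = ofReal (2 * r * ca) := by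
        rw [← ofReal_mul (by positivity), ← ofReal_mul ha.pos.le,
          ← ofReal_add (by positivity) (by positivity)]
        congr 1; field_simp; ring

lemma IsSymbol.int (ha : IsSymbol a ca)
    (ε R : ℝ) (hε : 0 < ε) : IntegrableOn a (Ioc ε R) := by
  rcases le_or_gt R 0 with hR | hR
  · rw [Ioc_eq_empty (by linarith)]
    exact integrableOn_empty
  have h := ha.lintegral_le hR
  exact ⟨ha.meas.mono_set fun t ht => hε.trans ht.1, (lintegral_mono_set (Ioc_subset_Ioc_left hε.le)).trans_lt (h.trans_lt ofReal_lt_top)⟩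

namespace StandardSemigroup

variable (S : StandardSemigroup τ)

lemma pair_eq (f : N ⊕ τ.L2) (y z : τ.PreL2) :
    pair f y z = ⟪(z : τ.L2), act y (toX f)⟫_ℂ := by
  rcases f with f | f
  · rw [pair, toX, act_apply, _root_.map_zero, add_zero, Completion.inner_coe]
  · have e0 : mulLeft (0 : N) y = 0 := PreL2.ext (by simp)
    rw [pair, toX, act_apply, e0, Completion.coe_zero, zero_add,
      L2.inner_mulRightL, L2.mulRightL_coe]

lemma pair_map_eq (m : ℕ) (ht : 0 < t) (f : N ⊕ τ.L2) (y z : τ.PreL2) :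
    pair (Sum.map (S.dP m t) (S.dP2 m t) f) y z =
      ⟪(z : τ.L2), act y (S.dX m t (toX f))⟫_ℂ := by
  rw [pair_eq]
  rcases f with f | f
  · rw [Sum.map_inl, toX, toX, S.dX_inl m ht]
  · rw [Sum.map_inr, toX, toX, S.dX_inr m ht]

/-- `g = M_{a,n} f` in `N ⊕ L₂`. -/
def IsMultiplierX (a : ℝ → ℂ) (n : ℕ) (f g : τ.X) : Prop :=
  ∀ y z : τ.PreL2, Tendsto (fun r : ℝ × ℝ => ∫ t in Ioc r.1 r.2,
      a t * (t : ℂ) ^ (n - 1) * ⟪(z : τ.L2), act y (S.dX n t f)⟫_ℂ)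
    (𝓝[>] 0 ×ˢ atTop) (𝓝 ⟪(z : τ.L2), act y g⟫_ℂ)

lemma eventually_trunc :
    ∀ᶠ r : ℝ × ℝ in 𝓝[>] 0 ×ˢ atTop, 0 < r.1 ∧ r.1 ≤ r.2 := by
  filter_upwards [((eventually_nhdsWithin_of_forall fun _ h => h).and ((eventually_le_nhds one_pos).filter_mono nhdsWithin_le_nhds)).prod_mk (eventually_ge_atTop 1)] with r hr
  exact ⟨hr.1.1, hr.1.2.trans hr.2⟩

lemma isMultiplier_iff {f g : N ⊕ τ.L2} :
    S.IsMultiplier a n f g ↔ S.IsMultiplierX a n (toX f) (toX g) := by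
  refine forall₂_congr fun y z => ?_; rw [pair_eq]; refine tendsto_congr' ?_
  filter_upwards [eventually_trunc] with r hr
  rw [intervalIntegral.integral_of_le hr.2]
  refine setIntegral_congr_fun measurableSet_Ioc fun t ht => ?_
  rw [S.pair_map_eq n (hr.1.trans ht.1)]

lemma integrableOn_mul_inner_act {n m : ℕ} {ε R : ℝ} (hε : 0 < ε)
    (ha : IntegrableOn a (Ioc ε R)) (f : τ.X) (y : τ.PreL2) (z : τ.L2) :
    IntegrableOn (fun t => a t * (t : ℂ) ^ n * ⟪z, act y (S.dX m t f)⟫_ℂ) (Ioc ε R) := by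
  have hc : ContinuousOn (fun t : ℝ => t ^ n * ⟪z, act y (S.dX m t f)⟫_ℂ) (Icc ε R) := by
    exact ContinuousOn.mul (by fun_prop) (((innerSL ℂ z).continuous.comp (act y).continuous).comp_continuousOn ((S.continuousOn_dX m f).mono fun t ht => hε.trans_le ht.1))
  obtain ⟨C, hC⟩ := isCompact_Icc.exists_bound_of_continuousOn hc
  simp only [mul_assoc]
  exact Integrable.mul_bdd ha ((hc.mono Ioc_subset_Icc_self).aestronglyMeasurable measurableSet_Ioc)
    (c := C) ((ae_restrict_iff' measurableSet_Ioc).2 (.of_forall fun t ht => hC t (Ioc_subset_Icc_self ht)))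

lemma IsMultiplierX.map (h : S.IsMultiplierX a n f g)
    (ha : IsSymbol a ca) {A B : τ.X → τ.X}
    (hA : ∀ y : τ.PreL2, ∃ y' : τ.PreL2, ∀ f,
      ⟪(y : τ.L2), act y (A f)⟫_ℂ = ⟪(y' : τ.L2), act y' f⟫_ℂ)
    (hB : ∀ y : τ.PreL2, ∃ y' : τ.PreL2, ∀ f,
      ⟪(y : τ.L2), act y (B f)⟫_ℂ = ⟪(y' : τ.L2), act y' f⟫_ℂ) (y z : τ.PreL2) :
    Tendsto (fun r : ℝ × ℝ => ∫ t in Ioc r.1 r.2,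
      a t * (t : ℂ) ^ (n - 1) * ⟪(z : τ.L2), act y (A (S.dX n t f) - B (S.dX n t f))⟫_ℂ)
    (𝓝[>] 0 ×ˢ atTop) (𝓝 ⟪(z : τ.L2), act y (A g - B g)⟫_ℂ) := by
  choose p hp using fun k : Fin 4 => hA (y + I ^ (k : ℕ) • z)
  choose q hq using fun k => hB (y + I ^ (k : ℕ) • z)
  have key : ∀ x : τ.X, ⟪(z : τ.L2), act y (A x - B x)⟫_ℂ =
      4⁻¹ * ∑ k : Fin 4, I ^ (k : ℕ) * (⟪(p k : τ.L2), act (p k) x⟫_ℂ -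
        ⟪(q k : τ.L2), act (q k) x⟫_ℂ) := fun x => by
    rw [_root_.map_sub, inner_sub_right, inner_act_polarization, inner_act_polarization y z (B x),
      ← mul_sub, ← Finset.sum_sub_distrib]
    simp only [hp, hq, mul_sub]
  rw [key]
  refine ((tendsto_finsetSum Finset.univ fun k _ => (fun k => ((h (p k) (p k)).sub (h (q k) (q k))).const_mul (I ^ (k : ℕ))) k).const_mul (4⁻¹ : ℂ)).congr' ?_
  filter_upwards [eventually_trunc] with r hr
  have hi : ∀ w : τ.PreL2, IntegrableOn (fun t => a t * t ^ (n - 1) *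
      ⟪(w : τ.L2), act w (S.dX n t f)⟫_ℂ) (Ioc r.1 r.2) := fun w =>
    S.integrableOn_mul_inner_act hr.1 (ha.int _ _ hr.1) f w w
  simp only [key]
  have e : ∀ t : ℝ, a t * t ^ (n - 1) * (4⁻¹ * ∑ k : Fin 4, I ^ (k : ℕ) *
      (⟪(p k : τ.L2), act (p k) (S.dX n t f)⟫_ℂ -
        ⟪(q k : τ.L2), act (q k) (S.dX n t f)⟫_ℂ)) =
      4⁻¹ * ∑ k : Fin 4, I ^ (k : ℕ) *
      (a t * t ^ (n - 1) * ⟪(p k : τ.L2), act (p k) (S.dX n t f)⟫_ℂ -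
        a t * t ^ (n - 1) * ⟪(q k : τ.L2), act (q k) (S.dX n t f)⟫_ℂ) := by
    intro t; rw [mul_left_comm, Finset.mul_sum]; congr 1; refine Finset.sum_congr rfl fun k _ => ?_
    ring
  simp only [e]
  have h2 : ∀ k : Fin 4, IntegrableOn (fun t => I ^ (k : ℕ) *
      (a t * t ^ (n - 1) * ⟪(p k : τ.L2), act (p k) (S.dX n t f)⟫_ℂ -
        a t * t ^ (n - 1) * ⟪(q k : τ.L2), act (q k) (S.dX n t f)⟫_ℂ)) (Ioc r.1 r.2) :=
    fun k => ((hi _).sub (hi _)).const_mul _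
  rw [integral_const_mul, integral_finsetSum _ fun k _ => h2 k]; congr 1
  refine Finset.sum_congr rfl fun k _ => ?_; rw [integral_const_mul, integral_sub (hi _) (hi _)]

lemma IsMultiplierX.tendsto_frame
    (h : S.IsMultiplierX a n f g) (ha : IsSymbol a ca)
    (y z : τ.PreL2) (u v : ℝ≥0) (j : ℕ) (hs : 0 < s) :
    Tendsto (fun r : ℝ × ℝ => ∫ t in Ioc r.1 r.2,
      a t * (t : ℂ) ^ (n - 1) * ⟪(z : τ.L2), S.frame y u v (S.dX (n + j) (t + s) f)⟫_ℂ)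
    (𝓝[>] 0 ×ˢ atTop) (𝓝 ⟪(z : τ.L2), S.frame y u v (S.dX j s g)⟫_ℂ) := by
  set ψ := pDeriv j s
  have hψ : IntegrableOn ψ (Ioi 0) := integrableOn_pDeriv j hs
  have hp := hψ.pos_part
  have hn := hψ.neg_part
  have hA : ∀ χ : ℝ → ℝ, IntegrableOn χ (Ioi 0) → (∀ u, 0 ≤ χ u) → ∀ y : τ.PreL2, ∃ y' : τ.PreL2,
      ∀ f, ⟪(y : τ.L2), act y (S.TX v (S.intX χ f))⟫_ℂ = ⟪(y' : τ.L2), act y' f⟫_ℂ := by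
    intro χ hχ h0 y
    obtain ⟨y', hy'⟩ := S.exists_inner_act_intX hχ h0 (S.evolve v y)
    exact ⟨y', fun f => by rw [inner_act_TX, hy']⟩
  have key := h.map S ha (hA _ hp fun u => le_max_right _ _) (hA _ hn fun u => le_max_right _ _)
    (S.evolve u y) z
  have e : ∀ x : τ.X, S.TX v (S.intX (fun u => max (ψ u) 0) x) -
      S.TX v (S.intX (fun u => max (-ψ u) 0) x) = S.TX v (S.dX j s x) := fun x => by
    rw [← _root_.map_sub, ← (S.intX_isL1Bounded x).sub _ _ hp hn]
    have e1 : ((fun u => max (ψ u) 0) - fun u => max (-ψ u) 0) = ψ := by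
      ext u; simp only [Pi.sub_apply]
      rcases le_total (ψ u) 0 with h | h
      · rw [max_eq_right h, max_eq_left (by linarith)]; ring
      · rw [max_eq_left h, max_eq_right (by linarith)]; ring
    rw [e1]; rfl
  simp only [e, ← frame_apply] at key; refine key.congr' ?_
  filter_upwards [eventually_trunc] with r hr
  refine setIntegral_congr_fun measurableSet_Ioc fun t ht => ?_
  rw [S.frame_dX_dX y u v j n hs (hr.1.trans ht.1), add_comm j n, add_comm s t]

lemma lintegral_min_mul_le {G : ℝ → ℝ → ℝ≥0∞}
    (hG : ∀ t t' s, 0 < t → t ≤ t' → 0 < s → G t' s ≤ ofReal (t' / t) * G t s) {B : ℝ≥0∞}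
    (hB : ∀ t, 0 < t → ∫⁻ s in Ioo 0 t, ofReal s * G t s ≤ B) (ht : 0 < t) :
    ∫⁻ s in Ioi 0, ofReal (min t s) * G (t + 3 / 2 * s) s ≤ 12 * B := by
  set F : ℝ → ℝ≥0∞ := fun s => ofReal (min t s) * G (t + 3 / 2 * s) s with hF
  set b : ℕ → ℝ := fun k => (3 / 2) ^ k * t with hb
  have hb0 : ∀ k, t ≤ b k := fun k => le_mul_of_one_le_left ht.le (one_le_pow₀ (by norm_num))
  have hbs : ∀ k, b (k + 1) = 3 / 2 * b k := fun k => by simp only [hb]; ring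
  have h1 : ∫⁻ s in Ioo 0 t, F s ≤ ofReal (5 / 2) * B := by
    calc ∫⁻ s in Ioo 0 t, F s ≤ ∫⁻ s in Ioo 0 t, ofReal (5 / 2) * (ofReal s * G t s) := by
          refine setLIntegral_mono' measurableSet_Ioo fun s hs => ?_
          have h := hG t (t + 3 / 2 * s) s ht (by linarith [hs.1]) hs.1
          have h2 : ofReal ((t + 3 / 2 * s) / t) ≤ ofReal (5 / 2) := by
            refine ofReal_le_ofReal ?_; rw [div_le_iff₀ ht]; linarith [hs.2]
          rw [mul_left_comm]
          exact mul_le_mul' (ofReal_le_ofReal (min_le_right _ _)) (h.trans (mul_le_mul' h2 le_rfl))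
      _ ≤ _ := by
        rw [lintegral_const_mul' _ _ ofReal_ne_top]; exact mul_le_mul' le_rfl (hB t ht)
  have h2 : ∀ k, ∫⁻ s in Ico (b k) (b (k + 1)), F s ≤ ofReal (9 / 4 * (2 / 3) ^ k) * B := by
    intro k
    have hk := ht.trans_le (hb0 k)
    have hk1 := ht.trans_le (hb0 (k + 1))
    calc ∫⁻ s in Ico (b k) (b (k + 1)), F s ≤ ∫⁻ s in Ico (b k) (b (k + 1)),
          ofReal (9 / 4 * (2 / 3) ^ k) * (ofReal s * G (b (k + 1)) s) := by
          refine setLIntegral_mono' measurableSet_Ico fun s hs => ?_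
          have h := hG (b (k + 1)) (t + 3 / 2 * s) s hk1 (by rw [hbs]; linarith [hs.1])
            (hk.trans_le hs.1)
          have h3 : ofReal ((t + 3 / 2 * s) / b (k + 1)) ≤ ofReal (9 / 4) := by
            refine ofReal_le_ofReal ?_; rw [div_le_iff₀ hk1]
            have := hs.2
            have := hb0 k
            have := hbs k
            linarith
          have h4 : ofReal (min t s) ≤ ofReal ((2 / 3) ^ k) * ofReal s := by
            rw [← ofReal_mul (by positivity)]
            refine ofReal_le_ofReal ((min_le_left _ _).trans ?_)
            calc t = (2 / 3) ^ k * b k := by simp only [hb]; rw [← mul_assoc, ← mul_pow]; norm_num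
              _ ≤ _ := mul_le_mul_of_nonneg_left hs.1 (by positivity)
          calc F s ≤ (ofReal ((2 / 3) ^ k) * ofReal s) *
                (ofReal (9 / 4) * G (b (k + 1)) s) :=
                mul_le_mul' h4 (h.trans (mul_le_mul' h3 le_rfl))
            _ = _ := by rw [ofReal_mul (by norm_num)]; ring
      _ ≤ ofReal (9 / 4 * (2 / 3) ^ k) * B := by
        rw [lintegral_const_mul' _ _ ofReal_ne_top]
        refine mul_le_mul' le_rfl (le_trans ?_ (hB (b (k + 1)) hk1))
        exact lintegral_mono_set fun s hs => ⟨hk.trans_le hs.1, hs.2⟩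
  have hcov : Ioi 0 ⊆ Ioo 0 t ∪ ⋃ k, Ico (b k) (b (k + 1)) := by
    intro s hs
    rcases lt_or_ge s t with h | h
    · exact Or.inl ⟨hs, h⟩
    · right
      obtain ⟨k, hk1, hk2⟩ := exists_nat_pow_near (show 1 ≤ s / t by rwa [one_le_div ht])
        (show 1 < 3 / 2 by norm_num)
      exact mem_iUnion.2 ⟨k, (le_div_iff₀ ht).1 hk1, (div_lt_iff₀ ht).1 hk2⟩
  calc ∫⁻ s in Ioi 0, F s ≤ ∫⁻ s in Ioo 0 t ∪ ⋃ k, Ico (b k) (b (k + 1)), F s := lintegral_mono_set hcov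
    _ ≤ _ := lintegral_union_le _ _ _
    _ ≤ ofReal (5 / 2) * B + ∑' k, ofReal (9 / 4 * (2 / 3) ^ k) * B :=
      add_le_add h1 ((lintegral_iUnion_le _ _).trans (ENNReal.tsum_le_tsum h2))
    _ ≤ 12 * B := by
      rw [ENNReal.tsum_mul_right, ← ENNReal.ofReal_tsum_of_nonneg (fun _ => by positivity)
        ((summable_geometric_of_lt_one (by norm_num) (by norm_num)).mul_left _), tsum_mul_left,
        tsum_geometric_of_lt_one (by norm_num) (by norm_num), ← add_mul,
        ← ofReal_add (by norm_num) (by norm_num)]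
      refine mul_le_mul' ?_ le_rfl; rw [show (12 : ℝ≥0∞) = ofReal 12 by simp]
      exact ofReal_le_ofReal (by norm_num)

/-- `∫ A(u, s) φ_t(u) du`. -/
def pAvg (A : ℝ → ℝ → ℝ≥0∞) (t s : ℝ) : ℝ≥0∞ :=
  ∫⁻ u in Ioi 0, ofReal (𝔭 t u) * A u s

lemma pAvg_mono_left {A : ℝ → ℝ → ℝ≥0∞} {t t' s : ℝ} (ht : 0 < t) (htt : t ≤ t') :
    pAvg A t' s ≤ ofReal (t' / t) * pAvg A t s := by
  rw [pAvg, pAvg, ← lintegral_const_mul' _ _ ofReal_ne_top]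
  refine setLIntegral_mono' measurableSet_Ioi fun u hu => ?_
  rw [← mul_assoc, ← ofReal_mul (div_nonneg (ht.le.trans htt) ht.le)]
  exact mul_le_mul' (ofReal_le_ofReal (pDensity_le ht htt hu)) le_rfl

lemma measurable_uncurry_pDensity : Measurable fun p : ℝ × ℝ => 𝔭 p.1 p.2 := by
  unfold poissonDensity; fun_prop

lemma measurable_pAvg {A : ℝ → ℝ → ℝ≥0∞} (hA : Measurable (Function.uncurry A)) :
    Measurable fun p : ℝ × ℝ => pAvg A p.1 p.2 := by
  have h : Measurable fun q : (ℝ × ℝ) × ℝ => ofReal (𝔭 q.1.1 q.2) * A q.2 q.1.2 := by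
    exact Measurable.mul (ENNReal.measurable_ofReal.comp
      (measurable_uncurry_pDensity.comp
        (f := fun q : (ℝ × ℝ) × ℝ => (q.1.1, q.2)) (by fun_prop))) (hA.comp (f := fun q : (ℝ × ℝ) × ℝ => (q.2, q.1.2)) (by fun_prop))
  exact h.lintegral_prod_right'

lemma pAvg_conv {A : ℝ → ℝ → ℝ≥0∞} (hA : Measurable (Function.uncurry A))
    (ht : 0 < t) (hr : 0 < r) (s : ℝ) :
    ∫⁻ u in Ioi 0, ofReal (𝔭 t u) * pAvg (fun v s => A (u + v) s) r s =
      pAvg A (t + r) s := by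
  have hA1 : Measurable fun u => A u s := hA.comp (f := fun u => (u, s)) (by fun_prop)
  have := isProb_poissonMeasure ht
  have := isProb_poissonMeasure hr
  have h1 : ∀ u, pAvg (fun v s => A (u + v) s) r s = ∫⁻ v, A (u + v) s ∂poissonMeasure r :=
    fun u => (lintegral_poissonMeasure r (hA1.comp (measurable_const_add u))).symm
  have h2 : pAvg A (t + r) s = ∫⁻ u, A u s ∂poissonMeasure (t + r) :=
    (lintegral_poissonMeasure _ hA1).symm
  have h3 : Measurable fun u => ∫⁻ v, A (u + v) s ∂poissonMeasure r :=
    (hA1.comp measurable_add).lintegral_prod_right'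
  simp only [h1]
  rw [← lintegral_poissonMeasure t h3, h2, ← poissonMeasure_conv ht hr, Measure.lintegral_conv hA1]

lemma lintegral_pAvg_le {A B : ℝ → ℝ → ℝ≥0∞}
    (hB : Measurable (Function.uncurry B)) {K b : ℝ≥0∞}
    (h : ∀ u s, 0 < u → 0 < s → ofReal s * A u s ≤
      K * ∫⁻ v in Ioi s, pAvg (fun r x => B (u + r) x) (3 / 8 * v) (v / 4))
    (hb : ∀ t, 0 < t → ∫⁻ s in Ioo 0 t, ofReal s * pAvg B t s ≤ b)
    (ht : 0 < t) :
    ∫⁻ s in Ioo 0 t, ofReal s * pAvg A t s ≤ 192 * K * b := by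
  have hm := measurable_pAvg hB
  have hm2 : Measurable fun p : ℝ × ℝ =>
      pAvg (fun r x => B (p.1 + r) x) (3 / 8 * p.2) (p.2 / 4) := by
    have h : Measurable fun q : (ℝ × ℝ) × ℝ =>
        ofReal (𝔭 (3 / 8 * q.1.2) q.2) * B (q.1.1 + q.2) (q.1.2 / 4) := by
      exact Measurable.mul (ENNReal.measurable_ofReal.comp
        (measurable_uncurry_pDensity.comp
          (f := fun q : (ℝ × ℝ) × ℝ => (3 / 8 * q.1.2, q.2)) (by fun_prop))) (hB.comp (f := fun q : (ℝ × ℝ) × ℝ => (q.1.1 + q.2, q.1.2 / 4)) (by fun_prop))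
    exact h.lintegral_prod_right'
  let C : ℝ → ℝ≥0∞ := fun v => pAvg B (t + 3 / 8 * v) (v / 4)
  have step : ∀ s, 0 < s → ofReal s * pAvg A t s ≤ K * ∫⁻ v in Ioi s, C v := by
    intro s hs
    calc ofReal s * pAvg A t s
        = ∫⁻ u in Ioi 0, ofReal (𝔭 t u) * (ofReal s * A u s) := by
          rw [pAvg, ← lintegral_const_mul' _ _ ofReal_ne_top]; simp only [mul_left_comm]
      _ ≤ ∫⁻ u in Ioi 0, K * ∫⁻ v in Ioi s, ofReal (𝔭 t u) *
            pAvg (fun r x => B (u + r) x) (3 / 8 * v) (v / 4) := by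
          refine setLIntegral_mono' measurableSet_Ioi fun u hu => ?_
          rw [lintegral_const_mul' _ _ ofReal_ne_top, mul_left_comm K]
          exact mul_le_mul' le_rfl (h u s hu hs)
      _ = K * ∫⁻ v in Ioi s, ∫⁻ u in Ioi 0, ofReal (𝔭 t u) *
            pAvg (fun r x => B (u + r) x) (3 / 8 * v) (v / 4) := by
          have hm3 :=
            ((ENNReal.measurable_ofReal.comp (measurable_pDensity t)).comp measurable_fst).mul hm2
          exact (lintegral_const_mul _ (hm3.lintegral_prod_right')).trans (congrArg _ (lintegral_lintegral_swap hm3.aemeasurable))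
      _ = _ := by
          congr 1
          exact setLIntegral_congr_fun measurableSet_Ioi fun v hv => pAvg_conv hB ht (by linarith [hs.trans hv]) _
  calc ∫⁻ s in Ioo 0 t, ofReal s * pAvg A t s
      ≤ ∫⁻ s in Ioo 0 t, K * ∫⁻ v in Ioi 0, (Ioi s).indicator C v := by
        refine setLIntegral_mono' measurableSet_Ioo fun s hs => (step s hs.1).trans (le_of_eq ?_)
        rw [lintegral_indicator measurableSet_Ioi, Measure.restrict_restrict measurableSet_Ioi,
          inter_eq_left.2 (Ioi_subset_Ioi hs.1.le)]
    _ = K * ∫⁻ v in Ioi 0, ∫⁻ s in Ioo 0 t, (Ioi s).indicator C v := by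
        have hm4 : Measurable (Function.uncurry fun s v : ℝ => (Ioi s).indicator C v) := by
          have : (Function.uncurry fun s v : ℝ => (Ioi s).indicator C v) = {p : ℝ × ℝ | p.1 < p.2}.indicator
            fun p => C p.2 := by
            ext p; simp [indicator, Function.uncurry]
          exact ((hm.comp (f := fun v : ℝ => (t + 3 / 8 * v, v / 4)) (by fun_prop)).comp measurable_snd).indicator (measurableSet_lt measurable_fst measurable_snd)
        exact (lintegral_const_mul _ (hm4.lintegral_prod_right')).trans (congrArg _ (lintegral_lintegral_swap hm4.aemeasurable))
    _ ≤ K * ∫⁻ v in Ioi 0, ofReal (min t v) * C v := by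
        refine mul_le_mul' le_rfl (setLIntegral_mono' measurableSet_Ioi fun v hv => ?_)
        have e : ∀ s, (Ioi s).indicator C v = (Iio v).indicator (fun _ => C v) s := fun s => by
          simp [indicator]
        simp only [e]
        rw [lintegral_indicator measurableSet_Iio, Measure.restrict_restrict measurableSet_Iio,
          lintegral_const, mul_comm]
        refine mul_le_mul' ?_ le_rfl; rw [Measure.restrict_apply_univ]
        refine (measure_mono (show Iio v ∩ Ioo 0 t ⊆ Ioo 0 (min t v) from
          fun s hs => ⟨hs.2.1, lt_min hs.2.2 hs.1⟩)).trans ?_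
        rw [Real.volume_Ioo, sub_zero]
    _ = K * (4 * ∫⁻ x in Ioi 0, ofReal (min t (4 * x)) * pAvg B (t + 3 / 2 * x) x) := by
        congr 1
        have him : (fun x : ℝ => 4 * x) '' Ioi 0 = Ioi 0 := by
          rw [image_mul_left_Ioi (by norm_num), mul_zero]
        rw [← him, lintegral_image_eq_lintegral_abs_deriv_mul (f' := fun _ => 4) measurableSet_Ioi
          (fun x _ => by simpa using ((hasDerivAt_id x).const_mul 4).hasDerivWithinAt)
          (fun x _ y _ h => by simpa using h), him, ← lintegral_const_mul' _ _ (by simp)]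
        refine setLIntegral_congr_fun measurableSet_Ioi fun x _ => ?_; simp [C]; congr 4 <;> ring
    _ ≤ K * (4 * (4 * (12 * b))) := by
        refine mul_le_mul' le_rfl (mul_le_mul' le_rfl ?_)
        refine le_trans ?_ (mul_le_mul' le_rfl (lintegral_min_mul_le (G := pAvg B)
          (fun t t' s h1 h2 _ => pAvg_mono_left h1 h2) hb ht))
        rw [← lintegral_const_mul' _ _ (by simp)]
        refine setLIntegral_mono' measurableSet_Ioi fun x hx => ?_; rw [← mul_assoc]
        refine mul_le_mul' ?_ le_rfl
        rw [show (4 : ℝ≥0∞) = ofReal 4 by simp, ← ofReal_mul (by norm_num)]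
        refine ofReal_le_ofReal ?_; rw [mul_min_of_nonneg _ _ (by norm_num)]
        exact min_le_min (by linarith) le_rfl
    _ = _ := by ring

/-- The form `⟪f y_{u+ρ}, g y_{u+ρ}⟫ - e ⟪T_ρ(f) y_u, T_ρ(g) y_u⟫`, positive for `0 ≤ e ≤ 1`. -/
def defect (e : ℝ) (ρ : ℝ≥0) (y : τ.PreL2) (u : ℝ≥0) (f g : τ.X) : ℂ :=
  ⟪S.frame y (u + ρ) 0 f, S.frame y (u + ρ) 0 g⟫_ℂ - e * ⟪S.frame y u ρ f, S.frame y u ρ g⟫_ℂ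

/-- The quadratic form of `defect`. -/
def defectSq (e : ℝ) (ρ : ℝ≥0) (y : τ.PreL2) (u : ℝ≥0) (f : τ.X) : ℝ :=
  ‖S.frame y (u + ρ) 0 f‖ ^ 2 - e * ‖S.frame y u ρ f‖ ^ 2

variable {e : ℝ} (ρ : ℝ≥0) (y : τ.PreL2) (u : ℝ≥0)

lemma le_mul_of_forall_le {q I J : ℝ} (hq : 0 ≤ q) (hI : 0 ≤ I) (hJ : 0 ≤ J)
    (h : ∀ c : ℝ, 0 < c → q ≤ (c * q * I + J / c) / 2) : q ≤ I * J := by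
  rcases hI.eq_or_lt with rfl | hI
  · by_contra hcon
    rw [zero_mul, not_le] at hcon
    have h3 := h ((J + 1) / q) (by positivity)
    have h4 : J / ((J + 1) / q) = q * (J / (J + 1)) := by field_simp
    have h2 : J / (J + 1) ≤ 1 := (div_le_one (by linarith)).2 (by linarith)
    nlinarith
  · have h1 := h I⁻¹ (by positivity)
    have h2 : I⁻¹ * q * I = q := by field_simp
    rw [h2, div_inv_eq_mul] at h1; linarith

lemma defect_self (e : ℝ) (f : τ.X) :
    S.defect e ρ y u f f = (S.defectSq e ρ y u f : ℂ) := by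
  rw [defect, defectSq, inner_self_eq_norm_sq_to_K, inner_self_eq_norm_sq_to_K]; push_cast; rfl

lemma defectSq_nonneg (he1 : e ≤ 1) (f : τ.X) : 0 ≤ S.defectSq e ρ y u f := by
  have h := S.norm_frame_add_le y u ρ 0 f
  rw [add_zero] at h
  have h1 := pow_le_pow_left₀ (norm_nonneg _) h 2
  rw [defectSq]; nlinarith

lemma norm_defect_le (he1 : e ≤ 1) (f g : τ.X) :
    ‖S.defect e ρ y u f g‖ ≤ √(S.defectSq e ρ y u f) * √(S.defectSq e ρ y u g) := by
  let c : PreInnerProductSpace.Core ℂ (τ.X) :=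
    { inner := S.defect e ρ y u
      conj_inner_symm := fun f g => by
        simp only [defect, _root_.map_sub, _root_.map_mul, inner_conj_symm, conj_ofReal]
      re_inner_nonneg := fun f => by
        rw [defect_self]; exact S.defectSq_nonneg ρ y u he1 f
      add_left := fun f g h => by
        simp only [defect, _root_.map_add, inner_add_left]; ring
      smul_left := fun f g r => by
        simp only [defect, _root_.map_smul, inner_smul_left]; ring }
  have h := InnerProductSpace.Core.norm_inner_le_norm (c := c) f g
  have hs : ∀ f, @Norm.norm _ (InnerProductSpace.Core.toNorm (c := c)) f = √(S.defectSq e ρ y u f) := by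
    intro f; rw [InnerProductSpace.Core.norm_eq_sqrt_re_inner]; congr 1
    exact congrArg Complex.re (S.defect_self ρ y u e f)
  rw [hs, hs] at h; exact h

lemma continuous_defectSq_TX (f : τ.X) :
    Continuous fun r : ℝ => S.defectSq e ρ y u (S.TX r.toNNReal f) := by
  simp only [defectSq, frame_TX]
  have := S.continuous_frame_toNNReal y (u + ρ) 0 f
  have := S.continuous_frame_toNNReal y u ρ f
  fun_prop

lemma defectSq_le (he0 : 0 ≤ e) (f : τ.X) : S.defectSq e ρ y u f ≤ (‖y‖ + ‖y.val‖) ^ 2 * ‖f‖ ^ 2 := by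
  have h := pow_le_pow_left₀ (norm_nonneg _) (S.norm_frame_le y (u + ρ) 0 f) 2
  have h2 : 0 ≤ e * ‖S.frame y u ρ f‖ ^ 2 := by positivity
  rw [defectSq]; linarith

lemma defect_intX (hψ : IntegrableOn ψ (Ioi 0)) (f g : τ.X) :
    S.defect e ρ y u g (S.intX ψ f) =
      ∫ r in Ioi (0 : ℝ), ψ r • S.defect e ρ y u g (S.TX r.toNNReal f) := by
  have key : ∀ (u v : ℝ≥0), IntegrableOn (fun r =>
      ψ r • ⟪S.frame y u v g, S.frame y u (v + r.toNNReal) f⟫_ℂ) (Ioi 0) ∧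
      ⟪S.frame y u v g, S.frame y u v (S.intX ψ f)⟫_ℂ =
      ∫ r in Ioi 0, ψ r • ⟪S.frame y u v g, S.frame y u (v + r.toNNReal) f⟫_ℂ := by
    intro u v
    have hi := S.integrableOn_frame hψ y u v f
    have h := (innerSL ℂ (S.frame y u v g)).integral_comp_comm hi
    have h2 := (innerSL ℂ (S.frame y u v g)).integrable_comp hi
    simp at h h2; simp only [← coe_smul, real_smul, S.frame_intX hψ]; exact ⟨h2, h.symm⟩
  obtain ⟨i1, e1⟩ := key (u + ρ) 0
  obtain ⟨i2, e2⟩ := key u ρ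
  rw [defect, e1, e2, ← integral_const_mul, ← integral_sub i1 (i2.const_mul _)]
  refine integral_congr_ae (.of_forall fun r => ?_); simp only [defect, frame_TX, real_smul]; ring

lemma defectSq_intX_le (he0 : 0 ≤ e) (he1 : e ≤ 1) (hψ : IntegrableOn ψ (Ioi 0)) (f : τ.X) :
    S.defectSq e ρ y u (S.intX ψ f) ≤ (∫ r in Ioi 0, |ψ r|) *
      ∫ r in Ioi 0, |ψ r| * S.defectSq e ρ y u (S.TX r.toNNReal f) := by
  set I := ∫ r in Ioi 0, |ψ r|
  set h := S.intX ψ f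
  set q := S.defectSq e ρ y u h
  set J := ∫ r in Ioi 0, |ψ r| * S.defectSq e ρ y u (S.TX r.toNNReal f) with hJ
  have hn := S.defectSq_nonneg ρ y u he1
  have hiJ : IntegrableOn (fun r => |ψ r| * S.defectSq e ρ y u (S.TX r.toNNReal f)) (Ioi 0) :=
    integrableOn_smul_bdd (K := (‖y‖ + ‖y.val‖) ^ 2 * ‖f‖ ^ 2) hψ.abs
      (S.continuous_defectSq_TX ρ y u f).aestronglyMeasurable fun r => by
        rw [norm_of_nonneg (hn _)]; refine (S.defectSq_le ρ y u he0 _).trans ?_; gcongr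
        exact S.norm_TX_le _ _
  have hq0 := hn h
  have hle : ∀ c : ℝ, 0 < c → q ≤ (c * q * I + J / c) / 2 := by
    intro c hc
    have h1 : q = ∫ r in Ioi 0, ψ r • S.defect e ρ y u h (S.TX r.toNNReal f) := by
      rw [← S.defect_intX ρ y u hψ, defect_self]
    have h2 := norm_integral_le_of_norm_le (f := fun r => ψ r • S.defect e ρ y u h (S.TX r.toNNReal f))
      (((hψ.abs.mul_const (c * q)).add (hiJ.div_const c)).div_const 2)
      (.of_forall fun r => by
        rw [norm_smul, norm_eq_abs]
        have h3 := S.norm_defect_le ρ y u he1 h (S.TX r.toNNReal f)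
        set p := S.defectSq e ρ y u (S.TX r.toNNReal f)
        have h4 : √q * √p ≤ (c * q + p / c) / 2 := by
          have e1 : √c * √q * (√p / √c) = √q * √p := by
            field_simp
          have h5 := two_mul_le_add_sq (√c * √q) (√p / √c)
          rw [mul_assoc, e1, mul_pow, div_pow, sq_sqrt hc.le, sq_sqrt hq0, sq_sqrt (hn _)] at h5
          linarith
        calc |ψ r| * _ ≤ |ψ r| * ((c * q + p / c) / 2) :=
              mul_le_mul_of_nonneg_left (h3.trans h4) (abs_nonneg _)
          _ = (|ψ r| * (c * q) + |ψ r| * p / c) / 2 := by ring)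
    rw [← h1, norm_real, norm_of_nonneg hq0, integral_div,
      integral_add' (hψ.abs.mul_const _) (hiJ.div_const c), integral_mul_const, integral_div] at h2
    refine h2.trans (le_of_eq ?_); ring
  exact le_mul_of_forall_le hq0 (integral_nonneg fun _ => abs_nonneg _) (integral_nonneg fun r => mul_nonneg (abs_nonneg _) (hn _)) hle

lemma defectSq_congr (h : ∀ u v, S.frame y u v f = S.frame y u v g) :
    S.defectSq e ρ y u f = S.defectSq e ρ y u g := by
  rw [defectSq, defectSq, h, h]

lemma defectSq_dX_dX (m k : ℕ) (ht : 0 < t) (hs : 0 < s) (f : τ.X) :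
    S.defectSq e ρ y u (S.dX m t (S.dX k s f)) = S.defectSq e ρ y u (S.dX (m + k) (t + s) f) :=
  S.defectSq_congr ρ y u fun u v => S.frame_dX_dX y u v m k ht hs f

lemma ofReal_defectSq_dX_le (he0 : 0 ≤ e) (he1 : e ≤ 1)
    (hΓ : ∀ (u v : ℝ≥0) (f : τ.X),
      S.defectSq e ρ y u (S.TX v f) ≤ S.defectSq e ρ y (u + v) f) (m : ℕ) (ht : 0 < t) (f : τ.X) :
    ofReal (S.defectSq e ρ y u (S.dX m t f)) ≤
      ofReal ((pConst m * (t ^ m)⁻¹) ^ 2) * ∫⁻ r in Ioi 0,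
        ofReal (𝔭 (t / 2) r) *
          ofReal (S.defectSq e ρ y (u + r.toNNReal) f) := by
  set c := pConst m * (t ^ m)⁻¹ with hc
  have hc0 : 0 ≤ c := mul_nonneg (pConst_nonneg m) (by positivity)
  have hψ := integrableOn_pDeriv m ht
  have hn := S.defectSq_nonneg ρ y u he1
  have h1 := S.defectSq_intX_le ρ y u he0 he1 hψ f
  have h2 : ofReal (∫ r in Ioi 0, |pDeriv m t r| * S.defectSq e ρ y u (S.TX r.toNNReal f)) ≤
      ∫⁻ r in Ioi 0, ofReal c * (ofReal (𝔭 (t / 2) r) *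
          ofReal (S.defectSq e ρ y (u + r.toNNReal) f)) := by
    rw [integral_eq_lintegral_of_nonneg_ae (.of_forall (fun r => mul_nonneg (abs_nonneg _) (hn _)))
      ((measurable_pDeriv m t).abs.mul
        (S.continuous_defectSq_TX ρ y u f).measurable).aestronglyMeasurable]
    refine ENNReal.ofReal_toReal_le.trans (setLIntegral_mono' measurableSet_Ioi fun r hr => ?_)
    have h3 := abs_pDeriv_le m ht hr
    have h4 := pDensity_nonneg (t := t / 2) (by linarith) (le_of_lt hr)
    rw [← ofReal_mul h4, ← ofReal_mul hc0, ← mul_assoc]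
    exact ofReal_le_ofReal (mul_le_mul h3 (hΓ u _ f) (hn _) (mul_nonneg hc0 h4))
  rw [lintegral_const_mul' _ _ ofReal_ne_top] at h2
  calc _ ≤ ofReal (∫ r in Ioi 0, |pDeriv m t r|) * ofReal (∫ r in Ioi 0,
        |pDeriv m t r| * S.defectSq e ρ y u (S.TX r.toNNReal f)) := by
        rw [← ofReal_mul (integral_nonneg fun _ => abs_nonneg _)]; exact ofReal_le_ofReal h1
    _ ≤ ofReal c * (ofReal c * _) := mul_le_mul' (ofReal_le_ofReal (integral_abs_pDeriv_le m ht)) h2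
    _ = _ := by rw [← mul_assoc, ← ofReal_mul hc0, sq]

end StandardSemigroup

lemma lintegral_mul_sq_le {α : Type*} {m : MeasurableSpace α} {μ : Measure α} {f g : α → ℝ≥0∞}
    (hf : AEMeasurable f μ) (hg : AEMeasurable g μ) :
    (∫⁻ x, f x * g x ∂μ) ^ 2 ≤ (∫⁻ x, f x ^ 2 ∂μ) * ∫⁻ x, g x ^ 2 ∂μ := by
  have h := pow_le_pow_left₀ (zero_le) (ENNReal.lintegral_mul_le_Lp_mul_Lq μ
    Real.HolderConjugate.two_two hf hg) 2
  have e : ∀ x : ℝ≥0∞, (x ^ (1 / 2 : ℝ)) ^ 2 = x := fun x => by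
    rw [← ENNReal.rpow_natCast, ← ENNReal.rpow_mul]; norm_num
  rw [mul_pow, e, e] at h; simpa only [ENNReal.rpow_two, Pi.mul_apply] using h

namespace StandardSemigroup

variable (S : StandardSemigroup τ)

lemma continuous_norm_frame_prod (y : τ.PreL2) (v : ℝ≥0) :
    Continuous fun p : ℝ≥0 × τ.X => ‖S.frame y p.1 v p.2‖ := by
  refine continuous_prod_of_continuous_lipschitzWith' _ (‖y‖₊ + ‖y.val‖₊) (fun u => ?_) fun f => ?_
  · refine LipschitzWith.of_dist_le_mul fun f g => ?_; rw [Real.dist_eq, dist_eq_norm]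
    refine (abs_norm_sub_norm_le _ _).trans ?_; rw [← _root_.map_sub]; exact S.norm_frame_le y u v _
  · have h := (Complex.continuous_re.comp (S.continuous_inner_frame y v v f f)).sqrt
    exact h.congr fun u => (norm_eq_sqrt_re_inner (𝕜 := ℂ) _).symm

lemma continuous_defectSq_prod (e : ℝ) (ρ : ℝ≥0) (y : τ.PreL2) :
    Continuous fun p : ℝ≥0 × τ.X => S.defectSq e ρ y p.1 p.2 := by
  have h1 := (S.continuous_norm_frame_prod y 0).comp
    (f := fun p : ℝ≥0 × τ.X => (p.1 + ρ, p.2)) (by fun_prop)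
  exact (h1.pow 2).sub ((S.continuous_norm_frame_prod y ρ).pow 2 |>.const_mul e)

open scoped Classical in
/-- `defectSq` at `∂_s^j P_s f`. -/
def defectFun (e : ℝ) (ρ : ℝ≥0) (y : τ.PreL2) (j : ℕ) (f : τ.X) (u s : ℝ) :
    ℝ≥0∞ :=
  if 0 < s then ofReal (S.defectSq e ρ y u.toNNReal (S.dX j s f)) else 0

lemma measurable_defectFun (e : ℝ) (ρ : ℝ≥0) (y : τ.PreL2) (j : ℕ) (f : τ.X) :
    Measurable (Function.uncurry (S.defectFun e ρ y j f)) := by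
  have hs : MeasurableSet {p : ℝ × ℝ | 0 < p.2} := measurableSet_lt measurable_const measurable_snd
  have hc : ContinuousOn (fun p =>
      ofReal (S.defectSq e ρ y p.1.toNNReal (S.dX j p.2 f))) {p : ℝ × ℝ | 0 < p.2} := by
    have h1 := (S.continuous_defectSq_prod e ρ y).comp_continuousOn ((continuous_real_toNNReal.comp continuous_fst).continuousOn.prodMk ((S.continuousOn_dX j f).comp continuous_snd.continuousOn fun _ hp => hp))
    exact ENNReal.continuous_ofReal.comp_continuousOn h1
  have h := hc.measurable_piecewise (continuousOn_const (c := (0 : ℝ≥0∞))) hs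
  have e1 : Function.uncurry (S.defectFun e ρ y j f) = {p : ℝ × ℝ | 0 < p.2}.piecewise (fun p =>
      ofReal (S.defectSq e ρ y p.1.toNNReal (S.dX j p.2 f))) fun _ => 0 := by
    ext ⟨u, s⟩
    by_cases hs : 0 < s <;> simp [Function.uncurry, defectFun, Set.piecewise, hs]
  exact h

lemma integrableOn_mul_of_continuousOn {ε R : ℝ} (ha : IntegrableOn a (Ioc ε R))
    {c : ℝ → ℂ} (hc : ContinuousOn c (Icc ε R)) : IntegrableOn (fun t => a t * c t) (Ioc ε R) := by
  obtain ⟨C, hC⟩ := isCompact_Icc.exists_bound_of_continuousOn hc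
  exact Integrable.mul_bdd ha ((hc.mono Ioc_subset_Icc_self).aestronglyMeasurable measurableSet_Ioc)
    (c := C) ((ae_restrict_iff' measurableSet_Ioc).2 (.of_forall fun t ht => hC t (Ioc_subset_Icc_self ht)))

lemma continuousOn_dX_add (m : ℕ) (hs : 0 < s) (f : τ.X) :
    ContinuousOn (fun t => S.dX m (t + s) f) (Ici 0) :=
  (S.continuousOn_dX m f).comp (by fun_prop) fun t ht => by
    have : 0 ≤ t := ht
    exact add_pos_of_nonneg_of_pos this hs

lemma frame_coe (y : τ.PreL2) (u v : ℝ≥0) (x : N) (z : τ.PreL2) : S.frame y u v (x, (z : τ.L2)) =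
    ((mulLeft (S.T v (x + z.val)) (S.evolve u y) : τ.PreL2) : τ.L2) := by
  have e1 : S.TX v (x, (z : τ.L2)) = (S.T v x, ((S.TP v z : τ.PreL2) : τ.L2)) :=
    Prod.ext rfl (S.T2L_coe v z)
  rw [frame_apply, e1, act_coe, val_TP, _root_.map_add]

variable {e : ℝ} (ρ : ℝ≥0) (y : τ.PreL2) (u : ℝ≥0)

lemma norm_defect_multiplier_le (he1 : e ≤ 1) (hM : S.IsMultiplierX a n f g)
    (ha : IsSymbol a ca) (j : ℕ) (hs : 0 < s) {M : ℝ}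
    (hM0 : 0 ≤ M) (hle : ∫⁻ t in Ioi 0, ‖a t‖ₑ *
      ofReal (t ^ (n - 1) * √(S.defectSq e ρ y u (S.dX (n + j) (t + s) f))) ≤
        ofReal M) (h : τ.X) :
    ‖S.defect e ρ y u h (S.dX j s g)‖ ≤ √(S.defectSq e ρ y u h) * M := by
  obtain ⟨x, z⟩ := h
  induction z using Completion.induction_on with
  | hp =>
    refine isClosed_le ?_ ?_
    · unfold defect; fun_prop
    · unfold defectSq; fun_prop
  | ih z =>
    have h1 := hM.tendsto_frame S ha y (mulLeft (S.T 0 (x + z.val)) (S.evolve (u + ρ) y))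
      (u + ρ) 0 j hs
    have h2 := hM.tendsto_frame S ha y (mulLeft (S.T ρ (x + z.val)) (S.evolve u y)) u ρ j hs
    simp only [← frame_coe] at h1 h2; refine le_of_tendsto (h1.sub (h2.const_mul (e : ℂ))).norm ?_
    filter_upwards [eventually_trunc] with r hr
    have hc : ∀ (u v : ℝ≥0) (w : τ.L2), IntegrableOn (fun t => a t * (t ^ (n - 1) *
        ⟪w, S.frame y u v (S.dX (n + j) (t + s) f)⟫_ℂ)) (Ioc r.1 r.2) := fun u v w => by
      exact integrableOn_mul_of_continuousOn (ha.int _ _ hr.1) (ContinuousOn.mul (by fun_prop) (((innerSL ℂ w).continuous.comp (S.frame y u v).continuous).comp_continuousOn ((S.continuousOn_dX_add _ hs f).mono fun t ht => hr.1.le.trans ht.1)))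
    simp only [mul_assoc]
    rw [← integral_const_mul, ← integral_sub (hc _ _ _) ((hc _ _ _).const_mul _)]
    have hb : ∀ t ∈ Ioc r.1 r.2, ‖a t * (t ^ (n - 1) * ⟪S.frame y (u + ρ) 0 (x, (z : τ.L2)),
        S.frame y (u + ρ) 0 (S.dX (n + j) (t + s) f)⟫_ℂ) - e * (a t * (t ^ (n - 1) *
        ⟪S.frame y u ρ (x, (z : τ.L2)), S.frame y u ρ (S.dX (n + j) (t + s) f)⟫_ℂ))‖ₑ ≤
        ofReal (√(S.defectSq e ρ y u (x, (z : τ.L2)))) * (‖a t‖ₑ * ofReal (t ^ (n - 1) *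
          √(S.defectSq e ρ y u (S.dX (n + j) (t + s) f)))) := by
      intro t ht
      have ht0 := hr.1.trans ht.1
      have e1 : a t * (t ^ (n - 1) * ⟪S.frame y (u + ρ) 0 (x, (z : τ.L2)),
        S.frame y (u + ρ) 0 (S.dX (n + j) (t + s) f)⟫_ℂ) - e * (a t * (t ^ (n - 1) *
        ⟪S.frame y u ρ (x, (z : τ.L2)), S.frame y u ρ (S.dX (n + j) (t + s) f)⟫_ℂ)) =
        a t * (t ^ (n - 1) * S.defect e ρ y u (x, (z : τ.L2)) (S.dX (n + j) (t + s) f)) := by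
        rw [defect]; ring
      rw [e1, enorm_mul, mul_left_comm]; refine mul_le_mul' le_rfl ?_
      rw [← ofReal_mul (Real.sqrt_nonneg _), ← ofReal_norm]; refine ofReal_le_ofReal ?_
      rw [norm_mul, norm_pow, norm_real, norm_of_nonneg ht0.le, mul_left_comm]
      exact mul_le_mul_of_nonneg_left (S.norm_defect_le ρ y u he1 _ _) (by positivity)
    have h3 := (enorm_integral_le_lintegral_enorm (μ := volume.restrict (Ioc r.1 r.2)) _).trans
      (setLIntegral_mono' measurableSet_Ioc hb)
    rw [lintegral_const_mul' _ _ ofReal_ne_top, ← ofReal_norm] at h3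
    have h4 := h3.trans (mul_le_mul' le_rfl ((lintegral_mono_set
      (show Ioc r.1 r.2 ⊆ Ioi 0 from fun t ht => hr.1.trans ht.1)).trans hle))
    rw [← ofReal_mul (Real.sqrt_nonneg _)] at h4; exact (ofReal_le_ofReal_iff (by positivity)).1 h4

lemma ofReal_defectSq_multiplier_le (he1 : e ≤ 1) (hM : S.IsMultiplierX a n f g)
    (ha : IsSymbol a ca) (j : ℕ) (hs : 0 < s) :
    ofReal (S.defectSq e ρ y u (S.dX j s g)) ≤ (∫⁻ t in Ioi 0, ‖a t‖ₑ *
      ofReal (t ^ (n - 1) * √(S.defectSq e ρ y u (S.dX (n + j) (t + s) f)))) ^ 2 := by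
  set L := ∫⁻ t in Ioi 0, ‖a t‖ₑ *
    ofReal (t ^ (n - 1) * √(S.defectSq e ρ y u (S.dX (n + j) (t + s) f))) with hL
  rcases eq_or_ne L ∞ with h | h
  · rw [h]; simp
  have h1 := S.norm_defect_multiplier_le ρ y u he1 hM ha j hs ENNReal.toReal_nonneg
    (by rw [ofReal_toReal h]) (S.dX j s g)
  have hq := S.defectSq_nonneg ρ y u he1 (S.dX j s g)
  rw [defect_self, norm_real, norm_of_nonneg hq] at h1
  set q := S.defectSq e ρ y u (S.dX j s g)
  have h2 : √q ≤ L.toReal := by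
    rcases hq.eq_or_lt with h0 | h0
    · rw [← h0, Real.sqrt_zero]; exact ENNReal.toReal_nonneg
    · refine le_of_mul_le_mul_left ?_ (Real.sqrt_pos.2 h0); rwa [Real.mul_self_sqrt hq]
  have h3 : q ≤ L.toReal ^ 2 := by
    rw [← sq_sqrt hq]; exact pow_le_pow_left₀ (Real.sqrt_nonneg _) h2 2
  refine (ofReal_le_ofReal h3).trans (le_of_eq ?_)
  rw [ofReal_pow ENNReal.toReal_nonneg, ofReal_toReal h]

lemma ofReal_mul_defectSq_multiplier_le (hn : 1 ≤ n) (he1 : e ≤ 1) (hM : S.IsMultiplierX a n f g)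
    (ha : IsSymbol a ca) (j : ℕ) (hs : 0 < s) :
    ofReal s * ofReal (S.defectSq e ρ y u (S.dX j s g)) ≤ ofReal (ca ^ 2) *
      ∫⁻ v in Ioi s, ofReal (v ^ (2 * n)) *
        ofReal (S.defectSq e ρ y u (S.dX (n + j) v f)) := by
  set q : ℝ → ℝ := fun v => S.defectSq e ρ y u (S.dX (n + j) v f) with hq
  have hpre : (fun v => v - s) ⁻¹' Ioi 0 = Ioi s := by ext; simp
  have h1 := S.ofReal_defectSq_multiplier_le ρ y u he1 hM ha j hs
  have htr := (measurePreserving_sub_right volume s).setLIntegral_comp_preimage_emb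
    (measurableEmbedding_subRight s) (fun t => ‖a t‖ₑ * ofReal (t ^ (n - 1) * √(q (t + s)))) (Ioi 0)
  rw [hpre] at htr; simp at htr; rw [← htr] at h1
  have ham2 : AEStronglyMeasurable (fun v => a (v - s)) (volume.restrict (Ioi s)) := by
    have h := (measurePreserving_sub_right volume s).restrict_preimage (measurableSet_Ioi (a := 0))
    rw [hpre] at h; exact ha.meas.comp_measurePreserving h
  have h2 : ∫⁻ v in Ioi s, ‖a (v - s)‖ₑ * ofReal ((v - s) ^ (n - 1) * √(q v)) ≤
      ∫⁻ v in Ioi s, (‖a (v - s)‖ₑ / ofReal v) * ofReal (v ^ n * √(q v)) := by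
    refine setLIntegral_mono' measurableSet_Ioi fun v hv => ?_
    have hv0 := hs.trans hv
    have hvs : s < v := hv
    rw [ENNReal.mul_comm_div, ← ofReal_div_of_pos hv0]
    refine mul_le_mul' le_rfl (ofReal_le_ofReal ?_)
    obtain ⟨k, rfl⟩ := Nat.exists_eq_add_of_le' hn
    rw [Nat.add_sub_cancel, pow_succ, le_div_iff₀ hv0]
    have : (v - s) ^ k ≤ v ^ k := pow_le_pow_left₀ (by linarith) (by linarith) k
    have h3 := Real.sqrt_nonneg (q v)
    calc (v - s) ^ k * √(q v) * v ≤ v ^ k * √(q v) * v := by gcongr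
      _ = _ := by ring
  have h3 := lintegral_mul_sq_le
    (f := fun v => ‖a (v - s)‖ₑ / ofReal v) (g := fun v => ofReal (v ^ n * √(q v)))
    (ham2.enorm.div (by fun_prop)) (ENNReal.measurable_ofReal.comp_aemeasurable
      ((ContinuousOn.mul (by fun_prop) (((S.continuous_defectSq_prod e ρ y).comp (Continuous.prodMk_right u)).comp_continuousOn ((S.continuousOn_dX (n + j) f).mono (Ioi_subset_Ioi hs.le))).sqrt).aemeasurable measurableSet_Ioi))
  have e1 : ∫⁻ v in Ioi s, (‖a (v - s)‖ₑ / ofReal v) ^ 2 =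
      ∫⁻ v in Ioi s, ‖a (v - s)‖ₑ ^ 2 / ofReal (v ^ 2) := by
    refine setLIntegral_congr_fun measurableSet_Ioi fun v hv => ?_
    rw [div_eq_mul_inv, mul_pow, ← ENNReal.inv_pow, ofReal_pow (hs.trans hv).le, div_eq_mul_inv]
  have e2 : ∫⁻ v in Ioi s, ofReal (v ^ n * √(q v)) ^ 2 =
      ∫⁻ v in Ioi s, ofReal (v ^ (2 * n)) * ofReal (q v) := by
    refine setLIntegral_congr_fun measurableSet_Ioi fun v hv => ?_
    have hv0 := hs.trans hv
    rw [← ofReal_pow (by positivity), ← ofReal_mul (by positivity), mul_pow,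
      sq_sqrt ((fun v => S.defectSq_nonneg ρ y u he1 _) v), ← pow_mul, mul_comm n]
  rw [e1, e2] at h3
  calc _ ≤ ofReal s * ((∫⁻ v in Ioi s, ‖a (v - s)‖ₑ ^ 2 / ofReal (v ^ 2)) *
        ∫⁻ v in Ioi s, ofReal (v ^ (2 * n)) * ofReal (q v)) :=
        mul_le_mul' le_rfl (h1.trans ((pow_le_pow_left₀ zero_le h2 2).trans h3))
    _ ≤ _ := by
        rw [← mul_assoc]; exact mul_le_mul' (ha.bound s hs) le_rfl

/-- The constant in the estimates of averaged forms. -/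
def multiplierConst (n : ℕ) : ℝ := 192 * (pConst n * (4 / 3) ^ n) ^ 2

lemma lintegral_pAvg_multiplier_le (hn : 1 ≤ n) (he0 : 0 ≤ e) (he1 : e ≤ 1)
    (hΓ : ∀ (u v : ℝ≥0) (f : τ.X),
      S.defectSq e ρ y u (S.TX v f) ≤ S.defectSq e ρ y (u + v) f)
    (hM : S.IsMultiplierX a n f g) (ha : IsSymbol a ca) (j : ℕ) {b : ℝ≥0∞} (hb : ∀ t, 0 < t →
      ∫⁻ s in Ioo 0 t, ofReal s * pAvg (S.defectFun e ρ y j f) t s ≤ b)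
    (ht : 0 < t) :
    ∫⁻ s in Ioo 0 t, ofReal s * pAvg (S.defectFun e ρ y j g) t s ≤
      ofReal (multiplierConst n * ca ^ 2) * b := by
  set C := (pConst n * (4 / 3) ^ n) ^ 2 with hC
  refine (lintegral_pAvg_le (S.measurable_defectFun e ρ y j f)
    (K := ofReal (C * ca ^ 2)) (fun u s hu hs => ?_) hb ht).trans (le_of_eq ?_)
  swap
  · rw [multiplierConst, ← hC, mul_assoc (192 : ℝ), ofReal_mul (by norm_num : (0 : ℝ) ≤ 192),
      ofReal_ofNat]
  rw [defectFun, if_pos hs]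
  refine (S.ofReal_mul_defectSq_multiplier_le ρ y u.toNNReal hn he1 hM ha j hs).trans ?_
  rw [mul_comm C, ofReal_mul (by positivity), mul_assoc,
    ← lintegral_const_mul' (ofReal C) _ ofReal_ne_top]
  refine mul_le_mul' le_rfl (setLIntegral_mono' measurableSet_Ioi fun v hv => ?_)
  have hv0 := hs.trans hv
  have e1 : S.defectSq e ρ y u.toNNReal (S.dX (n + j) v f) =
      S.defectSq e ρ y u.toNNReal (S.dX n (3 / 4 * v) (S.dX j (v / 4) f)) := by
    rw [S.defectSq_dX_dX ρ y u.toNNReal n j (by positivity) (by positivity)]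
    congr 2; ring
  have h2 := S.ofReal_defectSq_dX_le ρ y u.toNNReal he0 he1 hΓ n (show 0 < 3 / 4 * v by positivity)
    (S.dX j (v / 4) f)
  rw [e1]; refine (mul_le_mul' le_rfl h2).trans ?_; rw [← mul_assoc, ← ofReal_mul (by positivity)]
  refine mul_le_mul' (le_of_eq ?_) (le_of_eq ?_)
  · congr 1; rw [hC]
    have hv : v ^ (2 * n) = ((3 / 4 * v) ^ n * (4 / 3) ^ n) ^ 2 := by
      rw [← mul_pow, ← pow_mul, mul_comm n]; congr 1; ring
    rw [hv]; field_simp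
  · rw [pAvg, show 3 / 4 * v / 2 = 3 / 8 * v by ring]
    refine setLIntegral_congr_fun measurableSet_Ioi fun r hr => ?_; simp only [defectFun]
    rw [if_pos (by positivity), toNNReal_add hu.le (le_of_lt hr)]

end StandardSemigroup

lemma norm_taylor_two_le {E : Type*} [NormedAddCommGroup E] [NormedSpace ℝ E] {F F1 F2 : ℝ → E}
    (h1 : ∀ q, HasDerivAt F (F1 q) q) (h2 : ∀ q, HasDerivAt F1 (F2 q) q) (hK0 : 0 ≤ K)
    (hK : ∀ q, 0 ≤ q → ‖F2 q‖ ≤ K) {q : ℝ} (hq : 0 ≤ q) :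
    ‖F q - F 0 - q • F1 0‖ ≤ K * q ^ 2 := by
  have e1 : ∀ x ∈ Icc 0 q, ‖F1 x - F1 0‖ ≤ K * q := by
    intro x hx
    refine ((convex_Ici 0).norm_image_sub_le_of_norm_hasDerivWithin_le
      (fun z _ => (h2 z).hasDerivWithinAt) hK (mem_Ici.2 le_rfl) (mem_Ici.2 hx.1)).trans ?_
    rw [sub_zero, norm_of_nonneg hx.1]; exact mul_le_mul_of_nonneg_left hx.2 hK0
  have h3 := (convex_Icc 0 q).norm_image_sub_le_of_norm_hasDerivWithin_le
    (f := fun x => F x - x • F1 0) (f' := fun x => F1 x - F1 0)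
    (fun z _ => by
      have := (h1 z).sub ((hasDerivAt_id z).smul_const (F1 0))
      rw [one_smul] at this; exact this.hasDerivWithinAt)
    e1 (left_mem_Icc.2 hq) (right_mem_Icc.2 hq)
  simp only [zero_smul, sub_zero, norm_of_nonneg hq] at h3
  calc _ = ‖F q - q • F1 0 - F 0‖ := by congr 1; abel
    _ ≤ _ := h3.trans (le_of_eq (by ring))

lemma abs_norm_sq_taylor_le {E : Type*} [NormedAddCommGroup E] [InnerProductSpace ℂ E]
    {a b d : E} {K M q : ℝ} (hK : 0 ≤ K) (hq : 0 ≤ q) (hq1 : q ≤ 1) (hb : ‖b‖ ≤ M) (hd : ‖d‖ ≤ M)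
    (h : ‖a - b + q • d‖ ≤ K * q ^ 2) :
    |‖a‖ ^ 2 - ‖b‖ ^ 2 + 2 * q * (⟪d, b⟫_ℂ).re| ≤ (M + K) ^ 2 * 4 * q ^ 2 := by
  set e := a - b + q • d with he
  have hM := (norm_nonneg _).trans hb
  have ha : a = (b - q • d) + e := by rw [he]; abel
  have hc : ‖b - q • d‖ ≤ 2 * M := by
    refine (norm_sub_le _ _).trans ?_; rw [norm_smul, norm_of_nonneg hq]; nlinarith [norm_nonneg d]
  have h1 := norm_add_sq (𝕜 := ℂ) (b - q • d) e
  have h2 := norm_sub_sq (𝕜 := ℂ) b (q • d)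
  rw [← ha] at h1
  have h3 : ⟪b, q • d⟫_ℂ = q * ⟪b, d⟫_ℂ := by simp
  have h4 : (⟪b, d⟫_ℂ).re = (⟪d, b⟫_ℂ).re := by
    rw [← inner_conj_symm, Complex.conj_re]
  rw [h3] at h2
  simp only [RCLike.re_to_complex, re_ofReal_mul, h4, norm_smul, norm_of_nonneg hq] at h1 h2
  have h6 : ‖e‖ ^ 2 ≤ K ^ 2 * q ^ 2 := by
    calc ‖e‖ ^ 2 ≤ (K * q ^ 2) ^ 2 := by gcongr
      _ = K ^ 2 * q ^ 2 * q ^ 2 := by ring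
      _ ≤ K ^ 2 * q ^ 2 * 1 := by gcongr; nlinarith
      _ = _ := by ring
  have h7 : ‖d‖ ^ 2 ≤ M ^ 2 := by gcongr
  have e1 : ‖a‖ ^ 2 - ‖b‖ ^ 2 + 2 * q * (⟪d, b⟫_ℂ).re =
      q ^ 2 * ‖d‖ ^ 2 + 2 * (⟪b - q • d, e⟫_ℂ).re + ‖e‖ ^ 2 := by
    rw [h1, h2]; ring
  have h8 := abs_le.1 ((Complex.abs_re_le_norm _).trans ((norm_inner_le_norm _ _).trans (mul_le_mul hc h (norm_nonneg _) (by positivity))))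
  rw [abs_le]
  constructor <;> nlinarith [sq_nonneg ‖e‖]

namespace StandardSemigroup

variable (S : StandardSemigroup τ)

lemma ofReal_integral_pDensity {q : ℝ → ℝ} (hq : Continuous q) (h0 : ∀ u, 0 ≤ q u)
    (hK : ∀ u, q u ≤ K) (ht : 0 < t) :
    ofReal (∫ u in Ioi 0, 𝔭 t u * q u) =
      ∫⁻ u in Ioi 0, ofReal (𝔭 t u) * ofReal (q u) := by
  have hi : IntegrableOn (fun u => 𝔭 t u * q u) (Ioi 0) :=
    integrableOn_smul_bdd (integrableOn_pDensity ht) hq.aestronglyMeasurable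
      fun u => by rw [norm_of_nonneg (h0 u)]; exact hK u
  rw [ofReal_integral_eq_lintegral_ofReal hi]
  · exact setLIntegral_congr_fun measurableSet_Ioi fun u hu =>
      ofReal_mul (pDensity_nonneg ht.le (le_of_lt hu))
  · exact (ae_restrict_iff' measurableSet_Ioi).2 (.of_forall fun u hu =>
      mul_nonneg (pDensity_nonneg ht.le (le_of_lt hu)) (h0 u))

/-- The `φ_t`-average of `defectSq`. -/
def defectAvg (e : ℝ) (ρ : ℝ≥0) (y : τ.PreL2) (t : ℝ) (f : τ.X) : ℝ :=
  ∫ u in Ioi 0, 𝔭 t u * S.defectSq e ρ y u.toNNReal f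

/-- The `φ_t`-average of `‖T_v(f) y_u‖²`. -/
def normAvg (v : ℝ≥0) (y : τ.PreL2) (t : ℝ) (f : τ.X) : ℝ :=
  ∫ u in Ioi 0, 𝔭 t u * ‖S.frame y u.toNNReal v f‖ ^ 2

lemma continuous_defectSq_toNNReal (e : ℝ) (ρ : ℝ≥0) (y : τ.PreL2) (f : τ.X) :
    Continuous fun u : ℝ => S.defectSq e ρ y u.toNNReal f :=
  (S.continuous_defectSq_prod e ρ y).comp (f := fun u : ℝ => (u.toNNReal, f)) (by fun_prop)

lemma ofReal_defectAvg (he0 : 0 ≤ e) (he1 : e ≤ 1) (ρ : ℝ≥0) (y : τ.PreL2) (j : ℕ)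
    (ht : 0 < t) (hs : 0 < s) (f : τ.X) :
    ofReal (S.defectAvg e ρ y t (S.dX j s f)) = pAvg (S.defectFun e ρ y j f) t s := by
  rw [defectAvg, ofReal_integral_pDensity (S.continuous_defectSq_toNNReal e ρ y _)
    (fun u => S.defectSq_nonneg ρ y _ he1 _) (fun u => S.defectSq_le ρ y _ he0 _) ht, pAvg]
  simp only [defectFun, if_pos hs]

lemma integrableOn_norm_frame_sq (hψ : IntegrableOn ψ (Ioi 0)) (v : ℝ≥0) (y : τ.PreL2)
    (f : τ.X) : IntegrableOn (fun u => ψ u * ‖S.frame y u.toNNReal v f‖ ^ 2) (Ioi 0) := by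
  refine integrableOn_smul_bdd (K := ((‖y‖ + ‖y.val‖) * ‖f‖) ^ 2) hψ
    (((S.continuous_norm_frame_prod y v).comp (f := fun u : ℝ => (u.toNNReal, f)) (by fun_prop)).pow 2).aestronglyMeasurable fun u => ?_
  rw [norm_of_nonneg (by positivity)]
  gcongr; exact S.norm_frame_le _ _ _ _

lemma defectAvg_one (ρ : ℝ≥0) (y : τ.PreL2) (ht : 0 < t) (f : τ.X) :
    S.defectAvg 1 ρ y t f = S.normAvg 0 (S.evolve ρ y) t f - S.normAvg ρ y t f := by
  have h := integrableOn_pDensity ht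
  rw [normAvg, normAvg, ← integral_sub (S.integrableOn_norm_frame_sq h _ _ _)
    (S.integrableOn_norm_frame_sq h _ _ _), defectAvg]
  refine integral_congr_ae (.of_forall fun u => ?_); simp only [defectSq, frame_evolve]; ring

lemma re_W (m : ℕ) (ht : 0 < t) (f g : τ.X) (y : τ.PreL2) :
    (S.W m t f g y).re = ∫ u in Ioi 0, pDeriv m t u * (S.frameInner y f g u).re := by
  have h := Complex.reCLM.integral_comp_comm
    (S.integrableOn_frameInner (integrableOn_pDeriv m ht) y f g)
  refine h.symm.trans (integral_congr_ae (.of_forall fun u => ?_)); simp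

lemma re_frameInner_self (y : τ.PreL2) (f : τ.X) (u : ℝ) :
    (S.frameInner y f f u).re = ‖S.frame y u.toNNReal 0 f‖ ^ 2 := by
  rw [frameInner, inner_self_eq_norm_sq_to_K]; norm_cast

lemma re_W_self (ht : 0 < t) (f : τ.X) (y : τ.PreL2) :
    (S.W 0 t f f y).re = S.normAvg 0 y t f := by
  simp only [re_W S 0 ht, re_frameInner_self, normAvg, pDeriv_zero]

lemma normAvg_zero_eq_defectAvg (y : τ.PreL2) (t : ℝ) (f : τ.X) :
    S.normAvg 0 y t f = S.defectAvg 0 0 y t f := by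
  simp [normAvg, defectAvg, defectSq]

lemma defectSq_zero_TX_le (y : τ.PreL2) (u v : ℝ≥0) (f : τ.X) :
    S.defectSq 0 0 y u (S.TX v f) ≤ S.defectSq 0 0 y (u + v) f := by
  have h := pow_le_pow_left₀ (norm_nonneg _) (S.norm_frame_add_le y u v 0 f) 2
  simpa [defectSq, frame_TX] using h

lemma rpow_half_ofReal_mul {C ca : ℝ} (hC : 0 ≤ C) (hca : 0 ≤ ca) (b : ℝ≥0∞) :
    (ofReal (C * ca ^ 2) * b) ^ (1 / 2 : ℝ) =
      ofReal √C * ofReal ca * b ^ (1 / 2 : ℝ) := by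
  rw [ENNReal.mul_rpow_of_nonneg _ _ (by norm_num), ENNReal.ofReal_rpow_of_nonneg (by positivity)
    (by norm_num), ← Real.sqrt_eq_rpow, Real.sqrt_mul hC, Real.sqrt_sq hca,
    ofReal_mul (by positivity)]

lemma multiplierConst_nonneg (n : ℕ) : 0 ≤ multiplierConst n := by
  unfold multiplierConst; positivity

lemma bmoPartialAux_multiplier_le (hn : 1 ≤ n)
    (hM : S.IsMultiplierX a n f g) (ha : IsSymbol a ca) :
    bmoPartialAux S.dX S.W g ≤
      ofReal √(multiplierConst n) * ofReal ca * bmoPartialAux S.dX S.W f := by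
  have key : ∀ (f : τ.X) t (y : τ.PreL2), 0 < t →
      ∫⁻ s in Ioo 0 t, ofReal (s * (S.W 0 t (S.dX 1 s f) (S.dX 1 s f) y).re) =
        ∫⁻ s in Ioo 0 t, ofReal s * pAvg (S.defectFun 0 0 y 1 f) t s := by
    intro f t y ht; refine setLIntegral_congr_fun measurableSet_Ioo fun s hs => ?_
    rw [ofReal_mul hs.1.le, S.re_W_self ht, normAvg_zero_eq_defectAvg,
      S.ofReal_defectAvg le_rfl zero_le_one 0 y 1 ht hs.1]
  unfold bmoPartialAux; rw [← rpow_half_ofReal_mul (multiplierConst_nonneg n) ha.pos.le]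
  refine ENNReal.rpow_le_rpow ?_ (by norm_num)
  refine iSup₂_le fun t ht => iSup₂_le fun y hy => ?_; refine (key g t y ht).trans_le ?_
  refine S.lintegral_pAvg_multiplier_le 0 y hn le_rfl zero_le_one
    (S.defectSq_zero_TX_le y) hM ha 1 (fun r hr => ?_) ht
  rw [← key f r y hr]; exact le_iSup₂_of_le r hr (le_iSup₂_of_le y hy le_rfl)

lemma norm_frame_taylor_le (y : τ.PreL2) (u : ℝ≥0) (hs : 0 < s) (f : τ.X) {q : ℝ}
    (hq : 0 ≤ q) : ‖S.frame y u q.toNNReal (S.dX 0 s f) - S.frame y u 0 (S.dX 0 s f) +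
      q • S.frame y u 0 (S.dX 2 s f)‖ ≤ (‖y‖ + ‖y.val‖) * ‖S.dX 4 s f‖ * q ^ 2 := by
  set F : ℝ → τ.L2 := fun x => S.frame y u x.toNNReal f
  have hF : Continuous F := by
    have := S.continuous_frame_toNNReal y u 0 f
    simpa only [zero_add] using this
  set G : ℕ → ℝ → τ.L2 := fun m q => ∫ r in Ioi 0, pDeriv m s r • F (r + q)
  have hG : ∀ m q, 0 ≤ q → G m q = S.frame y u q.toNNReal (S.dX m s f) := by
    intro m q hq; rw [S.frame_dX y u _ m hs]
    refine setIntegral_congr_fun measurableSet_Ioi fun r hr => ?_; simp only [F]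
    rw [toNNReal_add (hr).le hq, add_comm]
  have hd : ∀ m q, HasDerivAt (G m) (-G (m + 2) q) q := fun m q =>
    hasDerivAt_integral_translate hF.stronglyMeasurable (fun x => S.norm_frame_le _ _ _ _) m hs q
  have h := norm_taylor_two_le (hd 0) (fun q => by
    have := (hd 2 q).neg
    rwa [neg_neg] at this) (K := (‖y‖ + ‖y.val‖) * ‖S.dX 4 s f‖) (by positivity)
    (fun q hq => by rw [hG 4 q hq]; exact S.norm_frame_le _ _ _ _) hq
  rw [hG 0 q hq, hG 0 0 le_rfl, hG _ 0 le_rfl, Real.toNNReal_zero, smul_neg, sub_neg_eq_add] at h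
  exact h

lemma exists_abs_normAvg_taylor_le (y : τ.PreL2) (ht : 0 < t) (hs : 0 < s)
    (f : τ.X) : ∃ K : ℝ, ∀ (p : ℝ≥0) (q : ℝ), 0 ≤ q → q ≤ 1 →
      |S.normAvg q.toNNReal (S.evolve p y) t (S.dX 0 s f) - S.normAvg 0 (S.evolve p y) t (S.dX 0 s f)
        + 2 * q * (S.W 0 t (S.dX 2 s f) (S.dX 0 s f) (S.evolve p y)).re| ≤ K * q ^ 2 := by
  set c := ‖y‖ + ‖y.val‖ with hc
  set M := c * ‖S.dX 0 s f‖ + c * ‖S.dX 2 s f‖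
  set L := c * ‖S.dX 4 s f‖
  refine ⟨(M + L) ^ 2 * 4, fun p q hq hq1 => ?_⟩
  set z := S.evolve p y
  have hz : ‖z‖ + ‖z.val‖ ≤ c := by
    rw [hc, S.norm_evolve]; gcongr; exact S.norm_val_evolve_le p y
  have hφ := integrableOn_pDensity ht
  have i1 := S.integrableOn_norm_frame_sq hφ q.toNNReal z (S.dX 0 s f)
  have i2 := S.integrableOn_norm_frame_sq hφ 0 z (S.dX 0 s f)
  have i3 : IntegrableOn (fun u => 𝔭 t u *
      (S.frameInner z (S.dX 2 s f) (S.dX 0 s f) u).re) (Ioi 0) := by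
    have := (S.integrableOn_frameInner hφ z (S.dX 2 s f) (S.dX 0 s f)).re
    refine this.congr (.of_forall fun u => ?_); simp
  rw [re_W S 0 ht, normAvg, normAvg, ← integral_const_mul, ← integral_sub i1 i2]
  simp only [pDeriv_zero]
  have i12 : IntegrableOn (fun u => 𝔭 t u *
      ‖S.frame z u.toNNReal q.toNNReal (S.dX 0 s f)‖ ^ 2 -
      𝔭 t u * ‖S.frame z u.toNNReal 0 (S.dX 0 s f)‖ ^ 2) (Ioi 0) := i1.sub i2
  rw [← integral_add i12 (i3.const_mul _), ← norm_eq_abs]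
  refine (norm_integral_le_of_norm_le
    (hφ.mul_const _) ((ae_restrict_iff' measurableSet_Ioi).2 (.of_forall fun u hu => ?_))).trans
    (le_of_eq (by rw [integral_mul_const, integral_pDensity ht, one_mul]))
  have h0 := pDensity_nonneg ht.le (le_of_lt hu)
  have e1 : 𝔭 t u * ‖S.frame z u.toNNReal q.toNNReal (S.dX 0 s f)‖ ^ 2 -
      𝔭 t u * ‖S.frame z u.toNNReal 0 (S.dX 0 s f)‖ ^ 2 + 2 * q *
        (𝔭 t u * (S.frameInner z (S.dX 2 s f) (S.dX 0 s f) u).re) =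
      𝔭 t u * (‖S.frame z u.toNNReal q.toNNReal (S.dX 0 s f)‖ ^ 2 -
        ‖S.frame z u.toNNReal 0 (S.dX 0 s f)‖ ^ 2 + 2 * q *
          (S.frameInner z (S.dX 2 s f) (S.dX 0 s f) u).re) := by ring
  rw [e1, norm_mul, norm_of_nonneg h0]; refine mul_le_mul_of_nonneg_left ?_ h0
  refine abs_norm_sq_taylor_le (by positivity) hq hq1
    ((S.norm_frame_le _ _ _ _).trans ((mul_le_mul_of_nonneg_right hz (norm_nonneg _)).trans (le_add_of_nonneg_right (by positivity))))
    ((S.norm_frame_le _ _ _ _).trans ((mul_le_mul_of_nonneg_right hz (norm_nonneg _)).trans (le_add_of_nonneg_left (by positivity))))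
    ((S.norm_frame_taylor_le z _ hs f hq).trans ?_)
  gcongr; exact mul_le_mul_of_nonneg_right hz (norm_nonneg _)

/-- `W` along the translates of the test element. -/
def translateW (m : ℕ) (t : ℝ) (f g : τ.X) (y : τ.PreL2) (p : ℝ) : ℂ :=
  ∫ u in Ioi 0, pDeriv m t u • S.frameInner y f g (u + p)

lemma translateW_eq (m : ℕ) (t : ℝ) (f g : τ.X) (y : τ.PreL2) {p : ℝ} (hp : 0 ≤ p) :
    S.translateW m t f g y p = S.W m t f g (S.evolve p.toNNReal y) := by
  refine setIntegral_congr_fun measurableSet_Ioi fun u hu => ?_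
  simp only [frameInner, frame_evolve]; rw [toNNReal_add (hu).le hp]

lemma hasDerivAt_translateW (m : ℕ) (ht : 0 < t) (f g : τ.X) (y : τ.PreL2) (p : ℝ) :
    HasDerivAt (S.translateW m t f g y) (-S.translateW (m + 2) t f g y p) p :=
  hasDerivAt_integral_translate (S.continuous_frameInner y f g).stronglyMeasurable
    (S.norm_frameInner_le y f g) m ht p

lemma W_evolve_zero (m : ℕ) (t : ℝ) (f g : τ.X) (y : τ.PreL2) :
    S.W m t f g (S.evolve 0 y) = S.W m t f g y := by
  simp only [W, frameInt, frameInner, frame_evolve, add_zero]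

lemma defectSq_evolve (e : ℝ) (ρ p : ℝ≥0) (y : τ.PreL2) (u : ℝ≥0) (f : τ.X) :
    S.defectSq e ρ (S.evolve p y) u f = S.defectSq e ρ y (u + p) f := by
  simp only [defectSq, frame_evolve, add_right_comm u ρ p]

lemma defectAvg_evolve_zero (e : ℝ) (ρ : ℝ≥0) (y : τ.PreL2) (t : ℝ) (f : τ.X) :
    S.defectAvg e ρ (S.evolve 0 y) t f = S.defectAvg e ρ y t f := by
  simp only [defectAvg, defectSq_evolve, add_zero]

lemma re_W_symm (m : ℕ) (ht : 0 < t) (f g : τ.X) (y : τ.PreL2) :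
    (S.W m t f g y).re = (S.W m t g f y).re := by
  simp only [re_W S m ht]; refine integral_congr_ae (.of_forall fun u => ?_); simp only [frameInner]
  rw [← inner_conj_symm, Complex.conj_re]

lemma smearedGamma_eq (ht : 0 < t) (s : ℝ) (f : τ.X) (y : τ.PreL2) :
    smearedGamma S.dX S.W t s f y = (S.W 0 t (S.dX 2 s f) (S.dX 0 s f) y).re -
      (S.W 2 t (S.dX 0 s f) (S.dX 0 s f) y).re / 2 := by
  have h := S.re_W_symm 0 ht (S.dX 0 s f) (S.dX 2 s f) y
  have e : ∀ z : ℂ, (z / 2).re = z.re / 2 := fun z => by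
    rw [show 2 = ((2 : ℝ) : ℂ) by norm_num, Complex.div_ofReal_re]
  rw [smearedGamma, e, sub_re, Complex.add_re, h]; ring

lemma tendsto_defectAvg (ht : 0 < t) (hs : 0 < s) (f : τ.X) (y : τ.PreL2)
    {p : ℝ → ℝ} {p0 : ℝ} (hp : Tendsto p (𝓝[>] 0) (𝓝 p0)) (hp0 : ∀ᶠ r in 𝓝[>] 0, 0 ≤ p r) :
    Tendsto (fun r : ℝ => (2 * r)⁻¹ *
        S.defectAvg 1 r.toNNReal (S.evolve (p r).toNNReal y) t (S.dX 0 s f))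
      (𝓝[>] 0) (𝓝 (smearedGamma S.dX S.W t s f (S.evolve p0.toNNReal y))) := by
  have hp00 := ge_of_tendsto hp hp0
  set h := S.dX 0 s f with hh
  set A : ℝ → ℝ := fun x => (S.translateW 0 t h h y x).re
  set w : ℝ → ℝ := fun x => (S.translateW 0 t (S.dX 2 s f) h y x).re
  have hA : ∀ x, HasDerivAt A (-(S.translateW 2 t h h y x).re) x := fun x => by
    have h1 := Complex.reCLM.hasFDerivAt.comp_hasDerivAt x (S.hasDerivAt_translateW 0 ht h h y x)
    exact h1.congr_deriv (by simp)
  have hc :=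
    fun m f g => Complex.continuous_re.comp
      (continuous_iff_continuousAt.2 fun x => (S.hasDerivAt_translateW m ht f g y x).continuousAt)
  have hr0 : Tendsto (fun r : ℝ => r) (𝓝[>] 0) (𝓝 0) := nhdsWithin_le_nhds
  obtain ⟨K, hK⟩ := S.exists_abs_normAvg_taylor_le y ht hs f
  have l1 : Tendsto (fun r => r⁻¹ * (A (p r + r) - A (p r))) (𝓝[>] 0)
      (𝓝 (-(S.translateW 2 t h h y p0).re)) := by
    have hpr : Tendsto (fun r => (p r + r, p r)) (𝓝[>] 0) (𝓝 (p0, p0)) := by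
      have := hp.add hr0
      rw [add_zero] at this; exact this.prodMk_nhds hp
    have h1 := (hasStrictDerivAt_of_hasDerivAt_of_continuousAt (.of_forall hA) (hc 2 h h).neg.continuousAt).hasStrictFDerivAt.isLittleO.comp_tendsto hpr
    have h2 := h1.tendsto_inv_smul_nhds_zero
    simp at h2
    have h3 := h2.add_const (-(S.translateW 2 t h h y p0).re)
    rw [zero_add] at h3; refine h3.congr' ?_
    filter_upwards [self_mem_nhdsWithin] with r hr
    have hr : 0 < r := hr
    field_simp; ring
  have l2 : Tendsto (fun r => w (p r)) (𝓝[>] 0) (𝓝 (w p0)) := ((hc 0 _ _).tendsto p0).comp hp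
  have l3 : Tendsto (fun r => r⁻¹ * (S.normAvg r.toNNReal (S.evolve (p r).toNNReal y) t h -
      S.normAvg 0 (S.evolve (p r).toNNReal y) t h + 2 * r * w (p r))) (𝓝[>] 0) (𝓝 0) := by
    refine squeeze_zero_norm' ?_ (by simpa using hr0.const_mul K)
    filter_upwards [self_mem_nhdsWithin, hp0, hr0.eventually_le_const one_pos] with r hr hpr hr1
    have hr : 0 < r := hr
    have h1 := hK (p r).toNNReal r hr.le hr1
    rw [norm_mul, norm_of_nonneg (inv_nonneg.2 hr.le), norm_eq_abs]; simp only [w]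
    rw [S.translateW_eq 0 t _ _ y hpr]
    calc _ ≤ r⁻¹ * (K * r ^ 2) := by gcongr
      _ = K * r := by field_simp
  have l4 := ((l1.const_mul 2⁻¹).sub (l3.const_mul 2⁻¹)).add l2
  have e1 : smearedGamma S.dX S.W t s f (S.evolve p0.toNNReal y) =
      2⁻¹ * -(S.translateW 2 t h h y p0).re - 2⁻¹ * 0 + w p0 := by
    rw [S.smearedGamma_eq ht, ← hh, ← S.translateW_eq 2 t _ _ y hp00,
      ← S.translateW_eq 0 t _ _ y hp00]
    ring
  rw [e1]; refine l4.congr' ?_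
  filter_upwards [self_mem_nhdsWithin, hp0] with r hr hpr
  have hr : 0 < r := hr
  have e2 : A (p r + r) = S.normAvg 0 (S.evolve r.toNNReal (S.evolve (p r).toNNReal y)) t h := by
    simp only [A]; rw [S.translateW_eq 0 t h h y (by positivity), S.re_W_self ht]
    simp only [normAvg, frame_evolve]; rw [toNNReal_add hpr hr.le]
    simp only [add_comm (p r).toNNReal, add_assoc]
  have e3 : A (p r) = S.normAvg 0 (S.evolve (p r).toNNReal y) t h := by
    simp only [A]; rw [S.translateW_eq 0 t h h y hpr, S.re_W_self ht]
  rw [S.defectAvg_one _ _ ht, e2, e3]; field_simp; ring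

lemma tendsto_defectAvg_self (ht : 0 < t) (hs : 0 < s) (f : τ.X) (y : τ.PreL2) :
    Tendsto (fun r : ℝ => (2 * r)⁻¹ * S.defectAvg 1 r.toNNReal y t (S.dX 0 s f))
      (𝓝[>] 0) (𝓝 (smearedGamma S.dX S.W t s f y)) := by
  have h := S.tendsto_defectAvg ht hs f y tendsto_const_nhds (.of_forall fun _ => le_rfl)
  simp only [Real.toNNReal_zero, defectAvg_evolve_zero] at h
  simpa only [smearedGamma, W_evolve_zero] using h

/-- `Γ² ≥ 0` in integrated form. -/
def GammaSqX : Prop := ∀ (ρ : ℝ≥0) (y : τ.PreL2) (u v : ℝ≥0) (f : τ.X),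
  S.defectSq 1 ρ y u (S.TX v f) ≤ S.defectSq 1 ρ y (u + v) f

variable {S}

lemma GammaSqX.defectSq_succ_le (hΓ : S.GammaSqX) (ρ : ℝ≥0) (y : τ.PreL2) (f : τ.X) (m : ℕ)
    (u : ℝ≥0) : S.defectSq 1 ((m + 1 : ℕ) * ρ) y u f ≤
      (m + 1 : ℕ) * S.defectSq 1 ρ y (u + m * ρ) f := by
  induction m generalizing u with
  | zero => simp
  | succ m ih =>
    have h1 := ih (u + ρ)
    have h2 := hΓ ρ y u ((m + 1 : ℕ) * ρ) f
    have e1 : u + ρ + m * ρ = u + (m + 1 : ℕ) * ρ := by push_cast; ring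
    rw [e1] at h1
    have e2 : S.defectSq 1 ((m + 1 + 1 : ℕ) * ρ) y u f =
        S.defectSq 1 ((m + 1 : ℕ) * ρ) y (u + ρ) f +
          S.defectSq 1 ρ y u (S.TX ((m + 1 : ℕ) * ρ) f) := by
      simp only [defectSq, frame_TX]
      have e3 : u + ρ + ((m + 1 : ℕ) : ℝ≥0) * ρ = u + ((m + 1 + 1 : ℕ) : ℝ≥0) * ρ := by push_cast; ring
      have e4 : ρ + ((m + 1 : ℕ) : ℝ≥0) * ρ = ((m + 1 + 1 : ℕ) : ℝ≥0) * ρ := by push_cast; ring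
      rw [e3, e4, zero_add]; ring
    push_cast at *; linarith

lemma integrableOn_defectSq (hψ : IntegrableOn ψ (Ioi 0)) (he0 : 0 ≤ e)
    (he1 : e ≤ 1) (ρ : ℝ≥0) (y : τ.PreL2) (f : τ.X) :
    IntegrableOn (fun u => ψ u * S.defectSq e ρ y u.toNNReal f) (Ioi 0) :=
  integrableOn_smul_bdd hψ
    (S.continuous_defectSq_toNNReal e ρ y f).aestronglyMeasurable fun u => by
      rw [norm_of_nonneg (S.defectSq_nonneg ρ y _ he1 f)]; exact S.defectSq_le ρ y _ he0 f

lemma GammaSqX.defectAvg_le (hΓ : S.GammaSqX) (ht : 0 < t) (hs : 0 < s) (f : τ.X)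
    (y : τ.PreL2) (hr : 0 < r) : (2 * r)⁻¹ * S.defectAvg 1 r.toNNReal y t (S.dX 0 s f) ≤
      smearedGamma S.dX S.W t s f (S.evolve r.toNNReal y) := by
  have hp : Tendsto (fun ρ => r - ρ) (𝓝[>] 0) (𝓝 r) := by
    have : Continuous fun ρ => r - ρ := by fun_prop
    simpa using (this.tendsto 0).mono_left nhdsWithin_le_nhds
  have h1 := S.tendsto_defectAvg ht hs f y hp ((hp.eventually_const_lt hr).mono fun _ h => le_of_lt h)
  have hm : Tendsto (fun m => r / (m + 1 : ℕ)) atTop (𝓝[>] 0) := by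
    refine tendsto_nhdsWithin_iff.2 ⟨?_, Eventually.of_forall fun m => by
      have : (0 : ℝ) < (m + 1 : ℕ) := by positivity
      exact div_pos hr this⟩
    exact (tendsto_add_atTop_iff_nat 1).2 (tendsto_const_div_atTop_nhds_zero_nat r)
  refine ge_of_tendsto' (h1.comp hm) fun m => ?_
  set ρ : ℝ≥0 := (r / (m + 1 : ℕ)).toNNReal with hρ
  have hρr : ((m + 1 : ℕ) : ℝ≥0) * ρ = r.toNNReal := by
    rw [hρ, Real.toNNReal_div hr.le, Real.toNNReal_natCast]; exact mul_div_cancel₀ _ (by positivity)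
  have hρ2 : (r - r / (m + 1 : ℕ)).toNNReal = m * ρ := by
    rw [hρ, ← Real.toNNReal_natCast m, ← Real.toNNReal_mul (by positivity)]
    congr 1; push_cast; field_simp; ring
  have h2 : S.defectAvg 1 r.toNNReal y t (S.dX 0 s f) ≤
      (m + 1 : ℕ) * S.defectAvg 1 ρ (S.evolve (m * ρ) y) t (S.dX 0 s f) := by
    have hφ := integrableOn_pDensity ht
    rw [defectAvg, defectAvg, ← integral_const_mul]
    refine setIntegral_mono_on (integrableOn_defectSq hφ zero_le_one le_rfl _ _ _)
      ((integrableOn_defectSq hφ zero_le_one le_rfl _ _ _).const_mul _) measurableSet_Ioi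
      fun u hu => ?_
    rw [defectSq_evolve, ← hρr, mul_left_comm]
    exact mul_le_mul_of_nonneg_left (hΓ.defectSq_succ_le ρ y _ m _)
      (pDensity_nonneg ht.le (le_of_lt hu))
  simp only [Function.comp_apply]; rw [hρ2]
  calc _ ≤ (2 * r)⁻¹ * ((m + 1 : ℕ) * S.defectAvg 1 ρ (S.evolve (m * ρ) y) t (S.dX 0 s f)) := by
        gcongr
    _ = _ := by rw [hρ]; field_simp

lemma defectAvg_nonneg (ht : 0 < t) (he1 : e ≤ 1) (ρ : ℝ≥0) (y : τ.PreL2)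
    (f : τ.X) : 0 ≤ S.defectAvg e ρ y t f :=
  setIntegral_nonneg measurableSet_Ioi fun _ hu =>
    mul_nonneg (pDensity_nonneg ht.le (le_of_lt hu)) (S.defectSq_nonneg _ _ _ he1 _)

lemma GammaSqX.bmoGammaAux_multiplier_le (hΓ : S.GammaSqX)
    (hn : 1 ≤ n) (hM : S.IsMultiplierX a n f g)
    (ha : IsSymbol a ca) :
    bmoGammaAux S.dX S.W g ≤
      ofReal √(multiplierConst n) * ofReal ca * bmoGammaAux S.dX S.W f := by
  unfold bmoGammaAux; rw [← rpow_half_ofReal_mul (multiplierConst_nonneg n) ha.pos.le]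
  refine ENNReal.rpow_le_rpow ?_ (by norm_num)
  refine iSup₂_le fun t ht => iSup₂_le fun y hy => ?_
  set b := ⨆ (t : ℝ) (_ : 0 < t), opNorm fun y =>
    ∫⁻ s in Ioo 0 t, ofReal (s * smearedGamma S.dX S.W t s f y) with hb
  set r : ℕ → ℝ := fun k => 1 / ((k : ℝ) + 1)
  have hr0 : ∀ k, 0 < r k := fun k => by positivity
  set F : ℕ → ℝ → ℝ≥0∞ := fun k s => ofReal (2 * r k)⁻¹ * (ofReal s *
    pAvg (S.defectFun 1 (r k).toNNReal y 0 g) t s)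
  have hF : ∀ k, Measurable (F k) := fun k => by
    have h1 := (measurable_pAvg (S.measurable_defectFun 1 (r k).toNNReal y 0 g)).comp
      (measurable_prodMk_left (x := t))
    exact (ENNReal.measurable_ofReal.mul h1).const_mul _
  have h1 : ∫⁻ s in Ioo 0 t, ofReal (s * smearedGamma S.dX S.W t s g y) ≤
      ∫⁻ s in Ioo 0 t, liminf (fun k => F k s) atTop := by
    refine setLIntegral_mono' measurableSet_Ioo fun s hs => le_of_eq ?_
    refine (Tendsto.liminf_eq ?_).symm
    have h2 := (S.tendsto_defectAvg_self ht hs.1 g y).comp (tendsto_nhdsWithin_iff.2 ⟨tendsto_one_div_add_atTop_nhds_zero_nat, Eventually.of_forall hr0⟩)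
    refine (tendsto_ofReal (h2.const_mul s)).congr fun k => ?_; simp only [F, Function.comp_apply]
    rw [← S.ofReal_defectAvg zero_le_one le_rfl _ _ _ ht hs.1, ← ofReal_mul hs.1.le,
      ← ofReal_mul (by have := hr0 k; positivity)]
    congr 1; ring
  refine h1.trans ((lintegral_liminf_le hF).trans ?_)
  refine liminf_le_of_le (by isBoundedDefault) fun c hc => ?_
  obtain ⟨k, hk⟩ := hc.exists
  refine hk.trans ?_
  have hk0 := hr0 k
  have h3 := S.lintegral_pAvg_multiplier_le (r k).toNNReal y hn zero_le_one le_rfl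
    (hΓ _ y) hM ha 0 (b := ofReal (2 * r k) * b) (fun t' ht' => ?_) ht
  · calc _ = ofReal (2 * r k)⁻¹ * ∫⁻ s in Ioo 0 t, ofReal s *
          pAvg (S.defectFun 1 (r k).toNNReal y 0 g) t s :=
          lintegral_const_mul' _ _ ofReal_ne_top
      _ ≤ ofReal (2 * r k)⁻¹ * (ofReal (multiplierConst n * ca ^ 2) *
          (ofReal (2 * r k) * b)) := mul_le_mul' le_rfl h3
      _ = ofReal (2 * r k)⁻¹ * ofReal (2 * r k) *
          (ofReal (multiplierConst n * ca ^ 2) * b) := by ring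
      _ = _ := by
        rw [← ofReal_mul (by positivity), inv_mul_cancel₀ (by positivity),
          ENNReal.ofReal_one, one_mul]
  · have h4 : ∫⁻ s in Ioo 0 t', ofReal (s *
        smearedGamma S.dX S.W t' s f (S.evolve (r k).toNNReal y)) ≤ b :=
      le_iSup₂_of_le t' ht' (le_iSup₂_of_le _
          (by rwa [S.norm_evolve]) le_rfl)
    refine le_trans ?_ (mul_le_mul' le_rfl h4); rw [← lintegral_const_mul' _ _ ofReal_ne_top]
    refine setLIntegral_mono' measurableSet_Ioo fun s hs => ?_
    rw [← S.ofReal_defectAvg zero_le_one le_rfl _ _ _ ht' hs.1, ← ofReal_mul hs.1.le,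
      ← ofReal_mul (by positivity)]
    refine ofReal_le_ofReal ?_
    have h5 := hΓ.defectAvg_le ht' hs.1 f y hk0
    rw [inv_mul_le_iff₀ (by positivity)] at h5
    calc _ ≤ s * (2 * r k * _) := mul_le_mul_of_nonneg_left h5 hs.1.le
      _ = _ := by ring

end StandardSemigroup

lemma norm_add_sq_add_norm_sub_smul_sq {E : Type*} [NormedAddCommGroup E] [InnerProductSpace ℂ E]
    (a b : E) {η : ℝ} (hη : 0 < η) : ‖a + b‖ ^ 2 + η⁻¹ * ‖a - (η : ℂ) • b‖ ^ 2 =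
      (1 + η⁻¹) * ‖a‖ ^ 2 + (1 + η) * ‖b‖ ^ 2 := by
  rw [norm_add_sq (𝕜 := ℂ), norm_sub_sq (𝕜 := ℂ), inner_smul_right, norm_smul, norm_real,
    norm_of_nonneg hη.le]
  simp; field_simp; ring

namespace StandardSemigroup

variable (S : StandardSemigroup τ)

lemma defectSq_add_le (he1 : e ≤ 1) (ρ : ℝ≥0) (y : τ.PreL2) (u : ℝ≥0) (f g : τ.X)
    {η : ℝ} (hη : 0 < η) : S.defectSq e ρ y u (f + g) ≤
      (1 + η⁻¹) * S.defectSq e ρ y u f + (1 + η) * S.defectSq e ρ y u g := by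
  have h := S.defectSq_nonneg ρ y u he1 (f - η • g)
  have h1 := norm_add_sq_add_norm_sub_smul_sq (S.frame y (u + ρ) 0 f) (S.frame y (u + ρ) 0 g) hη
  have h2 := norm_add_sq_add_norm_sub_smul_sq (S.frame y u ρ f) (S.frame y u ρ g) hη
  have h3 : 0 ≤ η⁻¹ * S.defectSq e ρ y u (f - (η : ℂ) • g) := mul_nonneg (by positivity) h
  simp only [defectSq, _root_.map_sub, _root_.map_smul, _root_.map_add] at h3 ⊢
  linear_combination h3 + h1 - e * h2

lemma frame_dX_add (y : τ.PreL2) (u v : ℝ≥0) (m : ℕ) (hs : 0 < s) (f g : τ.X) :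
    S.frame y u v (S.dX m s (f + g)) = S.frame y u v (S.dX m s f + S.dX m s g) := by
  have h := integrableOn_pDeriv m hs
  rw [_root_.map_add, S.frame_dX y u v m hs, S.frame_dX y u v m hs, S.frame_dX y u v m hs,
    ← integral_add (S.integrableOn_frame h y u v f) (S.integrableOn_frame h y u v g)]
  simp

lemma frame_dX_neg (y : τ.PreL2) (u v : ℝ≥0) (m : ℕ) (hs : 0 < s) (f : τ.X) :
    S.frame y u v (S.dX m s (-f)) = -S.frame y u v (S.dX m s f) := by
  rw [S.frame_dX y u v m hs, S.frame_dX y u v m hs, ← integral_neg]; simp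

lemma defectAvg_congr (ρ : ℝ≥0) (y : τ.PreL2) (t : ℝ)
    (h : ∀ u v, S.frame y u v f = S.frame y u v g) :
    S.defectAvg e ρ y t f = S.defectAvg e ρ y t g := by
  simp only [defectAvg, S.defectSq_congr ρ y _ h]

lemma defectAvg_dX_add_le (he0 : 0 ≤ e) (he1 : e ≤ 1) (ρ : ℝ≥0) (y : τ.PreL2) (j : ℕ)
    (ht : 0 < t) (hs : 0 < s) (f g : τ.X) {η : ℝ} (hη : 0 < η) :
    S.defectAvg e ρ y t (S.dX j s (f + g)) ≤ (1 + η⁻¹) * S.defectAvg e ρ y t (S.dX j s f) +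
      (1 + η) * S.defectAvg e ρ y t (S.dX j s g) := by
  have hi := fun k => integrableOn_defectSq (S := S) (integrableOn_pDensity ht) he0 he1 ρ y k
  rw [S.defectAvg_congr ρ y t fun u v => S.frame_dX_add y u v j hs f g, defectAvg, defectAvg,
    defectAvg, ← integral_const_mul, ← integral_const_mul,
    ← integral_add ((hi _).const_mul _) ((hi _).const_mul _)]
  refine setIntegral_mono_on (hi _) (((hi _).const_mul _).add ((hi _).const_mul _))
    measurableSet_Ioi fun u hu => ?_
  have h := mul_le_mul_of_nonneg_left (S.defectSq_add_le he1 ρ y u.toNNReal (S.dX j s f)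
    (S.dX j s g) hη) (pDensity_nonneg ht.le (le_of_lt hu))
  refine h.trans (le_of_eq ?_); ring

lemma defectAvg_neg (ρ : ℝ≥0) (y : τ.PreL2) (j : ℕ) (t : ℝ) (hs : 0 < s)
    (f : τ.X) : S.defectAvg e ρ y t (S.dX j s (-f)) = S.defectAvg e ρ y t (S.dX j s f) := by
  simp only [defectAvg, defectSq, S.frame_dX_neg y _ _ j hs, norm_neg]

lemma defectAvg_mono_left (he0 : 0 ≤ e) (he1 : e ≤ 1) (ρ : ℝ≥0) (y : τ.PreL2)
    {t t' : ℝ} (ht : 0 < t) (htt : t ≤ t') (f : τ.X) :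
    S.defectAvg e ρ y t' f ≤ t' / t * S.defectAvg e ρ y t f := by
  rw [defectAvg, defectAvg, ← integral_const_mul]
  refine setIntegral_mono_on
    (integrableOn_defectSq (integrableOn_pDensity (ht.trans_le htt)) he0 he1 _ _ _)
    ((integrableOn_defectSq (integrableOn_pDensity ht) he0 he1 _ _ _).const_mul _)
    measurableSet_Ioi fun u hu => ?_
  rw [← mul_assoc]
  exact mul_le_mul_of_nonneg_right (pDensity_le ht htt hu) (S.defectSq_nonneg ρ y _ he1 _)

lemma defectAvg_dX_zero_le (he0 : 0 ≤ e) (he1 : e ≤ 1) (ρ : ℝ≥0) (y : τ.PreL2)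
    (hΓ : ∀ (u v : ℝ≥0) (f : τ.X),
      S.defectSq e ρ y u (S.TX v f) ≤ S.defectSq e ρ y (u + v) f)
    {t c : ℝ} (ht : 0 < t) (hc : 0 < c) (f : τ.X) :
    S.defectAvg e ρ y t (S.dX 0 c f) ≤ S.defectAvg e ρ y (t + c) f := by
  have hn := fun u f => S.defectSq_nonneg ρ y u he1 f
  have e1 : ∀ t f, 0 < t → ofReal (S.defectAvg e ρ y t f) = ∫⁻ u in Ioi 0,
      ofReal (𝔭 t u) * ofReal (S.defectSq e ρ y u.toNNReal f) :=
    fun t f ht => ofReal_integral_pDensity (S.continuous_defectSq_toNNReal e ρ y _)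
      (fun u => hn _ _) (fun u => S.defectSq_le ρ y _ he0 _) ht
  rw [← ofReal_le_ofReal_iff (defectAvg_nonneg (by positivity) he1 ρ y f), e1 _ _ ht,
    e1 _ _ (by positivity)]
  have hA : Measurable (Function.uncurry fun u _ : ℝ =>
      ofReal (S.defectSq e ρ y u.toNNReal f)) :=
    ((S.continuous_defectSq_toNNReal e ρ y f).measurable.ennreal_ofReal).comp measurable_fst
  refine le_trans ?_ (le_of_eq (pAvg_conv hA ht hc 0))
  refine setLIntegral_mono' measurableSet_Ioi fun u hu => mul_le_mul' le_rfl ?_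
  have h1 := S.defectSq_intX_le ρ y u.toNNReal he0 he1 (integrableOn_pDeriv 0 hc) f
  have e2 : ∀ r ∈ Ioi 0, |pDeriv 0 c r| = 𝔭 c r := fun r hr => by
    rw [pDeriv_zero, abs_of_nonneg (pDensity_nonneg hc.le (le_of_lt hr))]
  rw [setIntegral_congr_fun measurableSet_Ioi e2, integral_pDensity hc, one_mul,
    setIntegral_congr_fun (g := fun r => 𝔭 c r *
      S.defectSq e ρ y u.toNNReal (S.TX r.toNNReal f)) measurableSet_Ioi
      fun r hr => by simp only [e2 r hr]] at h1
  refine (ofReal_le_ofReal h1).trans ?_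
  rw [ofReal_integral_pDensity (S.continuous_defectSq_TX ρ y _ f) (fun r => hn _ _)
    (K := (‖y‖ + ‖y.val‖) ^ 2 * ‖f‖ ^ 2) (fun r => (S.defectSq_le ρ y _ he0 _).trans (by
      gcongr; exact S.norm_TX_le _ _)) hc, pAvg]
  refine setLIntegral_mono' measurableSet_Ioi fun r hr => mul_le_mul' le_rfl ?_
  rw [toNNReal_add (hu).le (le_of_lt hr)]; exact ofReal_le_ofReal (hΓ _ _ _)

/-- `τ(y⋆ P_t (Γ(P_s f, P_s f) + |P_s' f|²) y)`. -/
def fullForm (y : τ.PreL2) (f : τ.X) (t s : ℝ) : ℝ :=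
  smearedGamma S.dX S.W t s f y + (S.W 0 t (S.dX 1 s f) (S.dX 1 s f) y).re

lemma tendsto_fullForm (ht : 0 < t) (hs : 0 < s) (f : τ.X) (y : τ.PreL2) :
    Tendsto (fun r : ℝ => (2 * r)⁻¹ * S.defectAvg 1 r.toNNReal y t (S.dX 0 s f) +
      S.defectAvg 0 0 y t (S.dX 1 s f)) (𝓝[>] 0) (𝓝 (S.fullForm y f t s)) := by
  have h := (S.tendsto_defectAvg_self ht hs f y).add_const (S.defectAvg 0 0 y t (S.dX 1 s f))
  rwa [fullForm, S.re_W_self ht, normAvg_zero_eq_defectAvg]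

lemma smearedGamma_nonneg (ht : 0 < t) (hs : 0 < s) (f : τ.X) (y : τ.PreL2) :
    0 ≤ smearedGamma S.dX S.W t s f y := by
  refine ge_of_tendsto (S.tendsto_defectAvg_self ht hs f y) ?_
  filter_upwards [self_mem_nhdsWithin] with r hr
  exact mul_nonneg (inv_nonneg.2 (mul_nonneg zero_le_two (le_of_lt hr)))
    (defectAvg_nonneg ht le_rfl _ _ _)

lemma re_W_self_nonneg (ht : 0 < t) (f : τ.X) (y : τ.PreL2) :
    0 ≤ (S.W 0 t f f y).re := by
  rw [S.re_W_self ht, normAvg_zero_eq_defectAvg]; exact defectAvg_nonneg ht zero_le_one _ _ _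

lemma fullForm_nonneg (y : τ.PreL2) (f : τ.X) (ht : 0 < t) (hs : 0 < s) :
    0 ≤ S.fullForm y f t s :=
  add_nonneg (S.smearedGamma_nonneg ht hs f y) (S.re_W_self_nonneg ht _ y)

lemma fullForm_add_le (y : τ.PreL2) (f g : τ.X) {t s η : ℝ} (ht : 0 < t) (hs : 0 < s)
    (hη : 0 < η) : S.fullForm y (f + g) t s ≤
      (1 + η⁻¹) * S.fullForm y f t s + (1 + η) * S.fullForm y g t s := by
  refine le_of_tendsto_of_tendsto (S.tendsto_fullForm ht hs (f + g) y)
    (((S.tendsto_fullForm ht hs f y).const_mul _).add ((S.tendsto_fullForm ht hs g y).const_mul _)) ?_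
  filter_upwards [self_mem_nhdsWithin] with r hr
  have hr : 0 < r := hr
  have h1 := S.defectAvg_dX_add_le zero_le_one le_rfl r.toNNReal y 0 ht hs f g hη
  have h2 := S.defectAvg_dX_add_le le_rfl zero_le_one 0 y 1 ht hs f g hη
  have h3 := mul_le_mul_of_nonneg_left h1 (show 0 ≤ (2 * r)⁻¹ by positivity)
  linarith

lemma fullForm_neg (y : τ.PreL2) (f : τ.X) (ht : 0 < t) (hs : 0 < s) :
    S.fullForm y (-f) t s = S.fullForm y f t s := by
  refine tendsto_nhds_unique (S.tendsto_fullForm ht hs (-f) y) ?_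
  simp only [S.defectAvg_neg _ y _ t hs]; exact S.tendsto_fullForm ht hs f y

lemma fullForm_dX (y : τ.PreL2) (f : τ.X) {t s c : ℝ} (ht : 0 < t) (hs : 0 < s)
    (hc : 0 < c) : S.fullForm y (S.dX 0 c f) t s = S.fullForm y f t (s + c) := by
  refine tendsto_nhds_unique (S.tendsto_fullForm ht hs (S.dX 0 c f) y) ?_
  simp only [S.defectAvg_congr _ y t fun u v => S.frame_dX_dX y u v 0 0 hs hc f,
    S.defectAvg_congr _ y t fun u v => S.frame_dX_dX y u v 1 0 hs hc f]
  exact S.tendsto_fullForm ht (by positivity) f y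

lemma fullForm_mono_left (y : τ.PreL2) (f : τ.X) {t t' s : ℝ} (ht : 0 < t) (htt : t ≤ t')
    (hs : 0 < s) : S.fullForm y f t' s ≤ t' / t * S.fullForm y f t s := by
  refine le_of_tendsto_of_tendsto (S.tendsto_fullForm (ht.trans_le htt) hs f y)
    ((S.tendsto_fullForm ht hs f y).const_mul _) ?_
  filter_upwards [self_mem_nhdsWithin] with r hr
  have hr : 0 < r := hr
  have h1 := S.defectAvg_mono_left zero_le_one le_rfl r.toNNReal y ht htt (S.dX 0 s f)
  have h2 := S.defectAvg_mono_left le_rfl zero_le_one 0 y ht htt (S.dX 1 s f)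
  have h3 := mul_le_mul_of_nonneg_left h1 (show 0 ≤ (2 * r)⁻¹ by positivity)
  linarith

lemma GammaSqX.fullForm_add_le_add {S : StandardSemigroup τ} (hΓ : S.GammaSqX) (y : τ.PreL2)
    (f : τ.X) {t s c : ℝ}
    (ht : 0 < t) (hs : 0 < s) (hc : 0 < c) : S.fullForm y f t (c + s) ≤ S.fullForm y f (t + c) s := by
  refine le_of_tendsto_of_tendsto (S.tendsto_fullForm ht (by positivity) f y)
    (S.tendsto_fullForm (by positivity) hs f y) ?_
  filter_upwards [self_mem_nhdsWithin] with r hr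
  have hr : 0 < r := hr
  have h1 := S.defectAvg_dX_zero_le zero_le_one le_rfl r.toNNReal y (hΓ _ y) ht hc (S.dX 0 s f)
  have h2 := S.defectAvg_dX_zero_le le_rfl zero_le_one 0 y (S.defectSq_zero_TX_le y) ht hc (S.dX 1 s f)
  rw [S.defectAvg_congr _ y t fun u v => S.frame_dX_dX y u v 0 0 hc hs f] at h1
  rw [S.defectAvg_congr _ y t fun u v => S.frame_dX_dX y u v 0 1 hc hs f] at h2
  exact add_le_add (mul_le_mul_of_nonneg_left h1 (by positivity)) h2

lemma GammaSqX.fullForm_le {S : StandardSemigroup τ} (hΓ : S.GammaSqX) (y : τ.PreL2)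
    (f : τ.X) {r x r' x' K : ℝ}
    (hr : 0 < r) (hx' : 0 < x') (hxx : x' ≤ x) (hr' : 0 < r') (h : r' + x' ≤ r + x)
    (hK : (r + x - x') / r' ≤ K) : S.fullForm y f r x ≤ K * S.fullForm y f r' x' := by
  have h1 : S.fullForm y f r x ≤ S.fullForm y f (r + (x - x')) x' := by
    rcases hxx.eq_or_lt with rfl | hlt
    · simp
    · have := hΓ.fullForm_add_le_add y f hr hx' (sub_pos.2 hlt)
      rwa [sub_add_cancel] at this
  have h2 := S.fullForm_mono_left y f hr' (t' := r + (x - x')) (by linarith) hx'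
  refine (h1.trans h2).trans (mul_le_mul_of_nonneg_right ?_ (S.fullForm_nonneg y f hr' hx'))
  rwa [← add_sub_assoc]

lemma hasDerivAt_re_W_dX (m j k : ℕ) (y : τ.PreL2) (f : τ.X) {r s : ℝ → ℝ} {r' s' x : ℝ}
    (hr0 : 0 < r x) (hs0 : 0 < s x) (hr : HasDerivAt r r' x) (hs : HasDerivAt s s' x) :
    HasDerivAt (fun v => (S.W m (r v) (S.dX j (s v) f) (S.dX k (s v) f) y).re)
      (r' * (S.W (m + 1) (r x) (S.dX j (s x) f) (S.dX k (s x) f) y).re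
        + s' * ((S.W m (r x) (S.dX (j + 1) (s x) f) (S.dX k (s x) f) y).re +
          (S.W m (r x) (S.dX j (s x) f) (S.dX (k + 1) (s x) f) y).re)) x := by
  have h := Complex.reCLM.hasFDerivAt.comp_hasDerivAt x (S.hasDerivAt_W_dX m j k y f f hr0 hs0 hr hs)
  exact h.congr_deriv (by simp)

/-- `τ(y⋆ P_r |P_s f|² y)`. -/
def squareForm (y : τ.PreL2) (f : τ.X) (r s : ℝ) : ℝ :=
  (S.W 0 r (S.dX 0 s f) (S.dX 0 s f) y).re

/-- The derivative of `squareForm` in the direction `(-1, 1)`. -/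
def squareFormDeriv (y : τ.PreL2) (f : τ.X) (r s : ℝ) : ℝ :=
  2 * (S.W 0 r (S.dX 1 s f) (S.dX 0 s f) y).re - (S.W 1 r (S.dX 0 s f) (S.dX 0 s f) y).re

lemma hasDerivAt_squareForm (y : τ.PreL2) (f : τ.X) {r s x : ℝ} (hr : 0 < r - x)
    (hs : 0 < s + x) : HasDerivAt (fun x => S.squareForm y f (r - x) (s + x))
      (S.squareFormDeriv y f (r - x) (s + x)) x := by
  have h := S.hasDerivAt_re_W_dX 0 0 0 y f hr hs
    ((hasDerivAt_id x).const_sub r) ((hasDerivAt_id x).const_add s)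
  refine h.congr_deriv ?_
  rw [squareFormDeriv, S.re_W_symm 0 hr (S.dX 0 (s + x) f) (S.dX (0 + 1) (s + x) f)]; ring_nf

lemma hasDerivAt_squareFormDeriv (y : τ.PreL2) (f : τ.X) {r s x : ℝ} (hr : 0 < r + x)
    (hs : 0 < s + x) : HasDerivAt (fun x => S.squareFormDeriv y f (r + x) (s + x))
      (2 * S.fullForm y f (r + x) (s + x)) x := by
  have hr' := (hasDerivAt_id x).const_add r
  have hs' := (hasDerivAt_id x).const_add s
  have h1 := S.hasDerivAt_re_W_dX 0 1 0 y f hr hs hr' hs'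
  have h2 := S.hasDerivAt_re_W_dX 1 0 0 y f hr hs hr' hs'
  refine ((h1.const_mul 2).sub h2).congr_deriv ?_
  rw [fullForm, S.smearedGamma_eq hr, S.re_W_symm 1 hr (S.dX 0 (s + x) f) (S.dX (0 + 1) (s + x) f)]
  ring_nf

lemma continuousAt_fullForm (y : τ.PreL2) (f : τ.X) {r s : ℝ → ℝ} {r' s' x : ℝ}
    (hr0 : 0 < r x) (hs0 : 0 < s x) (hr : HasDerivAt r r' x) (hs : HasDerivAt s s' x) :
    ContinuousAt (fun v => S.fullForm y f (r v) (s v)) x := by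
  have h := fun m j k => (S.hasDerivAt_re_W_dX m j k y f hr0 hs0 hr hs).continuousAt
  refine (((h 0 2 0).sub ((h 2 0 0).div_const 2)).add (h 0 1 1)).congr ?_
  filter_upwards [hr.continuousAt.eventually_const_lt hr0] with v hv
  rw [fullForm, S.smearedGamma_eq hv]; rfl

lemma tendsto_squareFormDeriv (y : τ.PreL2) (f : τ.X) (r s : ℝ) :
    Tendsto (fun v => S.squareFormDeriv y f (r + v) (s + v)) atTop (𝓝 0) := by
  have hr : Tendsto (fun v => r + v) atTop atTop := tendsto_atTop_add_const_left _ _ tendsto_id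
  have hs : Tendsto (fun v => s + v) atTop atTop := tendsto_atTop_add_const_left _ _ tendsto_id
  set c := (‖y‖ + ‖y.val‖) ^ 2
  have hd := fun m => (hs.eventually_gt_atTop 0).mono fun v hv => S.norm_dX_le m hv f
  have key : ∀ m j : ℕ, m + j = 1 →
      Tendsto (fun v => (S.W m (r + v) (S.dX j (s + v) f) (S.dX 0 (s + v) f) y).re) atTop (𝓝 0) := by
    intro m j hmj
    have hl : Tendsto (fun v => c * (‖f‖ * (pConst j * ((s + v) ^ j)⁻¹)) *
        (‖f‖ * (pConst 0 * ((s + v) ^ 0)⁻¹)) * (pConst m * ((r + v) ^ m)⁻¹)) atTop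
        (𝓝 0) := by
      have hrm : m = 1 → Tendsto (fun v => ((r + v) ^ m)⁻¹) atTop (𝓝 0) := fun h => by
        simpa [h, Function.comp_def] using tendsto_inv_atTop_zero.comp hr
      have hsj : j = 1 → Tendsto (fun v => ((s + v) ^ j)⁻¹) atTop (𝓝 0) := fun h => by
        simpa [h, Function.comp_def] using tendsto_inv_atTop_zero.comp hs
      rcases Nat.eq_zero_or_pos m with rfl | hm
      · have := ((((hsj (by omega)).const_mul (pConst j)).const_mul ‖f‖).const_mul c).mul_const
          (‖f‖ * (pConst 0 * 1))|>.mul_const (pConst 0 * 1)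
        simpa using this
      · obtain rfl : j = 0 := by omega
        have := ((hrm (by omega)).const_mul (pConst m)).const_mul
          (c * (‖f‖ * (pConst 0 * 1)) * (‖f‖ * (pConst 0 * 1)))
        simpa using this
    refine squeeze_zero_norm' ?_ hl
    filter_upwards [hr.eventually_gt_atTop 0, hs.eventually_gt_atTop 0, hd j, hd 0] with v hv hsv h1 h2
    have c0 := pConst_nonneg m
    have c1 := pConst_nonneg j
    refine (Complex.abs_re_le_norm _).trans ((S.norm_W_le m hv _ _ y).trans ?_); gcongr
  have := ((key 0 1 rfl).const_mul 2).sub (key 1 0 rfl)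
  simpa [squareFormDeriv] using this

lemma ofReal_neg_squareFormDeriv (y : τ.PreL2) (f : τ.X) (hr : 0 < r) (hs : 0 < s) :
    ofReal (-S.squareFormDeriv y f r s) =
      ∫⁻ v in Ioi 0, ofReal (2 * S.fullForm y f (r + v) (s + v)) := by
  have hd : ∀ x ∈ Ici 0, HasDerivAt (fun x => S.squareFormDeriv y f (r + x) (s + x))
      (2 * S.fullForm y f (r + x) (s + x)) x := fun x hx => by
    have hx : 0 ≤ x := hx
    exact S.hasDerivAt_squareFormDeriv y f (by positivity) (by positivity)
  have h0 : ∀ x ∈ Ioi 0, 0 ≤ 2 * S.fullForm y f (r + x) (s + x) := fun x hx => by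
    have hx : 0 < x := hx
    exact mul_nonneg zero_le_two (S.fullForm_nonneg y f (by positivity) (by positivity))
  have hl := S.tendsto_squareFormDeriv y f r s
  rw [← ofReal_integral_eq_lintegral_ofReal (integrableOn_Ioi_deriv_of_nonneg' hd h0 hl)
    ((ae_restrict_iff' measurableSet_Ioi).2 (.of_forall h0)),
    integral_Ioi_of_hasDerivAt_of_nonneg' hd h0 hl]
  simp

lemma squareFormDeriv_nonpos (y : τ.PreL2) (f : τ.X) (hr : 0 < r) (hs : 0 < s) :
    S.squareFormDeriv y f r s ≤ 0 := by
  have hm : MonotoneOn (fun x => S.squareFormDeriv y f (r + x) (s + x)) (Ici 0) := by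
    have hd : ∀ x ∈ Ici 0, HasDerivAt (fun x => S.squareFormDeriv y f (r + x) (s + x))
        (2 * S.fullForm y f (r + x) (s + x)) x := fun x hx => by
      have hx : 0 ≤ x := hx
      exact S.hasDerivAt_squareFormDeriv y f (by positivity) (by positivity)
    refine monotoneOn_of_hasDerivWithinAt_nonneg (convex_Ici 0)
      (fun x hx => (hd x hx).continuousAt.continuousWithinAt)
      (fun x hx => (hd x (interior_subset hx)).hasDerivWithinAt) fun x hx => ?_
    have hx : 0 ≤ x := interior_subset hx
    exact mul_nonneg zero_le_two (S.fullForm_nonneg y f (by positivity) (by positivity))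
  refine ge_of_tendsto (S.tendsto_squareFormDeriv y f r s) ?_
  filter_upwards [eventually_ge_atTop 0] with v hv
  simpa using hm (mem_Ici.2 le_rfl) (mem_Ici.2 hv) hv

lemma ofReal_squareForm_sub (y : τ.PreL2) (f : τ.X) {r s δ : ℝ} (hδ : 0 < δ) (hr : δ < r)
    (hs : 0 < s) : ofReal (S.squareForm y f r s - S.squareForm y f (r - δ) (s + δ)) =
      ∫⁻ σ in Ioo 0 δ, ∫⁻ v in Ioi 0,
        ofReal (2 * S.fullForm y f (r - σ + v) (s + σ + v)) := by
  have hd : ∀ x ∈ uIcc 0 δ, HasDerivAt (fun x => S.squareForm y f (r - x) (s + x))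
      (S.squareFormDeriv y f (r - x) (s + x)) x := fun x hx => by
    rw [uIcc_of_le hδ.le] at hx
    exact S.hasDerivAt_squareForm y f (by linarith [hx.2]) (by linarith [hx.1])
  have hc : ContinuousOn (fun x => S.squareFormDeriv y f (r - x) (s + x)) (uIcc 0 δ) := by
    intro x hx; rw [uIcc_of_le hδ.le] at hx
    have h := fun m j k => (S.hasDerivAt_re_W_dX m j k y f (r := fun x => r - x)
      (s := fun x => s + x) (by linarith [hx.2]) (by linarith [hx.1])
      ((hasDerivAt_id x).const_sub r) ((hasDerivAt_id x).const_add s)).continuousAt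
    exact (((h 0 1 0).const_mul 2).sub (h 1 0 0)).continuousWithinAt
  have h1 := intervalIntegral.integral_eq_sub_of_hasDerivAt hd hc.intervalIntegrable
  have h2 : S.squareForm y f r s - S.squareForm y f (r - δ) (s + δ) =
      ∫ x in Ioc 0 δ, -S.squareFormDeriv y f (r - x) (s + x) := by
    rw [integral_neg, ← intervalIntegral.integral_of_le hδ.le, h1]; ring
  have hi : IntegrableOn (fun x => -S.squareFormDeriv y f (r - x) (s + x)) (Ioc 0 δ) :=
    ((intervalIntegrable_iff_integrableOn_Ioc_of_le hδ.le).1 hc.intervalIntegrable).neg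
  rw [h2, ofReal_integral_eq_lintegral_ofReal hi, setLIntegral_congr Ioo_ae_eq_Ioc.symm]
  · exact setLIntegral_congr_fun measurableSet_Ioo fun σ hσ =>
      S.ofReal_neg_squareFormDeriv y f (by linarith [hσ.2]) (by linarith [hσ.1])
  · exact (ae_restrict_iff' measurableSet_Ioc).2 (.of_forall fun σ hσ =>
      neg_nonneg.2 (S.squareFormDeriv_nonpos y f (by linarith [hσ.2]) (by linarith [hσ.1])))

end StandardSemigroup

lemma setLIntegral_Ioi_add_left (F : ℝ → ℝ≥0∞) (c b : ℝ) :
    ∫⁻ v in Ioi b, F (c + v) = ∫⁻ x in Ioi (c + b), F x := by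
  have h := (measurePreserving_add_left volume c).setLIntegral_comp_preimage_emb
    (measurableEmbedding_addLeft c) F (Ioi (c + b))
  rwa [Set.preimage_const_add_Ioi, add_sub_cancel_left] at h

lemma lintegral_lintegral_Ioi {F : ℝ → ℝ≥0∞} (hF : Measurable F) {g : ℝ → ℝ} (hg : Measurable g)
    (a : ℝ) : ∫⁻ σ in Ioo 0 a, ∫⁻ x in Ioi (g σ), F x =
      ∫⁻ x, F x * volume (Ioo 0 a ∩ {σ | g σ < x}) := by
  have e1 : ∀ σ, ∫⁻ x in Ioi (g σ), F x =
      ∫⁻ x, {p : ℝ × ℝ | g p.1 < p.2}.indicator (fun p => F p.2) (σ, x) := fun σ =>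
    (lintegral_indicator measurableSet_Ioi F).symm
  simp only [e1]
  rw [lintegral_lintegral_swap (f := fun σ x =>
    {p : ℝ × ℝ | g p.1 < p.2}.indicator (fun p => F p.2) (σ, x))
    ((hF.comp measurable_snd).indicator (measurableSet_lt (hg.comp measurable_fst) measurable_snd)).aemeasurable]
  refine lintegral_congr fun x => ?_
  have hx : MeasurableSet {σ | g σ < x} := measurableSet_lt hg measurable_const
  have e2 : ∀ σ, {p : ℝ × ℝ | g p.1 < p.2}.indicator (fun p => F p.2) (σ, x) =
      {σ | g σ < x}.indicator (fun _ => F x) σ := fun σ => rfl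
  simp only [e2]; rw [lintegral_indicator_const hx, Measure.restrict_apply hx, inter_comm]

lemma measurable_indicator_ofReal {g : ℝ → ℝ} {s : Set ℝ} (hs : MeasurableSet s)
    (hg : ContinuousOn g s) : Measurable (s.indicator fun x => ofReal (g x)) := by
  classical
  exact (ENNReal.continuous_ofReal.comp_continuousOn hg).measurable_piecewise continuousOn_const hs

namespace StandardSemigroup

variable (S : StandardSemigroup τ)

lemma continuousOn_fullForm_linear (y : τ.PreL2) (f : τ.X) {a b c d : ℝ} (ha : 0 ≤ a)
    (hc : 0 ≤ c) (hb : 0 ≤ b) (hd : 0 ≤ d) (hab : 0 < a + b) (hcd : 0 < c + d) :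
    ContinuousOn (fun x => S.fullForm y f (a + b * x) (c + d * x)) (Ioi 0) := fun x hx => by
  have hx : 0 < x := hx
  refine (S.continuousAt_fullForm y f (r := fun x => a + b * x) (s := fun x => c + d * x) ?_ ?_
    (((hasDerivAt_id x).const_mul b).const_add a)
    (((hasDerivAt_id x).const_mul d).const_add c)).continuousWithinAt
  · rcases ha.eq_or_lt with rfl | ha
    · have : 0 < b := by linarith
      positivity
    · positivity
  · rcases hc.eq_or_lt with rfl | hc
    · have : 0 < d := by linarith
      positivity
    · positivity

lemma lintegral_fullForm_le_squareForm (y : τ.PreL2) (f : τ.X) (ht : 0 < t)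
    (hs : 0 < s) : ∫⁻ x in Ioo 0 t, ofReal (x / 2 * S.fullForm y f (2 * t) (s + x)) ≤
      ofReal (S.squareForm y f t s) := by
  have hcont : ContinuousOn (fun x => S.fullForm y f (2 * t) (s + x)) (Ioi 0) := by
    simpa using S.continuousOn_fullForm_linear y f
      (by positivity) hs.le le_rfl zero_le_one (by positivity) (by positivity)
  set F : ℝ → ℝ≥0∞ := (Ioo 0 t).indicator fun x => ofReal (S.fullForm y f (2 * t) (s + x))
  have h1 := S.ofReal_squareForm_sub y f (half_pos ht) (half_lt_self ht) hs
  have h2 : 0 ≤ S.squareForm y f (t - t / 2) (s + t / 2) := S.re_W_self_nonneg (by linarith) _ y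
  refine le_trans ?_ (ofReal_le_ofReal
    (show S.squareForm y f t s - S.squareForm y f (t - t / 2) (s + t / 2) ≤ _ by linarith))
  rw [h1]
  calc ∫⁻ x in Ioo 0 t, ofReal (x / 2 * S.fullForm y f (2 * t) (s + x))
      ≤ ∫⁻ x, F x * volume (Ioo 0 (t / 2) ∩ {σ | 2 * σ < x}) := by
        rw [← lintegral_indicator measurableSet_Ioo]; refine lintegral_mono fun x => ?_
        by_cases hx : x ∈ Ioo 0 t
        · have e : Ioo 0 (t / 2) ∩ {σ : ℝ | 2 * σ < x} = Ioo 0 (x / 2) := by grind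
          simp only [F, indicator_of_mem hx, e, Real.volume_Ioo, sub_zero]
          rw [mul_comm, ofReal_mul' (by linarith [hx.1])]
        · simp [indicator_of_notMem hx]
    _ = ∫⁻ σ in Ioo 0 (t / 2), ∫⁻ x in Ioi (2 * σ), F x :=
        (lintegral_lintegral_Ioi (measurable_indicator_ofReal measurableSet_Ioo (hcont.mono fun x hx => hx.1)) (measurable_const_mul 2) _).symm
    _ ≤ _ := by
        refine setLIntegral_mono' measurableSet_Ioo fun σ hσ => ?_
        have e : 2 * σ = σ + σ := by ring
        rw [e, ← setLIntegral_Ioi_add_left F σ σ]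
        refine (setLIntegral_mono' measurableSet_Ioi fun v hv => ?_).trans
          (lintegral_mono_set (Ioi_subset_Ioi hσ.1.le))
        have hv : σ < v := hv
        by_cases hx : σ + v ∈ Ioo 0 t
        · simp only [F, indicator_of_mem hx]; refine ofReal_le_ofReal ?_
          have hx2 := hx.2
          have hσ1 := hσ.1
          have hr : 0 < t - σ + v := by linarith
          have h3 := S.fullForm_mono_left y f (t' := 2 * t) (s := s + σ + v) hr
            (by linarith) (by linarith)
          have h4 := S.fullForm_nonneg y f (s := s + σ + v) hr (by linarith)
          rw [← add_assoc]; refine h3.trans (mul_le_mul_of_nonneg_right ?_ h4); rw [div_le_iff₀ hr]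
          linarith
        · simp [F, indicator_of_notMem hx]

lemma squareForm_le (y : τ.PreL2) (f : τ.X) (ht : 0 < t) (hs : 0 < s) :
    S.squareForm y f t s ≤ (t + s) / t * (S.W 0 t f f y).re := by
  rw [squareForm, S.re_W_self ht, S.re_W_self ht, normAvg_zero_eq_defectAvg,
    normAvg_zero_eq_defectAvg]
  exact (S.defectAvg_dX_zero_le le_rfl zero_le_one 0 y (S.defectSq_zero_TX_le y) ht hs f).trans
    (S.defectAvg_mono_left le_rfl zero_le_one 0 y ht (by linarith) f)

lemma lintegral_fullForm_le (y : τ.PreL2) (f : τ.X) {t B : ℝ} (ht : 0 < t)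
    (hB : (S.W 0 t f f y).re ≤ B) :
    ∫⁻ x in Ioo 0 t, ofReal (x / 2 * S.fullForm y f (2 * t) x) ≤ ofReal (2 * B) := by
  set s : ℕ → ℝ := fun k => t / (k + 1)
  have hs0 : ∀ k, 0 < s k := fun k => by positivity
  have hs1 : ∀ k, s k ≤ t := fun k => div_le_self ht.le (by linarith [k.cast_nonneg (α := ℝ)])
  have hs : Tendsto s atTop (𝓝 0) := by
    simpa [s] using (tendsto_add_atTop_iff_nat 1).2 (tendsto_const_div_atTop_nhds_zero_nat t)
  have hc := fun a ha => by
    simpa using S.continuousOn_fullForm_linear y f (a := 2 * t) (c := a)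
      (by positivity) ha le_rfl zero_le_one (by positivity) (by positivity)
  set F : ℕ → ℝ → ℝ≥0∞ := fun k x => ofReal (x / 2 * S.fullForm y f (2 * t) (s k + x))
  have hF : ∀ k, AEMeasurable (F k) (volume.restrict (Ioo 0 t)) := fun k => by
    exact ContinuousOn.aemeasurable (ENNReal.continuous_ofReal.comp_continuousOn ((by fun_prop : ContinuousOn (fun x : ℝ => x / 2) (Ioo 0 t)).mul ((hc _ (hs0 k).le).mono fun x hx => hx.1))) measurableSet_Ioo
  have h1 : ∫⁻ x in Ioo 0 t, ofReal (x / 2 * S.fullForm y f (2 * t) x) ≤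
      ∫⁻ x in Ioo 0 t, liminf (fun k => F k x) atTop := by
    exact setLIntegral_mono' measurableSet_Ioo fun x hx => le_of_eq (Tendsto.liminf_eq (tendsto_ofReal (((S.continuousAt_fullForm y f (r := fun _ => 2 * t) (by positivity) hx.1 (hasDerivAt_const x _) (hasDerivAt_id x)).tendsto.comp (by simpa using hs.add_const x)).const_mul (x / 2)))).symm
  refine h1.trans ((lintegral_liminf_le' hF).trans ?_)
  refine liminf_le_of_le (by isBoundedDefault) fun c hc => ?_
  obtain ⟨k, hk⟩ := hc.exists
  refine hk.trans ((S.lintegral_fullForm_le_squareForm y f ht (hs0 k)).trans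
    (ofReal_le_ofReal ((S.squareForm_le y f ht (hs0 k)).trans ?_)))
  refine mul_le_mul ?_ hB (S.re_W_self_nonneg ht f y) zero_le_two; rw [div_le_iff₀ ht]
  linarith [hs1 k]

lemma exists_sq_mul_fullForm_le (y : τ.PreL2) (f : τ.X) :
    ∃ M : ℝ, ∀ t, 0 < t → t ^ 2 * S.fullForm y f t t ≤ M := by
  set c := (‖y‖ + ‖y.val‖) ^ 2
  have key : ∀ (m j k : ℕ), ∃ M : ℝ, m + j + k = 2 → ∀ t, 0 < t →
      |(S.W m t (S.dX j t f) (S.dX k t f) y).re| ≤ M / t ^ 2 := by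
    intro m j k; refine ⟨c * (‖f‖ * pConst j) * (‖f‖ * pConst k) * pConst m, fun h t ht => ?_⟩
    have c0 := pConst_nonneg j
    have c2 := pConst_nonneg m
    refine (Complex.abs_re_le_norm _).trans ((S.norm_W_le m ht _ _ y).trans ?_)
    calc _ ≤ c * (‖f‖ * (pConst j * (t ^ j)⁻¹)) * (‖f‖ * (pConst k * (t ^ k)⁻¹)) *
          (pConst m * (t ^ m)⁻¹) := by
          gcongr
          · exact S.norm_dX_le j ht f
          · exact S.norm_dX_le k ht f
      _ = c * (‖f‖ * pConst j) * (‖f‖ * pConst k) * pConst m / t ^ (m + j + k) := by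
          rw [pow_add, pow_add]; field_simp
      _ = _ := by rw [h]
  obtain ⟨M1, h1⟩ := key 0 2 0
  obtain ⟨M2, h2⟩ := key 2 0 0
  obtain ⟨M3, h3⟩ := key 0 1 1
  refine ⟨M1 + M2 / 2 + M3, fun t ht => ?_⟩
  have a1 := (abs_le.1 (h1 rfl t ht)).2
  have a2 := (abs_le.1 (h2 rfl t ht)).1
  have a3 := (abs_le.1 (h3 rfl t ht)).2
  rw [fullForm, S.smearedGamma_eq ht]
  calc _ ≤ t ^ 2 * (M1 / t ^ 2 + M2 / t ^ 2 / 2 + M3 / t ^ 2) := by gcongr; linarith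
    _ = _ := by field_simp

variable {S}

lemma GammaSqX.sq_mul_fullForm_step (hΓ : S.GammaSqX) (y : τ.PreL2) (f : τ.X) {t B : ℝ}
    (ht : 0 < t) (hB : (S.W 0 t (f - S.dX 0 t f) (f - S.dX 0 t f) y).re ≤ B) :
    (3 / 2 * t) ^ 2 * S.fullForm y f (3 / 2 * t) (3 / 2 * t) ≤
      1894 * B + 4 / 5 * ((15 / 8 * t) ^ 2 * S.fullForm y f (15 / 8 * t) (15 / 8 * t)) := by
  set h := f - S.dX 0 t f with hh
  set p := S.fullForm y f (3 / 2 * t) (3 / 2 * t)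
  set q := S.fullForm y f (15 / 8 * t) (15 / 8 * t)
  have hB0 := (S.re_W_self_nonneg ht h y).trans hB
  have hq : 0 ≤ q := S.fullForm_nonneg y f (by positivity) (by positivity)
  set m := (16 / 17 * p - 33 / 32 * (17 / 15) * q) / 33 with hm
  have hz : ∀ z, 7 / 8 * t ≤ z → z ≤ t → m ≤ S.fullForm y h (2 * t) z := by
    intro z hz1 hz2
    have hz0 : 0 < z := by linarith
    have h1 : p ≤ 17 / 16 * S.fullForm y f (2 * t) z :=
      hΓ.fullForm_le y f (by positivity) hz0 (by linarith) (by positivity) (by linarith)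
        (by rw [div_le_iff₀ (by positivity)]; linarith)
    have h2 := S.fullForm_add_le y h (S.dX 0 t f) (t := 2 * t) (by positivity) hz0
      (show (0 : ℝ) < 1 / 32 by norm_num)
    rw [hh, sub_add_cancel, ← hh, S.fullForm_dX y f (by positivity) hz0 ht] at h2
    have h3 : S.fullForm y f (2 * t) (z + t) ≤ 17 / 15 * q :=
      hΓ.fullForm_le y f (by positivity) (by positivity) (by linarith) (by positivity) (by linarith)
        (by rw [div_le_iff₀ (by positivity)]; linarith)
    norm_num at h2; rw [hm]; linarith
  have h1 : ofReal (3 / 8 * t * m) * ofReal (t / 8) ≤ ofReal (9 / 8 * B) := by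
    calc _ = ∫⁻ _ in Ioo (3 / 4 * t) (7 / 8 * t), ofReal (3 / 8 * t * m) := by
          rw [setLIntegral_const, Real.volume_Ioo]; congr 2; ring
      _ ≤ ∫⁻ x in Ioo (3 / 4 * t) (7 / 8 * t),
          ofReal (x / 2 * S.fullForm y h (2 * t) (t / 8 + x)) := by
          refine setLIntegral_mono' measurableSet_Ioo fun x hx => ofReal_le_ofReal ?_
          have h1 := hz (t / 8 + x) (by linarith [hx.1]) (by linarith [hx.2])
          have h0 := S.fullForm_nonneg y h (t := 2 * t) (s := t / 8 + x) (by positivity)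
            (by linarith [hx.1])
          exact (mul_le_mul_of_nonneg_left h1 (by positivity)).trans
            (mul_le_mul_of_nonneg_right (by linarith [hx.1]) h0)
      _ ≤ ∫⁻ x in Ioo 0 t, ofReal (x / 2 * S.fullForm y h (2 * t) (t / 8 + x)) :=
          lintegral_mono_set (Ioo_subset_Ioo (by positivity) (by linarith))
      _ ≤ _ := (S.lintegral_fullForm_le_squareForm y h ht (by positivity)).trans
          (ofReal_le_ofReal ((S.squareForm_le y h ht (by positivity)).trans (by
            have e : (t + t / 8) / t = 9 / 8 := by field_simp; norm_num
            rw [e]; gcongr)))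
  rw [← ofReal_mul' (by positivity), ofReal_le_ofReal_iff (by positivity)] at h1
  have h2 : t ^ 2 * m ≤ 24 * B := by nlinarith
  have h3 : t ^ 2 * m = (16 / 17 * (t ^ 2 * p) - 33 / 32 * (17 / 15) * (t ^ 2 * q)) / 33 := by
    rw [hm]; ring
  have h4 : 0 ≤ t ^ 2 * q := by positivity
  have e1 : (3 / 2 * t) ^ 2 * p = 9 / 4 * (t ^ 2 * p) := by ring
  have e2 : (15 / 8 * t) ^ 2 * q = 225 / 64 * (t ^ 2 * q) := by ring
  rw [e1, e2]; linarith

lemma GammaSqX.sq_mul_fullForm_le (hΓ : S.GammaSqX) (y : τ.PreL2) (f : τ.X) {B : ℝ}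
    (hB : ∀ t, 0 < t → (S.W 0 t (f - S.dX 0 t f) (f - S.dX 0 t f) y).re ≤ B) (ht : 0 < t) :
    t ^ 2 * S.fullForm y f t t ≤ 9470 * B := by
  obtain ⟨M, hM⟩ := S.exists_sq_mul_fullForm_le y f
  have key : ∀ (k : ℕ) t, 0 < t →
      t ^ 2 * S.fullForm y f t t ≤ 9470 * B + (4 / 5) ^ k * (M - 9470 * B) := by
    intro k
    induction k with
    | zero => intro t ht; linarith [hM t ht]
    | succ k ih =>
      intro t ht
      have h1 := hΓ.sq_mul_fullForm_step y f (t := 2 / 3 * t) (by positivity) (hB _ (by positivity))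
      have e1 : 3 / 2 * (2 / 3 * t) = t := by ring
      rw [e1] at h1
      have h2 := ih (15 / 8 * (2 / 3 * t)) (by positivity)
      rw [pow_succ (4 / 5 : ℝ)]; linarith
  have := ge_of_tendsto' (((tendsto_pow_atTop_nhds_zero_of_lt_one (by norm_num) (by norm_num)).mul_const _).const_add _) fun k => key k t ht
  linarith

lemma GammaSqX.lintegral_fullForm_le_of_osc (hΓ : S.GammaSqX) (y : τ.PreL2) (f : τ.X) {B : ℝ}
    (hB : ∀ t, 0 < t → (S.W 0 t (f - S.dX 0 t f) (f - S.dX 0 t f) y).re ≤ B) (ht : 0 < t) :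
    ∫⁻ x in Ioo 0 t, ofReal (x * S.fullForm y f t x) ≤ ofReal (120000 * B) := by
  obtain ⟨t, rfl⟩ : ∃ r, t = 2 * r := ⟨t / 2, by ring⟩
  have ht : 0 < t := by linarith
  set h := f - S.dX 0 t f with hh
  have hB0 := (S.re_W_self_nonneg ht h y).trans (hB t ht)
  set p := S.fullForm y f t t
  have hp0 := S.fullForm_nonneg y f ht ht
  have hD := hΓ.sq_mul_fullForm_le y f hB ht
  have h1 : ∫⁻ x in Ioo 0 t, ofReal (x * S.fullForm y f (2 * t) x) ≤
      ofReal (8 * B + 6 * (t ^ 2 * p)) := by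
    calc _ ≤ ∫⁻ x in Ioo 0 t, (ofReal 4 * ofReal (x / 2 * S.fullForm y h (2 * t) x) +
          ofReal (6 * t * p)) := by
          refine setLIntegral_mono' measurableSet_Ioo fun x hx => ?_
          have hx0 := hx.1
          have h2 := S.fullForm_add_le y h (S.dX 0 t f) (t := 2 * t) (by positivity) hx0 one_pos
          rw [hh, sub_add_cancel, ← hh, S.fullForm_dX y f (by positivity) hx0 ht] at h2
          have h3 : S.fullForm y f (2 * t) (x + t) ≤ 3 * p :=
            hΓ.fullForm_le y f (by positivity) ht (by linarith) ht (by linarith)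
              (by rw [div_le_iff₀ ht]; linarith [hx.2])
          have h4 : S.fullForm y f (2 * t) x ≤ 2 * S.fullForm y h (2 * t) x + 6 * p := by grind
          have h5 := S.fullForm_nonneg y h (t := 2 * t) (by positivity) hx0
          rw [← ofReal_mul (by norm_num), ← ofReal_add (by positivity) (by positivity)]
          refine ofReal_le_ofReal ((mul_le_mul_of_nonneg_left h4 hx0.le).trans ?_)
          have h6 := mul_le_mul_of_nonneg_right hx.2.le hp0
          linarith
      _ = ofReal 4 * (∫⁻ x in Ioo 0 t, ofReal (x / 2 * S.fullForm y h (2 * t) x)) +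
          ofReal (6 * t * p) * ofReal t := by
          rw [lintegral_add_right _ measurable_const, lintegral_const_mul' _ _ ofReal_ne_top,
            setLIntegral_const, Real.volume_Ioo, sub_zero]
      _ ≤ ofReal 4 * ofReal (2 * B) + ofReal (6 * t * p) * ofReal t :=
          add_le_add_left (mul_le_mul' le_rfl (S.lintegral_fullForm_le y h ht (hB t ht))) _
      _ = _ := by
          rw [← ofReal_mul (by norm_num), ← ofReal_mul (by positivity),
            ← ofReal_add (by positivity) (by positivity)]
          congr 1; ring
  have h2 : ∫⁻ x in Ico t (2 * t), ofReal (x * S.fullForm y f (2 * t) x) ≤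
      ofReal (6 * (t ^ 2 * p)) := by
    calc _ ≤ ∫⁻ _ in Ico t (2 * t), ofReal (6 * t * p) := by
          refine setLIntegral_mono' measurableSet_Ico fun x hx => ofReal_le_ofReal ?_
          have hx1 := hx.1
          calc x * S.fullForm y f (2 * t) x ≤ x * (3 * p) := mul_le_mul_of_nonneg_left (hΓ.fullForm_le y f (by positivity) ht hx.1 ht (by linarith) (by rw [div_le_iff₀ ht]; linarith [hx.2])) (by linarith)
            _ ≤ 2 * t * (3 * p) := mul_le_mul_of_nonneg_right hx.2.le (by positivity)
            _ = _ := by ring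
      _ = _ := by
          rw [setLIntegral_const, Real.volume_Ico, ← ofReal_mul (by positivity)]
          congr 1; ring
  calc _ ≤ ∫⁻ x in Ioo 0 t ∪ Ico t (2 * t), ofReal (x * S.fullForm y f (2 * t) x) := by
        refine lintegral_mono_set fun x hx => ?_
        rcases lt_or_ge x t with h | h
        · exact Or.inl ⟨hx.1, h⟩
        · exact Or.inr ⟨h, hx.2⟩
    _ ≤ _ := lintegral_union_le _ _ _
    _ ≤ ofReal (8 * B + 6 * (t ^ 2 * p)) + ofReal (6 * (t ^ 2 * p)) := add_le_add h1 h2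
    _ ≤ _ := by
        rw [← ofReal_add (by positivity) (by positivity)]
        exact ofReal_le_ofReal (by linarith)

variable (S)

lemma tendsto_squareForm (y : τ.PreL2) (f : τ.X) (ht : 0 < t) :
    Tendsto (fun s => S.squareForm y f t s) (𝓝[>] 0) (𝓝 (S.W 0 t f f y).re) := by
  simp only [squareForm, S.re_W_self ht]
  set c := (‖y‖ + ‖y.val‖) * (‖f‖ * pConst 0)
  refine tendsto_integral_filter_of_dominated_convergence (fun u => 𝔭 t u * c ^ 2)
    (.of_forall fun s => ?_) ?_ ((integrableOn_pDensity ht).mul_const _) ?_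
  · exact (S.integrableOn_norm_frame_sq (integrableOn_pDensity ht) 0 y _).aestronglyMeasurable
  · filter_upwards [self_mem_nhdsWithin] with s hs
    refine (ae_restrict_iff' measurableSet_Ioi).2 (.of_forall fun u hu => ?_)
    have h0 := pDensity_nonneg ht.le (le_of_lt hu)
    rw [norm_of_nonneg (by positivity)]
    refine mul_le_mul_of_nonneg_left ?_ h0; gcongr; refine (S.norm_frame_le _ _ _ _).trans ?_
    have h1 := S.norm_dX_le 0 hs f
    rw [pow_zero, inv_one, mul_one] at h1; exact mul_le_mul_of_nonneg_left h1 (by positivity)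
  · refine Eventually.of_forall fun u => ?_
    refine Tendsto.const_mul _ (Tendsto.pow (Tendsto.norm ?_) 2)
    have hc := S.continuous_frame_toNNReal y u.toNNReal 0 f
    have h1 := tendsto_integral_pDensity_zero hc.stronglyMeasurable
      (fun x => S.norm_frame_le y u.toNNReal _ f) hc.continuousWithinAt
    rw [Real.toNNReal_zero, add_zero] at h1; refine h1.congr' ?_
    filter_upwards [self_mem_nhdsWithin] with s hs
    rw [S.frame_dX y _ _ 0 hs]; simp only [pDeriv_zero]

lemma two_mul_re_W_le (y : τ.PreL2) (f g : τ.X) {t c : ℝ} (ht : 0 < t) (hc : 0 < c) :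
    2 * (S.W 0 t f g y).re ≤ c * (S.W 0 t f f y).re + c⁻¹ * (S.W 0 t g g y).re := by
  have hφ := integrableOn_pDeriv 0 ht
  have hi : ∀ f g, IntegrableOn (fun u => pDeriv 0 t u * (S.frameInner y f g u).re) (Ioi 0) := by
    intro f g; refine (S.integrableOn_frameInner hφ y f g).re.congr (.of_forall fun u => ?_); simp
  rw [re_W S 0 ht, re_W S 0 ht, re_W S 0 ht, ← integral_const_mul, ← integral_const_mul,
    ← integral_const_mul, ← integral_add ((hi _ _).const_mul _) ((hi _ _).const_mul _)]
  refine setIntegral_mono_on ((hi _ _).const_mul _)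
    (((hi _ _).const_mul _).add ((hi _ _).const_mul _)) measurableSet_Ioi fun u hu => ?_
  rw [re_frameInner_self, re_frameInner_self, pDeriv_zero]
  have h0 := pDensity_nonneg ht.le (le_of_lt hu)
  have h1 : (S.frameInner y f g u).re ≤ ‖S.frame y u.toNNReal 0 f‖ * ‖S.frame y u.toNNReal 0 g‖ :=
    (Complex.re_le_norm _).trans (norm_inner_le_norm _ _)
  set a := ‖S.frame y u.toNNReal 0 f‖
  set b := ‖S.frame y u.toNNReal 0 g‖
  have h2 : 2 * (a * b) ≤ c * a ^ 2 + c⁻¹ * b ^ 2 := by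
    have h3 : 0 ≤ c⁻¹ * (c * a - b) ^ 2 := by positivity
    have h4 : c⁻¹ * (c * a - b) ^ 2 = c * a ^ 2 + c⁻¹ * b ^ 2 - 2 * (a * b) := by
      field_simp; ring
    linarith
  calc 2 * (𝔭 t u * (S.frameInner y f g u).re) ≤
        𝔭 t u * (2 * (a * b)) := by
        have := mul_le_mul_of_nonneg_left h1 h0
        linarith
    _ ≤ 𝔭 t u * (c * a ^ 2 + c⁻¹ * b ^ 2) := mul_le_mul_of_nonneg_left h2 h0
    _ = _ := by ring

lemma re_W_self_congr (ht : 0 < t) (y : τ.PreL2)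
    (h : ∀ u, ‖S.frame y u 0 f‖ = ‖S.frame y u 0 g‖) : (S.W 0 t f f y).re = (S.W 0 t g g y).re := by
  simp only [S.re_W_self ht, normAvg, h]

lemma re_W_sub_le (y : τ.PreL2) (f : τ.X) {r s t M : ℝ} (hr : 0 < r) (hs : 0 < s) (ht : 0 < t)
    (hM : ∀ x ∈ Icc s (s + t), (S.W 0 r (S.dX 1 x f) (S.dX 1 x f) y).re ≤ M) :
    (S.W 0 r (S.dX 0 (s + t) f - S.dX 0 s f) (S.dX 0 (s + t) f - S.dX 0 s f) y).re ≤
      3 * t ^ 2 * M := by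
  set k : ℝ → τ.X := fun x => S.dX 0 x f - S.dX 0 s f
  set n : ℝ → ℝ := fun x => (S.W 0 r (k x) (k x) y).re with hn
  have hM0 := (S.re_W_self_nonneg hr _ y).trans (hM s ⟨le_rfl, by linarith⟩)
  have hd : ∀ x ∈ Icc s (s + t), HasDerivAt n (2 * (S.W 0 r (S.dX 1 x f) (k x) y).re) x := by
    intro x hx
    have hk : HasDerivAt k (S.dX 1 x f) x := (S.hasDerivAt_dX 0 (hs.trans_le hx.1) f).sub_const _
    have h1 := S.hasDerivAt_W 0 y hr (hasDerivAt_const x r) hk hk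
    have h2 := Complex.reCLM.hasFDerivAt.comp_hasDerivAt x h1
    refine h2.congr_deriv ?_; simp; rw [S.re_W_symm 0 hr (k x)]; ring
  have hQ : AntitoneOn (fun x => exp (-(x - s) / t) * n x - t * M * (x - s)) (Icc s (s + t)) := by
    have hdQ : ∀ x ∈ Icc s (s + t), HasDerivAt
        (fun x => exp (-(x - s) / t) * n x - t * M * (x - s))
        (exp (-(x - s) / t) * (-1 / t) * n x +
          exp (-(x - s) / t) * (2 * (S.W 0 r (S.dX 1 x f) (k x) y).re) - t * M * 1) x := by
      intro x hx
      exact (((((hasDerivAt_id x).sub_const s).neg).div_const t).exp.mul (hd x hx)).sub (((hasDerivAt_id x).sub_const s).const_mul _)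
    refine antitoneOn_of_hasDerivWithinAt_nonpos (convex_Icc _ _)
      (fun x hx => (hdQ x hx).continuousAt.continuousWithinAt)
      (fun x hx => (hdQ x (interior_subset hx)).hasDerivWithinAt) fun x hx => ?_
    have hx := interior_subset hx
    have h1 := S.two_mul_re_W_le y (S.dX 1 x f) (k x) hr ht
    have h2 := hM x hx
    set E := exp (-(x - s) / t)
    have hE1 : E ≤ 1 := Real.exp_le_one_iff.2 (by
      have := hx.1
      exact div_nonpos_of_nonpos_of_nonneg (by linarith) ht.le)
    have h3 : E * (2 * (S.W 0 r (S.dX 1 x f) (k x) y).re) ≤ E * (t * M + t⁻¹ * n x) := by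
      refine mul_le_mul_of_nonneg_left (h1.trans ?_) ((Real.exp_pos _).le); gcongr
    have h4 : E * (t * M) ≤ 1 * (t * M) := mul_le_mul_of_nonneg_right hE1 (by positivity)
    have h5 : E * (-1 / t) * n x = -(E * (t⁻¹ * n x)) := by ring
    linarith
  have h1 := hQ (left_mem_Icc.2 (by linarith)) (right_mem_Icc.2 (by linarith : s ≤ s + t)) (by linarith)
  have e0 : n s = 0 := by
    simp [hn, k, S.re_W_self hr, normAvg]
  simp only [e0, sub_self, mul_zero, add_sub_cancel_left, neg_div, div_self ht.ne'] at h1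
  have h2 : exp 1 * (exp (-1) * n (s + t)) ≤ 3 * (t * M * t) :=
    mul_le_mul (Real.exp_one_lt_d9.le.trans (by norm_num)) (by linarith)
      (mul_nonneg (Real.exp_pos _).le ((fun x => S.re_W_self_nonneg hr _ y) _)) (by norm_num)
  rw [← mul_assoc, ← Real.exp_add, add_neg_cancel, Real.exp_zero, one_mul] at h2
  exact h2.trans (le_of_eq (by ring))

lemma squareForm_sub_dX (y : τ.PreL2) (f : τ.X) (hr : 0 < r) (hs : 0 < s)
    (ht : 0 < t) : S.squareForm y (f - S.dX 0 t f) r s =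
      (S.W 0 r (S.dX 0 (s + t) f - S.dX 0 s f) (S.dX 0 (s + t) f - S.dX 0 s f) y).re := by
  refine S.re_W_self_congr hr y fun u => ?_
  rw [sub_eq_add_neg f, S.frame_dX_add y u 0 0 hs, _root_.map_add, S.frame_dX_neg y u 0 0 hs,
    S.frame_dX_dX y u 0 0 0 hs ht, ← norm_neg, _root_.map_sub]
  congr 1; abel

variable {S}

lemma GammaSqX.sq_mul_fullForm_le_of_carleson (hΓ : S.GammaSqX) (y : τ.PreL2) (f : τ.X)
    {G : ℝ} (hG0 : 0 ≤ G) (ht : 0 < t)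
    (hG : ∫⁻ x in Ioo 0 t, ofReal (x * S.fullForm y f t x) ≤ ofReal G) :
    t ^ 2 * S.fullForm y f t t ≤ 6 * G := by
  set p := S.fullForm y f t t
  have h1 : ofReal (t / 2 * (2 / 3 * p)) * ofReal (t / 2) ≤ ofReal G := by
    calc _ = ∫⁻ _ in Ioo (t / 2) t, ofReal (t / 2 * (2 / 3 * p)) := by
          rw [setLIntegral_const, Real.volume_Ioo]; congr 2; ring
      _ ≤ ∫⁻ x in Ioo (t / 2) t, ofReal (x * S.fullForm y f t x) := by
          refine setLIntegral_mono' measurableSet_Ioo fun x hx => ofReal_le_ofReal ?_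
          have hx0 : 0 < x := by linarith [hx.1]
          have h2 : p ≤ 3 / 2 * S.fullForm y f t x :=
            hΓ.fullForm_le y f ht hx0 hx.2.le ht (by linarith [hx.2])
              (by rw [div_le_iff₀ ht]; linarith [hx.1])
          have h0 := S.fullForm_nonneg y f ht hx0
          calc _ ≤ t / 2 * S.fullForm y f t x := by gcongr; linarith
            _ ≤ _ := by gcongr; exact hx.1.le
      _ ≤ ∫⁻ x in Ioo 0 t, ofReal (x * S.fullForm y f t x) :=
          lintegral_mono_set (Ioo_subset_Ioo (by positivity) le_rfl)
      _ ≤ _ := hG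
  rw [← ofReal_mul' (by positivity), ofReal_le_ofReal_iff hG0] at h1
  linarith

lemma GammaSqX.squareForm_half_le (hΓ : S.GammaSqX) (y : τ.PreL2) (f : τ.X)
    {G : ℝ} (hG0 : 0 ≤ G) (ht : 0 < t) (hs : t / 2 ≤ s) (hst : s ≤ t)
    (hG : ∫⁻ x in Ioo 0 (t / 2), ofReal (x * S.fullForm y f (t / 2) x) ≤ ofReal G) :
    S.squareForm y (f - S.dX 0 t f) (t / 2) s ≤ 288 * G := by
  have hs0 : 0 < s := by linarith
  have ht2 := half_pos ht
  have hD := hΓ.sq_mul_fullForm_le_of_carleson y f hG0 ht2 hG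
  set p := S.fullForm y f (t / 2) (t / 2)
  rw [S.squareForm_sub_dX y f ht2 hs0 ht]
  exact (S.re_W_sub_le y f (M := 4 * p) ht2 hs0 ht fun x hx => (le_add_of_nonneg_left (S.smearedGamma_nonneg ht2 (by linarith [hx.1]) f y)).trans (hΓ.fullForm_le y f ht2 ht2 (by linarith [hx.1]) ht2 (by linarith [hx.1]) (by rw [div_le_iff₀ ht2]; linarith [hx.2]))).trans (by linarith)

lemma GammaSqX.lintegral_min_fullForm_le (hΓ : S.GammaSqX) (y : τ.PreL2) (f : τ.X) {G : ℝ≥0∞}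
    (hG : ∀ t, 0 < t → ∫⁻ x in Ioo 0 t, ofReal (x * S.fullForm y f t x) ≤ G)
    (ht : 0 < t) : ∫⁻ x in Ioi 0, ofReal (min t x) *
      ofReal (S.fullForm y f (t + 3 / 10 * x) (x / 5)) ≤ 300 * G := by
  have h1 := lintegral_min_mul_le (G := fun t s => if 0 < t then ofReal (S.fullForm y f t s) else 0)
    (fun t t' s ht htt hs => by
      rw [if_pos ht, if_pos (ht.trans_le htt), ← ofReal_mul (div_nonneg (ht.le.trans htt) ht.le)]
      exact ofReal_le_ofReal (S.fullForm_mono_left y f ht htt hs))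
    (fun t ht => by
      refine le_trans (le_of_eq ?_) (hG t ht)
      refine setLIntegral_congr_fun measurableSet_Ioo fun x hx => ?_; simp only [if_pos ht]
      rw [ofReal_mul hx.1.le]) ht
  have him : (fun x : ℝ => 5 * x) '' Ioi 0 = Ioi 0 := by
    rw [image_mul_left_Ioi (by norm_num), mul_zero]
  rw [← him, lintegral_image_eq_lintegral_abs_deriv_mul (f' := fun _ => 5) measurableSet_Ioi
    (fun x _ => by simpa using ((hasDerivAt_id x).const_mul 5).hasDerivWithinAt)
    (mul_right_injective₀ (by norm_num : (5 : ℝ) ≠ 0)).injOn]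
  calc _ ≤ ∫⁻ x in Ioi 0, ofReal 25 * (ofReal (min t x) *
        (if 0 < t + 3 / 2 * x then ofReal (S.fullForm y f (t + 3 / 2 * x) x) else 0)) := by
        refine setLIntegral_mono' measurableSet_Ioi fun x hx => ?_
        have hx : 0 < x := hx
        have e1 : t + 3 / 10 * (5 * x) = t + 3 / 2 * x := by ring
        have e2 : 5 * x / 5 = x := by ring
        rw [e1, e2, if_pos (by positivity), ← mul_assoc, ← mul_assoc]
        refine mul_le_mul' ?_ le_rfl; rw [← ofReal_mul (abs_nonneg _), ← ofReal_mul (by norm_num)]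
        refine ofReal_le_ofReal ?_; rw [abs_of_pos (by norm_num : (0 : ℝ) < 5)]
        have h2 : min t (5 * x) ≤ 5 * min t x := by
          rw [mul_min_of_nonneg _ _ (by norm_num)]
          exact min_le_min (by linarith) le_rfl
        linarith
    _ ≤ ofReal 25 * (12 * G) := by
        rw [lintegral_const_mul' _ _ ofReal_ne_top]; exact mul_le_mul' le_rfl h1
    _ = _ := by
        rw [← mul_assoc, ofReal_ofNat]; norm_num

lemma GammaSqX.ofReal_squareForm_sub_le (hΓ : S.GammaSqX) (y : τ.PreL2) (f : τ.X) {G : ℝ≥0∞}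
    (hG : ∀ t, 0 < t → ∫⁻ x in Ioo 0 t, ofReal (x * S.fullForm y f t x) ≤ G)
    (ht : 0 < t) (hs : 0 < s) :
    ofReal (S.squareForm y (f - S.dX 0 t f) t s -
      S.squareForm y (f - S.dX 0 t f) (t - t / 2) (s + t / 2)) ≤ 28800 * G := by
  have ht2 := half_pos ht
  have hcont := S.continuousOn_fullForm_linear y f (b := 3 / 10) (d := 1 / 5)
    ht2.le le_rfl (by norm_num) (by norm_num) (by positivity) (by norm_num)
  set F : ℝ → ℝ≥0∞ := (Ioi 0).indicator fun x =>
    ofReal (96 * S.fullForm y f (t / 2 + 3 / 10 * x) (0 + 1 / 5 * x))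
  rw [S.ofReal_squareForm_sub y _ ht2 (half_lt_self ht) hs]
  calc _ ≤ ∫⁻ σ in Ioo 0 (t / 2), ∫⁻ x in Ioi (s + σ), F x := by
        refine setLIntegral_mono' measurableSet_Ioo fun σ hσ => ?_
        have := setLIntegral_Ioi_add_left F (s + σ) 0
        rw [add_zero] at this; rw [← this]
        refine setLIntegral_mono' measurableSet_Ioi fun v hv => ?_
        have hv : 0 < v := hv
        have hσ0 := hσ.1
        have hσ1 := hσ.2
        set x := s + σ + v with hx
        have hx0 : 0 < x := by positivity
        have hr : 0 < t - σ + v := by linarith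
        simp only [F]; rw [indicator_of_mem (by exact hx0)]
        refine ofReal_le_ofReal ?_
        have h1 := S.fullForm_add_le y f (-S.dX 0 t f) hr hx0 one_pos
        rw [← sub_eq_add_neg, S.fullForm_neg y _ hr hx0, S.fullForm_dX y f hr hx0 ht] at h1
        have h2 : S.fullForm y f (t - σ + v) (x + t) ≤ 3 * S.fullForm y f (t - σ + v) x :=
          hΓ.fullForm_le y f hr hx0 (by linarith) hr (by linarith)
            (by rw [div_le_iff₀ hr]; linarith)
        have h3 : S.fullForm y f (t - σ + v) x ≤
            6 * S.fullForm y f (t / 2 + 3 / 10 * x) (0 + 1 / 5 * x) :=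
          hΓ.fullForm_le y f hr (by positivity) (by linarith) (by positivity) (by linarith)
            (by rw [div_le_iff₀ (by positivity)]; linarith)
        linarith
    _ = ∫⁻ x, F x * volume (Ioo 0 (t / 2) ∩ {σ | s + σ < x}) :=
        lintegral_lintegral_Ioi (measurable_indicator_ofReal measurableSet_Ioi (hcont.const_mul 96)) (measurable_const_add s) _
    _ ≤ ∫⁻ x in Ioi 0, ofReal 96 * (ofReal (min (t / 2) x) *
          ofReal (S.fullForm y f (t / 2 + 3 / 10 * x) (x / 5))) := by
        rw [← lintegral_indicator measurableSet_Ioi]; refine lintegral_mono fun x => ?_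
        by_cases hx : x ∈ Ioi 0
        · simp only [F, indicator_of_mem hx]
          rw [ofReal_mul (by norm_num), mul_assoc, mul_comm (ofReal (min _ _))]
          have e : 0 + 1 / 5 * x = x / 5 := by ring
          rw [e]; refine mul_le_mul' le_rfl (mul_le_mul' le_rfl ?_)
          have hsub : Ioo 0 (t / 2) ∩ {σ | s + σ < x} ⊆ Ioo 0 (min (t / 2) x) := by
            rintro σ ⟨h1, h2⟩
            have h2 : s + σ < x := h2
            exact ⟨h1.1, lt_min h1.2 (by linarith)⟩
          refine (measure_mono hsub).trans (le_of_eq ?_); rw [Real.volume_Ioo, sub_zero]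
        · simp [F, indicator_of_notMem hx]
    _ ≤ ofReal 96 * (300 * G) := by
        rw [lintegral_const_mul' _ _ ofReal_ne_top]
        exact mul_le_mul' le_rfl (hΓ.lintegral_min_fullForm_le y f hG ht2)
    _ = _ := by
        rw [← mul_assoc, ofReal_ofNat]; norm_num

lemma GammaSqX.osc_le_of_carleson (hΓ : S.GammaSqX) (y : τ.PreL2) (f : τ.X) {G : ℝ}
    (hG0 : 0 ≤ G)
    (hG : ∀ t, 0 < t →
      ∫⁻ x in Ioo 0 t, ofReal (x * S.fullForm y f t x) ≤ ofReal G)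
    (ht : 0 < t) : (S.W 0 t (f - S.dX 0 t f) (f - S.dX 0 t f) y).re ≤ 30000 * G := by
  refine le_of_tendsto (S.tendsto_squareForm y (f - S.dX 0 t f) ht) ?_
  filter_upwards [Ioo_mem_nhdsGT (half_pos ht)] with s hs
  have h1 := hΓ.ofReal_squareForm_sub_le y f hG ht hs.1
  have h2 := hΓ.squareForm_half_le y f hG0 ht (s := s + t / 2) (by linarith [hs.1])
    (by linarith [hs.2]) (hG _ (half_pos ht))
  rw [sub_half, show (28800 : ℝ≥0∞) = ofReal 28800 by simp,
    ← ofReal_mul (by norm_num), ofReal_le_ofReal_iff (by positivity)] at h1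
  linarith

/-- The constant in the three estimates. -/
def bmoConst (n : ℕ) : ℝ := 7200000000 * (multiplierConst n + 1)

lemma bmoConst_pos (n : ℕ) : 0 < bmoConst n := by
  have := multiplierConst_nonneg n
  unfold bmoConst; positivity

lemma GammaSqX.bmoPoissonAux_multiplier_le (hΓ : S.GammaSqX)
    (hn : 1 ≤ n) (hM : S.IsMultiplierX a n f g)
    (ha : IsSymbol a ca) :
    bmoPoissonAux S.dX S.W g ≤
      ofReal √(bmoConst n) * ofReal ca * bmoPoissonAux S.dX S.W f := by
  have hm0 := multiplierConst_nonneg n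
  have hca := ha.pos
  have hpγ := hΓ.bmoGammaAux_multiplier_le hn hM ha
  have hp := S.bmoPartialAux_multiplier_le hn hM ha
  rw [bmoGammaAux, bmoGammaAux, ← rpow_half_ofReal_mul hm0 hca.le,
    ENNReal.rpow_le_rpow_iff (by norm_num)] at hpγ
  rw [bmoPartialAux, bmoPartialAux, ← rpow_half_ofReal_mul hm0 hca.le,
    ENNReal.rpow_le_rpow_iff (by norm_num)] at hp
  unfold bmoPoissonAux; rw [← rpow_half_ofReal_mul (bmoConst_pos n).le hca.le]
  refine ENNReal.rpow_le_rpow ?_ (by norm_num)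
  set β := ⨆ (t : ℝ) (_ : 0 < t), opNorm fun y =>
    ofReal (S.W 0 t (f - S.dX 0 t f) (f - S.dX 0 t f) y).re with hβ
  rcases eq_or_ne β ∞ with hβ' | hβ'
  · have h1 : ofReal (bmoConst n * ca ^ 2) ≠ 0 := by
      have := bmoConst_pos n
      positivity
    rw [hβ', ENNReal.mul_top h1]; exact le_top
  obtain ⟨B, hB⟩ : ∃ B : ℝ≥0, β = B := ⟨β.toNNReal, (ENNReal.coe_toNNReal hβ').symm⟩
  have hle : ∀ (F : ℝ → τ.PreL2 → ℝ≥0∞) (b), (⨆ (t : ℝ) (_ : 0 < t), opNorm (F t)) ≤ b →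
      ∀ y, ‖y‖ ≤ 1 → ∀ t, 0 < t → F t y ≤ b := fun F _ h y hy t ht =>
    (le_iSup₂_of_le t ht (le_iSup₂_of_le (f := fun y (_ : ‖y‖ ≤ 1) => F t y) y hy le_rfl)).trans h
  have hosc : ∀ y : τ.PreL2, ‖y‖ ≤ 1 → ∀ t, 0 < t →
      (S.W 0 t (f - S.dX 0 t f) (f - S.dX 0 t f) y).re ≤ B := by
    intro y hy t ht
    have h1 := hle _ _ hβ.ge y hy t ht
    rwa [hB, ← ENNReal.ofReal_coe_nnreal, ofReal_le_ofReal_iff B.coe_nonneg] at h1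
  have hcarl : ∀ F : ℝ → ℝ → τ.PreL2 → ℝ,
      (∀ t s y, 0 < t → 0 < s → F t s y ≤ S.fullForm y f t s) →
      (⨆ (t : ℝ) (_ : 0 < t), opNorm fun y => ∫⁻ s in Ioo 0 t, ofReal (s * F t s y)) ≤
        ofReal (120000 * B) := fun F hF => iSup₂_le fun t ht => iSup₂_le fun y hy =>
    (setLIntegral_mono' measurableSet_Ioo fun s hs => ofReal_le_ofReal (mul_le_mul_of_nonneg_left
      (hF t s y ht hs.1) hs.1.le)).trans (hΓ.lintegral_fullForm_le_of_osc y f (hosc y hy) ht)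
  set K := multiplierConst n * ca ^ 2 with hK
  have hγ1 := hpγ.trans (mul_le_mul' le_rfl (hcarl _ fun _ _ y ht _ =>
    le_add_of_nonneg_right (S.re_W_self_nonneg ht _ y)))
  have hp1 := hp.trans (mul_le_mul' le_rfl (hcarl _ fun _ _ y ht hs =>
    le_add_of_nonneg_left (S.smearedGamma_nonneg ht hs f y)))
  rw [← ofReal_mul (by positivity)] at hγ1 hp1
  have hcarlg : ∀ y : τ.PreL2, ‖y‖ ≤ 1 → ∀ t, 0 < t →
      ∫⁻ x in Ioo 0 t, ofReal (x * S.fullForm y g t x) ≤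
        ofReal (2 * (K * (120000 * B))) := by
    intro y hy t ht
    have hmeas : AEMeasurable (fun s => ofReal (s * (S.W 0 t (S.dX 1 s g) (S.dX 1 s g) y).re))
        (volume.restrict (Ioo 0 t)) := by
      refine ContinuousOn.aemeasurable ?_ measurableSet_Ioo
      refine ENNReal.continuous_ofReal.comp_continuousOn (continuousOn_id.mul fun s hs => ?_)
      exact (S.hasDerivAt_re_W_dX 0 1 1 y g ht hs.1 (hasDerivAt_const s t)
        (hasDerivAt_id s)).continuousAt.continuousWithinAt
    calc _ = ∫⁻ s in Ioo 0 t, (ofReal (s * smearedGamma S.dX S.W t s g y) +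
          ofReal (s * (S.W 0 t (S.dX 1 s g) (S.dX 1 s g) y).re)) := by
          refine setLIntegral_congr_fun measurableSet_Ioo fun s hs => ?_
          rw [← ofReal_add (mul_nonneg hs.1.le (S.smearedGamma_nonneg ht hs.1 g y))
            (mul_nonneg hs.1.le (S.re_W_self_nonneg ht _ y)), fullForm, mul_add]
      _ ≤ _ := by
          rw [lintegral_add_right' _ hmeas]
          refine (add_le_add (hle _ _ hγ1 y hy t ht) (hle _ _ hp1 y hy t ht)).trans (le_of_eq ?_)
          rw [← ofReal_add (by positivity) (by positivity), two_mul]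
  refine iSup₂_le fun t ht => iSup₂_le fun y hy => ?_
  have h3 := hΓ.osc_le_of_carleson y g (by positivity) (hcarlg y hy) ht
  rw [hB, ← ENNReal.ofReal_coe_nnreal, ← ofReal_mul (by
    have := (bmoConst_pos n).le
    positivity)]
  refine ofReal_le_ofReal (h3.trans ?_); rw [hK, bmoConst]; nlinarith

end StandardSemigroup

lemma CStarAlgebra.exists_cut {A : Type*} [CStarAlgebra A] [PartialOrder A] [StarOrderedRing A]
    {a : A} (ha0 : 0 ≤ a) (hε : 0 < ε) : ∃ K L : A, star K = K ∧ star L = L ∧ a * K = L ∧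
      ‖a * (1 - K * L)‖ ≤ ε ∧ ∀ p : ℝ, 1 ≤ p → L * L ≤ ε ^ (1 - p) • a ^ p := by
  have hasp : ∀ t ∈ spectrum ℝ a, 0 ≤ t := fun t ht => spectrum_nonneg_of_nonneg ha0 ht
  set l : ℝ → ℝ := fun t => √(max (t - ε) 0) with hl
  set k : ℝ → ℝ := fun t => √(max (t - ε) 0) / max t ε with hk
  have hlc : Continuous l := by fun_prop
  have hkc : Continuous k := hlc.div (by fun_prop) fun t => ((fun t => lt_max_of_lt_right hε) t).ne'
  have hll : ∀ t, l t * l t = max (t - ε) 0 := fun t => Real.mul_self_sqrt (le_max_right _ _)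
  have htk : ∀ t, t * k t = l t := fun t => by
    rcases le_total t ε with h | h
    · have : max (t - ε) 0 = 0 := max_eq_right (by linarith)
      simp [hk, hl, this]
    · have h0 := (hε.trans_le h).ne'
      simp only [hk, hl, max_eq_left h]; field_simp
  have hid := cfc_id' ℝ a
  have hmul : ∀ f g : ℝ → ℝ, Continuous f → Continuous g →
      cfc f a * cfc g a = cfc (fun t => f t * g t) a := fun f g hf hg =>
    (cfc_mul f g a hf.continuousOn hg.continuousOn).symm
  have hkl := hkc.mul hlc
  have hsub : 1 - cfc k a * cfc l a = cfc (fun t => 1 - k t * l t) a := by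
    rw [hmul k l hkc hlc, ← cfc_const_one ℝ a, ← cfc_sub (fun _ => 1) (fun t => k t * l t) a
      continuousOn_const hkl.continuousOn]
  refine ⟨cfc k a, cfc l a, IsSelfAdjoint.star_eq (cfc_predicate k a),
    IsSelfAdjoint.star_eq (cfc_predicate l a), ?_, ?_, fun p hp => ?_⟩
  · calc a * cfc k a = cfc (fun t => t) a * cfc k a := by rw [hid]
      _ = cfc l a := by rw [hmul _ _ continuous_id' hkc]; exact cfc_congr fun t _ => htk t
  · have e : a * (1 - cfc k a * cfc l a) = cfc (fun t => t * (1 - k t * l t)) a := by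
      rw [hsub]
      calc _ = cfc (fun t => t) a * cfc (fun t => 1 - k t * l t) a := by rw [hid]
        _ = _ := hmul _ _ continuous_id' (continuous_const.sub hkl)
    rw [e]; refine norm_cfc_le hε.le fun t ht => ?_
    have ht0 := hasp t ht
    have h7 : t * (1 - k t * l t) = t - max (t - ε) 0 := by
      rw [mul_sub, mul_one, ← mul_assoc, htk, hll]
    rw [h7, norm_eq_abs, abs_le]
    rcases le_total t ε with h | h
    · rw [max_eq_right (by linarith)]; constructor <;> linarith
    · rw [max_eq_left (by linarith)]; constructor <;> linarith
  · have hpc := Real.continuous_rpow_const (by linarith)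
    rw [hmul _ _ hlc hlc, CFC.rpow_eq_cfc_real ha0,
      ← cfc_smul (ε ^ (1 - p)) (fun t => t ^ p) a hpc.continuousOn]
    refine cfc_mono (fun t ht => ?_) (hlc.mul hlc).continuousOn
      (by exact (hpc.const_smul (ε ^ (1 - p))).continuousOn)
    have ht0 := hasp t ht
    rw [hll]; refine max_le ?_ (by positivity)
    rcases le_total t ε with h | h
    · exact (sub_nonpos.2 h).trans (by positivity)
    · have h2 : t = t ^ (1 - p) * t ^ p := by
        rw [← Real.rpow_add (hε.trans_le h), sub_add_cancel, Real.rpow_one]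
      have h3 : t ^ (1 - p) * t ^ p ≤ ε ^ (1 - p) * t ^ p :=
        mul_le_mul_of_nonneg_right (Real.rpow_le_rpow_of_nonpos hε h (by linarith)) (by positivity)
      rw [smul_eq_mul]; linarith

namespace NSFTrace

lemma norm_inner_mulLeft_le_lp {x : N} {p : ℝ} (hp : 1 ≤ p)
    (hfin : τ.toFun (CFC.abs x ^ p) < ∞) (hε : 0 < ε) (z w : τ.PreL2) :
    ‖⟪z, mulLeft x w⟫_ℂ‖ ≤ ε * (‖z‖ * ‖w‖) +
      ‖z.val‖ * ‖w.val‖ * (ε ^ (1 - p) * (τ.toFun (CFC.abs x ^ p)).toReal) := by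
  set a := CFC.abs x with ha
  have ha0 : 0 ≤ a := CFC.abs_nonneg x
  have haa := (CFC.abs_mul_abs x).symm
  have hasa := (of_nonneg ha0).star_eq
  obtain ⟨K, L, hKs, hLs, haK, hsm, hLp⟩ := CStarAlgebra.exists_cut ha0 hε
  have hKa : K * a = L := by
    have := congrArg star haK
    rwa [star_mul, hKs, hLs, hasa] at this
  have hLL0 : 0 ≤ L * L := by
    have := star_mul_self_nonneg L
    rwa [hLs] at this
  obtain ⟨c, hc⟩ : ∃ c : ℝ≥0, c = ε ^ (1 - p) := ⟨⟨ε ^ (1 - p), by positivity⟩, rfl⟩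
  have hLle : L * L ≤ c • a ^ p := by
    have := hLp p hp
    rwa [← hc, ← coe_smul] at this
  have hτ := (τ.mono hLL0 hLle).trans_eq (τ.map_smul _ _ (CFC.rpow_nonneg))
  have hτtop : (c : ℝ≥0∞) * τ.toFun (a ^ p) < ∞ := ENNReal.mul_lt_top ENNReal.coe_lt_top hfin
  have hLt : τ.toFun (star L * L) < ∞ := by rw [hLs]; exact hτ.trans_lt hτtop
  have hxK : star (x * K) * (x * K) = L * L := by
    rw [star_mul, hKs, mul_assoc, ← mul_assoc (star x), haa, ← mul_assoc, ← mul_assoc, hKa,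
      mul_assoc, haK]
  set A := PreL2.mk L hLt with hA
  set B := PreL2.mk (x * K) (by rw [hxK]; rwa [hLs] at hLt) with hB
  set D := ε ^ (1 - p) * (τ.toFun (a ^ p)).toReal with hD
  have hLD : (τ.toFun (L * L)).toReal ≤ D := by
    have := toReal_mono hτtop.ne hτ
    rwa [ENNReal.toReal_mul, ENNReal.coe_toReal, hc] at this
  have hAn : ‖A‖ ^ 2 ≤ D := by
    rw [norm_sq]; change (τ.toFun (star L * L)).toReal ≤ D; rwa [hLs]
  have hBn : ‖B‖ ^ 2 ≤ D := by
    rw [norm_sq]; change (τ.toFun (star (x * K) * (x * K))).toReal ≤ D; rwa [hxK]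
  have e1 : mulLeft x w = mulLeft (x * (1 - K * L)) w + mulLeft (x * K) (mulRight w.val A) :=
    PreL2.ext (by
      change x * w.val = x * (1 - K * L) * w.val + x * K * (L * w.val)
      simp only [mul_sub, sub_mul, mul_one, mul_assoc]; abel)
  have e2 : mulLeft (star (x * K)) z = mulRight z.val (adj B) := PreL2.ext rfl
  have hsmall : ‖x * (1 - K * L)‖ ≤ ε := by
    refine le_of_sq_le_sq ?_ hε.le
    have e5 : star (x * (1 - K * L)) * (x * (1 - K * L)) =
        star (a * (1 - K * L)) * (a * (1 - K * L)) := by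
      simp only [star_mul, hasa, mul_assoc]; rw [← mul_assoc (star x), haa, mul_assoc]
    rw [sq, ← CStarRing.norm_star_mul_self, e5, CStarRing.norm_star_mul_self, ← sq]
    exact pow_le_pow_left₀ (norm_nonneg _) hsm 2
  rw [e1, inner_add_right, inner_mulLeft (x * K), e2]
  refine (norm_add_le _ _).trans (add_le_add ?_ ?_)
  · refine (norm_inner_le_norm _ _).trans ?_
    calc _ ≤ ‖z‖ * (ε * ‖w‖) := mul_le_mul_of_nonneg_left ((norm_mulLeft_le _ _).trans
          (mul_le_mul_of_nonneg_right hsmall (norm_nonneg _))) (norm_nonneg _)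
      _ = _ := by ring
  · refine (norm_inner_le_norm _ _).trans ((mul_le_mul (norm_mulRight_le _ _)
      (norm_mulRight_le _ _) (norm_nonneg _) (by positivity)).trans ?_)
    rw [norm_adj]
    calc _ = ‖z.val‖ * ‖w.val‖ * (‖B‖ * ‖A‖) := by ring
      _ ≤ _ := mul_le_mul_of_nonneg_left (by nlinarith [sq_nonneg (‖B‖ - ‖A‖)]) (by positivity)

lemma exists_lpNorm_lt_norm_inner_le {p : ℝ≥0∞} (hp : 1 ≤ p) (K : ℝ) (hε : 0 < ε) :
    ∃ δ > 0, ∀ x : N, τ.lpNorm p x < δ → ∀ z w : τ.PreL2, ‖z‖ ≤ K → ‖w‖ ≤ K → ‖z.val‖ ≤ K →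
      ‖w.val‖ ≤ K → ‖⟪z, mulLeft x w⟫_ℂ‖ ≤ ε := by
  set ε' := ε / (2 * (K ^ 2 + 1)) with hε'
  have hε'0 : 0 < ε' := by positivity
  have hε'K : ε' * K ^ 2 ≤ ε / 2 := by
    rw [hε', div_mul_eq_mul_div, div_le_div_iff₀ (by positivity) (by positivity)]
    nlinarith
  have hzw : ∀ {a b : ℝ}, 0 ≤ a → 0 ≤ b → a ≤ K → b ≤ K → a * b ≤ K ^ 2 := fun h1 h2 h3 h4 => by
    rw [sq]; exact mul_le_mul h3 h4 h2 (h1.trans h3)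
  rcases eq_or_ne p ∞ with rfl | hp'
  · refine ⟨ofReal ε', ENNReal.ofReal_pos.2 hε'0, fun x hx z w hz hw _ _ => ?_⟩
    rw [lpNorm, if_pos rfl, ← ofReal_norm, ENNReal.ofReal_lt_ofReal_iff hε'0] at hx
    refine (norm_inner_le_norm _ _).trans ?_
    have h1 := mul_le_mul_of_nonneg_left (norm_mulLeft_le x w) (norm_nonneg z)
    have h2 := mul_le_mul hx.le (hzw (norm_nonneg z) (norm_nonneg w) hz hw) (by positivity) hε'0.le
    linarith
  · have hp1 : 1 ≤ p.toReal := by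
      have := toReal_mono hp' hp
      simpa using this
    set C := K ^ 2 * ε' ^ (1 - p.toReal) + 1 with hC
    have hC0 : 0 < C := by positivity
    have hr : 0 < ε / 2 / C := by positivity
    refine ⟨ofReal (ε / 2 / C) ^ (1 / p.toReal),
      ENNReal.rpow_pos (ENNReal.ofReal_pos.2 hr) ofReal_ne_top, fun x hx z w hz hw hz' hw' => ?_⟩
    rw [lpNorm, if_neg hp', ENNReal.rpow_lt_rpow_iff (by positivity)] at hx
    have hfin := hx.trans ofReal_lt_top
    refine (norm_inner_mulLeft_le_lp hp1 hfin hε'0 z w).trans ?_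
    have h1 := mul_le_mul_of_nonneg_left (hzw (norm_nonneg z) (norm_nonneg w) hz hw) hε'0.le
    have h2 : ‖z.val‖ * ‖w.val‖ * (ε' ^ (1 - p.toReal) * (τ.toFun (CFC.abs x ^ p.toReal)).toReal) ≤
        K ^ 2 * (ε' ^ (1 - p.toReal) * (ε / 2 / C)) :=
      mul_le_mul (hzw (norm_nonneg _) (norm_nonneg _) hz' hw')
        (mul_le_mul_of_nonneg_left (ENNReal.toReal_le_of_le_ofReal hr.le hx.le) (by positivity)) (by positivity) (by positivity)
    have h3 : K ^ 2 * (ε' ^ (1 - p.toReal) * (ε / 2 / C)) ≤ ε / 2 := by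
      calc _ = K ^ 2 * ε' ^ (1 - p.toReal) * (ε / 2 / C) := by ring
        _ ≤ C * (ε / 2 / C) := mul_le_mul_of_nonneg_right (by rw [hC]; linarith) hr.le
        _ = ε / 2 := by field_simp
    linarith

end NSFTrace

namespace StandardSemigroup

variable (S : StandardSemigroup τ)

/-- The values at `star b * x * c` of the forms of the translates of `y`. -/
def evolveForm (y : τ.PreL2) (w : ℝ≥0) : StrongDual ℂ N :=
  form (S.evolve w y) (S.evolve w y)

lemma evolveForm_apply (y : τ.PreL2) (w : ℝ≥0) (b x c : N) :
    S.evolveForm y w (star b * x * c) = ⟪mulLeft b (S.evolve w y),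
      mulLeft x (mulLeft c (S.evolve w y))⟫_ℂ := by
  have e : mulLeft (star b * x * c) (S.evolve w y) =
      mulLeft (star b) (mulLeft x (mulLeft c (S.evolve w y))) :=
    PreL2.ext (by simp [mul_assoc])
  rw [evolveForm, form_apply, e, inner_mulLeft (star b), star_star]

/-- The domain of the generator. -/
def InDom (h : N) : Prop := ∃ p : ℝ≥0∞, 1 ≤ p ∧ S.MemDom p h

variable {S}

lemma InDom.exists_small {h : N} (hh : S.InDom h) (y : τ.PreL2) (B : ℝ) (hε : 0 < ε) :
    ∃ U ∈ 𝓝[>] (0 : ℝ), ∀ r ∈ U, ∀ r' ∈ U, ∀ (w : ℝ≥0) (b c : N), ‖b‖ ≤ B → ‖c‖ ≤ B →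
      ‖S.evolveForm y w (star b * (S.genQuot r h - S.genQuot r' h) * c)‖ ≤ ε := by
  obtain ⟨p, hp, hm⟩ := hh
  obtain ⟨δ, hδ, h1⟩ := exists_lpNorm_lt_norm_inner_le (τ := τ) hp (max B 0 * max ‖y‖ ‖y.val‖) hε
  obtain ⟨U, hU, hU'⟩ := eventually_prod_self_iff (r := fun r r' =>
    τ.lpNorm p (S.genQuot r h - S.genQuot r' h) < δ) |>.1 (hm.2.eventually (gt_mem_nhds hδ))
  refine ⟨U, hU, fun r hr r' hr' w b c hb hc => ?_⟩
  have hq := hU' r hr r' hr'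
  rw [evolveForm_apply]
  have hn : ∀ b : N, ‖b‖ ≤ B → ‖mulLeft b (S.evolve w y)‖ ≤ max B 0 * max ‖y‖ ‖y.val‖ :=
    fun b hb => (norm_mulLeft_le _ _).trans (by
      rw [norm_evolve]
      exact mul_le_mul (hb.trans (le_max_left _ _)) (le_max_left _ _) (norm_nonneg _) (le_max_right _ _))
  have hv : ∀ b : N, ‖b‖ ≤ B → ‖(mulLeft b (S.evolve w y)).val‖ ≤ max B 0 * max ‖y‖ ‖y.val‖ :=
    fun b hb => (norm_mul_le _ _).trans (mul_le_mul (hb.trans (le_max_left _ _))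
      ((S.norm_val_evolve_le w y).trans (le_max_right _ _)) (norm_nonneg _) (le_max_right _ _))
  exact h1 _ hq _ _ (hn b hb) (hn c hc) (hv b hb) (hv c hc)

variable (S) in
lemma tendsto_evolveForm (y : τ.PreL2) {w : ℝ → ℝ≥0} {w0 : ℝ≥0}
    (hw : Tendsto w (𝓝[>] 0) (𝓝 w0)) :
    Tendsto (fun r => ‖S.evolveForm y (w r) - S.evolveForm y w0‖) (𝓝[>] 0) (𝓝 0) :=
  tendsto_iff_norm_sub_tendsto_zero.1 (((S.continuous_form_evolve y).tendsto w0).comp hw)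

lemma InDom.exists_tendsto {h : N} (hh : S.InDom h) (y : τ.PreL2) {w : ℝ → ℝ≥0} {w0 : ℝ≥0}
    (hw : Tendsto w (𝓝[>] 0) (𝓝 w0)) (b c : N) : ∃ ℓ : ℂ,
      Tendsto (fun r => S.evolveForm y w0 (star b * S.genQuot r h * c)) (𝓝[>] 0) (𝓝 ℓ) ∧
      Tendsto (fun r => S.evolveForm y (w r) (star b * S.genQuot r h * c)) (𝓝[>] 0) (𝓝 ℓ) := by
  have hs := fun ε (hε : 0 < ε) => hh.exists_small y (max ‖b‖ ‖c‖) hε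
  have hsub : ∀ (φ : StrongDual ℂ N) (x x' : N),
      φ (star b * x * c) - φ (star b * x' * c) = φ (star b * (x - x') * c) := fun φ x x' => by
    rw [← map_sub, mul_sub, sub_mul]
  have hc : Cauchy (map (fun r => S.evolveForm y w0 (star b * S.genQuot r h * c)) (𝓝[>] 0)) := by
    refine cauchy_map_iff.2 ⟨inferInstance, Metric.uniformity_basis_dist_le.tendsto_right_iff.2
      fun ε hε => ?_⟩
    obtain ⟨U, hU, h2⟩ := hs ε hε
    filter_upwards [prod_mem_prod hU hU] with q hq
    refine (dist_eq_norm _ _).trans_le ?_; rw [hsub]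
    exact h2 _ hq.1 _ hq.2 _ _ _ (le_max_left _ _) (le_max_right _ _)
  obtain ⟨ℓ, hℓ⟩ := CompleteSpace.complete hc
  refine ⟨ℓ, hℓ, ?_⟩
  suffices hd : Tendsto (fun r => S.evolveForm y (w r) (star b * S.genQuot r h * c) -
      S.evolveForm y w0 (star b * S.genQuot r h * c)) (𝓝[>] 0) (𝓝 0) by
    simpa using hd.add (show Tendsto _ _ (𝓝 ℓ) from hℓ)
  refine Metric.tendsto_nhds.2 fun ε hε => ?_
  obtain ⟨U, hU, h2⟩ := hs (ε / 4) (by positivity)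
  obtain ⟨r0, hr0⟩ := (show (𝓝[>] (0 : ℝ)).NeBot from inferInstance).nonempty_of_mem hU
  set x0 := star b * S.genQuot r0 h * c with hx0
  have h3 := ((S.tendsto_evolveForm y hw).mul_const ‖x0‖).eventually
    (gt_mem_nhds (show 0 * ‖x0‖ < ε / 4 by rw [zero_mul]; positivity))
  filter_upwards [hU, h3] with r hr hr3
  rw [dist_zero_right]
  have t1 := h2 r hr r0 hr0 (w r) b c (le_max_left _ _) (le_max_right _ _)
  have t2 := h2 r hr r0 hr0 w0 b c (le_max_left _ _) (le_max_right _ _)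
  have t3 := (le_opNorm (S.evolveForm y (w r) - S.evolveForm y w0) x0).trans_lt hr3
  rw [← hsub] at t1 t2; rw [sub_apply] at t3
  set p1 := S.evolveForm y (w r) (star b * S.genQuot r h * c)
  set p2 := S.evolveForm y w0 (star b * S.genQuot r h * c)
  have e : p1 - p2 = (p1 - S.evolveForm y (w r) x0) + (S.evolveForm y (w r) x0 - S.evolveForm y w0 x0)
    - (p2 - S.evolveForm y w0 x0) := by ring
  rw [e]
  have t4 := norm_sub_le ((p1 - S.evolveForm y (w r) x0) + (S.evolveForm y (w r) x0 -
    S.evolveForm y w0 x0)) (p2 - S.evolveForm y w0 x0)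
  have t5 := norm_add_le (p1 - S.evolveForm y (w r) x0) (S.evolveForm y (w r) x0 - S.evolveForm y w0 x0)
  linarith

variable (S) in
lemma tendsto_norm_mulLeft_sub_evolve (g : N) (y : τ.PreL2) {w : ℝ → ℝ≥0} {w0 : ℝ≥0}
    (hw : Tendsto w (𝓝[>] 0) (𝓝 w0)) :
    Tendsto (fun r : ℝ => ‖mulLeft (g - S.T r.toNNReal g) (S.evolve (w r) y)‖)
      (𝓝[>] 0) (𝓝 0) := by
  set d : ℝ → N := fun r => g - S.T r.toNNReal g
  have hd : ∀ r, ‖d r‖ ≤ 2 * ‖g‖ := fun r =>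
    (norm_sub_le _ _).trans (by linarith [S.norm_T_le r.toNNReal g])
  have hr0 : Tendsto (fun r : ℝ => r.toNNReal) (𝓝[>] 0) (𝓝 0) := by
    have := (continuous_real_toNNReal.tendsto 0).mono_left (nhdsWithin_le_nhds (s := Ioi 0))
    rwa [Real.toNNReal_zero] at this
  have h1 : Tendsto (fun r => ‖mulLeft (d r) (S.evolve w0 y)‖) (𝓝[>] 0) (𝓝 0) := by
    refine ((S.tendsto_mulLeft_T_sub (S.evolve w0 y) g).comp hr0).congr fun r => ?_
    have e : mulLeft (d r) (S.evolve w0 y) =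
        -mulLeft (S.T r.toNNReal g - g) (S.evolve w0 y) :=
      PreL2.ext (by
        change (g - S.T r.toNNReal g) * _ = -((S.T r.toNNReal g - g) * _); rw [← neg_mul, neg_sub])
    rw [e, norm_neg, Function.comp]
  have h2 : Tendsto (fun r => √(‖S.evolveForm y (w r) - S.evolveForm y w0‖ * (2 * ‖g‖) ^ 2 +
      ‖mulLeft (d r) (S.evolve w0 y)‖ ^ 2)) (𝓝[>] 0) (𝓝 0) := by
    have := (((S.tendsto_evolveForm y hw).mul_const ((2 * ‖g‖) ^ 2)).add (h1.pow 2)).sqrt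
    simpa using this
  refine squeeze_zero (fun r => norm_nonneg _) (fun r => Real.le_sqrt_of_sq_le ?_) h2
  have e1 : ∀ w, ‖mulLeft (d r) (S.evolve w y)‖ ^ 2 = (S.evolveForm y w (star (d r) * d r)).re :=
    fun w => by rw [evolveForm, form_self_star_mul, ofReal_re]
  rw [e1, e1, ← sub_le_iff_le_add, ← sub_re, ← sub_apply]
  refine (Complex.re_le_norm _).trans ((le_opNorm _ _).trans ?_)
  rw [CStarRing.norm_star_mul_self, ← sq]
  exact mul_le_mul_of_nonneg_left (pow_le_pow_left₀ (norm_nonneg _) (hd r) 2) (norm_nonneg _)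

lemma smul_genQuot (hr : 0 < r) (g : N) :
    (r : ℂ) • S.genQuot r g = g - S.T r.toNNReal g := by
  rw [genQuot, smul_smul, Complex.ofReal_inv, mul_inv_cancel₀ (by exact_mod_cast hr.ne'), one_smul]

lemma InDom.tendsto_remainder {g : N} (hg : S.InDom g) (y : τ.PreL2) {w : ℝ → ℝ≥0} {w0 : ℝ≥0}
    (hw : Tendsto w (𝓝[>] 0) (𝓝 w0)) :
    Tendsto (fun r : ℝ => S.evolveForm y (w r) (star (g - S.T r.toNNReal g) * S.genQuot r g))
      (𝓝[>] 0) (𝓝 0) := by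
  refine Metric.tendsto_nhds.2 fun ε hε => ?_
  obtain ⟨U, hU, h2⟩ := hg.exists_small y (max (2 * ‖g‖) ‖(1 : N)‖) (ε := ε / 2) (by positivity)
  obtain ⟨r0, hr0⟩ := (show (𝓝[>] (0 : ℝ)).NeBot from inferInstance).nonempty_of_mem hU
  set x0 := S.genQuot r0 g
  have h3 := ((S.tendsto_norm_mulLeft_sub_evolve g y hw).mul_const (‖x0‖ * ‖y‖)).eventually
    (gt_mem_nhds (show 0 * (‖x0‖ * ‖y‖) < ε / 2 by rw [zero_mul]; positivity))
  filter_upwards [hU, h3] with r hr hr3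
  rw [dist_zero_right]
  set d := g - S.T r.toNNReal g
  have t1 := h2 r hr r0 hr0 (w r) d 1 (((norm_sub_le _ _).trans (by linarith [S.norm_T_le r.toNNReal g])).trans (le_max_left _ _)) (le_max_right _ _)
  have e1 : mulLeft (1 : N) (S.evolve (w r) y) = S.evolve (w r) y := PreL2.ext (by simp)
  have t2 : ‖S.evolveForm y (w r) (star d * x0 * 1)‖ ≤
      ‖mulLeft d (S.evolve (w r) y)‖ * (‖x0‖ * ‖y‖) := by
    rw [evolveForm_apply, e1]
    refine (norm_inner_le_norm _ _).trans (mul_le_mul_of_nonneg_left ?_ (norm_nonneg _))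
    have := norm_mulLeft_le x0 (S.evolve (w r) y)
    rwa [norm_evolve] at this
  have e2 : star d * S.genQuot r g = star d * (S.genQuot r g - x0) * 1 + star d * x0 * 1 := by
    rw [mul_one, mul_one, mul_sub, sub_add_cancel]
  rw [e2, _root_.map_add]; refine (norm_add_le _ _).trans_lt ?_; linarith

variable (S) in
lemma T_toNNReal_add (hr : 0 ≤ r) (hs : 0 ≤ s) (f : N) :
    S.T (s + r).toNNReal f = S.T r.toNNReal (S.T s.toNNReal f) := by
  rw [add_comm, toNNReal_add hr hs, S.map_add]

variable (S) in
/-- The interpolation `s ↦ τ(y⋆ T_{t-s}(|T_s f|²) y)`. -/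
def interpolation (y : τ.PreL2) (t : ℝ) (f : N) (s : ℝ) : ℝ :=
  (S.evolveForm y (t - s).toNNReal (star (S.T s.toNNReal f) * S.T s.toNNReal f)).re

variable (S) in
lemma evolveForm_add (y : τ.PreL2) (w r : ℝ≥0) (b : N) :
    S.evolveForm y (w + r) b = S.evolveForm y w (S.T r b) := by
  simp only [evolveForm, form_evolve, S.map_add]

lemma hasDerivWithinAt_interpolation (y : τ.PreL2) (hs : 0 ≤ s) (hst : s < t) (f : N)
    (h1 : S.InDom (S.T s.toNNReal f)) (h2 : S.InDom (star (S.T s.toNNReal f)))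
    (h3 : S.InDom (star (S.T s.toNNReal f) * S.T s.toNNReal f)) :
    HasDerivWithinAt (S.interpolation y t f)
      (-2 * S.gammaForm (t - s).toNNReal (S.T s.toNNReal f) y) (Ici s) s := by
  set g := S.T s.toNNReal f with hg
  set w : ℝ → ℝ≥0 := fun r => (t - (s + r)).toNNReal with hw
  have hwt : Tendsto w (𝓝[>] 0) (𝓝 (t - s).toNNReal) := by
    have : Continuous w := by fun_prop
    have := (this.tendsto 0).mono_left (nhdsWithin_le_nhds (s := Ioi 0))
    simpa [hw] using this
  obtain ⟨ℓ1, l1, l1'⟩ := h1.exists_tendsto y hwt g 1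
  obtain ⟨ℓ2, l2, l2'⟩ := h2.exists_tendsto y hwt 1 g
  obtain ⟨ℓ3, l3, l3'⟩ := h3.exists_tendsto y hwt 1 1
  have l4 := h1.tendsto_remainder y hwt
  have hγ : S.gammaForm (t - s).toNNReal g y = (2⁻¹ * (ℓ2 + ℓ1 - ℓ3)).re := by
    refine Tendsto.limUnder_eq ((Complex.continuous_re.tendsto _).comp
      ((((l2.add l1).sub l3).const_mul 2⁻¹).congr fun r => ?_))
    change _ = form y y (S.T (t - s).toNNReal (S.gammaQuot r g)); rw [← form_evolve]
    simp only [gammaQuot, star_one, one_mul, mul_one, _root_.map_smul, smul_eq_mul, map_sub,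
      _root_.map_add]
    rfl
  rw [← hasDerivWithinAt_Ioi_iff_Ici, hasDerivWithinAt_iff_tendsto_slope' (by simp), hγ]
  have hsub : Tendsto (fun x => x - s) (𝓝[>] s) (𝓝[>] 0) := by
    refine tendsto_nhdsWithin_iff.2 ⟨?_, ?_⟩
    · have : Continuous fun x => x - s := by fun_prop
      have := (this.tendsto s).mono_left (nhdsWithin_le_nhds (s := Ioi s))
      simpa using this
    · filter_upwards [self_mem_nhdsWithin] with x hx
      exact sub_pos.2 (mem_Ioi.1 hx)
  have key : Tendsto (fun r => (-(S.evolveForm y (w r) (star 1 * S.genQuot r (star g) * g) +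
      S.evolveForm y (w r) (star g * S.genQuot r g * 1) -
      S.evolveForm y (w r) (star 1 * S.genQuot r (star g * g) * 1)) +
      S.evolveForm y (w r) (star (g - S.T r.toNNReal g) * S.genQuot r g)).re) (𝓝[>] 0)
      (𝓝 (-2 * (2⁻¹ * (ℓ2 + ℓ1 - ℓ3)).re)) := by
    have := (Complex.continuous_re.tendsto _).comp ((((l2'.add l1').sub l3').neg).add l4)
    refine this.congr' (.of_forall fun r => rfl) |>.trans (le_of_eq ?_); congr 1; simp
  refine ((key.comp hsub).congr' ?_)
  filter_upwards [nhdsWithin_le_nhds (gt_mem_nhds hst), self_mem_nhdsWithin] with x hxt hxs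
  obtain ⟨r, rfl⟩ : ∃ r, x = s + r := ⟨x - s, by ring⟩
  have hr : 0 < r := by simpa using hxs
  simp only [Function.comp, add_sub_cancel_left]
  have hw0 : (t - s).toNNReal = w r + r.toNNReal := by
    rw [hw, ← toNNReal_add (by linarith) hr.le]
    congr 1; ring
  rw [slope_def_field, add_sub_cancel_left, eq_div_iff hr.ne', interpolation, interpolation, ← hg, hw0,
    evolveForm_add, S.T_toNNReal_add hr.le hs, ← hg]
  have e1 : S.T r.toNNReal g = g - (r : ℂ) • S.genQuot r g := by rw [smul_genQuot hr]; abel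
  have e2 : S.T r.toNNReal (star g * g) = star g * g - (r : ℂ) • S.genQuot r (star g * g) := by
    rw [smul_genQuot hr]; abel
  have e3 : S.genQuot r (star g) = star (S.genQuot r g) := by
    rw [genQuot, genQuot, star_smul, star_sub, map_star']; simp
  have e4 : star (S.T r.toNNReal g) * S.T r.toNNReal g - S.T r.toNNReal (star g * g) =
      (r : ℂ) • (-(star 1 * S.genQuot r (star g) * g + star g * S.genQuot r g * 1 -
        star 1 * S.genQuot r (star g * g) * 1) + star (g - S.T r.toNNReal g) * S.genQuot r g) := by
    rw [e2, e3, e1]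
    simp only [star_sub, star_smul, star_one, one_mul, mul_one, sub_mul, mul_sub, smul_mul_assoc,
      mul_smul_comm, Complex.star_def, conj_ofReal]
    module
  rw [← sub_re, ← map_sub, e4, _root_.map_smul, smul_eq_mul, re_ofReal_mul, mul_comm]
  simp only [_root_.map_add, map_neg, map_sub, w]

variable (S)

lemma continuous_interpolation (y : τ.PreL2) (t : ℝ) (f : N) : Continuous (S.interpolation y t f) := by
  set c : ℝ → N := fun s => star (S.T s.toNNReal f) * S.T s.toNNReal f
  have hc : ∀ s, ‖c s‖ ≤ ‖f‖ ^ 2 := fun s => by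
    rw [CStarRing.norm_star_mul_self, ← sq]
    exact pow_le_pow_left₀ (norm_nonneg _) (S.norm_T_le _ f) 2
  refine Complex.continuous_re.comp (continuous_iff_continuousAt.2 fun s0 => ?_)
  have h1 : Tendsto (fun s => S.evolveForm y (t - s0).toNNReal (c s)) (𝓝 s0)
      (𝓝 (S.evolveForm y (t - s0).toNNReal (c s0))) := by
    simp only [c, evolveForm, form_self_star_mul]
    have h := S.continuous_mulLeft_T (S.evolve (t - s0).toNNReal y) f
    exact (Complex.continuous_ofReal.comp ((h.comp continuous_real_toNNReal).norm.pow 2)).tendsto s0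
  have h2 : Tendsto (fun s => S.evolveForm y (t - s).toNNReal (c s) -
      S.evolveForm y (t - s0).toNNReal (c s)) (𝓝 s0) (𝓝 0) := by
    have h3 : Continuous fun s => S.evolveForm y (t - s).toNNReal :=
      (S.continuous_form_evolve y).comp (by fun_prop)
    have h4 := (tendsto_iff_norm_sub_tendsto_zero.1 (h3.tendsto s0)).mul_const (‖f‖ ^ 2)
    rw [zero_mul] at h4; refine squeeze_zero_norm (fun s => ?_) h4; rw [← sub_apply]
    exact (le_opNorm _ _).trans (mul_le_mul_of_nonneg_left (hc s) (norm_nonneg _))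
  have := h2.add h1
  simpa [ContinuousAt] using this

lemma norm_frame_inl_sq (y : τ.PreL2) (u v : ℝ≥0) (f : N) : ‖S.frame y u v (f, 0)‖ ^ 2 =
    (S.evolveForm y u (star (S.T v f) * S.T v f)).re := by
  have h := S.frame_coe y u v f 0
  rw [Completion.coe_zero] at h
  rw [h, Completion.norm_coe, evolveForm, form_self_star_mul, ofReal_re]
  change ‖mulLeft (S.T v (f + 0)) _‖ ^ 2 = _; rw [add_zero]

lemma gammaForm_evolve (w v : ℝ≥0) (f : N) (y : τ.PreL2) :
    S.gammaForm v f (S.evolve w y) = S.gammaForm (w + v) f y := by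
  have e : ∀ x : N, ⟪S.evolve w y, mulLeft (S.T v x) (S.evolve w y)⟫_ℂ =
      ⟪y, mulLeft (S.T (w + v) x) y⟫_ℂ := fun x => by
    have := S.form_evolve w y (S.T v x)
    rwa [← S.map_add] at this
  simp only [gammaForm, e]

variable {S}

lemma defectSq_le_of_gammaForm_le {𝒜 : NonUnitalStarSubalgebra ℂ N}
    (hT : ∀ s, ∀ f ∈ 𝒜, S.T s f ∈ 𝒜) (hdom : ∀ f ∈ 𝒜, S.InDom f)
    (hΓ : ∀ v : ℝ≥0, 0 < v → ∀ f ∈ 𝒜, ∀ y : τ.PreL2, S.gammaForm 0 (S.T v f) y ≤ S.gammaForm v f y)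
    (ρ : ℝ≥0) (y : τ.PreL2) (u v : ℝ≥0) {f : N} (hf : f ∈ 𝒜) :
    S.defectSq 1 ρ y u (S.TX v (f, 0)) ≤ S.defectSq 1 ρ y (u + v) (f, 0) := by
  have hd : ∀ g ∈ 𝒜, ∀ t s : ℝ, 0 ≤ s → s < t → HasDerivWithinAt (S.interpolation y t g)
      (-2 * S.gammaForm (t - s).toNNReal (S.T s.toNNReal g) y) (Ici s) s := fun g hg t s hs hst =>
    hasDerivWithinAt_interpolation y hs hst g (hdom _ (hT _ _ hg)) (hdom _ (star_mem (hT _ _ hg)))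
      (hdom _ (mul_mem (star_mem (hT _ _ hg)) (hT _ _ hg)))
  have hΓ' : ∀ v : ℝ≥0, ∀ f ∈ 𝒜, ∀ y : τ.PreL2, S.gammaForm 0 (S.T v f) y ≤ S.gammaForm v f y := by
    intro v f hf y
    rcases eq_or_ne v 0 with rfl | hv
    · rw [S.map_zero]
    · exact hΓ v (pos_iff_ne_zero.2 hv) f hf y
  set t1 : ℝ := u + ρ
  set t2 : ℝ := u + v + ρ
  have hk := image_le_of_deriv_right_le_deriv_boundary
    (B := fun s => S.interpolation y t1 (S.T v f) s +
      (S.interpolation y t2 f 0 - S.interpolation y t1 (S.T v f) 0))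
    (S.continuous_interpolation y t2 f).continuousOn
    (fun s hs => hd f hf t2 s hs.1 (hs.2.trans_le (by simp [t2]; positivity)))
    (by simp) ((S.continuous_interpolation y t1 (S.T v f)).add continuous_const).continuousOn
    (fun s hs => (hd _ (hT v f hf) t1 s hs.1 (hs.2.trans_le (by simp [t1]))).add_const _)
    (fun s hs => by
      have e1 : (t2 - s).toNNReal = (t1 - s).toNNReal + v := by
        have h1 : t2 - s = (t1 - s) + v := by simp only [t1, t2]; ring
        have h2 : 0 ≤ t1 - s := by
          have := hs.2
          have := u.coe_nonneg
          linarith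
        rw [h1, toNNReal_add h2 v.coe_nonneg, Real.toNNReal_coe]
      have h3 := hΓ' v _ (hT s.toNNReal f hf) (S.evolve (t1 - s).toNNReal y)
      rw [gammaForm_evolve, gammaForm_evolve, add_zero, ← S.map_add, add_comm v, S.map_add, ← e1] at h3
      linarith)
    ⟨ρ.coe_nonneg, le_rfl⟩
  have e2 : ∀ (u v : ℝ≥0) (f : N) (t s : ℝ), t = u + s → s = v →
      S.interpolation y t f s = ‖S.frame y u v (f, 0)‖ ^ 2 := by
    rintro u v f t _ rfl rfl
    rw [norm_frame_inl_sq, interpolation, add_sub_cancel_right, Real.toNNReal_coe, Real.toNNReal_coe]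
  have e3 : S.TX v (f, 0) = (S.T v f, 0) := Prod.ext rfl (_root_.map_zero (S.T2L v))
  rw [e2 (u + v) ρ f t2 ρ (by simp [t2]) rfl, e2 u ρ (S.T v f) t1 ρ (by simp [t1]) rfl,
    e2 (u + v + ρ) 0 f t2 0 (by simp [t2]) (by simp), e2 (u + ρ) 0 (S.T v f) t1 0 (by simp [t1])
    (by simp)] at hk
  rw [defectSq, defectSq, e3]; linarith

lemma mem_closure_image_of_weakStar_dense {F : Type*} [NormedAddCommGroup F] [InnerProductSpace ℂ F]
    [CompleteSpace F] (A : N →L[ℂ] F) (hA : ∀ e : F, (innerSL ℂ e) ∘L A ∈ N.predual)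
    (V : Submodule ℂ N) (hV : ∀ b : N, b ∈ @closure N (weakStar N) (V : Set N)) (f : N) :
    A f ∈ closure (A '' V) := by
  have h : A f ∈ (V.map (A : N →ₗ[ℂ] F)).topologicalClosure := by
    rw [← Submodule.orthogonal_orthogonal_eq_closure, Submodule.mem_orthogonal]; intro e he
    have h1 := VonNeumannAlgebra.eq_zero_of_weakStar_dense (hA e) hV fun b hb =>
      Submodule.inner_left_of_mem_orthogonal (Submodule.mem_map_of_mem hb) he
    exact DFunLike.congr_fun h1 f
  exact h

variable (S) in
lemma inner_frame_mem_predual (y : τ.PreL2) (u v : ℝ≥0) (e : τ.L2) :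
    (innerSL ℂ e) ∘L S.frame y u v ∘L ContinuousLinearMap.inl ℂ N τ.L2 ∈ N.predual := by
  induction e using Completion.induction_on with
  | hp =>
    exact (isClosed_predual N).preimage (by fun_prop)
  | ih z =>
    have e1 : (innerSL ℂ (z : τ.L2)) ∘L S.frame y u v ∘L ContinuousLinearMap.inl ℂ N τ.L2 =
        form z (S.evolve u y) ∘L S.TL v := by
      ext b
      have h := S.frame_coe y u v b 0
      rw [Completion.coe_zero] at h
      change ⟪(z : τ.L2), S.frame y u v (b, 0)⟫_ℂ = ⟪z, mulLeft (S.T v b) (S.evolve u y)⟫_ℂ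
      rw [h, Completion.inner_coe]; change ⟪z, mulLeft (S.T v (b + 0)) (S.evolve u y)⟫_ℂ = _
      rw [add_zero]
    rw [e1]; exact S.form_T_mem_predual z _ v

lemma GammaSqNonneg.gammaSqX (h : S.GammaSqNonneg) : S.GammaSqX := by
  obtain ⟨𝒜, hdense, hT, hdom, hΓ⟩ := h
  intro ρ y u v f
  let A : Fin 4 → τ.X →L[ℂ] τ.L2 := ![S.frame y (u + ρ) v, S.frame y u (ρ + v),
    S.frame y (u + v + ρ) 0, S.frame y (u + v) ρ]
  let Q : Set (PiLp 2 fun _ : Fin 4 => τ.L2) :=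
    {e | ‖e 0‖ ^ 2 - 1 * ‖e 1‖ ^ 2 ≤ ‖e 2‖ ^ 2 - 1 * ‖e 3‖ ^ 2}
  have hQ : IsClosed Q := isClosed_le (by fun_prop) (by fun_prop)
  let B : τ.X →L[ℂ] PiLp 2 fun _ => τ.L2 :=
    (PiLp.continuousLinearEquiv 2 ℂ fun _ => τ.L2).symm.toContinuousLinearMap ∘L
      ContinuousLinearMap.pi A
  have hB : ∀ f, B f ∈ Q ↔ S.defectSq 1 ρ y u (S.TX v f) ≤ S.defectSq 1 ρ y (u + v) f := by
    intro f; rw [defectSq, defectSq, frame_TX, frame_TX, zero_add]; rfl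
  rw [← hB]
  have h1 : ∀ b : N, B (b, 0) ∈ Q := by
    intro b
    have h2 := mem_closure_image_of_weakStar_dense (B ∘L ContinuousLinearMap.inl ℂ N τ.L2) (fun e => ?_)
      𝒜.toSubmodule hdense b
    · refine hQ.closure_subset_iff.2 ?_ h2; rintro _ ⟨a, ha, rfl⟩
      exact (hB _).2 (defectSq_le_of_gammaForm_le hT hdom hΓ ρ y u v ha)
    · have e1 : (innerSL ℂ e) ∘L B ∘L ContinuousLinearMap.inl ℂ N τ.L2 =
          ∑ i, (innerSL ℂ (e i)) ∘L A i ∘L ContinuousLinearMap.inl ℂ N τ.L2 := by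
        ext b; exact PiLp.inner_apply e (B (b, 0))
      rw [e1]; refine Submodule.sum_mem _ fun i _ => ?_
      fin_cases i <;> exact S.inner_frame_mem_predual y _ _ _
  obtain ⟨b, g⟩ := f
  induction g using Completion.induction_on with
  | hp => exact hQ.preimage (B.continuous.comp (by fun_prop))
  | ih z =>
    have e1 : B (b, (z : τ.L2)) = B (b + z.val, 0) := by
      have e2 : ∀ u v, S.frame y u v (b, (z : τ.L2)) = S.frame y u v (b + z.val, 0) := fun u v => by
        have h := S.frame_coe y u v (b + z.val) 0
        rw [Completion.coe_zero] at h; rw [h, frame_coe]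
        change _ = ((mulLeft (S.T v (b + z.val + 0)) _ : τ.PreL2) : τ.L2); rw [add_zero]
      have e3 : (fun i => A i (b, (z : τ.L2))) = fun i => A i (b + z.val, 0) := by
        funext i
        fin_cases i <;> exact e2 _ _
      exact congrArg (PiLp.continuousLinearEquiv 2 ℂ fun _ => τ.L2).symm e3
    rw [e1]; exact h1 _

end StandardSemigroup

lemma aecover_truncation : AECover (volume.restrict (Ioi (0 : ℝ)))
    (𝓝[>] (0 : ℝ) ×ˢ (atTop : Filter ℝ)) fun r => Ioc r.1 r.2 where
  ae_eventually_mem := (ae_restrict_iff' measurableSet_Ioi).2 (ae_of_all _ fun x hx => by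
    have h1 : ∀ᶠ ε in 𝓝[>] 0, ε < x := nhdsWithin_le_nhds (gt_mem_nhds hx)
    exact (h1.prod_mk (eventually_ge_atTop x)).mono fun r hr => ⟨hr.1, hr.2⟩)
  measurableSet _ := measurableSet_Ioc

lemma tendsto_setIntegral_truncation {F : ℝ → ℂ} (hF : IntegrableOn F (Ioi 0)) :
    Tendsto (fun r : ℝ × ℝ => ∫ t in Ioc r.1 r.2, F t) (𝓝[>] (0 : ℝ) ×ˢ (atTop : Filter ℝ))
      (𝓝 (∫ t in Ioi 0, F t)) := by
  refine (aecover_truncation.integral_tendsto_of_countably_generated hF).congr' ?_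
  filter_upwards [StandardSemigroup.eventually_trunc] with r hr
  rw [Measure.restrict_restrict measurableSet_Ioc,
    inter_eq_left.2 (Ioc_subset_Ioi_self.trans (Ioi_subset_Ioi hr.1.le))]

lemma setLIntegral_Ioi_le_of_truncation {F : ℝ → ℝ≥0∞} (hF : AEMeasurable F (volume.restrict (Ioi 0)))
    {C : ℝ≥0∞} (h : ∀ ε R, 0 < ε → ε ≤ R → ∫⁻ t in Ioc ε R, F t ≤ C) : ∫⁻ t in Ioi 0, F t ≤ C := by
  refine le_of_tendsto (aecover_truncation.lintegral_tendsto_of_countably_generated hF) ?_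
  filter_upwards [StandardSemigroup.eventually_trunc] with r hr
  rw [Measure.restrict_restrict measurableSet_Ioc,
    inter_eq_left.2 (Ioc_subset_Ioi_self.trans (Ioi_subset_Ioi hr.1.le))]
  exact h _ _ hr.1 hr.2

namespace StandardSemigroup

variable (S : StandardSemigroup τ)

lemma exists_isMultiplierX_inl (hn : 1 ≤ n)
    (ham : AEStronglyMeasurable a (volume.restrict (Ioi 0)))
    (hat : IntegrableOn (fun t => a t / t) (Ioi 0)) (f : N) :
    ∃ g : N, S.IsMultiplierX a n (f, 0) (g, 0) := by
  set G : ℝ → N := fun t => (a t * t ^ (n - 1)) • (S.dX n t (f, 0)).1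
  have hG : IntegrableOn G (Ioi 0) := by
    refine (hat.norm.const_mul (‖(f, (0 : τ.L2))‖ * pConst n)).mono' ?_ ?_
    · refine AEStronglyMeasurable.smul (ham.mul ?_) ?_
      · exact (by fun_prop : Continuous fun t : ℝ => (t : ℂ) ^ (n - 1)).aestronglyMeasurable
      · exact (continuous_fst.comp_continuousOn (S.continuousOn_dX n (f, 0))).aestronglyMeasurable
          measurableSet_Ioi
    · refine (ae_restrict_iff' measurableSet_Ioi).2 (ae_of_all _ fun t ht => ?_)
      have ht : 0 < t := ht
      have h1 := (norm_fst_le _).trans (S.norm_dX_le n ht (f, 0))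
      simp only [G, norm_smul, norm_mul, norm_pow, norm_div, norm_real, norm_eq_abs, abs_of_pos ht]
      refine (mul_le_mul_of_nonneg_left h1 (by positivity)).trans (le_of_eq ?_)
      obtain ⟨k, rfl⟩ := Nat.exists_eq_add_of_le hn
      rw [add_tsub_cancel_left, pow_add, pow_one]; field_simp
  refine ⟨∫ t in Ioi 0, G t, fun y z => ?_⟩
  let L : N →L[ℂ] ℂ := (innerSL ℂ (z : τ.L2)) ∘L act y ∘L ContinuousLinearMap.inl ℂ N τ.L2
  have hL := L.integral_comp_comm hG
  have h2 := tendsto_setIntegral_truncation (L.integrable_comp hG)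
  have e : ⟪(z : τ.L2), act y (∫ t in Ioi 0, G t, 0)⟫_ℂ = ∫ t in Ioi 0, L (G t) := hL.symm
  rw [e]; refine h2.congr' ?_
  filter_upwards [eventually_trunc] with r hr
  refine setIntegral_congr_fun measurableSet_Ioc fun t ht => ?_
  have e2 : S.dX n t (f, 0) = ((S.dX n t (f, 0)).1, 0) := by rw [S.dX_inl n (hr.1.trans ht.1)]
  simp only [G, _root_.map_smul, smul_eq_mul]
  conv_rhs => rw [e2]
  rfl

/-- `∂_t^m P_t` on `L₂`. -/
def d2 (m : ℕ) (t : ℝ) (f : τ.L2) : τ.L2 :=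
  ∫ u in Ioi (0 : ℝ), pDeriv m t u • S.T2L u.toNNReal f

lemma hasDerivAt_d2 (m : ℕ) (ht : 0 < t) (f : τ.L2) :
    HasDerivAt (fun r => S.d2 m r f) (S.d2 (m + 1) t f) t :=
  (ContinuousLinearMap.snd ℝ N τ.L2).hasFDerivAt.comp_hasDerivAt t (S.hasDerivAt_dX m ht (0, f))

lemma norm_d2_le (m : ℕ) (ht : 0 < t) (f : τ.L2) :
    ‖S.d2 m t f‖ ≤ ‖f‖ * (pConst m * (t ^ m)⁻¹) := by
  have h := (norm_snd_le _).trans (S.norm_dX_le m ht (0, f))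
  have e : ‖((0 : N), f)‖ = ‖f‖ := by simp [Prod.norm_def]
  rwa [e] at h

lemma integrableOn_d2 (hψ : IntegrableOn ψ (Ioi 0)) (f : τ.L2) :
    IntegrableOn (fun u : ℝ => ψ u • S.T2L u.toNNReal f) (Ioi 0) := by
  refine (hψ.norm.mul_const ‖f‖).mono' (hψ.aestronglyMeasurable.smul
    (S.continuous_T2L_toNNReal f).aestronglyMeasurable) (ae_of_all _ fun u => ?_)
  rw [norm_smul]; exact mul_le_mul_of_nonneg_left (S.norm_T2L_le _ f) (norm_nonneg _)

lemma inner_d2 (m : ℕ) (ht : 0 < t) (f h : τ.L2) : ⟪h, S.d2 m t f⟫_ℂ = ⟪S.d2 m t h, f⟫_ℂ := by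
  have hi := integrableOn_pDeriv m ht
  rw [d2, ← integral_inner (S.integrableOn_d2 hi f), ← inner_conj_symm, d2,
    ← integral_inner (S.integrableOn_d2 hi h), ← integral_conj]
  refine integral_congr_ae (ae_of_all _ fun u => ?_); simp only [inner_conj_symm]
  rw [inner_smul_right_eq_smul, inner_smul_left_eq_smul, inner_T2L]

lemma d2_d2 (i j : ℕ) (hs : 0 < s) (ht : 0 < t) (f : τ.L2) :
    S.d2 i s (S.d2 j t f) = S.d2 (i + j) (s + t) f := by
  have h := integral_pDeriv_conv
    (S.continuous_T2L_toNNReal f).stronglyMeasurable (fun u => S.norm_T2L_le _ f) i j hs ht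
  rw [d2, d2, d2, ← h]; refine setIntegral_congr_fun measurableSet_Ioi fun r hr => ?_
  rw [← (S.T2L r.toNNReal).integral_comp_comm (S.integrableOn_d2 (integrableOn_pDeriv j ht) f)]
  congr 1; refine setIntegral_congr_fun measurableSet_Ioi fun q hq => ?_
  rw [toNNReal_add (mem_Ioi.1 hr).le (mem_Ioi.1 hq).le, T2L_add,
    (S.T2L r.toNNReal).map_smul_of_tower]

lemma continuousOn_d2 (m : ℕ) (f : τ.L2) : ContinuousOn (fun r => S.d2 m r f) (Ioi 0) := fun _ hr =>
  (S.hasDerivAt_d2 m hr f).continuousAt.continuousWithinAt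

lemma lintegral_norm_d2_sq_le (h : τ.L2) :
    ∫⁻ r in Ioi 0, ofReal (r * ‖S.d2 1 (r / 3) h‖ ^ 2) ≤
      ofReal (9 / 2 * (pConst 0 + pConst 1) * ‖h‖ ^ 2) := by
  set k : ℕ → ℝ → ℝ := fun m r => (⟪h, S.d2 m (2 * r / 3) h⟫_ℂ).re with hk
  have hkd : ∀ m r, 0 < r → HasDerivAt (k m) (2 / 3 * k (m + 1) r) r := by
    intro m r hr
    have hr' : 0 < 2 * r / 3 := by positivity
    have h2 := (S.hasDerivAt_d2 m hr' h).scomp r (by simpa using ((hasDerivAt_id r).const_mul 2).div_const 3)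
    have h3 := ((Complex.reCLM ∘L (innerSL ℂ h).restrictScalars ℝ).hasFDerivAt).comp_hasDerivAt r h2
    refine h3.congr_deriv ?_; simp [hk]
  have hk2 : ∀ r, 0 < r → k 2 r = ‖S.d2 1 (r / 3) h‖ ^ 2 := by
    intro r hr
    have h1 := S.d2_d2 1 1 (show 0 < r / 3 by positivity) (show 0 < r / 3 by positivity) h
    rw [show r / 3 + r / 3 = 2 * r / 3 by ring] at h1
    simp only [hk]; rw [← h1, S.inner_d2 1 (by positivity), inner_self_eq_norm_sq_to_K]
    norm_cast
  have hkb : ∀ m r, 0 < r → |k m r| ≤ ‖h‖ ^ 2 * (pConst m * ((2 * r / 3) ^ m)⁻¹) := by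
    intro m r hr; refine (Complex.abs_re_le_norm _).trans ((norm_inner_le_norm _ _).trans ?_)
    have := mul_le_mul_of_nonneg_left (S.norm_d2_le m (show 0 < 2 * r / 3 by positivity) h) (norm_nonneg h)
    linarith
  have hFb : ∀ r, 0 < r → |3 / 2 * r * k 1 r - 9 / 4 * k 0 r| ≤
      9 / 4 * (pConst 0 + pConst 1) * ‖h‖ ^ 2 := by
    intro r hr
    have h0 := hkb 0 r hr
    have h1 := mul_le_mul_of_nonneg_left (hkb 1 r hr) (show 0 ≤ 3 / 2 * r by positivity)
    have e : 3 / 2 * r * (‖h‖ ^ 2 * (pConst 1 * ((2 * r / 3) ^ 1)⁻¹)) =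
        9 / 4 * pConst 1 * ‖h‖ ^ 2 := by
      field_simp; ring
    rw [pow_zero, inv_one, mul_one] at h0; refine (abs_sub _ _).trans ?_
    rw [abs_mul, abs_mul (9 / 4 : ℝ), abs_of_pos (show 0 < 3 / 2 * r by positivity),
      abs_of_pos (show (0 : ℝ) < 9 / 4 by norm_num)]
    linarith
  refine setLIntegral_Ioi_le_of_truncation ?_ fun ε R hε hR => ?_
  · refine ENNReal.measurable_ofReal.comp_aemeasurable (ContinuousOn.aemeasurable ?_ measurableSet_Ioi)
    refine continuousOn_id.mul ((ContinuousOn.norm ?_).pow 2)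
    exact (S.continuousOn_d2 1 h).comp (by fun_prop) fun r hr => div_pos (mem_Ioi.1 hr) (by norm_num)
  · have hsub : Icc ε R ⊆ Ioi 0 := fun r hr => hε.trans_le hr.1
    have hc : ContinuousOn (fun r => r * k 2 r) (Icc ε R) :=
      (continuousOn_id.mul ((fun m r hr => (hkd m r hr).continuousAt.continuousWithinAt) 2)).mono hsub
    have h1 := intervalIntegral.integral_eq_sub_of_hasDerivAt
      (f := fun r => 3 / 2 * r * k 1 r - 9 / 4 * k 0 r) (f' := fun r => r * k 2 r)
      (fun r hr => by
        rw [uIcc_of_le hR] at hr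
        have hr0 := hsub hr
        have h2 := (((hasDerivAt_id r).const_mul (3 / 2)).mul (hkd 1 r hr0)).sub
          ((hkd 0 r hr0).const_mul (9 / 4))
        refine h2.congr_deriv ?_; simp
        ring) (by
        refine ContinuousOn.intervalIntegrable ?_; rwa [uIcc_of_le hR])
    rw [intervalIntegral.integral_of_le hR] at h1
    have h2 : ∫⁻ r in Ioc ε R, ofReal (r * ‖S.d2 1 (r / 3) h‖ ^ 2) =
        ofReal (∫ r in Ioc ε R, r * k 2 r) := by
      rw [ofReal_integral_eq_lintegral_ofReal ((hc.integrableOn_Icc).mono_set Ioc_subset_Icc_self)]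
      · refine setLIntegral_congr_fun measurableSet_Ioc fun r hr => ?_; rw [hk2 r (hε.trans hr.1)]
      · refine (ae_restrict_iff' measurableSet_Ioc).2 (ae_of_all _ fun r hr => ?_)
        have hr0 := hε.trans hr.1
        simp; rw [hk2 r hr0]; positivity
    rw [h2, h1]; refine ofReal_le_ofReal ?_
    have h3 := abs_le.1 (hFb R (hε.trans_le hR))
    have h4 := abs_le.1 (hFb ε hε)
    linarith

lemma enorm_inner_d2_le_lintegral (hn : 1 ≤ n) (f h : τ.L2) (ht : 0 < t) :
    ‖⟪h, S.d2 n t f⟫_ℂ‖ₑ ≤ ∫⁻ r in Ioi t, ‖⟪h, S.d2 (n + 1) r f⟫_ℂ‖ₑ := by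
  have hd : ∀ r, 0 < r → HasDerivAt (fun r => ⟪h, S.d2 n r f⟫_ℂ) ⟪h, S.d2 (n + 1) r f⟫_ℂ r :=
    fun r hr => ((innerSL ℂ h).restrictScalars ℝ).hasFDerivAt.comp_hasDerivAt r (S.hasDerivAt_d2 n hr f)
  have hle : ∀ R, t ≤ R → ‖⟪h, S.d2 n t f⟫_ℂ‖ₑ ≤
      ofReal (‖h‖ * (‖f‖ * (pConst n * (R ^ n)⁻¹))) +
        ∫⁻ r in Ioi t, ‖⟪h, S.d2 (n + 1) r f⟫_ℂ‖ₑ := by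
    intro R hR
    have hR0 := ht.trans_le hR
    have h1 := intervalIntegral.integral_eq_sub_of_hasDerivAt (fun r hr => by
        rw [uIcc_of_le hR] at hr
        exact hd r (ht.trans_le hr.1)) (by
        refine ContinuousOn.intervalIntegrable ?_; rw [uIcc_of_le hR]
        exact continuousOn_const.inner ((S.continuousOn_d2 (n + 1) f).mono fun r hr => ht.trans_le hr.1))
    rw [intervalIntegral.integral_of_le hR] at h1
    have e : ⟪h, S.d2 n t f⟫_ℂ = ⟪h, S.d2 n R f⟫_ℂ - ∫ r in Ioc t R, ⟪h, S.d2 (n + 1) r f⟫_ℂ := by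
      rw [h1]; ring
    rw [e]; refine (enorm_sub_le).trans (add_le_add ?_ ?_)
    · rw [← ofReal_norm]; refine ofReal_le_ofReal ((norm_inner_le_norm _ _).trans ?_)
      exact mul_le_mul_of_nonneg_left (S.norm_d2_le n hR0 f) (norm_nonneg h)
    · exact (enorm_integral_le_lintegral_enorm _).trans (lintegral_mono_set Ioc_subset_Ioi_self)
  have hlim : Tendsto (fun R => ofReal (‖h‖ * (‖f‖ * (pConst n * (R ^ n)⁻¹))) +
        ∫⁻ r in Ioi t, ‖⟪h, S.d2 (n + 1) r f⟫_ℂ‖ₑ) atTop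
      (𝓝 (ofReal (‖h‖ * (‖f‖ * (pConst n * 0))) +
        ∫⁻ r in Ioi t, ‖⟪h, S.d2 (n + 1) r f⟫_ℂ‖ₑ)) := by
    exact Tendsto.add (tendsto_ofReal (Tendsto.const_mul _ (Tendsto.const_mul _
      (Tendsto.const_mul _ (tendsto_inv_atTop_zero.comp (tendsto_pow_atTop (by omega))))))) tendsto_const_nhds
  rw [mul_zero, mul_zero, mul_zero, ENNReal.ofReal_zero, zero_add] at hlim
  exact ge_of_tendsto hlim ((eventually_ge_atTop t).mono hle)

end StandardSemigroup

lemma lintegral_Ioi_mul_lintegral_Ioi {A B : ℝ → ℝ≥0∞} (hA : AEMeasurable A (volume.restrict (Ioi 0)))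
    (hB : AEMeasurable B (volume.restrict (Ioi 0))) :
    ∫⁻ t in Ioi (0 : ℝ), A t * ∫⁻ r in Ioi t, B r =
      ∫⁻ r in Ioi (0 : ℝ), B r * ∫⁻ t in Ioo 0 r, A t := by
  set g : ℝ × ℝ → ℝ≥0∞ := {p : ℝ × ℝ | p.1 < p.2}.indicator 1
  have hg : Measurable g := measurable_one.indicator (measurableSet_lt measurable_fst measurable_snd)
  have hm : AEMeasurable (Function.uncurry fun t r => A t * (B r * g (t, r)))
      ((volume.restrict (Ioi 0)).prod (volume.restrict (Ioi 0))) :=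
    (hA.comp_quasiMeasurePreserving Measure.quasiMeasurePreserving_fst).mul
      ((hB.comp_quasiMeasurePreserving Measure.quasiMeasurePreserving_snd).mul hg.aemeasurable)
  have h := lintegral_lintegral_swap hm
  have e1 : ∀ t ∈ Ioi 0, ∫⁻ r in Ioi 0, A t * (B r * g (t, r)) = A t * ∫⁻ r in Ioi t, B r := by
    intro t ht
    have hBg : AEMeasurable (fun r => B r * g (t, r)) (volume.restrict (Ioi 0)) :=
      hB.mul (hg.comp measurable_prodMk_left).aemeasurable
    rw [lintegral_const_mul'' _ hBg]; congr 1
    have e2 : ∀ r, B r * g (t, r) = (Ioi t).indicator B r := fun r => by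
      by_cases hr : t < r
      · simp [g, hr]
      · simp [g, hr]
    simp only [e2]
    rw [lintegral_indicator measurableSet_Ioi, Measure.restrict_restrict measurableSet_Ioi,
      inter_eq_left.2 (Ioi_subset_Ioi (mem_Ioi.1 ht).le)]
  have e3 : ∀ r ∈ Ioi 0, ∫⁻ t in Ioi 0, A t * (B r * g (t, r)) = B r * ∫⁻ t in Ioo 0 r, A t := by
    intro r hr
    have e4 : ∀ t, A t * (B r * g (t, r)) = B r * (Iio r).indicator A t := fun t => by
      by_cases hr : t < r
      · simp [g, hr, mul_comm]
      · simp [g, hr]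
    simp only [e4]
    rw [lintegral_const_mul'' _ (hA.indicator measurableSet_Iio), lintegral_indicator measurableSet_Iio,
      Measure.restrict_restrict measurableSet_Iio, inter_comm, Ioi_inter_Iio]
  rw [setLIntegral_congr_fun measurableSet_Ioi e1, setLIntegral_congr_fun measurableSet_Ioi e3] at h
  exact h

namespace StandardSemigroup

variable (S : StandardSemigroup τ)

lemma norm_inner_d2_succ_le (hn : 1 ≤ n) (f h : τ.L2) (hr : 0 < r) :
    r ^ n * ‖⟪h, S.d2 (n + 1) r f⟫_ℂ‖ ≤ pConst (n - 1) * 3 ^ (n - 1) *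
      (r * ‖S.d2 1 (r / 3) h‖ ^ 2 + r * ‖S.d2 1 (r / 3) f‖ ^ 2) := by
  obtain ⟨k, rfl⟩ := Nat.exists_eq_add_of_le hn
  have hr3 : 0 < r / 3 := by positivity
  have e : S.d2 (1 + k + 1) r f = S.d2 1 (r / 3) (S.d2 k (r / 3) (S.d2 1 (r / 3) f)) := by
    rw [S.d2_d2 k 1 hr3 hr3, S.d2_d2 1 (k + 1) hr3 (by positivity)]
    congr 1; ring
  have hC := pConst_nonneg k
  set x := ‖S.d2 1 (r / 3) h‖
  set w := S.d2 1 (r / 3) f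
  have h1 : ‖⟪h, S.d2 (1 + k + 1) r f⟫_ℂ‖ ≤ x * (‖w‖ * (pConst k * ((r / 3) ^ k)⁻¹)) := by
    rw [e, S.inner_d2 1 hr3]
    exact (norm_inner_le_norm _ _).trans (mul_le_mul_of_nonneg_left (S.norm_d2_le k hr3 w) (norm_nonneg _))
  have h2 : x * ‖w‖ ≤ x ^ 2 + ‖w‖ ^ 2 := by nlinarith [sq_nonneg (x - ‖w‖), sq_nonneg x, sq_nonneg ‖w‖]
  rw [add_tsub_cancel_left]
  calc r ^ (1 + k) * ‖⟪h, S.d2 (1 + k + 1) r f⟫_ℂ‖ ≤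
        r ^ (1 + k) * (x * (‖w‖ * (pConst k * ((r / 3) ^ k)⁻¹))) := by gcongr
    _ = pConst k * 3 ^ k * r * (x * ‖w‖) := by
        rw [div_pow, pow_add, pow_one]; field_simp
    _ ≤ pConst k * 3 ^ k * r * (x ^ 2 + ‖w‖ ^ 2) := by gcongr
    _ = _ := by ring

lemma exists_lintegral_multiplier_le (hn : 1 ≤ n) (ha : IsSymbol a ca) :
    ∃ K : ℝ, 0 ≤ K ∧ ∀ f h : τ.L2,
      ∫⁻ t in Ioi 0, ‖a t * (t : ℂ) ^ (n - 1) * ⟪h, S.d2 n t f⟫_ℂ‖ₑ ≤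
        ofReal (K * (‖h‖ ^ 2 + ‖f‖ ^ 2)) := by
  have hca := ha.pos
  set C := pConst (n - 1) * 3 ^ (n - 1)
  set D := 9 / 2 * (pConst 0 + pConst 1)
  have hC : 0 ≤ C := mul_nonneg (pConst_nonneg _) (by positivity)
  have hD : 0 ≤ D := mul_nonneg (by norm_num) (add_nonneg (pConst_nonneg _) (pConst_nonneg _))
  refine ⟨2 * ca * C * D, by positivity, fun f h => ?_⟩
  set A : ℝ → ℝ≥0∞ := fun t => ‖a t * t ^ (n - 1)‖ₑ
  set B : ℝ → ℝ≥0∞ := fun r => ‖⟪h, S.d2 (n + 1) r f⟫_ℂ‖ₑ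
  have hsq : ∀ h : τ.L2, AEMeasurable (fun r => ofReal (r * ‖S.d2 1 (r / 3) h‖ ^ 2))
      (volume.restrict (Ioi 0)) := fun h => by
    refine ENNReal.measurable_ofReal.comp_aemeasurable (ContinuousOn.aemeasurable ?_ measurableSet_Ioi)
    exact continuousOn_id.mul ((ContinuousOn.norm ((S.continuousOn_d2 1 h).comp (by fun_prop) fun r hr => div_pos (mem_Ioi.1 hr) (by norm_num))).pow 2)
  have hin : ∀ r ∈ Ioi 0, B r * ∫⁻ t in Ioo 0 r, A t ≤ ofReal (2 * ca * C) *
      (ofReal (r * ‖S.d2 1 (r / 3) h‖ ^ 2) + ofReal (r * ‖S.d2 1 (r / 3) f‖ ^ 2)) := by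
    intro r hr
    have hr : 0 < r := hr
    have h1 : ∫⁻ t in Ioo 0 r, A t ≤ ofReal (r ^ (n - 1)) * ofReal (2 * r * ca) := by
      calc _ ≤ ∫⁻ t in Ioo 0 r, ofReal (r ^ (n - 1)) * ‖a t‖ₑ := by
            refine setLIntegral_mono' measurableSet_Ioo fun t ht => ?_; simp only [A]
            rw [enorm_mul, mul_comm]; refine mul_le_mul' ?_ le_rfl
            rw [← ofReal_norm, norm_pow, norm_real, norm_of_nonneg ht.1.le]
            exact ofReal_le_ofReal (pow_le_pow_left₀ ht.1.le ht.2.le _)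
        _ ≤ _ := by
            rw [lintegral_const_mul' _ _ ofReal_ne_top]
            exact mul_le_mul' le_rfl ((lintegral_mono_set Ioo_subset_Ioc_self).trans
              (ha.lintegral_le hr))
    refine (mul_le_mul' le_rfl h1).trans ?_
    have h2 := S.norm_inner_d2_succ_le hn f h hr
    simp only [B]
    rw [← ofReal_norm, ← ofReal_mul (by positivity), ← ofReal_mul (norm_nonneg _),
      ← ofReal_add (by positivity) (by positivity), ← ofReal_mul (by positivity)]
    refine ofReal_le_ofReal ?_
    have e : r ^ n = r ^ (n - 1) * r := by rw [← pow_succ, Nat.sub_add_cancel hn]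
    have h3 := mul_le_mul_of_nonneg_left h2 (show 0 ≤ 2 * ca by positivity)
    rw [e] at h3; linarith
  calc ∫⁻ t in Ioi 0, ‖a t * t ^ (n - 1) * ⟪h, S.d2 n t f⟫_ℂ‖ₑ
      ≤ ∫⁻ t in Ioi 0, A t * ∫⁻ r in Ioi t, B r := by
        refine setLIntegral_mono' measurableSet_Ioi fun t ht => ?_; rw [enorm_mul]
        exact mul_le_mul' le_rfl (S.enorm_inner_d2_le_lintegral hn f h ht)
    _ = ∫⁻ r in Ioi 0, B r * ∫⁻ t in Ioo 0 r, A t := lintegral_Ioi_mul_lintegral_Ioi ((ha.meas.mul (by fun_prop : Continuous fun t : ℝ => (t : ℂ) ^ (n - 1)).aestronglyMeasurable).enorm) (((continuousOn_const.inner (S.continuousOn_d2 (n + 1) f)).aestronglyMeasurable measurableSet_Ioi).enorm)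
    _ ≤ ∫⁻ r in Ioi 0, ofReal (2 * ca * C) * (ofReal (r * ‖S.d2 1 (r / 3) h‖ ^ 2) +
          ofReal (r * ‖S.d2 1 (r / 3) f‖ ^ 2)) := setLIntegral_mono' measurableSet_Ioi hin
    _ ≤ ofReal (2 * ca * C) * (ofReal (D * ‖h‖ ^ 2) + ofReal (D * ‖f‖ ^ 2)) := by
        rw [lintegral_const_mul' _ _ ofReal_ne_top, lintegral_add_left' (hsq h)]
        gcongr <;> exact S.lintegral_norm_d2_sq_le _
    _ = _ := by
        rw [← ofReal_add (by positivity) (by positivity), ← ofReal_mul (by positivity)]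
        congr 1; ring

lemma exists_isMultiplierX_inr (hn : 1 ≤ n) (ha : IsSymbol a ca) (f : τ.L2) : ∃ g : τ.L2, S.IsMultiplierX a n (0, f) (0, g) := by
  obtain ⟨K, hK, hle⟩ := S.exists_lintegral_multiplier_le hn ha
  set F : τ.L2 → ℝ → ℂ := fun h t => a t * t ^ (n - 1) * ⟪h, S.d2 n t f⟫_ℂ with hF
  have hint : ∀ h, IntegrableOn (F h) (Ioi 0) := fun h => by
    exact ⟨(ha.meas.mul (by fun_prop : Continuous fun t : ℝ => (t : ℂ) ^ (n - 1)).aestronglyMeasurable).mul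
      ((continuousOn_const.inner (S.continuousOn_d2 n f)).aestronglyMeasurable measurableSet_Ioi), (hle f h).trans_lt ofReal_lt_top⟩
  let Λ : τ.L2 →ₗ[ℂ] ℂ :=
    { toFun := fun h => ∫ t in Ioi 0, (starRingEnd ℂ) (F h t)
      map_add' := fun h h' => by
        rw [integral_conj, integral_conj, integral_conj, ← _root_.map_add, ← integral_add (hint h) (hint h')]
        simp only [hF, inner_add_left, mul_add]
      map_smul' := fun c h => by
        have e : ∀ t, F (c • h) t = (starRingEnd ℂ) c * F h t := fun t => by
          simp only [hF, inner_smul_left]; ring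
        simp only [e]
        rw [integral_conj, integral_conj, integral_const_mul, _root_.map_mul, Complex.conj_conj]
        rfl }
  have hb : ∀ h, ‖h‖ ≤ 1 → ‖Λ h‖ ≤ K * (1 + ‖f‖ ^ 2) := fun h hh => by
    change ‖∫ t in Ioi 0, (starRingEnd ℂ) (F h t)‖ ≤ _; rw [integral_conj, RCLike.norm_conj]
    have h1 := (enorm_integral_le_lintegral_enorm (F h)).trans (hle f h)
    rw [← ofReal_norm, ofReal_le_ofReal_iff (by positivity)] at h1
    refine h1.trans (mul_le_mul_of_nonneg_left ?_ hK)
    have := pow_le_one₀ (n := 2) (norm_nonneg h) hh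
    linarith
  have hb' := LinearMap.bound_of_ball_bound' zero_lt_one _ Λ fun h hh => hb h (by simpa using hh)
  set g := (InnerProductSpace.toDual ℂ τ.L2).symm (Λ.mkContinuous _ hb')
  have hg : ∀ h, ⟪h, g⟫_ℂ = ∫ t in Ioi 0, F h t := fun h => by
    rw [← inner_conj_symm, InnerProductSpace.toDual_symm_apply]
    change (starRingEnd ℂ) (∫ t in Ioi 0, (starRingEnd ℂ) (F h t)) = _
    rw [integral_conj, Complex.conj_conj]
  have hact : ∀ (y z : τ.PreL2) (k : τ.L2), ⟪(z : τ.L2), act y (0, k)⟫_ℂ =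
      ⟪L2.mulRightL (star y.val) z, k⟫_ℂ := fun y z k => by
    have e : ((mulLeft (0 : N) y : τ.PreL2) : τ.L2) = 0 := by
      rw [show mulLeft (0 : N) y = 0 from PreL2.ext (zero_mul _), Completion.coe_zero]
    rw [act_apply]; simp only [e, zero_add]; rw [L2.inner_mulRightL]
  refine ⟨g, fun y z => ?_⟩; rw [hact, hg]
  refine (tendsto_setIntegral_truncation (hint _)).congr' ?_
  filter_upwards [eventually_trunc] with r hr
  refine setIntegral_congr_fun measurableSet_Ioc fun t ht => ?_
  have e2 : S.dX n t (0, f) = (0, S.d2 n t f) := by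
    have h1 := S.dX_inr n (hr.1.trans ht.1) f
    have h2 : (S.dX n t (0, f)).2 = S.d2 n t f := rfl
    rw [h1] at h2; rw [h1, ← h2]
  rw [e2, hact]

lemma multiplierConst_le_bmoConst (n : ℕ) : multiplierConst n ≤ bmoConst n := by
  have := multiplierConst_nonneg n
  unfold bmoConst; linarith

end StandardSemigroup

end

theorem mainTheorem6 :
    ∃ c : ℕ → ℝ≥0, ∀ (H : Type u) [NormedAddCommGroup H] [InnerProductSpace ℂ H] [CompleteSpace H]
      (N : VonNeumannAlgebra H) (τ : NSFTrace N) (S : StandardSemigroup τ)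
      (n : ℕ) (hn : 1 ≤ n) (a : ℝ → ℂ) (ha : AEStronglyMeasurable a (volume.restrict (Ioi 0)))
      (ca : ℝ) (hca : 0 < ca)
      (hbound : ∀ s : ℝ, 0 < s → ENNReal.ofReal s *
        ∫⁻ v in Ioi s, ‖a (v - s)‖ₑ ^ 2 / ENNReal.ofReal (v ^ 2) ≤ ENNReal.ofReal (ca ^ 2)),
      (∀ f : τ.L2, ∃ g : τ.L2, S.IsMultiplier a n (.inr f) (.inr g)) ∧
      (IntegrableOn (fun t => a t / t) (Ioi 0) →
        ∀ f : N, ∃ g : N, S.IsMultiplier a n (.inl f) (.inl g)) ∧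
      (∀ f g : N ⊕ τ.L2, S.IsMultiplier a n f g →
        S.bmoPartial g ≤ c n * ENNReal.ofReal ca * S.bmoPartial f) ∧
      (S.GammaSqNonneg → ∀ f g : N ⊕ τ.L2, S.IsMultiplier a n f g →
        S.bmoGamma g ≤ c n * ENNReal.ofReal ca * S.bmoGamma f ∧
        S.bmoPoisson g ≤ c n * ENNReal.ofReal ca * S.bmoPoisson f) := by
  refine ⟨fun n => (√(StandardSemigroup.bmoConst n)).toNNReal, ?_⟩
  intro H _ _ _ N τ S n hn a ha ca hca hbound
  have hs : IsSymbol a ca := ⟨hca, ha, hbound⟩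
  have hmono : ∀ b : ℝ≥0∞, ENNReal.ofReal √(StandardSemigroup.multiplierConst n) * ENNReal.ofReal ca * b ≤
      ENNReal.ofReal √(StandardSemigroup.bmoConst n) * ENNReal.ofReal ca * b := fun b =>
    mul_le_mul' (mul_le_mul' (ENNReal.ofReal_le_ofReal
      (Real.sqrt_le_sqrt (StandardSemigroup.multiplierConst_le_bmoConst n))) le_rfl) le_rfl
  refine ⟨fun f => ?_, fun hat f => ?_, fun f g hM => ?_, fun hΓ f g hM => ?_⟩
  · obtain ⟨g, hg⟩ := S.exists_isMultiplierX_inr hn hs f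
    exact ⟨g, S.isMultiplier_iff.2 hg⟩
  · obtain ⟨g, hg⟩ := S.exists_isMultiplierX_inl hn ha hat f
    exact ⟨g, S.isMultiplier_iff.2 hg⟩
  · rw [S.bmoPartial_eq, S.bmoPartial_eq]
    exact (S.bmoPartialAux_multiplier_le hn (S.isMultiplier_iff.1 hM) hs).trans (hmono _)
  · have hX := hΓ.gammaSqX
    rw [S.bmoGamma_eq, S.bmoGamma_eq, S.bmoPoisson_eq, S.bmoPoisson_eq]
    exact ⟨(hX.bmoGammaAux_multiplier_le hn (S.isMultiplier_iff.1 hM) hs).trans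
      (hmono _), hX.bmoPoissonAux_multiplier_le hn (S.isMultiplier_iff.1 hM) hs⟩
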